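/- Let $\mathcal C=\bigoplus_{i\ge 0}\mathcal C^i$ be a finite-dimensional, non-negatively graded, unital dg Frobenius algebra over $\mathbb R$: a graded-commutative dg algebra with differential $d$ of degree $+1$ and a non-degenerate graded-symmetric pairing $\pi$ of degree $-3$ with $\pi(da,b)+(-1)^{|a|}\pi(a,db)=0$ and $\pi(a,bc)=\pi(ab,c)$. Assume $\dim H^0(\mathcal C)=1$. Let $\mathfrak g$ be a finite-dimensional Lie algebra with a non-degenerate symmetric ad-invariant pairing, and put on $\mathfrak g\otimes\mathcal C$ the bracket $l(x\otimes a,y\otimes b)=[x,y]\otimes ab$ and the product pairing, again denoted $\pi$. Choose homogeneous bases $\{e_I\}$ of $\mathcal C$ and $\{e_p\}$ of $H^\bullet(\mathcal C)$ and a basis $\{T_a\}$ of $\mathfrak g$; let $\omega=\sum T_ae_I\omega^{Ia}$ and $\alpha=\sum T_ae_p\alpha^{pa}$, with supercommuting coordinates $\omega^{Ia}$, $\alpha^{pa}$ of ghost numbers $1-|e_I|$, $1-|e_p|$. Let $S(\omega)=\frac12\pi(\omega,d\omega)+\frac16\pi(\omega,l(\omega,\omega))$ and $S_0(\omega)=\frac12\pi(\omega,d\omega)$.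 Induction data is a pair $(\iota,K)$, where $\iota:H^\bullet(\mathcal C)\to\mathcal C$ is linear of degree $0$ with $\iota([a])\in a+d\,\mathcal C$ for every cocycle $a$, and $K:\mathcal C^\bullet\to\mathcal C^{\bullet-1}$ is linear with $dK+Kd=\mathrm{id}-P'$ ($P'$ the $\pi$-orthogonal projection onto $\mathrm{im}\,\iota$), $\pi(Ka,b)=(-1)^{|a|}\pi(a,Kb)$, $K\iota=0$ and $K^2=0$. The effective action is the formal series $$W(\alpha)=\hbar\log\Big(e^{-\hbar\frac12\pi^{-1}(\partial_\omega,K\partial_\omega)}\big|_{\omega=0}\;e^{(S(\iota(\alpha)+\omega)-S_0(\omega))/\hbar}\Big)=\sum_{l\ge0}\hbar^l\sum_{n\ge0}W_{l,n}(\alpha),$$ with $W_{l,n}$ a polynomial of degree $n$ in $\alpha$. Let $\alpha_{(1)}$ be the component of $\alpha$ in $\mathfrak g\otimes H^1(\mathcal C)$, so that its coordinates are even; write $\alpha_{(1)}=\sum_i\alpha_{(1)}^i\otimes e_{(1)i}$ with $\alpha_{(1)}^i\in\mathfrak g$, where $\{e_{(1)i}\}$ are the basis elements of degree $1$. Suppose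 that $\iota$ is a homomorphism of algebras (so that $\mathcal C$ is formal). Then: 1. $W(\alpha)=W_{\mathrm{prod}}(\alpha)+\sum_{l\ge1}\hbar^lF^{(l)}(\alpha_{(1)})$, where $W_{\mathrm{prod}}(\alpha)=\frac16\pi(\iota(\alpha),l(\iota(\alpha),\iota(\alpha)))$ and every $F^{(l)}$ is a formal power series in the coordinates of $\alpha_{(1)}$ invariant under the diagonal adjoint action of $\mathfrak g$ on the $\alpha_{(1)}^i$. 2. As formal power series in $\alpha_{(1)}$, $$F^{(1)}(\alpha_{(1)})=\tfrac12\,\mathrm{Str}_{\mathfrak g\otimes\mathcal C}\log\big(1+K\circ l(\iota(\alpha_{(1)}),\bullet)\big)=\tfrac12\sum_{n\ge1}\tfrac{(-1)^{n+1}}n\mathrm{Str}_{\mathfrak g\otimes\mathcal C}\big((K\circ l(\iota(\alpha_{(1)}),\bullet))^n\big),$$ where the supertrace uses the grading of $\mathcal C$. 3. Let $\mathrm{MC}$ be the set of all $\alpha_{(1)}\in\mathfrak g\otimes H^1(\mathcal C)$ with $\sum_{j,k}\mu_{ijk}[\alpha_{(1)}^j,\alpha_{(1)}^k]=0$ for all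 $i$, where $\mu_{ijk}=\pi(\iota(e_{(1)i}),\iota(e_{(1)j})\iota(e_{(1)k}))$. The restriction of $F^{(1)}$ (that is, of each of its homogeneous components) to $\mathrm{MC}$ is invariant under deformations of $(\iota,K)$ that preserve the homomorphism property of $\iota$: it is unchanged to first order under every infinitesimal deformation (one satisfying all the conditions on $(\iota,K)$ and the homomorphism property to first order), and it is constant along every differentiable path $(\iota_t,K_t)_{t\in[0,1]}$ of induction data with all $\iota_t$ homomorphisms. -/

import Mathlib

open scoped TensorProduct Nat

noncomputable section

/-! ### dg Frobenius algebras with a pairing of degree `-3` -/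

/-- The structure of a dg Frobenius algebra with pairing of degree `-3` on a non-negatively graded
unital algebra `C = ⨁ 𝒞 i` over `ℝ`. -/
structure DGFrobenius {C : Type*} [Ring C] [Algebra ℝ C] (𝒞 : ℕ → Submodule ℝ C)
    [GradedAlgebra 𝒞] where
  /-- the differential -/
  d : C →ₗ[ℝ] C
  /-- the pairing -/
  pair : LinearMap.BilinForm ℝ C
  mul_comm' : ∀ i j a b, a ∈ 𝒞 i → b ∈ 𝒞 j → a * b = (-1 : ℝ) ^ (i * j) • (b * a)
  d_mem : ∀ i a, a ∈ 𝒞 i → d a ∈ 𝒞 (i + 1)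
  d_d : ∀ a, d (d a) = 0
  leibniz : ∀ i a b, a ∈ 𝒞 i → d (a * b) = d a * b + (-1 : ℝ) ^ i • (a * d b)
  pair_symm : ∀ i j a b, a ∈ 𝒞 i → b ∈ 𝒞 j → pair a b = (-1 : ℝ) ^ (i * j) * pair b a
  pair_deg : ∀ i j a b, a ∈ 𝒞 i → b ∈ 𝒞 j → pair a b ≠ 0 → i + j = 3
  pair_nondegenerate : pair.Nondegenerate
  pair_d : ∀ i a b, a ∈ 𝒞 i → pair (d a) b + (-1 : ℝ) ^ i * pair a (d b) = 0
  pair_mul : ∀ a b c, pair a (b * c) = pair (a * b) c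

section Algebra

variable {C : Type*} [Ring C] [Algebra ℝ C] {𝒞 : ℕ → Submodule ℝ C} [GradedAlgebra 𝒞]

namespace DGFrobenius

variable (D : DGFrobenius 𝒞)

/-- Cocycles. -/
def cocycles : Submodule ℝ C := LinearMap.ker D.d

/-- Coboundaries, as a subspace of the cocycles. -/
def coboundaries : Submodule ℝ D.cocycles := (LinearMap.range D.d).comap D.cocycles.subtype

/-- The cohomology `H^•(C)`. -/
abbrev Cohomology : Type _ := D.cocycles ⧸ D.coboundaries

/-- The cohomology class of a cocycle. -/
def cls : D.cocycles →ₗ[ℝ] D.Cohomology := D.coboundaries.mkQ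

/-- The degree `i` part `H^i(C)` of the cohomology. -/
def cohomologyDeg (i : ℕ) : Submodule ℝ D.Cohomology :=
  ((𝒞 i).comap D.cocycles.subtype).map D.cls

theorem one_mem_cocycles : (1 : C) ∈ D.cocycles := by
  have h := D.leibniz 0 1 1 SetLike.GradedOne.one_mem
  simpa [cocycles] using h

theorem mul_mem_cocycles {a b : C} (ha : a ∈ D.cocycles) (hb : b ∈ D.cocycles) :
    a * b ∈ D.cocycles := by
  classical
  simp only [cocycles, LinearMap.mem_ker] at *
  have h : ∀ x : C, D.d (x * b) = D.d x * b := by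
    intro x
    rw [← DirectSum.sum_support_decompose 𝒞 x, Finset.sum_mul, map_sum, map_sum, Finset.sum_mul]
    refine Finset.sum_congr rfl fun i _ => ?_
    rw [D.leibniz i _ b (SetLike.coe_mem _), hb]
    simp
  rw [h, ha, zero_mul]

/-- `(ι, K)` is induction data: `ι` is a degree `0` choice of representatives of cohomology classes
and `K` is a symmetric chain homotopy retracting `C` to `H^•(C)`, with `K ι = 0` and `K² = 0`. -/
structure IsInductionData (ι : D.Cohomology →ₗ[ℝ] C) (K : C →ₗ[ℝ] C) : Prop where
  ι_mem : ∀ i x, x ∈ D.cohomologyDeg i → ι x ∈ 𝒞 i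
  ι_rep : ∀ z : D.cocycles, ∃ y, ι (D.cls z) = (z : C) + D.d y
  K_mem : ∀ i a, a ∈ 𝒞 (i + 1) → K a ∈ 𝒞 i
  K_zero : ∀ a, a ∈ 𝒞 0 → K a = 0
  /-- `id - (dK + Kd)` takes values in the image of `ι` ... -/
  homotopy_mem : ∀ a, a - (D.d (K a) + K (D.d a)) ∈ LinearMap.range ι
  /-- ... and its difference with `id` takes values in the orthogonal of the image of `ι`; so
  `dK + Kd = id - P'` with `P'` the orthogonal projection onto the image of `ι`. -/
  homotopy_orth : ∀ x a, D.pair (ι x) (D.d (K a) + K (D.d a)) = 0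
  K_symm : ∀ i a b, a ∈ 𝒞 i → D.pair (K a) b = (-1 : ℝ) ^ i * D.pair a (K b)
  K_ι : ∀ x, K (ι x) = 0
  K_K : ∀ a, K (K a) = 0

/-- `ι` is a homomorphism of unital algebras, for the product `[a][b] = [ab]` on cohomology. -/
structure IsAlgHom (ι : D.Cohomology →ₗ[ℝ] C) : Prop where
  map_one : ι (D.cls ⟨1, D.one_mem_cocycles⟩) = 1
  map_mul : ∀ a b : D.cocycles, ι (D.cls ⟨a * b, D.mul_mem_cocycles a.2 b.2⟩) =
    ι (D.cls a) * ι (D.cls b)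

/-- `(δι, δK)` is an infinitesimal deformation of the induction data `(ι, K)` preserving the
homomorphism property: `(ι + ε δι, K + ε δK)` satisfies all the defining equations of
`IsInductionData` and of `IsAlgHom` modulo `ε²`. -/
structure IsInfinitesimalDeformation (ι : D.Cohomology →ₗ[ℝ] C) (K : C →ₗ[ℝ] C)
    (δι : D.Cohomology →ₗ[ℝ] C) (δK : C →ₗ[ℝ] C) : Prop where
  ι_mem : ∀ i x, x ∈ D.cohomologyDeg i → δι x ∈ 𝒞 i
  ι_rep : ∀ x, ∃ y, δι x = D.d y
  K_mem : ∀ i a, a ∈ 𝒞 (i + 1) → δK a ∈ 𝒞 i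
  K_zero : ∀ a, a ∈ 𝒞 0 → δK a = 0
  homotopy_mem : ∀ a x, a - (D.d (K a) + K (D.d a)) = ι x →
    ∃ x', -(D.d (δK a) + δK (D.d a)) = δι x + ι x'
  homotopy_orth : ∀ x a, D.pair (δι x) (D.d (K a) + K (D.d a)) +
    D.pair (ι x) (D.d (δK a) + δK (D.d a)) = 0
  K_symm : ∀ i a b, a ∈ 𝒞 i → D.pair (δK a) b = (-1 : ℝ) ^ i * D.pair a (δK b)
  K_ι : ∀ x, δK (ι x) + K (δι x) = 0
  K_K : ∀ a, δK (K a) + K (δK a) = 0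
  map_one : δι (D.cls ⟨1, D.one_mem_cocycles⟩) = 0
  map_mul : ∀ a b : D.cocycles, δι (D.cls ⟨a * b, D.mul_mem_cocycles a.2 b.2⟩) =
    δι (D.cls a) * ι (D.cls b) + ι (D.cls a) * δι (D.cls b)

end DGFrobenius

end Algebra

/-! ### Polynomial superfunctions -/

/-- Polynomial functions in supercommuting variables `x : τ`, where `odd x` tells whether `x` is
odd: the exterior algebra on the odd variables tensored with polynomials in the even ones. -/
abbrev SFun (τ : Type*) (odd : τ → Bool) : Type _ :=
  ExteriorAlgebra ℝ ({x // odd x = true} →₀ ℝ) ⊗[ℝ] MvPolynomial {x // odd x = false} ℝ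

namespace SFun

variable {τ : Type*} {odd : τ → Bool}

/-- The coordinate function `x`. -/
def coord (odd : τ → Bool) (x : τ) : SFun τ odd :=
  if h : odd x = true then ExteriorAlgebra.ι ℝ (Finsupp.single ⟨x, h⟩ 1) ⊗ₜ 1
  else 1 ⊗ₜ MvPolynomial.X ⟨x, by simpa using h⟩

/-- The left derivative `∂/∂x`. -/
def pd (odd : τ → Bool) (x : τ) : Module.End ℝ (SFun τ odd) :=
  if h : odd x = true then
    LinearMap.rTensor _ (CliffordAlgebra.contractLeft (Finsupp.lapply ⟨x, h⟩))
  else LinearMap.lTensor _ (MvPolynomial.pderiv ⟨x, by simpa using h⟩).toLinearMap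

/-- Setting the variables of the second kind equal to `0`. -/
def setZero {τ' : Type*} (odd : τ → Bool) (odd' : τ' → Bool) :
    SFun (τ ⊕ τ') (Sum.elim odd odd') →ₐ[ℝ] SFun τ odd :=
  Algebra.TensorProduct.map
    (ExteriorAlgebra.map (Finsupp.lift _ ℝ {x // Sum.elim odd odd' x = true} fun
      | ⟨.inl y, h⟩ => Finsupp.single ⟨y, h⟩ (1 : ℝ)
      | ⟨.inr _, _⟩ => 0))
    (MvPolynomial.aeval fun x : {x // Sum.elim odd odd' x = false} => match x with
      | ⟨.inl y, h⟩ => MvPolynomial.X ⟨y, h⟩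
      | ⟨.inr _, _⟩ => 0)

end SFun

/-! ### Formal logarithm and exponentials -/

/-- `log Z = ∑_{j ≥ 1} (-1)^{j+1} (Z - 1)^j / j`, for `Z` with constant coefficient `1`. -/
def formalLog {R : Type*} [Ring R] [Algebra ℝ R] (Z : PowerSeries R) : PowerSeries R :=
  PowerSeries.mk fun n =>
    ∑ j ∈ Finset.Icc 1 n, ((-1 : ℝ) ^ (j + 1) / j) • PowerSeries.coeff n ((Z - 1) ^ j)

section ChernSimons

variable {C : Type*} [Ring C] [Algebra ℝ C] {𝒞 : ℕ → Submodule ℝ C} [GradedAlgebra 𝒞]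
variable {g : Type*} [LieRing g] [LieAlgebra ℝ g]

/-- A non-degenerate symmetric ad-invariant pairing on a Lie algebra. -/
structure IsQuadratic (B : LinearMap.BilinForm ℝ g) : Prop where
  symm : ∀ x y, B x y = B y x
  nondegenerate : B.Nondegenerate
  invariant : ∀ x y z, B x ⁅y, z⁆ = B ⁅x, y⁆ z

/-- Homogeneous (finite) bases of `C` and `H^•(C)`, and a basis of `g`. They provide coordinates
`ω^{Ia}` on `F = g ⊗ C[1]` and `α^{pa}` on `F' = g ⊗ H^•(C)[1]`, of ghost numbers `1 - |e_I|` and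
`1 - |e_p|`. -/
structure FieldCoords (D : DGFrobenius 𝒞) (g : Type*) [LieRing g] [LieAlgebra ℝ g]
    (I P A : Type*) where
  bC : Module.Basis I ℝ C
  degC : I → ℕ
  bC_mem : ∀ i, bC i ∈ 𝒞 (degC i)
  bH : Module.Basis P ℝ D.Cohomology
  degH : P → ℕ
  bH_mem : ∀ p, bH p ∈ D.cohomologyDeg (degH p)
  bg : Module.Basis A ℝ g

namespace FieldCoords

variable {D : DGFrobenius 𝒞} {I P A : Type*} (X : FieldCoords D g I P A)

/-- Parity of the coordinate `ω^{Ia}`: its ghost number `1 - |e_I|` is odd iff `|e_I|` is even. -/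
def oddC (x : I × A) : Bool := decide (Even (X.degC x.1))

/-- Parity of the coordinate `α^{pa}`. -/
def oddH (x : P × A) : Bool := decide (Even (X.degH x.1))

/-- `Fun(F')`. -/
abbrev Fun' : Type _ := SFun (P × A) X.oddH

/-- `Fun(F' ⊕ F)`: functions of `α` and of the fluctuation `ω`. -/
abbrev FunTot : Type _ := SFun ((P × A) ⊕ (I × A)) (Sum.elim X.oddH X.oddC)

/-- Indices of the coordinates `α_(1)` on `H^1(C)`. -/
abbrev P1 : Type _ := {p : P // X.degH p = 1}

variable [Fintype I] [Fintype P] [Fintype A] [DecidableEq I] [DecidableEq A]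
variable (B : LinearMap.BilinForm ℝ g)

section Action

variable {R : Type*} [Ring R] [Algebra ℝ R]

/-- `½ π(Ω, dΩ)` for the field `Ω = ∑ T_a e_I Ω^{Ia}`, where `Ω^{Ia}` has the parity of
`1 - |e_I|`. -/
def quadTerm (Ω : I → A → R) : R :=
  (1 / 2 : ℝ) • ∑ i, ∑ j, ∑ a, ∑ b,
    ((-1 : ℝ) ^ (X.degC i + 1) * B (X.bg a) (X.bg b) * D.pair (X.bC i) (D.d (X.bC j))) •
      (Ω i a * Ω j b)

/-- `⅙ π(Ω, l(Ω, Ω))`, with the same conventions; `l` is the bracket of `g ⊗ C`. -/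
def cubicTerm (Ω : I → A → R) : R :=
  (1 / 6 : ℝ) • ∑ i, ∑ j, ∑ k, ∑ a, ∑ b, ∑ c,
    ((-1 : ℝ) ^ (X.degC j * (X.degC k + 1)) * B (X.bg a) ⁅X.bg b, X.bg c⁆ *
      D.pair (X.bC i) (X.bC j * X.bC k)) • (Ω i a * Ω j b * Ω k c)

/-- The abstract Chern--Simons action `S(Ω) = ½ π(Ω, dΩ) + ⅙ π(Ω, l(Ω, Ω))`. -/
def csAction (Ω : I → A → R) : R := X.quadTerm B Ω + X.cubicTerm B Ω

/-- The components of `ι(α)`, from those of `α`. -/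
def embedField (ι : D.Cohomology →ₗ[ℝ] C) (α : P → A → R) : I → A → R :=
  fun i a => ∑ p, X.bC.repr (ι (X.bH p)) i • α p a

end Action

/-- The BV field `α`, as a field with components in `Fun(F')`. -/
def zeroMode (p : P) (a : A) : X.Fun' := SFun.coord X.oddH (p, a)

/-- `W_prod(α) = ⅙ π(ι(α), l(ι(α), ι(α)))`. -/
def Wprod (ι : D.Cohomology →ₗ[ℝ] C) : X.Fun' := X.cubicTerm B (X.embedField ι X.zeroMode)

/-- `S(ι(α) + ω) - S_0(ω)` with `S_0(ω) = ½ π(ω, dω)`. -/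
def interaction (ι : D.Cohomology →ₗ[ℝ] C) : X.FunTot :=
  let α : P → A → X.FunTot := fun p a => SFun.coord _ (Sum.inl (p, a))
  let ω : I → A → X.FunTot := fun i a => SFun.coord _ (Sum.inr (i, a))
  X.csAction B (X.embedField ι α + ω) - X.quadTerm B ω

/-- `K^{IJ}`: the components of `K` with the second index raised by the inverse of the pairing. -/
def propagator (K : C →ₗ[ℝ] C) : Matrix I I ℝ :=
  LinearMap.toMatrix X.bC X.bC K * (Matrix.of fun i j => D.pair (X.bC i) (X.bC j))⁻¹

/-- The operator `-½ π⁻¹(∂/∂ω, K ∂/∂ω)`. The bivector `K^{IJ}` is supported on the image of `K`,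
so only derivatives along the fluctuations `ω''` in the image of `K` occur. -/
def wick (K : C →ₗ[ℝ] C) : Module.End ℝ X.FunTot :=
  (-1 / 2 : ℝ) • ∑ i, ∑ j, ∑ a, ∑ b,
    (X.propagator K i j * (Matrix.of fun a b => B (X.bg a) (X.bg b))⁻¹ a b) •
      (SFun.pd _ (Sum.inr (i, a)) * SFun.pd _ (Sum.inr (j, b)))

/-- The generating series of
`exp(-ħ ½ π⁻¹(∂/∂ω, K ∂/∂ω))|_{ω = 0} exp((S(ι(α) + ω) - S_0(ω)) / ħ)`:
the outer power series variable stands for the factor `1/ħ` of each vertex, the inner one for the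
factor `ħ` of each edge. -/
def partition (ι : D.Cohomology →ₗ[ℝ] C) (K : C →ₗ[ℝ] C) : PowerSeries (PowerSeries X.Fun') :=
  PowerSeries.mk fun v => PowerSeries.mk fun e =>
    ((v ! : ℝ)⁻¹ * (e ! : ℝ)⁻¹) •
      SFun.setZero X.oddH X.oddC ((X.wick B K ^ e) (X.interaction B ι ^ v))

/-- The effective action `W = ħ log(...)`: `effAction l n` is the coefficient of `ħ^l` in `W`, in
polynomial degree `n` in `α`, so that `W = ∑_l ħ^l ∑_n effAction l n`. A term with `v` (cubic)
vertices and `e` edges comes with `ħ^(1 + e - v)` and has degree `3v - 2e` in `α`; so the term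
`(l, n)` is the one with `v = n + 2l - 2` and `e = n + 3l - 3`. -/
def effAction (ι : D.Cohomology →ₗ[ℝ] C) (K : C →ₗ[ℝ] C) (l n : ℕ) : X.Fun' :=
  if 2 ≤ n + 2 * l ∧ 3 ≤ n + 3 * l then
    PowerSeries.coeff (n + 3 * l - 3)
      (PowerSeries.coeff (n + 2 * l - 2) (formalLog (X.partition B ι K)))
  else 0

/-- A polynomial in the coordinates `α_(1)`, viewed as a function on `F'`. -/
def ofH1 : MvPolynomial (X.P1 × A) ℝ →ₐ[ℝ] X.Fun' :=
  Algebra.TensorProduct.includeRight.comp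
    (MvPolynomial.rename fun x => ⟨(x.1.1, x.2), by simp [oddH, x.1.2]⟩)

/-- Restriction of functions on `F'` to `α = α_(1)`, i.e. to `α_(0) = α_(2) = α_(3) = 0`. -/
def restrictH1 : X.Fun' →ₐ[ℝ] MvPolynomial (X.P1 × A) ℝ :=
  (Algebra.TensorProduct.lid ℝ _).toAlgHom.comp
    (Algebra.TensorProduct.map ExteriorAlgebra.algebraMapInv
      (MvPolynomial.aeval fun x : {x // X.oddH x = false} =>
        if h : X.degH x.1.1 = 1 then MvPolynomial.X (⟨x.1.1, h⟩, x.1.2) else 0))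

/-- The `l`-loop part `F^(l)(α_(1))`: `loopPart l n` is its component of degree `n`. -/
def loopPart (ι : D.Cohomology →ₗ[ℝ] C) (K : C →ₗ[ℝ] C) (l n : ℕ) :
    MvPolynomial (X.P1 × A) ℝ :=
  X.restrictH1 (X.effAction B ι K l n)

/-- Invariance of `F` under `α_(1)^i ↦ α_(1)^i + [x, α_(1)^i]` to first order in `x ∈ g`. -/
def IsAdInvariant (F : MvPolynomial (X.P1 × A) ℝ) : Prop :=
  ∀ x : g, ∑ i : X.P1, ∑ a, ∑ b,
    X.bg.repr ⁅x, X.bg b⁆ a • (MvPolynomial.X (i, b) * MvPolynomial.pderiv (i, a) F) = 0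

/-- The `g`-valued coordinate `α_(1)^i` of a point of `H^1(C, g)[1]`. -/
def gCoord (α : X.P1 × A → ℝ) (i : X.P1) : g := ∑ a, α (i, a) • X.bg a

/-- The point of `g ⊗ H^1(C)` with the given coordinates. -/
def point (α : X.P1 × A → ℝ) : g ⊗[ℝ] D.Cohomology := ∑ i : X.P1, X.gCoord α i ⊗ₜ X.bH i

/-- The Maurer--Cartan equations `∑_{j,k} μ_{ijk} [α_(1)^j, α_(1)^k] = 0`, where
`μ_{ijk} = π(ι(e_i), ι(e_j) ι(e_k))`. -/
def IsMaurerCartan (ι : D.Cohomology →ₗ[ℝ] C) (α : X.P1 × A → ℝ) : Prop :=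
  ∀ i : X.P1, ∑ j : X.P1, ∑ k : X.P1,
    D.pair (ι (X.bH i)) (ι (X.bH j) * ι (X.bH k)) • ⁅X.gCoord α j, X.gCoord α k⁆ = 0

end FieldCoords

/-- The bracket `l(x ⊗ a, y ⊗ b) = [x, y] ⊗ ab` of `g ⊗ C`. -/
def tensorBracket (g C : Type*) [LieRing g] [LieAlgebra ℝ g] [Ring C] [Algebra ℝ C] :
    (g ⊗[ℝ] C) →ₗ[ℝ] (g ⊗[ℝ] C) →ₗ[ℝ] (g ⊗[ℝ] C) :=
  TensorProduct.map₂ (LieAlgebra.ad ℝ g : g →ₗ[ℝ] Module.End ℝ g) (LinearMap.mul ℝ C)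

/-- The operator `(-1)^{|a|}` on `C`. -/
def gradingSign (𝒞 : ℕ → Submodule ℝ C) [GradedAlgebra 𝒞] : C →ₗ[ℝ] C :=
  DirectSum.toModule ℝ ℕ C (fun i => (-1 : ℝ) ^ i • (𝒞 i).subtype) ∘ₗ
    (DirectSum.decomposeLinearEquiv 𝒞).toLinearMap

/-- The supertrace over `g ⊗ C`, with the grading of `C`. -/
def superTrace (𝒞 : ℕ → Submodule ℝ C) [GradedAlgebra 𝒞] (T : Module.End ℝ (g ⊗[ℝ] C)) : ℝ :=
  LinearMap.trace ℝ (g ⊗[ℝ] C) (LinearMap.lTensor g (gradingSign 𝒞) ∘ₗ T)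

/-- `Str log(1 + t T) = ∑_{n ≥ 1} (-1)^{n+1}/n Str(T^n) t^n`, as a formal power series in `t`. -/
def strLog (𝒞 : ℕ → Submodule ℝ C) [GradedAlgebra 𝒞] (T : Module.End ℝ (g ⊗[ℝ] C)) :
    PowerSeries ℝ :=
  PowerSeries.mk fun n =>
    if n = 0 then 0 else (-1 : ℝ) ^ (n + 1) / n * superTrace 𝒞 (T ^ n)

/-- The operator `K ∘ l(ι(α), •)` on `g ⊗ C`. -/
def wheelOp {D : DGFrobenius 𝒞} (ι : D.Cohomology →ₗ[ℝ] C) (K : C →ₗ[ℝ] C)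
    (α : g ⊗[ℝ] D.Cohomology) : Module.End ℝ (g ⊗[ℝ] C) :=
  LinearMap.lTensor g K ∘ₗ tensorBracket g C (LinearMap.lTensor g ι α)

end ChernSimons

end

/-!
# The effective action of a formal Chern--Simons model

Two structures carry the proof: the count of legs and degrees in the perturbation series, and the
twisted differential `d + l(ι(α), ·)`.

**Shape of the effective action.** Since `K d K = K`, replacing the fluctuation `ω` by `K d ω` does not
change the contractions (`SFun.setZero_laplace_pow_substInr`, `substMatrix_bivector`), so all legs of
the vertices may be taken of the form `ι(α)` or `K d ω`. A vertex with exactly one fluctuation then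
vanishes, because `ι` is multiplicative and `K ι = 0` (`two_le_flucCount`); a zero mode of degree `0`
is a scalar and drops out of the vertices with two fluctuations because `K² = 0`
(`degH_ne_zero_of_fluctuationWeight`). Apart from the vertex without fluctuations, a graph with `v`
vertices and `e` edges therefore satisfies `v ≤ e`, and its `3v - 2e` external legs have positive
degrees of total `3v - 2e`: all of them are legs `α_(1)` (`edgeContraction_mem`). The vertex without
fluctuations is `W_prod`; it is central, is not touched by the propagator, and contributes an
exponential factor to the partition function (`partition_eq_mul`), hence a summand to its logarithm
(`formalLog_exp_mul_of_central`). Passing to the logarithm preserves the bounds above, the degree and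
the invariance (`loopTerms`, `coeff_coeff_formalLog_mem`). Invariance holds because the adjoint vector
field annihilates the vertices and commutes with the contraction (`derivation_vertex`,
`adMatrix_bivector`, `linVF_edgeContraction`).

**The one-loop part.** At a real point `α` the interaction is a function of the fluctuations alone:
a constant, the quadratic form of `l(ι(α), ·)`, a cubic form and a linear form. The linear form is
annihilated by `K`, and in the diagonal coefficients `v = e` of the logarithm only the quadratic form
contributes. The moments of a quadratic form satisfy a recursion (`SFun.moment_succ`) whose
coefficients are wheels, equal to one half of the supertraces of powers of `K ∘ l(ι(α), ·)`
(`wheelValue_eq`); solving it gives the logarithm (`loopPart_one_eq_strLog`). An infinitesimal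
deformation `(ι + ε δι, K + ε δK)` is induction data only modulo `ε²`, so that the linear form
survives in second order; the identity then still holds to first order (`loopPart_one_mem_sameJet`),
which is all that the derivative sees.

**Invariance.** On the Maurer--Cartan set `l(ι(α), ι(α)) = 0` (`bracket_point_eq_zero`), so the twist
`T = l(ι(α), ·)` satisfies `T² = 0` and anticommutes with `d`. A variation of `K` is a commutator with
`d` up to terms which do not contribute to the supertraces (`IsWheelHomotopy.trace_variation`). A
variation of `ι` is exact, `δι = d K δι`, and the commutator of `d` with `l(K δι(α), ·)` is traded
step by step for a commutator with `T`, along the tower `β_{j+1} = K l(ι(α), β_j)`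
(`IsWheelHomotopy.trace_tower`, `IsWheelHomotopy.d_tower`); what remains at the end is a trace of
`ad`, which vanishes on a quadratic Lie algebra (`trace_adjoint`). Hence the supertraces of all powers
of `K ∘ T` are stationary (`superTrace_variation`), and both invariance statements follow
(`hasDerivAt_loopPart`, `eval_loopPart_eq`).
-/

open scoped TensorProduct Nat

noncomputable section

set_option linter.unusedSectionVars false

/-! ### Calculus of superfunctions -/

namespace SFun

variable {τ : Type*} {odd : τ → Bool}

/-- The sign `(-1)^{|x||y|}`. -/
def sgn (odd : τ → Bool) (x y : τ) : ℝ := if odd x = true ∧ odd y = true then -1 else 1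

theorem sgn_comm (x y : τ) : sgn odd x y = sgn odd y x := by simp [sgn, and_comm]

theorem sgn_mul_self (x y : τ) : sgn odd x y * sgn odd x y = 1 := by
  unfold sgn; split_ifs <;> norm_num

theorem sgn_congr_left {x x' : τ} (h : odd x = odd x') (y : τ) : sgn odd x y = sgn odd x' y := by
  simp [sgn, h]

theorem sgn_congr_right {y y' : τ} (x : τ) (h : odd y = odd y') : sgn odd x y = sgn odd x y' := by
  simp [sgn, h]

theorem coord_of_odd {x : τ} (h : odd x = true) :
    coord odd x = ExteriorAlgebra.ι ℝ (Finsupp.single ⟨x, h⟩ 1) ⊗ₜ 1 := by simp [coord, h]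

theorem coord_of_even {x : τ} (h : odd x = false) :
    coord odd x = 1 ⊗ₜ MvPolynomial.X ⟨x, h⟩ := by simp [coord, h]

theorem pd_of_odd {x : τ} (h : odd x = true) :
    pd odd x = LinearMap.rTensor _ (CliffordAlgebra.contractLeft (Finsupp.lapply ⟨x, h⟩)) := by
  simp [pd, h]

theorem pd_of_even {x : τ} (h : odd x = false) :
    pd odd x = LinearMap.lTensor _ (MvPolynomial.pderiv ⟨x, h⟩).toLinearMap := by
  simp [pd, h]

theorem coord_mul_coord (x y : τ) :
    coord odd x * coord odd y = sgn odd x y • (coord odd y * coord odd x) := by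
  rcases hx : odd x <;> rcases hy : odd y
  · simp [coord_of_even hx, coord_of_even hy, sgn, hx, mul_comm]
  · simp [coord_of_even hx, coord_of_odd hy, sgn, hx]
  · simp [coord_of_odd hx, coord_of_even hy, sgn, hy]
  · simp only [coord_of_odd hx, coord_of_odd hy, sgn, hx, hy, and_self, if_true,
      Algebra.TensorProduct.tmul_mul_tmul, mul_one]
    rw [eq_neg_of_add_eq_zero_left (ExteriorAlgebra.ι_add_mul_swap _ _), TensorProduct.neg_tmul]
    exact (neg_one_smul ℝ _).symm

theorem pd_one (x : τ) : pd odd x 1 = 0 := by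
  rcases hx : odd x
  · rw [pd_of_even hx, Algebra.TensorProduct.one_def]; simp
  · rw [pd_of_odd hx, Algebra.TensorProduct.one_def]
    simp [CliffordAlgebra.contractLeft_one]

/-- The signed Leibniz rule. -/
theorem pd_coord_mul [DecidableEq τ] (x y : τ) (f : SFun τ odd) :
    pd odd x (coord odd y * f) =
      (if x = y then f else 0) + sgn odd x y • (coord odd y * pd odd x f) := by
  induction f using TensorProduct.induction_on with
  | zero => simp
  | add f g hf hg =>
    rw [mul_add, map_add, hf, hg, map_add, mul_add, smul_add]
    split_ifs <;> abel
  | tmul u p =>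
    rcases hx : odd x <;> rcases hy : odd y
    · simp only [pd_of_even hx, coord_of_even hy, sgn, hx, Algebra.TensorProduct.tmul_mul_tmul,
        LinearMap.lTensor_tmul, Derivation.coeFn_coe, Derivation.leibniz, one_mul,
        MvPolynomial.pderiv_X, smul_eq_mul, Bool.false_eq_true, false_and, if_false, one_smul,
        TensorProduct.tmul_add]
      rw [add_comm]
      congr 1
      by_cases h : x = y
      · subst h; simp
      · simp [h, Subtype.ext_iff, Ne.symm h]
    · have h : x ≠ y := by rintro rfl; simp [hx] at hy
      simp [pd_of_even hx, coord_of_odd hy, sgn, hx, h]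
    · have h : x ≠ y := by rintro rfl; simp [hx] at hy
      simp [pd_of_odd hx, coord_of_even hy, sgn, hy, h]
    · simp only [pd_of_odd hx, coord_of_odd hy, sgn, hx, hy, Algebra.TensorProduct.tmul_mul_tmul,
        LinearMap.rTensor_tmul, one_mul, and_self, if_true]
      erw [CliffordAlgebra.contractLeft_ι_mul]
      rw [TensorProduct.sub_tmul, sub_eq_add_neg]
      congr 1
      by_cases h : x = y
      · subst h; simp
      · simp [h]

/-- Superfunctions are generated from `1` by multiplication with coordinates and linear
combinations. -/
theorem induction_coord {p : SFun τ odd → Prop} (h1 : p 1)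
    (hc : ∀ x f, p f → p (coord odd x * f)) (ha : ∀ f g, p f → p g → p (f + g))
    (hs : ∀ (r : ℝ) f, p f → p (r • f)) (f : SFun τ odd) : p f := by
  have h0 : p 0 := by simpa using hs 0 1 h1
  have hsum : ∀ (s : Finset {x // odd x = true}) (c : {x // odd x = true} → ℝ) (f),
      p f → p (∑ x ∈ s, c x • (coord odd x.1 * f)) := by
    intro s c f hf
    induction s using Finset.cons_induction with
    | empty => simpa
    | cons a s has ih => rw [Finset.sum_cons]; exact ha _ _ (hs _ _ (hc _ _ hf)) ih
  have hpoly : ∀ q : MvPolynomial {x // odd x = false} ℝ, p ((1 : ExteriorAlgebra ℝ _) ⊗ₜ q) := by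
    intro q
    induction q using MvPolynomial.induction_on with
    | C r =>
      have := hs r 1 h1
      rwa [Algebra.TensorProduct.one_def, ← TensorProduct.tmul_smul,
        ← MvPolynomial.C_1, ← MvPolynomial.C_mul', ← MvPolynomial.C_mul, mul_one] at this
    | add q r hq hr => rw [TensorProduct.tmul_add]; exact ha _ _ hq hr
    | mul_X q x hq =>
      have := hc x.1 _ hq
      rwa [coord_of_even x.2, Algebra.TensorProduct.tmul_mul_tmul, one_mul, mul_comm] at this
  induction f using TensorProduct.induction_on with
  | zero => exact h0
  | add f g hf hg => exact ha _ _ hf hg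
  | tmul u q =>
    induction u using CliffordAlgebra.left_induction with
    | algebraMap r =>
      have := hs r _ (hpoly q)
      rwa [TensorProduct.smul_tmul', ← Algebra.algebraMap_eq_smul_one] at this
    | add u v hu hv => rw [TensorProduct.add_tmul]; exact ha _ _ hu hv
    | ι_mul u m hu =>
      have := hsum m.support m _ hu
      convert this using 1
      conv_lhs => rw [← Finsupp.sum_single m]
      simp only [Finsupp.sum, map_sum, Finset.sum_mul, TensorProduct.sum_tmul]
      refine Finset.sum_congr rfl fun x _ => ?_
      rw [coord_of_odd x.2, Algebra.TensorProduct.tmul_mul_tmul, one_mul, TensorProduct.smul_tmul',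
        ← smul_mul_assoc]
      congr 2
      erw [← map_smul (ExteriorAlgebra.ι ℝ)]
      rw [Finsupp.smul_single, smul_eq_mul, mul_one]

theorem algHom_ext {R : Type*} [Ring R] [Algebra ℝ R] {F G : SFun τ odd →ₐ[ℝ] R}
    (h : ∀ x, F (coord odd x) = G (coord odd x)) : F = G := by
  refine AlgHom.ext fun f => ?_
  induction f using induction_coord with
  | h1 => simp
  | hc x f hf => rw [map_mul, map_mul, hf, h]
  | ha f g hf hg => rw [map_add, map_add, hf, hg]
  | hs r f hf => rw [map_smul, map_smul, hf]

theorem pd_pd_comm (x y : τ) (f : SFun τ odd) :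
    pd odd x (pd odd y f) = sgn odd x y • pd odd y (pd odd x f) := by
  classical
  induction f using induction_coord with
  | h1 => simp [pd_one]
  | hc z f hf =>
    rw [pd_coord_mul, pd_coord_mul, map_add, map_add, map_smul, map_smul, pd_coord_mul,
      pd_coord_mul, hf]
    have h1 : pd odd x (if y = z then f else 0) = if y = z then pd odd x f else 0 := by
      split_ifs <;> simp
    have h2 : pd odd y (if x = z then f else 0) = if x = z then pd odd y f else 0 := by
      split_ifs <;> simp
    have h3 : sgn odd y z • (if x = z then pd odd y f else 0) =
        sgn odd x y • if x = z then pd odd y f else 0 := by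
      split_ifs with h
      · subst h; rw [sgn_comm]
      · simp
    have h4 : sgn odd x y • sgn odd x z • (if y = z then pd odd x f else 0) =
        if y = z then pd odd x f else 0 := by
      split_ifs with h
      · subst h; rw [smul_smul, sgn_mul_self, one_smul]
      · simp
    simp only [smul_add, h1, h2, h3, h4, mul_smul_comm]
    rw [smul_comm (sgn odd y z) (sgn odd x z), smul_comm (sgn odd y z) (sgn odd x y),
      smul_comm (sgn odd x z) (sgn odd x y)]
    abel
  | ha f g hf hg => simp only [map_add, hf, hg, smul_add]
  | hs r f hf => simp only [map_smul, hf]; rw [smul_comm]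

/-- An element commuting with all coordinates is central. -/
theorem mem_center_of_coord {c : SFun τ odd} (h : ∀ x, coord odd x * c = c * coord odd x) :
    c ∈ Subalgebra.center ℝ (SFun τ odd) := by
  rw [Subalgebra.mem_center_iff]
  intro f
  induction f using induction_coord with
  | h1 => simp
  | hc x f hf => rw [mul_assoc, hf, ← mul_assoc, h, mul_assoc]
  | ha f g hf hg => rw [add_mul, mul_add, hf, hg]
  | hs r f hf => rw [smul_mul_assoc, mul_smul_comm, hf]

/-! ### Linear even vector fields, constant coefficient operators, quadratic functions -/

/-- The matrix `M` does not mix even and odd variables. -/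
def IsEven (odd : τ → Bool) (M : Matrix τ τ ℝ) : Prop := ∀ x y, M x y ≠ 0 → odd x = odd y

theorem coord_mul_pair {x y : τ} (h : odd x = odd y) (z : τ) :
    coord odd z * (coord odd x * coord odd y) = coord odd x * coord odd y * coord odd z := by
  rw [← mul_assoc, coord_mul_coord z x, smul_mul_assoc, mul_assoc, coord_mul_coord z y,
    mul_smul_comm, smul_smul, sgn_congr_right z h, sgn_mul_self, one_smul, mul_assoc]

section Sums

variable {κ μ ν V : Type*} [Fintype κ] [Fintype μ] [Fintype ν] [AddCommGroup V] [Module ℝ V]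

theorem sum_smul_sum_right (P : Matrix ν κ ℝ) (M : Matrix κ μ ℝ) (F : ν → μ → V) :
    ∑ z, ∑ w, P z w • ∑ x, M w x • F z x = ∑ z, ∑ x, (P * M) z x • F z x := by
  refine Finset.sum_congr rfl fun z _ => ?_
  simp only [Finset.smul_sum, Matrix.mul_apply, Finset.sum_smul, smul_smul]
  exact Finset.sum_comm

theorem sum_smul_sum_left (P : Matrix κ ν ℝ) (M : Matrix κ μ ℝ) (F : μ → ν → V) :
    ∑ z, ∑ w, P z w • ∑ x, M z x • F x w = ∑ x, ∑ w, (M.transpose * P) x w • F x w := by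
  have h := sum_smul_sum_right P.transpose M fun w x => F x w
  rw [Finset.sum_comm, Finset.sum_comm (f := fun x w => (M.transpose * P) x w • F x w)]
  simpa [Matrix.mul_apply, mul_comm] using h

end Sums

section Operators

variable [Fintype τ]

/-- The linear vector field `∑ M_{yx} y ∂/∂x`. -/
def linVF (odd : τ → Bool) (M : Matrix τ τ ℝ) : Module.End ℝ (SFun τ odd) :=
  ∑ x, ∑ y, M y x • (LinearMap.mulLeft ℝ (coord odd y) * pd odd x)

/-- The constant coefficient operator `½ ∑ P_{zw} ∂/∂z ∂/∂w`. -/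
def laplace (odd : τ → Bool) (P : Matrix τ τ ℝ) : Module.End ℝ (SFun τ odd) :=
  (1 / 2 : ℝ) • ∑ z, ∑ w, P z w • (pd odd z * pd odd w)

/-- The quadratic function `½ ∑ N_{xy} x y`. -/
def quad (odd : τ → Bool) (N : Matrix τ τ ℝ) : SFun τ odd :=
  (1 / 2 : ℝ) • ∑ x, ∑ y, N x y • (coord odd x * coord odd y)

theorem linVF_apply (M : Matrix τ τ ℝ) (f : SFun τ odd) :
    linVF odd M f = ∑ x, ∑ y, M y x • (coord odd y * pd odd x f) := by
  simp [linVF, LinearMap.sum_apply]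

theorem laplace_apply (P : Matrix τ τ ℝ) (f : SFun τ odd) :
    laplace odd P f = (1 / 2 : ℝ) • ∑ z, ∑ w, P z w • pd odd z (pd odd w f) := by
  simp [laplace, LinearMap.sum_apply]

theorem linVF_one (M : Matrix τ τ ℝ) : linVF odd M 1 = 0 := by
  simp [linVF_apply, pd_one]

theorem linVF_coord (M : Matrix τ τ ℝ) (u : τ) :
    linVF odd M (coord odd u) = ∑ y, M y u • coord odd y := by
  classical
  have h : ∀ x, pd odd x (coord odd u) = if x = u then 1 else 0 := by
    intro x
    rw [← mul_one (coord odd u), pd_coord_mul, pd_one]; simp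
  simp only [linVF_apply, h, mul_ite, mul_one, mul_zero, smul_ite, smul_zero]
  rw [Finset.sum_comm]
  simp

theorem linVF_coord_mul {M : Matrix τ τ ℝ} (hM : IsEven odd M) (u : τ) (f : SFun τ odd) :
    linVF odd M (coord odd u * f) = linVF odd M (coord odd u) * f +
      coord odd u * linVF odd M f := by
  classical
  rw [linVF_coord]
  simp only [linVF_apply, pd_coord_mul, mul_add, smul_add, Finset.sum_add_distrib]
  congr 1
  · simp only [mul_ite, mul_zero, smul_ite, smul_zero]
    rw [Finset.sum_comm]
    simp [Finset.sum_mul, smul_mul_assoc]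
  · rw [Finset.mul_sum]
    refine Finset.sum_congr rfl fun x _ => ?_
    rw [Finset.mul_sum]
    refine Finset.sum_congr rfl fun y _ => ?_
    by_cases h : M y x = 0
    · simp [h]
    · rw [mul_smul_comm, ← mul_assoc, coord_mul_coord y u, mul_smul_comm, smul_mul_assoc,
        smul_smul (sgn odd x u), sgn_congr_left (hM y x h) u, sgn_mul_self, one_smul, mul_assoc]

/-- Linear even vector fields are derivations. -/
theorem linVF_mul {M : Matrix τ τ ℝ} (hM : IsEven odd M) (f g : SFun τ odd) :
    linVF odd M (f * g) = linVF odd M f * g + f * linVF odd M g := by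
  induction f using induction_coord with
  | h1 => simp [linVF_one]
  | hc x f hf =>
    rw [mul_assoc, linVF_coord_mul hM, hf, linVF_coord_mul hM, mul_add, add_mul]
    simp only [mul_assoc]
    abel
  | ha f f' hf hf' => rw [add_mul, map_add, map_add, hf, hf', add_mul, add_mul]; abel
  | hs r f hf => rw [smul_mul_assoc, map_smul, map_smul, hf, smul_add, smul_mul_assoc, smul_mul_assoc]

theorem linVF_pow_of_central {M : Matrix τ τ ℝ} (hM : IsEven odd M) {f : SFun τ odd}
    (hf : f ∈ Subalgebra.center ℝ (SFun τ odd)) (n : ℕ) :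
    linVF odd M (f ^ (n + 1)) = ((n : ℝ) + 1) • (linVF odd M f * f ^ n) := by
  induction n with
  | zero => simp
  | succ n ih =>
    rw [pow_succ', linVF_mul hM, ih, mul_smul_comm, ← mul_assoc,
      ← (Subalgebra.mem_center_iff.1 hf) (linVF odd M f), mul_assoc, ← pow_succ']
    push_cast
    module

/-- The commutator of a partial derivative with a linear vector field. -/
theorem pd_linVF {M : Matrix τ τ ℝ} (hM : IsEven odd M) (z : τ) (f : SFun τ odd) :
    pd odd z (linVF odd M f) = linVF odd M (pd odd z f) + ∑ x, M z x • pd odd x f := by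
  classical
  simp only [linVF_apply, map_sum, map_smul, pd_coord_mul, smul_add, Finset.sum_add_distrib]
  rw [add_comm]
  congr 1
  · refine Finset.sum_congr rfl fun x _ => Finset.sum_congr rfl fun y _ => ?_
    by_cases h : M y x = 0
    · simp [h]
    · rw [pd_pd_comm z x, sgn_congr_right z (hM y x h), mul_smul_comm,
        smul_smul (sgn odd z x), sgn_mul_self, one_smul]
  · simp

/-- The commutator of the Laplacian with a linear vector field is the Laplacian of the Lie
derivative of its bivector. -/
theorem laplace_linVF {M : Matrix τ τ ℝ} (hM : IsEven odd M) (P : Matrix τ τ ℝ) (f : SFun τ odd) :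
    laplace odd P (linVF odd M f) = linVF odd M (laplace odd P f) +
      laplace odd (M.transpose * P + P * M) f := by
  classical
  simp only [laplace_apply, pd_linVF hM, map_add, map_sum, map_smul, smul_add,
    Finset.sum_add_distrib, Matrix.add_apply, add_smul]
  rw [add_assoc, ← sum_smul_sum_left, ← sum_smul_sum_right P M]

theorem quad_mem_center {N : Matrix τ τ ℝ} (hN : IsEven odd N) :
    quad odd N ∈ Subalgebra.center ℝ (SFun τ odd) := by
  refine Subalgebra.smul_mem _ (Subalgebra.sum_mem _ fun x _ => Subalgebra.sum_mem _ fun y _ => ?_) _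
  by_cases h : N x y = 0
  · rw [h, zero_smul]; exact Subalgebra.zero_mem _
  · exact Subalgebra.smul_mem _ (mem_center_of_coord (coord_mul_pair (hN x y h))) _

/-- A matrix of a quadratic form in supercommuting variables: `N_{yx} = (-1)^{|x||y|} N_{xy}`. -/
def IsSuperSymm (odd : τ → Bool) (N : Matrix τ τ ℝ) : Prop :=
  ∀ x y, N y x = sgn odd x y * N x y

theorem pd_quad_mul {N : Matrix τ τ ℝ} (hN : IsEven odd N) (hs : IsSuperSymm odd N) (w : τ)
    (f : SFun τ odd) :
    pd odd w (quad odd N * f) =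
      quad odd N * pd odd w f + ∑ y, N w y • (coord odd y * f) := by
  classical
  have h2 : ∀ x y, N x y • pd odd w (coord odd x * coord odd y * f) =
      N x y • ((if w = x then coord odd y * f else 0) +
        (if w = y then sgn odd y x • (coord odd x * f) else 0) +
        coord odd x * coord odd y * pd odd w f) := by
    intro x y
    by_cases h : N x y = 0
    · simp [h]
    congr 1
    rw [mul_assoc, pd_coord_mul, pd_coord_mul, mul_add, smul_add, add_assoc, mul_smul_comm,
      smul_smul, sgn_congr_right w (hN x y h), sgn_mul_self, one_smul, mul_assoc]
    congr 2
    split_ifs with h'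
    · subst h'; rw [sgn_congr_right w (hN x w h)]
    · simp
  simp only [quad, smul_mul_assoc, Finset.sum_mul, map_smul, map_sum, h2, smul_add,
    Finset.sum_add_distrib]
  rw [add_comm]
  congr 1
  have h3 : ∑ x, ∑ y, N x y • (if w = x then coord odd y * f else 0) =
      ∑ y, N w y • (coord odd y * f) := by
    rw [Finset.sum_comm]; simp
  have h4 : ∑ x, ∑ y, N x y • (if w = y then sgn odd y x • (coord odd x * f) else 0) =
      ∑ y, N w y • (coord odd y * f) := by
    refine Finset.sum_congr rfl fun x _ => ?_
    simp only [smul_ite, smul_zero, Finset.sum_ite_eq, Finset.mem_univ, if_true]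
    rw [hs w x, smul_smul, mul_right_comm, mul_comm (sgn odd w x), sgn_mul_self, one_mul]
  rw [h3, h4, ← smul_add, ← two_smul ℝ, smul_smul]
  norm_num

/-- The commutator of a constant coefficient operator with a quadratic function is a linear vector
field plus a constant. -/
theorem laplace_quad_mul {N P : Matrix τ τ ℝ} (hN : IsEven odd N) (hs : IsSuperSymm odd N)
    (hPs : IsSuperSymm odd P) (f : SFun τ odd) :
    laplace odd P (quad odd N * f) = quad odd N * laplace odd P f +
      linVF odd (N.transpose * P) f + ((1 / 2 : ℝ) * (P * N).trace) • f := by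
  classical
  have h1 : ∀ z w, P z w • pd odd z (pd odd w (quad odd N * f)) =
      P z w • (quad odd N * pd odd z (pd odd w f)) +
      (P z w • ∑ y, N z y • (coord odd y * pd odd w f) +
        (P z w * N w z) • f + P w z • ∑ y, N w y • (coord odd y * pd odd z f)) := by
    intro z w
    rw [pd_quad_mul hN hs, map_add, pd_quad_mul hN hs, add_assoc, smul_add, smul_add]
    congr 1
    rw [add_assoc]
    congr 1
    simp only [map_sum, map_smul, pd_coord_mul, smul_add, Finset.sum_add_distrib]
    congr 1
    · simp [smul_smul]
    · rw [hPs z w, Finset.smul_sum, Finset.smul_sum]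
      refine Finset.sum_congr rfl fun y _ => ?_
      by_cases h : N w y = 0
      · simp [h]
      · rw [sgn_congr_right z (hN w y h), smul_smul, smul_smul, smul_smul]
        congr 1
        ring
  rw [laplace_apply, laplace_apply]
  simp only [h1, Finset.sum_add_distrib]
  rw [sum_smul_sum_left P N fun y w => coord odd y * pd odd w f]
  rw [Finset.sum_comm (f := fun z w => P w z • ∑ y, N w y • (coord odd y * pd odd z f))]
  rw [sum_smul_sum_left P N fun y w => coord odd y * pd odd w f]
  rw [linVF_apply, Finset.sum_comm (f := fun x y => (N.transpose * P) y x • _)]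
  have h5 : ∑ z, ∑ w, (P z w * N w z) • f = (P * N).trace • f := by
    simp [Matrix.trace, Matrix.mul_apply, Finset.sum_smul]
  rw [h5]
  simp only [mul_smul_comm, Finset.mul_sum]
  module

theorem linVF_quad {M : Matrix τ τ ℝ} (hM : IsEven odd M) (N : Matrix τ τ ℝ) :
    linVF odd M (quad odd N) = quad odd (M * N + N * M.transpose) := by
  classical
  simp only [quad, map_smul, map_sum, linVF_coord_mul hM, linVF_coord, smul_add,
    Finset.sum_add_distrib, Finset.sum_mul, Finset.mul_sum, Matrix.add_apply, add_smul,
    smul_mul_assoc, mul_smul_comm]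
  congr 2
  · have h := sum_smul_sum_left N M.transpose fun x y => coord odd x * coord odd y
    simpa using h
  · have h := sum_smul_sum_right N M.transpose fun x y => coord odd x * coord odd y
    simpa using h

end Operators

end SFun

namespace SFun

/-! ### Gaussian integrals over superspace -/

section Gaussian

variable {τ : Type*} [Fintype τ] [DecidableEq τ] {odd : τ → Bool}

/-- The diagonal matrix of the signs `(-1)^{|x|}`. -/
def parity (odd : τ → Bool) : Matrix τ τ ℝ := Matrix.diagonal fun x => if odd x = true then -1 else 1

theorem parity_mul_parity : parity odd * parity odd = 1 := by
  rw [parity, Matrix.diagonal_mul_diagonal, ← Matrix.diagonal_one]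
  congr 1; ext x; split_ifs <;> norm_num

omit [Fintype τ] in
theorem parity_transpose : (parity odd).transpose = parity odd := Matrix.diagonal_transpose _

theorem isEven_iff {N : Matrix τ τ ℝ} : IsEven odd N ↔ Commute (parity odd) N := by
  rw [Commute, SemiconjBy, ← Matrix.ext_iff]
  simp only [parity, Matrix.diagonal_mul, Matrix.mul_diagonal]
  refine forall_congr' fun x => forall_congr' fun y => ?_
  rcases odd x <;> rcases odd y <;> simp [eq_neg_iff_add_eq_zero, neg_eq_iff_add_eq_zero]

theorem isSuperSymm_iff {N : Matrix τ τ ℝ} (hN : IsEven odd N) :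
    IsSuperSymm odd N ↔ N.transpose = parity odd * N := by
  rw [← Matrix.ext_iff]
  simp only [parity, Matrix.diagonal_mul, Matrix.transpose_apply]
  refine forall_congr' fun x => forall_congr' fun y => ?_
  by_cases h : N x y = 0
  · simp [h]
  · simp only [sgn, ← hN x y h, and_self]

variable {N P : Matrix τ τ ℝ}

omit [DecidableEq τ] in
theorem laplace_commute {P P' : Matrix τ τ ℝ} (hP : IsEven odd P) :
    Commute (laplace odd P) (laplace odd P') := by
  have h : ∀ z w u : τ, odd z = odd w → Commute (pd odd z * pd odd w) (pd odd u) := by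
    intro z w u hzw
    refine LinearMap.ext fun f => ?_
    simp only [Module.End.mul_apply]
    rw [pd_pd_comm w u, map_smul, pd_pd_comm z u, smul_smul, sgn_congr_left hzw, sgn_mul_self,
      one_smul]
  refine Commute.smul_left (Commute.smul_right ?_ _) _
  refine Commute.sum_left _ _ _ fun z _ => Commute.sum_left _ _ _ fun w _ =>
    Commute.sum_right _ _ _ fun u _ => Commute.sum_right _ _ _ fun v _ => ?_
  by_cases hzw : P z w = 0
  · simp [hzw]
  · exact Commute.smul_left (Commute.smul_right
      ((h z w u (hP z w hzw)).mul_right (h z w v (hP z w hzw))) _) _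

/-- The even operator `(-1)^{|·|} N P` whose supertraces are the values of the wheels. -/
def wheelMatrix (odd : τ → Bool) (N P : Matrix τ τ ℝ) : Matrix τ τ ℝ := parity odd * N * P

variable (hN : IsEven odd N) (hP : IsEven odd P) (hNs : IsSuperSymm odd N)
  (hPs : IsSuperSymm odd P)

include hN hP

theorem isEven_wheelMatrix_pow (k : ℕ) : IsEven odd (wheelMatrix odd N P ^ k) := by
  rw [isEven_iff] at *
  exact Commute.pow_right (((Commute.refl _).mul_right hN).mul_right hP) k

include hNs hPs

theorem wheelMatrix_pow_transpose (k : ℕ) :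
    (wheelMatrix odd N P ^ k).transpose = (P * N * parity odd) ^ k := by
  rw [Matrix.transpose_pow, wheelMatrix, Matrix.transpose_mul, Matrix.transpose_mul,
    parity_transpose, (isSuperSymm_iff hN).1 hNs, (isSuperSymm_iff hP).1 hPs]
  rw [isEven_iff] at hN hP
  congr 1
  rw [hP.eq, mul_assoc P, ← mul_assoc (parity odd), ← mul_assoc (parity odd),
    parity_mul_parity, one_mul, mul_assoc]

omit hP hNs hPs in
theorem pow_mul_eq_mul_wheelMatrix_pow (k : ℕ) :
    (P * N * parity odd) ^ k * P = P * wheelMatrix odd N P ^ k := by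
  rw [isEven_iff] at hN
  have h : SemiconjBy P (wheelMatrix odd N P) (P * N * parity odd) := by
    rw [SemiconjBy, wheelMatrix, hN.eq]; simp only [mul_assoc]
  exact (h.pow_right k).eq.symm

omit hNs hPs in
theorem mul_pow_eq_wheelMatrix_pow_mul (k : ℕ) :
    N * (P * N * parity odd) ^ k = wheelMatrix odd N P ^ k * N := by
  rw [isEven_iff] at hN hP
  have h : SemiconjBy N (P * N * parity odd) (wheelMatrix odd N P) := by
    have h' := ((hN.mul_right hP).mul_right hN).eq
    rw [SemiconjBy, wheelMatrix]
    simp only [mul_assoc] at h' ⊢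
    exact h'.symm
  exact (h.pow_right k).eq

theorem linVF_wheelMatrix_quad (k : ℕ) :
    linVF odd (wheelMatrix odd N P ^ k) (quad odd N) =
      (2 : ℝ) • quad odd (wheelMatrix odd N P ^ k * N) := by
  rw [linVF_quad (isEven_wheelMatrix_pow hN hP k), wheelMatrix_pow_transpose hN hP hNs hPs,
    mul_pow_eq_wheelMatrix_pow_mul hN hP, ← two_smul ℝ]
  simp only [quad, Matrix.smul_apply, smul_assoc, ← Finset.smul_sum]
  rw [smul_comm]

theorem laplace_linVF_wheelMatrix (k : ℕ) (f : SFun τ odd) :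
    laplace odd P (linVF odd (wheelMatrix odd N P ^ k) f) =
      linVF odd (wheelMatrix odd N P ^ k) (laplace odd P f) +
        (2 : ℝ) • laplace odd (P * wheelMatrix odd N P ^ k) f := by
  rw [laplace_linVF (isEven_wheelMatrix_pow hN hP k), wheelMatrix_pow_transpose hN hP hNs hPs,
    pow_mul_eq_mul_wheelMatrix_pow hN, ← two_smul ℝ]
  simp only [laplace_apply, Matrix.smul_apply, smul_assoc, ← Finset.smul_sum]
  rw [smul_comm (2 : ℝ)]

theorem isSuperSymm_mul_wheelMatrix_pow (k : ℕ) :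
    IsSuperSymm odd (P * wheelMatrix odd N P ^ k) := by
  have hE : IsEven odd (P * wheelMatrix odd N P ^ k) := by
    have h := isEven_wheelMatrix_pow hN hP k
    rw [isEven_iff] at *
    exact hP.mul_right h
  rw [isSuperSymm_iff hE, Matrix.transpose_mul, wheelMatrix_pow_transpose hN hP hNs hPs,
    (isSuperSymm_iff hP).1 hPs]
  have hE' := isEven_iff.1 hE
  have hP' := isEven_iff.1 hP
  rw [hE'.eq, hP'.eq, ← mul_assoc, pow_mul_eq_mul_wheelMatrix_pow hN]

/-- The value `½ (-1)^{|·|}`-trace of the wheel with `k` spokes. -/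
def wheelValue (odd : τ → Bool) (N P : Matrix τ τ ℝ) (k : ℕ) : ℝ :=
  1 / 2 * (parity odd * wheelMatrix odd N P ^ k).trace

theorem laplace_wheelMatrix_quad_mul (k : ℕ) (f : SFun τ odd) :
    laplace odd (P * wheelMatrix odd N P ^ k) (quad odd N * f) =
      quad odd N * laplace odd (P * wheelMatrix odd N P ^ k) f +
        linVF odd (wheelMatrix odd N P ^ (k + 1)) f + wheelValue odd N P (k + 1) • f := by
  have hN' := isEven_iff.1 hN
  rw [laplace_quad_mul hN hNs (isSuperSymm_mul_wheelMatrix_pow hN hP hNs hPs k)]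
  congr 2
  · rw [(isSuperSymm_iff hN).1 hNs, pow_succ', ← mul_assoc]
    rfl
  · rw [wheelValue, pow_succ', wheelMatrix, ← mul_assoc, ← mul_assoc, ← mul_assoc,
      parity_mul_parity, one_mul, Matrix.trace_mul_comm, ← mul_assoc]

theorem linVF_wheelMatrix_quad_pow (k n : ℕ) :
    linVF odd (wheelMatrix odd N P ^ k) (quad odd N ^ (n + 1)) =
      (2 * ((n : ℝ) + 1)) • (quad odd (wheelMatrix odd N P ^ k * N) * quad odd N ^ n) := by
  rw [linVF_pow_of_central (isEven_wheelMatrix_pow hN hP k) (quad_mem_center hN),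
    linVF_wheelMatrix_quad hN hP hNs hPs, smul_mul_assoc, smul_smul, mul_comm 2]

theorem laplace_wheelMatrix_quad_pow (k n : ℕ) :
    laplace odd (P * wheelMatrix odd N P ^ k) (quad odd N ^ (n + 1)) =
      (((n : ℝ) + 1) * wheelValue odd N P (k + 1)) • quad odd N ^ n +
      ((n : ℝ) * (n + 1)) •
        (quad odd (wheelMatrix odd N P ^ (k + 1) * N) * quad odd N ^ (n - 1)) := by
  induction n with
  | zero =>
    have h0 : laplace odd (P * wheelMatrix odd N P ^ k) (1 : SFun τ odd) = 0 := by
      simp [laplace_apply, pd_one]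
    have h := laplace_wheelMatrix_quad_mul hN hP hNs hPs k 1
    rw [linVF_one, h0] at h
    simpa using h
  | succ n ih =>
    rw [pow_succ', laplace_wheelMatrix_quad_mul hN hP hNs hPs, ih,
      linVF_wheelMatrix_quad_pow hN hP hNs hPs, mul_add, mul_smul_comm, mul_smul_comm,
      ← pow_succ', ← mul_assoc, ← Subalgebra.mem_center_iff.1 (quad_mem_center hN), mul_assoc,
      ← pow_succ']
    rcases n with _ | n
    · simp only [Nat.cast_zero, zero_add, zero_mul, zero_smul, add_zero, Nat.cast_one]
      module
    · simp only [Nat.add_sub_cancel]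
      push_cast
      module

theorem laplace_pow_linVF (k e : ℕ) (f : SFun τ odd) :
    (laplace odd P ^ e) (linVF odd (wheelMatrix odd N P ^ k) f) =
      linVF odd (wheelMatrix odd N P ^ k) ((laplace odd P ^ e) f) +
      (2 * (e : ℝ)) • (laplace odd P ^ (e - 1)) (laplace odd (P * wheelMatrix odd N P ^ k) f) := by
  have hE : IsEven odd (P * wheelMatrix odd N P ^ k) := by
    have h := isEven_wheelMatrix_pow hN hP k
    rw [isEven_iff] at *
    exact hP.mul_right h
  induction e with
  | zero => simp
  | succ e ih =>
    rw [pow_succ', Module.End.mul_apply, ih, map_add, laplace_linVF_wheelMatrix hN hP hNs hPs,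
      map_smul, Module.End.mul_apply, Nat.add_sub_cancel, add_assoc]
    congr 1
    have h1 : laplace odd (P * wheelMatrix odd N P ^ k) ((laplace odd P ^ e) f) =
        (laplace odd P ^ e) (laplace odd (P * wheelMatrix odd N P ^ k) f) := by
      have := ((laplace_commute (P' := P) hE).pow_right e).eq
      exact LinearMap.congr_fun this f
    rw [h1]
    rcases e with _ | e
    · simp
    · rw [Nat.add_sub_cancel, ← Module.End.mul_apply (laplace odd P), ← pow_succ']
      push_cast
      module

section Moments

variable (E : SFun τ odd →ₐ[ℝ] ℝ) (hE : ∀ x, E (coord odd x) = 0)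

omit [DecidableEq τ] hN hP hNs hPs in
include hE in
theorem eval_linVF (M : Matrix τ τ ℝ) (f : SFun τ odd) : E (linVF odd M f) = 0 := by
  simp [linVF_apply, hE]

include hE

/-- One leg of the chain `q_k` of quadratic vertices is contracted: it either closes the chain to a
wheel, or meets one of the `m` further vertices and lengthens the chain. For `m = 0` the second term
has coefficient `0`, whatever `m - 1` stands for. -/
theorem moment_step (k m : ℕ) :
    E ((laplace odd P ^ (m + 1)) (quad odd (wheelMatrix odd N P ^ k * N) * quad odd N ^ m)) =
      ((m : ℝ) + 1) * wheelValue odd N P (k + 1) * E ((laplace odd P ^ m) (quad odd N ^ m)) +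
      ((m : ℝ) * (m + 1)) * E ((laplace odd P ^ m)
        (quad odd (wheelMatrix odd N P ^ (k + 1) * N) * quad odd N ^ (m - 1))) := by
  have h1 := congrArg E (laplace_pow_linVF hN hP hNs hPs k (m + 1) (quad odd N ^ (m + 1)))
  rw [map_add, eval_linVF E hE, zero_add, linVF_wheelMatrix_quad_pow hN hP hNs hPs, map_smul,
    map_smul, map_smul, Nat.add_sub_cancel, laplace_wheelMatrix_quad_pow hN hP hNs hPs] at h1
  simp only [map_add, map_smul, smul_eq_mul, Nat.cast_add, Nat.cast_one] at h1
  have h2 : (2 : ℝ) * (m + 1) ≠ 0 := by positivity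
  exact mul_left_cancel₀ h2 h1

/-- The Gaussian moments, normalized: `⟨q^m⟩ = [Δ^m q^m]₀ / m!²`. -/
def moment (E : SFun τ odd →ₐ[ℝ] ℝ) (N P : Matrix τ τ ℝ) (m : ℕ) : ℝ :=
  ((m ! : ℝ)⁻¹ * (m ! : ℝ)⁻¹) * E ((laplace odd P ^ m) (quad odd N ^ m))

/-- The chain is lengthened until it closes, which splits a wheel off the moment. -/
theorem wheel_moment_eq_sum (m : ℕ) : ∀ k,
    (((m + 1)! : ℝ)⁻¹ * (m ! : ℝ)⁻¹) * E ((laplace odd P ^ (m + 1))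
      (quad odd (wheelMatrix odd N P ^ k * N) * quad odd N ^ m)) =
    ∑ j ∈ Finset.range (m + 1), wheelValue odd N P (k + 1 + j) * moment E N P (m - j) := by
  induction m with
  | zero =>
    intro k
    rw [moment_step hN hP hNs hPs E hE]
    simp [moment]
  | succ m ih =>
    intro k
    rw [moment_step hN hP hNs hPs E hE, Finset.sum_range_succ']
    have h := ih (k + 1)
    simp only [Nat.add_sub_cancel, Nat.add_sub_add_right, add_zero, Nat.sub_zero]
    rw [Finset.sum_congr rfl (g := fun j => wheelValue odd N P (k + 1 + 1 + j) * moment E N P (m - j))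
      (fun j _ => by rw [show k + 1 + (j + 1) = k + 1 + 1 + j by ring]), ← h, moment]
    have e1 : ((m + 1 + 1)! : ℝ) = (m + 2) * ((m + 1)! : ℝ) := by
      rw [Nat.factorial_succ (m + 1)]; push_cast; ring
    have e2 : ((m + 1)! : ℝ) = (m + 1) * (m ! : ℝ) := by
      rw [Nat.factorial_succ m]; push_cast; ring
    have e3 : (m ! : ℝ) ≠ 0 := by positivity
    rw [e1, e2]
    push_cast
    field_simp
    ring

/-- The recursion for the Gaussian moments: `Z' = (∑ c_{j+1} t^j) Z` on the level of coefficients. -/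
theorem moment_succ (m : ℕ) : ((m : ℝ) + 1) * moment E N P (m + 1) =
    ∑ j ∈ Finset.range (m + 1), wheelValue odd N P (j + 1) * moment E N P (m - j) := by
  have h := wheel_moment_eq_sum hN hP hNs hPs E hE m 0
  simp only [pow_zero, one_mul, zero_add, add_comm 1] at h
  rw [← h, moment, ← pow_succ', Nat.factorial_succ]
  push_cast
  have e3 : (m ! : ℝ) ≠ 0 := by positivity
  field_simp

end Moments

end Gaussian
end SFun

/-! ### The formal logarithm -/

section FormalLog

open PowerSeries

theorem map_formalLog {R R' : Type*} [Ring R] [Algebra ℝ R] [Ring R'] [Algebra ℝ R'] (f : R →+* R')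
    (hf : ∀ (r : ℝ) x, f (r • x) = r • f x) (Z : PowerSeries R) :
    PowerSeries.map f (formalLog Z) = formalLog (PowerSeries.map f Z) := by
  ext n
  simp only [formalLog, coeff_map, coeff_mk, map_sum, hf]
  refine Finset.sum_congr rfl fun j _ => ?_
  rw [← coeff_map, map_pow, map_sub, map_one]

section Comm

variable {R : Type*} [CommRing R] [Algebra ℝ R]

theorem constantCoeff_formalLog (Z : PowerSeries R) : constantCoeff (formalLog Z) = 0 := by
  rw [← coeff_zero_eq_constantCoeff_apply]
  simp [formalLog]

theorem powerSeries_ext_of_derivative {F G : PowerSeries R} (h : d⁄dX R F = d⁄dX R G)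
    (h0 : constantCoeff F = constantCoeff G) : F = G := by
  ext n
  rcases n with _ | n
  · simpa using h0
  · have h1 := congrArg (coeff n) h
    rw [coeff_derivative, coeff_derivative] at h1
    have h2 : ((n : R) + 1) = algebraMap ℝ R (n + 1) := by simp
    have h3 : algebraMap ℝ R (n + 1) * algebraMap ℝ R (((n : ℝ) + 1)⁻¹) = 1 := by
      rw [← map_mul, mul_inv_cancel₀ (by positivity), map_one]
    calc coeff (n + 1) F = coeff (n + 1) F * ((n : R) + 1) * algebraMap ℝ R (((n : ℝ) + 1)⁻¹) := by
          rw [mul_assoc, h2, h3, mul_one]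
      _ = coeff (n + 1) G := by rw [h1, mul_assoc, h2, h3, mul_one]

omit [Algebra ℝ R] in
theorem coeff_eq_zero_of_constantCoeff {U : PowerSeries R} (hU : constantCoeff U = 0) {n j : ℕ}
    (h : n < j) (V : PowerSeries R) : coeff n (U ^ j * V) = 0 := by
  obtain ⟨W, rfl⟩ := X_dvd_iff.2 hU
  rw [mul_pow, mul_assoc, coeff_X_pow_mul', if_neg (by omega)]

/-- The partial sums of the logarithm series have the right coefficients. -/
theorem coeff_formalLog_eq {Z : PowerSeries R} (hZ : constantCoeff Z = 1) {n N : ℕ} (h : n ≤ N) :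
    coeff n (formalLog Z) =
      coeff n (∑ j ∈ Finset.range N, ((-1 : ℝ) ^ j / (j + 1)) • (Z - 1) ^ (j + 1)) := by
  have hU : constantCoeff (Z - 1) = 0 := by simp [hZ]
  rw [formalLog, coeff_mk, map_sum, ← Finset.sum_subset (Finset.range_subset_range.2 h)]
  · rw [Finset.range_eq_Ico, ← Finset.Ico_add_one_right_eq_Icc,
      ← Finset.sum_Ico_add' _ 0 n 1]
    refine Finset.sum_congr rfl fun j _ => ?_
    rw [pow_add _ j 2 |> fun h => show (-1 : ℝ) ^ (j + 1 + 1) = (-1) ^ j by rw [h]; norm_num]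
    push_cast
    rfl
  · intro j _ hj
    have : coeff n ((Z - 1) ^ (j + 1) * 1) = 0 :=
      coeff_eq_zero_of_constantCoeff hU (by simpa [Nat.lt_succ_iff] using hj) 1
    rw [mul_one] at this
    have h' : coeff n ((((-1 : ℝ) ^ j / (j + 1)) • (Z - 1) ^ (j + 1))) =
      ((-1 : ℝ) ^ j / (j + 1)) • coeff n ((Z - 1) ^ (j + 1)) := rfl
    rw [h', this, smul_zero]

/-- The formal logarithm solves `L' Z = Z'`, the equation that characterizes it together with its
vanishing constant term. -/
theorem derivative_formalLog_mul {Z : PowerSeries R} (hZ : constantCoeff Z = 1) :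
    d⁄dX R (formalLog Z) * Z = d⁄dX R Z := by
  have hU : constantCoeff (Z - 1) = 0 := by simp [hZ]
  ext n
  set S := ∑ j ∈ Finset.range (n + 1), ((-1 : ℝ) ^ j / (j + 1)) • (Z - 1) ^ (j + 1) with hS
  have h1 : coeff n (d⁄dX R (formalLog Z) * Z) = coeff n (d⁄dX R S * Z) := by
    rw [coeff_mul, coeff_mul]
    refine Finset.sum_congr rfl fun p hp => ?_
    rw [coeff_derivative, coeff_derivative, coeff_formalLog_eq hZ (N := n + 1)]
    have := Finset.HasAntidiagonal.mem_antidiagonal.1 hp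
    omega
  have h2 : d⁄dX R S = (∑ j ∈ Finset.range (n + 1), (-(Z - 1)) ^ j) * d⁄dX R Z := by
    rw [hS, map_sum, Finset.sum_mul]
    refine Finset.sum_congr rfl fun j _ => ?_
    have h' : ∀ (r : ℝ) (F : PowerSeries R), r • F = C (algebraMap ℝ R r) * F := by
      intro r F; ext m; rw [coeff_C_mul, ← Algebra.smul_def]; rfl
    have h3 : C (algebraMap ℝ R ((-1 : ℝ) ^ j / (j + 1))) * ((j : PowerSeries R) + 1) =
        (-1) ^ j := by
      have : ((j : PowerSeries R) + 1) = C (algebraMap ℝ R ((j : ℝ) + 1)) := by simp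
      rw [this, ← map_mul, ← map_mul, div_mul_cancel₀ _ (by positivity)]
      simp
    rw [h', Derivation.leibniz, derivative_C, smul_zero, add_zero, derivative_pow, smul_eq_mul,
      map_sub, derivative_one, sub_zero, Nat.add_sub_cancel, neg_pow (Z - 1), ← h3]
    push_cast
    ring
  have h4 : d⁄dX R S * Z = d⁄dX R Z - (Z - 1) ^ (n + 1) * ((-1) ^ (n + 1) * d⁄dX R Z) := by
    have h := geom_sum_mul (-(Z - 1)) (n + 1)
    rw [h2]
    have h5 : (∑ j ∈ Finset.range (n + 1), (-(Z - 1)) ^ j) * Z = 1 - (-(Z - 1)) ^ (n + 1) := by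
      linear_combination -h
    rw [mul_right_comm, h5, neg_pow]
    ring
  rw [h1, h4, map_sub, coeff_eq_zero_of_constantCoeff hU (by omega), sub_zero]

theorem formalLog_unique {Z L : PowerSeries R} (hZ : constantCoeff Z = 1)
    (hL : constantCoeff L = 0) (h : d⁄dX R L * Z = d⁄dX R Z) : formalLog Z = L := by
  have hu : IsUnit Z := isUnit_iff_constantCoeff.2 (by simp [hZ])
  refine powerSeries_ext_of_derivative ?_ (by rw [constantCoeff_formalLog, hL])
  exact hu.mul_right_cancel ((derivative_formalLog_mul hZ).trans h.symm)

theorem formalLog_mul {Z W : PowerSeries R} (hZ : constantCoeff Z = 1)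
    (hW : constantCoeff W = 1) : formalLog (Z * W) = formalLog Z + formalLog W := by
  refine formalLog_unique (by simp [hZ, hW]) (by simp [constantCoeff_formalLog]) ?_
  rw [map_add, Derivation.leibniz, ← derivative_formalLog_mul hZ, ← derivative_formalLog_mul hW]
  simp only [smul_eq_mul]
  ring

theorem formalLog_exp (c : R) :
    formalLog (PowerSeries.mk fun n => (n ! : ℝ)⁻¹ • c ^ n) = X * C c := by
  refine formalLog_unique (by simp [← coeff_zero_eq_constantCoeff_apply]) (by simp) ?_
  ext n
  have h : d⁄dX R (X * C c : PowerSeries R) = C c := by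
    rw [Derivation.leibniz, derivative_X, derivative_C]; simp
  rw [h, coeff_C_mul, coeff_derivative, coeff_mk, coeff_mk, Nat.factorial_succ, mul_smul_comm,
    pow_succ', smul_mul_assoc]
  have h2 : ((n : R) + 1) = algebraMap ℝ R (n + 1) := by simp
  rw [h2, mul_comm (c * c ^ n), ← Algebra.smul_def, smul_smul]
  congr 1
  push_cast
  have : (n ! : ℝ) ≠ 0 := by positivity
  field_simp

/-- The logarithm of a series with a given logarithmic derivative. -/
theorem formalLog_of_recursion {Z : PowerSeries ℝ} (hZ : constantCoeff Z = 1) (c : ℕ → ℝ)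
    (h : ∀ m : ℕ, ((m : ℝ) + 1) * coeff (m + 1) Z =
      ∑ j ∈ Finset.range (m + 1), c (j + 1) * coeff (m - j) Z) :
    formalLog Z = PowerSeries.mk fun n => c n / n := by
  refine formalLog_unique hZ (by simp [← coeff_zero_eq_constantCoeff_apply]) ?_
  ext n
  rw [coeff_derivative, mul_comm (coeff (n + 1) Z), h, coeff_mul, Finset.Nat.sum_antidiagonal_eq_sum_range_succ_mk]
  refine Finset.sum_congr rfl fun j _ => ?_
  rw [coeff_derivative, coeff_mk]
  push_cast
  rw [div_mul_cancel₀ _ (by positivity)]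

end Comm

section Bigraded

variable {R : Type*} [Ring R] [Algebra ℝ R] {S : ℕ → ℕ → Submodule ℝ R}

theorem coeff_coeff_mul_mem
    (hmul : ∀ v e v' e' a b, a ∈ S v e → b ∈ S v' e' → a * b ∈ S (v + v') (e + e'))
    {F G : PowerSeries (PowerSeries R)} (hF : ∀ v e, coeff e (coeff v F) ∈ S v e)
    (hG : ∀ v e, coeff e (coeff v G) ∈ S v e) (v e : ℕ) :
    coeff e (coeff v (F * G)) ∈ S v e := by
  rw [coeff_mul, map_sum]
  refine Submodule.sum_mem _ fun p hp => ?_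
  rw [coeff_mul]
  refine Submodule.sum_mem _ fun q hq => ?_
  have h := hmul _ _ _ _ _ _ (hF p.1 q.1) (hG p.2 q.2)
  rwa [Finset.HasAntidiagonal.mem_antidiagonal.1 hp, Finset.HasAntidiagonal.mem_antidiagonal.1 hq] at h

/-- The formal logarithm respects multiplicative constraints on the coefficients. -/
theorem coeff_coeff_formalLog_mem (hone : 1 ∈ S 0 0)
    (hmul : ∀ v e v' e' a b, a ∈ S v e → b ∈ S v' e' → a * b ∈ S (v + v') (e + e'))
    {Z : PowerSeries (PowerSeries R)} (hZ : ∀ v e, coeff e (coeff v Z) ∈ S v e) (v e : ℕ) :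
    coeff e (coeff v (formalLog Z)) ∈ S v e := by
  have h1 : ∀ v e, coeff e (coeff v (1 : PowerSeries (PowerSeries R))) ∈ S v e := by
    intro v e
    rw [coeff_one]
    split_ifs with hv
    · rw [coeff_one]
      split_ifs with he
      · rw [hv, he]; exact hone
      · exact Submodule.zero_mem _
    · rw [map_zero]; exact Submodule.zero_mem _
  have hp : ∀ j v e, coeff e (coeff v ((Z - 1) ^ j)) ∈ S v e := by
    intro j
    induction j with
    | zero => simpa using h1
    | succ j ih =>
      rw [pow_succ]
      refine coeff_coeff_mul_mem hmul ih fun v e => ?_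
      rw [map_sub, map_sub]
      exact Submodule.sub_mem _ (hZ v e) (h1 v e)
  rw [formalLog, coeff_mk, map_sum]
  exact Submodule.sum_mem _ fun j _ => Submodule.smul_mem _ _ (hp j v e)

end Bigraded

section Diagonal

/-- The diagonal part of a double power series. -/
def diagPart (F : PowerSeries (PowerSeries ℝ)) : PowerSeries ℝ :=
  PowerSeries.mk fun n => coeff n (coeff n F)

variable {F G Z : PowerSeries (PowerSeries ℝ)}

theorem diagPart_mul (hF : ∀ v e, e < v → coeff e (coeff v F) = 0)
    (hG : ∀ v e, e < v → coeff e (coeff v G) = 0) :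
    diagPart (F * G) = diagPart F * diagPart G := by
  ext n
  rw [diagPart, coeff_mk, coeff_mul, coeff_mul, map_sum]
  refine Finset.sum_congr rfl fun p hp => ?_
  rw [coeff_mul, Finset.sum_eq_single p]
  · simp [diagPart]
  · intro q hq hne
    have h1 := Finset.HasAntidiagonal.mem_antidiagonal.1 hp
    have h2 := Finset.HasAntidiagonal.mem_antidiagonal.1 hq
    rcases lt_trichotomy q.1 p.1 with h | h | h
    · rw [hF _ _ h, zero_mul]
    · exact absurd (Prod.ext h (by omega)) hne
    · rw [hG p.2 q.2 (by omega), mul_zero]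
  · exact fun h => absurd hp h

/-- The formal logarithm commutes with taking the diagonal part of a triangular double series. -/
theorem diagPart_formalLog (hZ : ∀ v e, e < v → coeff e (coeff v Z) = 0) :
    diagPart (formalLog Z) = formalLog (diagPart Z) := by
  have h1 : ∀ v e, e < v → coeff e (coeff v (Z - 1)) = 0 := by
    intro v e h
    rw [map_sub, map_sub, hZ v e h, coeff_one, if_neg (by omega)]; simp
  have hd : diagPart (Z - 1) = diagPart Z - 1 := by
    ext n
    simp only [diagPart, coeff_mk, map_sub, coeff_one]
    split_ifs with h <;> simp [coeff_one, h]
  have hp : ∀ j, (∀ v e, e < v → coeff e (coeff v ((Z - 1) ^ j)) = 0) ∧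
      diagPart ((Z - 1) ^ j) = (diagPart Z - 1) ^ j := by
    intro j
    induction j with
    | zero =>
      refine ⟨fun v e h => by rw [pow_zero, coeff_one, if_neg (by omega), map_zero], ?_⟩
      ext n
      simp only [diagPart, coeff_mk, pow_zero, coeff_one]
      split_ifs with h <;> simp [coeff_one, h]
    | succ j ih =>
      refine ⟨fun v e h => ?_, ?_⟩
      · rw [pow_succ, coeff_mul, map_sum]
        refine Finset.sum_eq_zero fun p hp => ?_
        rw [coeff_mul]
        refine Finset.sum_eq_zero fun q hq => ?_
        have h3 := Finset.HasAntidiagonal.mem_antidiagonal.1 hp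
        have h4 := Finset.HasAntidiagonal.mem_antidiagonal.1 hq
        rcases lt_or_ge q.1 p.1 with h | h
        · rw [ih.1 _ _ h, zero_mul]
        · rw [h1 p.2 q.2 (by omega), mul_zero]
      · rw [pow_succ, diagPart_mul ih.1 h1, ih.2, hd, pow_succ]
  ext n
  rw [diagPart, coeff_mk, formalLog, formalLog, coeff_mk, coeff_mk, map_sum]
  refine Finset.sum_congr rfl fun j _ => ?_
  rw [← (hp j).2, diagPart, coeff_mk]
  rfl

end Diagonal

end FormalLog

namespace SFun

variable {τ τ' : Type*} {odd : τ → Bool} {odd' : τ' → Bool}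

/-! ### Spans of monomials -/

/-- The span of the monomials whose multiset of variables lies in `S`. -/
def monoSpan (odd : τ → Bool) (S : Set (Multiset τ)) : Submodule ℝ (SFun τ odd) :=
  Submodule.span ℝ {f | ∃ l : List τ, (l : Multiset τ) ∈ S ∧ f = (l.map (coord odd)).prod}

theorem prod_mem_monoSpan {S : Set (Multiset τ)} {l : List τ} (h : (l : Multiset τ) ∈ S) :
    (l.map (coord odd)).prod ∈ monoSpan odd S := Submodule.subset_span ⟨l, h, rfl⟩

theorem monoSpan_mono {S T : Set (Multiset τ)} (h : S ⊆ T) : monoSpan odd S ≤ monoSpan odd T :=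
  Submodule.span_mono fun _ ⟨l, hl, hf⟩ => ⟨l, h hl, hf⟩

theorem one_mem_monoSpan {S : Set (Multiset τ)} (h : 0 ∈ S) : 1 ∈ monoSpan odd S :=
  prod_mem_monoSpan (l := []) h

theorem coord_mem_monoSpan {S : Set (Multiset τ)} {x : τ} (h : {x} ∈ S) :
    coord odd x ∈ monoSpan odd S := by
  have := prod_mem_monoSpan (odd := odd) (l := [x]) h
  simpa using this

theorem mul_mem_monoSpan {S T U : Set (Multiset τ)} (h : ∀ s ∈ S, ∀ t ∈ T, s + t ∈ U)
    {f g : SFun τ odd} (hf : f ∈ monoSpan odd S) (hg : g ∈ monoSpan odd T) :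
    f * g ∈ monoSpan odd U := by
  have h1 := Submodule.mul_mem_mul hf hg
  rw [monoSpan, monoSpan, Submodule.span_mul_span] at h1
  refine Submodule.span_mono ?_ h1
  rintro _ ⟨_, ⟨l, hl, rfl⟩, _, ⟨m, hm, rfl⟩, rfl⟩
  exact ⟨l ++ m, by simpa using h _ hl _ hm, by simp⟩

theorem pow_mem_monoSpan {S : ℕ → Set (Multiset τ)} (h0 : 0 ∈ S 0)
    (h : ∀ n, ∀ s ∈ S 1, ∀ t ∈ S n, s + t ∈ S (n + 1)) {f : SFun τ odd}
    (hf : f ∈ monoSpan odd (S 1)) (n : ℕ) : f ^ n ∈ monoSpan odd (S n) := by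
  induction n with
  | zero => exact one_mem_monoSpan h0
  | succ n ih => rw [pow_succ']; exact mul_mem_monoSpan (h n) hf ih

/-- To map a monomial span into a submodule, it suffices to map monomials. -/
theorem map_monoSpan {V : Type*} [AddCommGroup V] [Module ℝ V] {S : Set (Multiset τ)}
    (F : SFun τ odd →ₗ[ℝ] V) (W : Submodule ℝ V)
    (h : ∀ l : List τ, (l : Multiset τ) ∈ S → F (l.map (coord odd)).prod ∈ W) {f : SFun τ odd}
    (hf : f ∈ monoSpan odd S) : F f ∈ W := by
  have : monoSpan odd S ≤ W.comap F := Submodule.span_le.2 (by rintro _ ⟨l, hl, rfl⟩; exact h l hl)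
  exact this hf

theorem pd_mem_monoSpan {S T : Set (Multiset τ)} {x : τ} (h : ∀ s, x ::ₘ s ∈ S → s ∈ T)
    {f : SFun τ odd} (hf : f ∈ monoSpan odd S) : pd odd x f ∈ monoSpan odd T := by
  classical
  have key : ∀ l : List τ, pd odd x (l.map (coord odd)).prod ∈
      monoSpan odd {s | x ::ₘ s = (l : Multiset τ)} := by
    intro l
    induction l with
    | nil => simp [pd_one]
    | cons y l ih =>
      rw [List.map_cons, List.prod_cons, pd_coord_mul]
      refine Submodule.add_mem _ ?_ (Submodule.smul_mem _ _ ?_)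
      · split_ifs with hxy
        · subst hxy; exact prod_mem_monoSpan (by simp)
        · exact Submodule.zero_mem _
      · refine mul_mem_monoSpan (S := {{y}}) ?_ (coord_mem_monoSpan rfl) ih
        rintro s rfl t ht
        simp only [Set.mem_ofPred_eq] at ht ⊢
        rw [← Multiset.cons_coe, ← ht, Multiset.singleton_add, Multiset.cons_swap]
  refine map_monoSpan (pd odd x) _ (fun l hl => monoSpan_mono ?_ (key l)) hf
  intro s hs
  rw [Set.mem_ofPred_eq] at hs
  exact h s (hs ▸ hl)

theorem laplace_mem_monoSpan [Fintype τ] {S T : Set (Multiset τ)} {P : Matrix τ τ ℝ}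
    (h : ∀ z w s, P z w ≠ 0 → w ::ₘ z ::ₘ s ∈ S → s ∈ T) {f : SFun τ odd}
    (hf : f ∈ monoSpan odd S) : laplace odd P f ∈ monoSpan odd T := by
  rw [laplace_apply]
  refine Submodule.smul_mem _ _ (Submodule.sum_mem _ fun z _ => Submodule.sum_mem _ fun w _ => ?_)
  by_cases hz : P z w = 0
  · rw [hz, zero_smul]; exact Submodule.zero_mem _
  · refine Submodule.smul_mem _ _ ?_
    exact pd_mem_monoSpan (S := {s | w ::ₘ s ∈ S}) (fun s hs => h z w s hz hs)
      (pd_mem_monoSpan (fun s hs => hs) hf)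

theorem laplace_pow_mem_monoSpan [Fintype τ] {S : ℕ → Set (Multiset τ)} {P : Matrix τ τ ℝ}
    (h : ∀ e z w s, P z w ≠ 0 → w ::ₘ z ::ₘ s ∈ S e → s ∈ S (e + 1)) {f : SFun τ odd}
    (hf : f ∈ monoSpan odd (S 0)) (e : ℕ) : (laplace odd P ^ e) f ∈ monoSpan odd (S e) := by
  induction e with
  | zero => exact hf
  | succ e ih =>
    rw [pow_succ', Module.End.mul_apply]
    exact laplace_mem_monoSpan (h e) ih

theorem setZero_coord_inl (y : τ) :
    setZero odd odd' (coord _ (Sum.inl y)) = coord odd y := by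
  rcases h : odd y
  · rw [coord_of_even (x := Sum.inl y) (odd := Sum.elim odd odd') h, coord_of_even h]
    simp [setZero]
  · rw [coord_of_odd (x := Sum.inl y) (odd := Sum.elim odd odd') h, coord_of_odd h]
    simp [setZero]

theorem setZero_coord_inr (y : τ') :
    setZero odd odd' (coord _ (Sum.inr y)) = 0 := by
  rcases h : odd' y
  · rw [coord_of_even (x := Sum.inr y) (odd := Sum.elim odd odd') h]
    simp [setZero]
  · rw [coord_of_odd (x := Sum.inr y) (odd := Sum.elim odd odd') h]
    simp [setZero]

theorem setZero_mem_monoSpan {S : Set (Multiset (τ ⊕ τ'))} {T : Set (Multiset τ)}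
    (h : ∀ s : Multiset τ, s.map Sum.inl ∈ S → s ∈ T) {f : SFun (τ ⊕ τ') (Sum.elim odd odd')}
    (hf : f ∈ monoSpan _ S) : setZero odd odd' f ∈ monoSpan odd T := by
  have key : ∀ l : List (τ ⊕ τ'), setZero odd odd' (l.map (coord _)).prod ∈
      monoSpan odd {s | s.map Sum.inl = (l : Multiset (τ ⊕ τ'))} := by
    intro l
    induction l with
    | nil => simpa using one_mem_monoSpan (odd := odd) (by simp)
    | cons y l ih =>
      rw [List.map_cons, List.prod_cons, map_mul]
      rcases y with y | y
      · rw [setZero_coord_inl]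
        refine mul_mem_monoSpan (S := {{y}}) ?_ (coord_mem_monoSpan rfl) ih
        rintro s rfl t ht
        simp only [Set.mem_ofPred_eq] at ht ⊢
        rw [← Multiset.cons_coe, ← ht, Multiset.map_add]
        simp
      · rw [setZero_coord_inr, zero_mul]; exact Submodule.zero_mem _
  refine map_monoSpan (setZero odd odd').toLinearMap _ (fun l hl => monoSpan_mono ?_ (key l)) hf
  intro s hs
  rw [Set.mem_ofPred_eq] at hs
  exact h s (hs ▸ hl)

theorem eval_eq_zero_of_mem_monoSpan {E : SFun τ odd →ₐ[ℝ] ℝ} (hE : ∀ x, E (coord odd x) = 0)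
    {S : Set (Multiset τ)} (hS : 0 ∉ S) {f : SFun τ odd} (hf : f ∈ monoSpan odd S) : E f = 0 := by
  refine (Submodule.mem_bot ℝ).1 (map_monoSpan E.toLinearMap ⊥ (fun l hl => ?_) hf)
  rcases l with _ | ⟨x, l⟩
  · exact absurd hl hS
  · simp [hE]

/-! ### Affine substitutions -/

/-- The substitution `x ↦ r_x + ∑ T_{yx} y` (without the terms mixing even and odd variables). -/
def affineHom (odd : τ → Bool) (odd' : τ' → Bool) [Fintype τ'] (r : τ → ℝ) (T : Matrix τ' τ ℝ) :
    SFun τ odd →ₐ[ℝ] SFun τ' odd' :=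
  Algebra.TensorProduct.map
    (ExteriorAlgebra.map (Finsupp.lift _ ℝ {x // odd x = true} fun x =>
      ∑ y : {y // odd' y = true}, T y.1 x.1 • Finsupp.single y (1 : ℝ)))
    (MvPolynomial.aeval fun x : {x // odd x = false} =>
      algebraMap ℝ _ (r x.1) + ∑ y : {y // odd' y = false}, T y.1 x.1 • MvPolynomial.X y)

theorem affineHom_coord [Fintype τ'] {r : τ → ℝ} {T : Matrix τ' τ ℝ}
    (hr : ∀ x, odd x = true → r x = 0) (hT : ∀ y x, T y x ≠ 0 → odd' y = odd x) (x : τ) :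
    affineHom odd odd' r T (coord odd x) = r x • 1 + ∑ y, T y x • coord odd' y := by
  classical
  have hsum : ∀ b, odd x = b → ∑ y, T y x • coord odd' y =
      ∑ y : {y // odd' y = b}, T y.1 x • coord odd' y.1 := by
    intro b hb
    rw [← Finset.sum_filter_of_ne (p := fun y => odd' y = b)]
    · exact Finset.sum_subtype _ (by simp) _
    · intro y _ hy
      rw [hT y x (fun h => hy (by rw [h, zero_smul])), hb]
  rcases h : odd x
  · rw [hsum _ h, coord_of_even h]
    simp only [affineHom, Algebra.TensorProduct.map_tmul, map_one, MvPolynomial.aeval_X,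
      TensorProduct.tmul_add, TensorProduct.tmul_sum]
    congr 1
    · rw [Algebra.algebraMap_eq_smul_one, TensorProduct.tmul_smul]; rfl
    · refine Finset.sum_congr rfl fun y _ => ?_
      rw [coord_of_even y.2, TensorProduct.tmul_smul]
  · rw [hsum _ h, coord_of_odd h, hr x h, zero_smul, zero_add]
    simp only [affineHom, Algebra.TensorProduct.map_tmul, map_one, ExteriorAlgebra.map_apply_ι,
      Finsupp.lift_apply]
    simp only [zero_smul, Finsupp.sum_single_index, one_smul, map_sum, map_smul,
      TensorProduct.sum_tmul]
    refine Finset.sum_congr rfl fun y _ => ?_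
    rw [coord_of_odd y.2, TensorProduct.smul_tmul']

/-- Chain rule for affine substitutions. -/
theorem pd_affine [Fintype τ] [Fintype τ'] {F : SFun τ odd →ₐ[ℝ] SFun τ' odd'} {r : τ → ℝ}
    {T : Matrix τ' τ ℝ} (hr : ∀ x, odd x = true → r x = 0) (hT : ∀ y x, T y x ≠ 0 → odd' y = odd x)
    (hF : ∀ x, F (coord odd x) = r x • 1 + ∑ y, T y x • coord odd' y) (z : τ') (f : SFun τ odd) :
    pd odd' z (F f) = ∑ w, T z w • F (pd odd w f) := by
  classical
  induction f using induction_coord with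
  | h1 => simp [pd_one]
  | hc x f hf =>
    set s : ℝ := if odd' z = true ∧ odd x = true then -1 else 1 with hs
    have h1 : pd odd' z (F (coord odd x) * F f) =
        T z x • F f + s • (F (coord odd x) * pd odd' z (F f)) := by
      rw [hF]
      simp only [add_mul, map_add, Finset.sum_mul, map_sum, smul_mul_assoc, map_smul, one_mul,
        pd_coord_mul, smul_add, Finset.sum_add_distrib]
      have e1 : ∑ y, T y x • (if z = y then F f else 0) = T z x • F f := by simp
      have e2 : r x • pd odd' z (F f) = s • r x • pd odd' z (F f) := by
        by_cases h : odd x = true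
        · simp [hr x h]
        · simp [hs, h]
      have e3 : ∀ y, T y x • sgn odd' z y • (coord odd' y * pd odd' z (F f)) =
          s • T y x • (coord odd' y * pd odd' z (F f)) := by
        intro y
        by_cases h : T y x = 0
        · simp [h]
        · rw [smul_comm]
          congr 1
          simp [hs, sgn, hT y x h]
      rw [e1]
      simp only [e3, ← Finset.smul_sum]
      conv_lhs => rw [e2]
      abel
    rw [map_mul, h1, hf]
    have h2 : ∀ w, T z w • F (pd odd w (coord odd x * f)) =
        (if w = x then T z w • F f else 0) + s • (F (coord odd x) * T z w • F (pd odd w f)) := by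
      intro w
      by_cases h : T z w = 0
      · simp [h]
      · rw [pd_coord_mul, map_add, smul_add]
        congr 1
        · split_ifs <;> simp
        · rw [map_smul, map_mul, mul_smul_comm, smul_comm]
          congr 1
          simp [hs, sgn, hT z w h]
    simp only [h2, Finset.sum_add_distrib, ← Finset.smul_sum, ← Finset.mul_sum]
    simp
  | ha f g hf hg => simp only [map_add, hf, hg, smul_add, Finset.sum_add_distrib]
  | hs c f hf =>
    simp only [map_smul, hf, Finset.smul_sum]
    exact Finset.sum_congr rfl fun w _ => smul_comm _ _ _

theorem laplace_affine [Fintype τ] [Fintype τ'] {F : SFun τ odd →ₐ[ℝ] SFun τ' odd'} {r : τ → ℝ}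
    {T : Matrix τ' τ ℝ} (hr : ∀ x, odd x = true → r x = 0) (hT : ∀ y x, T y x ≠ 0 → odd' y = odd x)
    (hF : ∀ x, F (coord odd x) = r x • 1 + ∑ y, T y x • coord odd' y) (P : Matrix τ' τ' ℝ)
    (f : SFun τ odd) :
    laplace odd' P (F f) = F (laplace odd (T.transpose * P * T) f) := by
  simp only [laplace_apply, map_smul, map_sum, pd_affine hr hT hF]
  congr 1
  rw [sum_smul_sum_right P T fun z u => ∑ v, T z v • F (pd odd v (pd odd u f)),
    sum_smul_sum_left (P * T) T fun v u => F (pd odd v (pd odd u f)), Matrix.mul_assoc]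

end SFun

/-! ### The grading operator and the pairing -/

section Frobenius

variable {C : Type*} [Ring C] [Algebra ℝ C] {𝒞 : ℕ → Submodule ℝ C} [GradedAlgebra 𝒞]

theorem gradingSign_of_mem {i : ℕ} {a : C} (ha : a ∈ 𝒞 i) :
    gradingSign 𝒞 a = (-1 : ℝ) ^ i • a := by
  have h : DirectSum.decompose 𝒞 a = DirectSum.of (fun i => 𝒞 i) i ⟨a, ha⟩ :=
    DirectSum.decompose_of_mem 𝒞 ha
  rw [gradingSign, LinearMap.comp_apply]
  change DirectSum.toModule ℝ ℕ C (fun i => (-1 : ℝ) ^ i • (𝒞 i).subtype)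
    (DirectSum.decompose 𝒞 a) = _
  rw [h]
  exact DirectSum.toModule_lof (M := fun i => 𝒞 i) ℝ i (⟨a, ha⟩ : 𝒞 i)

/-- Linear maps agreeing on homogeneous elements are equal. -/
theorem linearMap_ext_homogeneous {M : Type*} [AddCommGroup M] [Module ℝ M] {F G : C →ₗ[ℝ] M}
    (h : ∀ i, ∀ a ∈ 𝒞 i, F a = G a) : F = G := by
  ext a
  induction a using DirectSum.Decomposition.inductionOn 𝒞 with
  | zero => simp
  | homogeneous a => exact h _ _ a.2
  | add a b ha hb => rw [map_add, map_add, ha, hb]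

variable (𝒞) in
theorem gradingSign_comp_self : gradingSign 𝒞 ∘ₗ gradingSign 𝒞 = LinearMap.id := by
  refine linearMap_ext_homogeneous (𝒞 := 𝒞) fun i a ha => ?_
  rw [LinearMap.comp_apply, gradingSign_of_mem ha, map_smul, gradingSign_of_mem ha, smul_smul,
    ← pow_add, Even.neg_one_pow ⟨i, rfl⟩, one_smul, LinearMap.id_apply]

theorem gradingSign_gradingSign (a : C) : gradingSign 𝒞 (gradingSign 𝒞 a) = a :=
  LinearMap.congr_fun (gradingSign_comp_self 𝒞) a

theorem gradingSign_mul_of_mem {i : ℕ} {e : C} (he : e ∈ 𝒞 i) (a : C) :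
    gradingSign 𝒞 (e * a) = (-1 : ℝ) ^ i • (e * gradingSign 𝒞 a) := by
  suffices h : gradingSign 𝒞 ∘ₗ LinearMap.mulLeft ℝ e =
      (-1 : ℝ) ^ i • (LinearMap.mulLeft ℝ e ∘ₗ gradingSign 𝒞) from LinearMap.congr_fun h a
  refine linearMap_ext_homogeneous (𝒞 := 𝒞) fun j b hb => ?_
  simp only [LinearMap.comp_apply, LinearMap.mulLeft_apply, LinearMap.smul_apply]
  rw [gradingSign_of_mem (SetLike.mul_mem_graded he hb), gradingSign_of_mem hb, mul_smul_comm,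
    smul_smul, pow_add]

/-- An operator of degree `-1` anticommutes with the grading operator. -/
theorem map_gradingSign_of_lowering {K : C →ₗ[ℝ] C} (h : ∀ i a, a ∈ 𝒞 (i + 1) → K a ∈ 𝒞 i)
    (h0 : ∀ a, a ∈ 𝒞 0 → K a = 0) (a : C) : K (gradingSign 𝒞 a) = -gradingSign 𝒞 (K a) := by
  suffices h : K ∘ₗ gradingSign 𝒞 = -(gradingSign 𝒞 ∘ₗ K) from LinearMap.congr_fun h a
  refine linearMap_ext_homogeneous (𝒞 := 𝒞) fun j b hb => ?_
  rw [LinearMap.comp_apply, LinearMap.neg_apply, LinearMap.comp_apply, gradingSign_of_mem hb,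
    map_smul]
  rcases j with _ | j
  · simp [h0 b hb]
  · rw [gradingSign_of_mem (h j b hb), pow_succ]; module

namespace DGFrobenius

variable (D : DGFrobenius 𝒞)

/-- The pairing is symmetric without signs: it vanishes unless the degrees add up to `3`, and then
one of them is even. -/
theorem pair_comm (a b : C) : D.pair a b = D.pair b a := by
  suffices h : D.pair = D.pair.flip from LinearMap.congr_fun₂ h a b
  refine linearMap_ext_homogeneous (𝒞 := 𝒞) fun i a ha => linearMap_ext_homogeneous (𝒞 := 𝒞)
    fun j b hb => ?_
  change D.pair a b = D.pair b a
  by_cases h : i + j = 3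
  · have h2 : Even (i * j) := by
      have : j = 3 - i := by omega
      have hi : i ≤ 3 := by omega
      subst this
      interval_cases i <;> decide
    rw [D.pair_symm i j a b ha hb, h2.neg_one_pow, one_mul]
  · have h1 : D.pair a b = 0 := by
      by_contra h1; exact h (D.pair_deg i j a b ha hb h1)
    have h2 : D.pair b a = 0 := by
      by_contra h2; have := D.pair_deg j i b a hb ha h2; omega
    rw [h1, h2]

/-- The degrees of two vectors with non-zero pairing add up to `3`, so their parities differ. -/
theorem pair_gradingSign (a b : C) :
    D.pair (gradingSign 𝒞 a) b = -D.pair a (gradingSign 𝒞 b) := by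
  suffices h : D.pair ∘ₗ gradingSign 𝒞 = -(D.pair.compl₂ (gradingSign 𝒞)) from
    LinearMap.congr_fun₂ h a b
  refine linearMap_ext_homogeneous (𝒞 := 𝒞) fun i a ha => linearMap_ext_homogeneous (𝒞 := 𝒞)
    fun j b hb => ?_
  rw [LinearMap.comp_apply, LinearMap.neg_apply, LinearMap.neg_apply, LinearMap.compl₂_apply,
    gradingSign_of_mem ha, gradingSign_of_mem hb, map_smul, map_smul, LinearMap.smul_apply]
  by_cases h : D.pair a b = 0
  · simp [h]
  · have hij := D.pair_deg i j a b ha hb h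
    have : j = 3 - i := by omega
    have hi : i ≤ 3 := by omega
    subst this
    interval_cases i <;> norm_num

include D in
theorem mul_gradingSign_of_mem_one {e : C} (he : e ∈ 𝒞 1) (a : C) :
    gradingSign 𝒞 a * e = e * a := by
  suffices h : LinearMap.mulRight ℝ e ∘ₗ gradingSign 𝒞 = LinearMap.mulLeft ℝ e from
    LinearMap.congr_fun h a
  refine linearMap_ext_homogeneous (𝒞 := 𝒞) fun i a ha => ?_
  rw [LinearMap.comp_apply, LinearMap.mulRight_apply, LinearMap.mulLeft_apply,
    gradingSign_of_mem ha, D.mul_comm' 1 i e a he ha, one_mul, smul_mul_assoc]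

include D in
theorem d_gradingSign (a : C) : D.d (gradingSign 𝒞 a) = -gradingSign 𝒞 (D.d a) := by
  suffices h : D.d ∘ₗ gradingSign 𝒞 = -(gradingSign 𝒞 ∘ₗ D.d) from LinearMap.congr_fun h a
  refine linearMap_ext_homogeneous (𝒞 := 𝒞) fun j b hb => ?_
  rw [LinearMap.comp_apply, LinearMap.neg_apply, LinearMap.comp_apply, gradingSign_of_mem hb,
    map_smul, gradingSign_of_mem (D.d_mem j b hb), pow_succ]
  module

theorem pair_d_left (a b : C) : D.pair (D.d a) b = -D.pair (gradingSign 𝒞 a) (D.d b) := by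
  suffices h : D.pair ∘ₗ D.d = -((D.pair ∘ₗ gradingSign 𝒞).compl₂ D.d) from
    LinearMap.congr_fun₂ h a b
  refine linearMap_ext_homogeneous (𝒞 := 𝒞) fun i a ha => ?_
  ext b
  have := D.pair_d i a b ha
  simp [gradingSign_of_mem ha]
  linarith

/-- Symmetric operators of degree `-1`, as the chain homotopy `K` and its variations. -/
structure IsSymmLowering (K : C →ₗ[ℝ] C) : Prop where
  mem : ∀ i a, a ∈ 𝒞 (i + 1) → K a ∈ 𝒞 i
  zero : ∀ a, a ∈ 𝒞 0 → K a = 0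
  symm : ∀ i a b, a ∈ 𝒞 i → D.pair (K a) b = (-1 : ℝ) ^ i * D.pair a (K b)

variable {D}

theorem IsInductionData.isSymmLowering {ι : D.Cohomology →ₗ[ℝ] C} {K : C →ₗ[ℝ] C}
    (h : D.IsInductionData ι K) : D.IsSymmLowering K := ⟨h.K_mem, h.K_zero, h.K_symm⟩

theorem IsInfinitesimalDeformation.isSymmLowering {ι δι : D.Cohomology →ₗ[ℝ] C} {K δK : C →ₗ[ℝ] C}
    (h : D.IsInfinitesimalDeformation ι K δι δK) : D.IsSymmLowering δK :=
  ⟨h.K_mem, h.K_zero, h.K_symm⟩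

namespace IsSymmLowering

variable {K L : C →ₗ[ℝ] C}

theorem add_smul (hK : D.IsSymmLowering K) (hL : D.IsSymmLowering L) (r : ℝ) :
    D.IsSymmLowering (K + r • L) where
  mem i a ha := Submodule.add_mem _ (hK.mem i a ha) (Submodule.smul_mem _ _ (hL.mem i a ha))
  zero a ha := by simp [hK.zero a ha, hL.zero a ha]
  symm i a b ha := by simp [hK.symm i a b ha, hL.symm i a b ha]; ring

theorem map_gradingSign (hK : D.IsSymmLowering K) (a : C) :
    K (gradingSign 𝒞 a) = -gradingSign 𝒞 (K a) := map_gradingSign_of_lowering hK.mem hK.zero a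

/-- The symmetry of `K`, with the sign written as an operator. -/
theorem pair_map (hK : D.IsSymmLowering K) (a b : C) :
    D.pair (K a) b = D.pair (gradingSign 𝒞 a) (K b) := by
  suffices h : D.pair ∘ₗ K = (D.pair ∘ₗ gradingSign 𝒞).compl₂ K from LinearMap.congr_fun₂ h a b
  refine linearMap_ext_homogeneous (𝒞 := 𝒞) fun i a ha => ?_
  ext b
  simp [gradingSign_of_mem ha, hK.symm i a b ha]

end IsSymmLowering

end DGFrobenius

/-! ### The tensor product with the Lie algebra -/

variable {g : Type*} [LieRing g] [LieAlgebra ℝ g]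

/-- The product pairing on `g ⊗ C`. -/
def tensorPair (D : DGFrobenius 𝒞) (B : LinearMap.BilinForm ℝ g) :
    LinearMap.BilinForm ℝ (g ⊗[ℝ] C) := LinearMap.BilinForm.tmul B D.pair

@[simp]
theorem tensorPair_tmul (D : DGFrobenius 𝒞) (B : LinearMap.BilinForm ℝ g) (x y : g) (a b : C) :
    tensorPair D B (x ⊗ₜ a) (y ⊗ₜ b) = B x y * D.pair a b := by
  simp [tensorPair, mul_comm]

@[simp]
theorem tensorBracket_tmul (x y : g) (a b : C) :
    tensorBracket g C (x ⊗ₜ a) (y ⊗ₜ b) = ⁅x, y⁆ ⊗ₜ (a * b) := rfl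

variable (g) in
/-- The grading operator of `g ⊗ C`. -/
def tensorSign (𝒞 : ℕ → Submodule ℝ C) [GradedAlgebra 𝒞] : Module.End ℝ (g ⊗[ℝ] C) :=
  LinearMap.lTensor g (gradingSign 𝒞)

@[simp]
theorem tensorSign_tmul (x : g) (a : C) :
    tensorSign g 𝒞 (x ⊗ₜ a) = x ⊗ₜ gradingSign 𝒞 a := rfl

theorem tensorSign_mul_self : tensorSign g 𝒞 * tensorSign g 𝒞 = 1 := by
  ext x a
  simp [gradingSign_gradingSign]

variable (g) in
/-- The degree `i` part of `g ⊗ C`. -/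
def tensorDeg (𝒞 : ℕ → Submodule ℝ C) (i : ℕ) : Submodule ℝ (g ⊗[ℝ] C) :=
  Submodule.span ℝ {v | ∃ x : g, ∃ a ∈ 𝒞 i, v = x ⊗ₜ a}

omit [GradedAlgebra 𝒞] in
theorem tmul_mem_tensorDeg {i : ℕ} (x : g) {a : C} (ha : a ∈ 𝒞 i) :
    x ⊗ₜ[ℝ] a ∈ tensorDeg g 𝒞 i := Submodule.subset_span ⟨x, a, ha, rfl⟩

omit [GradedAlgebra 𝒞] in
/-- To prove a linear identity on `tensorDeg`, check it on pure tensors. -/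
theorem eq_of_mem_tensorDeg {M : Type*} [AddCommGroup M] [Module ℝ M] {i : ℕ}
    {F G : (g ⊗[ℝ] C) →ₗ[ℝ] M} (h : ∀ x : g, ∀ a ∈ 𝒞 i, F (x ⊗ₜ a) = G (x ⊗ₜ a)) {v : g ⊗[ℝ] C}
    (hv : v ∈ tensorDeg g 𝒞 i) : F v = G v := by
  have : tensorDeg g 𝒞 i ≤ LinearMap.eqLocus F G :=
    Submodule.span_le.2 (by rintro _ ⟨x, a, ha, rfl⟩; exact h x a ha)
  exact this hv

theorem tensorSign_of_mem {i : ℕ} {v : g ⊗[ℝ] C} (hv : v ∈ tensorDeg g 𝒞 i) :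
    tensorSign g 𝒞 v = (-1 : ℝ) ^ i • v := by
  refine eq_of_mem_tensorDeg (F := tensorSign g 𝒞) (G := (-1 : ℝ) ^ i • LinearMap.id)
    (fun x a ha => ?_) hv
  simp [gradingSign_of_mem ha]

omit [GradedAlgebra 𝒞] in
theorem map_mem_tensorDeg {i j : ℕ} {F : (g ⊗[ℝ] C) →ₗ[ℝ] (g ⊗[ℝ] C)}
    (h : ∀ x : g, ∀ a ∈ 𝒞 i, F (x ⊗ₜ a) ∈ tensorDeg g 𝒞 j) {v : g ⊗[ℝ] C}
    (hv : v ∈ tensorDeg g 𝒞 i) : F v ∈ tensorDeg g 𝒞 j := by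
  have : tensorDeg g 𝒞 i ≤ (tensorDeg g 𝒞 j).comap F :=
    Submodule.span_le.2 (by rintro _ ⟨x, a, ha, rfl⟩; exact h x a ha)
  exact this hv

theorem tensorBracket_mem {i j : ℕ} {v w : g ⊗[ℝ] C} (hv : v ∈ tensorDeg g 𝒞 i)
    (hw : w ∈ tensorDeg g 𝒞 j) : tensorBracket g C v w ∈ tensorDeg g 𝒞 (i + j) := by
  refine map_mem_tensorDeg (F := tensorBracket g C v) (fun y b hb => ?_) hw
  refine map_mem_tensorDeg (F := (tensorBracket g C).flip (y ⊗ₜ b)) (fun x a ha => ?_) hv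
  exact tmul_mem_tensorDeg _ (SetLike.mul_mem_graded ha hb)

variable {D : DGFrobenius 𝒞} {B : LinearMap.BilinForm ℝ g}

theorem tensorPair_comm (hB : IsQuadratic B) (v w : g ⊗[ℝ] C) :
    tensorPair D B v w = tensorPair D B w v := by
  suffices h : tensorPair D B = (tensorPair D B).flip from LinearMap.congr_fun₂ h v w
  ext x a y b
  simp [hB.symm x y, D.pair_comm a b]

theorem tensorPair_sign (v w : g ⊗[ℝ] C) :
    tensorPair D B (tensorSign g 𝒞 v) w = -tensorPair D B v (tensorSign g 𝒞 w) := by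
  suffices h : tensorPair D B ∘ₗ tensorSign g 𝒞 = -(tensorPair D B).compl₂ (tensorSign g 𝒞) from
    LinearMap.congr_fun₂ h v w
  ext x a y b
  simp [D.pair_gradingSign a b]

theorem tensorPair_lTensor {K : C →ₗ[ℝ] C} (hK : D.IsSymmLowering K) (v w : g ⊗[ℝ] C) :
    tensorPair D B (LinearMap.lTensor g K v) w =
      tensorPair D B (tensorSign g 𝒞 v) (LinearMap.lTensor g K w) := by
  suffices h : tensorPair D B ∘ₗ LinearMap.lTensor g K =
      (tensorPair D B ∘ₗ tensorSign g 𝒞).compl₂ (LinearMap.lTensor g K) from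
    LinearMap.congr_fun₂ h v w
  ext x a y b
  simp [hK.pair_map a b]

theorem lTensor_mul_sign {K : C →ₗ[ℝ] C} (hK : D.IsSymmLowering K) :
    LinearMap.lTensor g K * tensorSign g 𝒞 = -(tensorSign g 𝒞 * LinearMap.lTensor g K) := by
  ext x a
  simp [hK.map_gradingSign, TensorProduct.tmul_neg]

theorem lTensor_d_mul_sign :
    LinearMap.lTensor g D.d * tensorSign g 𝒞 = -(tensorSign g 𝒞 * LinearMap.lTensor g D.d) := by
  ext x a
  simp [D.d_gradingSign, TensorProduct.tmul_neg]

theorem tensorPair_bracket (hB : IsQuadratic B) (u v w : g ⊗[ℝ] C) :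
    tensorPair D B u (tensorBracket g C v w) = tensorPair D B (tensorBracket g C u v) w := by
  induction u using TensorProduct.induction_on with
  | zero => simp
  | add u u' hu hu' => simp only [map_add, LinearMap.add_apply, hu, hu']
  | tmul x a =>
    induction v using TensorProduct.induction_on with
    | zero => simp
    | add u u' hu hu' => simp only [map_add, LinearMap.add_apply, hu, hu']
    | tmul y b =>
      induction w using TensorProduct.induction_on with
      | zero => simp
      | add u u' hu hu' => simp only [map_add, hu, hu']
      | tmul z c => simp [hB.invariant x y z, D.pair_mul a b c]

/-- The bracket with an element of degree `1` is anticommutative up to the grading operator. -/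
theorem tensorBracket_swap (D : DGFrobenius 𝒞) {v : g ⊗[ℝ] C} (hv : v ∈ tensorDeg g 𝒞 1)
    (w : g ⊗[ℝ] C) :
    tensorBracket g C (tensorSign g 𝒞 w) v = -tensorBracket g C v w := by
  refine eq_of_mem_tensorDeg (F := tensorBracket g C (tensorSign g 𝒞 w))
    (G := -(tensorBracket g C).flip w) (fun x a ha => ?_) hv
  suffices h : (tensorBracket g C).flip (x ⊗ₜ a) ∘ₗ tensorSign g 𝒞 =
    -tensorBracket g C (x ⊗ₜ a) from LinearMap.congr_fun h w
  ext y b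
  simp only [D.mul_gradingSign_of_mem_one ha, TensorProduct.AlgebraTensorModule.curry_apply,
    LinearMap.restrictScalars_self, TensorProduct.curry_apply, LinearMap.comp_apply,
    LinearMap.flip_apply, tensorSign_tmul, tensorBracket_tmul, LinearMap.neg_apply]
  rw [← lie_skew x y, TensorProduct.neg_tmul, neg_neg]

theorem tensorBracket_mul_sign {v : g ⊗[ℝ] C} (hv : v ∈ tensorDeg g 𝒞 1) :
    (tensorBracket g C v : Module.End ℝ (g ⊗[ℝ] C)) * tensorSign g 𝒞 =
      -(tensorSign g 𝒞 * tensorBracket g C v) := by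
  refine eq_of_mem_tensorDeg (F := (LinearMap.mulRight ℝ (tensorSign g 𝒞)) ∘ₗ tensorBracket g C)
    (G := -(LinearMap.mulLeft ℝ (tensorSign g 𝒞) ∘ₗ tensorBracket g C)) (fun x a ha => ?_) hv
  ext y b
  simp [gradingSign_mul_of_mem ha, TensorProduct.tmul_neg]

theorem tensorPair_bracket_left (hB : IsQuadratic B) {v : g ⊗[ℝ] C} (hv : v ∈ tensorDeg g 𝒞 1)
    (w w' : g ⊗[ℝ] C) :
    tensorPair D B (tensorBracket g C v w) w' =
      -tensorPair D B (tensorSign g 𝒞 w) (tensorBracket g C v w') := by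
  rw [tensorPair_bracket hB, tensorBracket_swap D hv]; simp

end Frobenius

section ChernSimons

variable {C : Type*} [Ring C] [Algebra ℝ C] {𝒞 : ℕ → Submodule ℝ C} [GradedAlgebra 𝒞]
variable {g : Type*} [LieRing g] [LieAlgebra ℝ g]

namespace FieldCoords

variable {D : DGFrobenius 𝒞} {I P A : Type*} (X : FieldCoords D g I P A)
variable (B : LinearMap.BilinForm ℝ g)

/-! ### Matrices in the basis `T_a ⊗ e_I` -/

/-- The basis `T_a ⊗ e_I` of `g ⊗ C`. -/
def tensorBasis : Module.Basis (I × A) ℝ (g ⊗[ℝ] C) :=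
  (X.bg.tensorProduct X.bC).reindex (Equiv.prodComm A I)

theorem tensorBasis_apply (x : I × A) : X.tensorBasis x = X.bg x.2 ⊗ₜ X.bC x.1 := by
  rw [tensorBasis, Module.Basis.reindex_apply]
  exact Module.Basis.tensorProduct_apply _ _ _ _

theorem tensorBasis_repr_tmul (y : g) (c : C) (x : I × A) :
    X.tensorBasis.repr (y ⊗ₜ c) x = X.bg.repr y x.2 * X.bC.repr c x.1 := by
  rw [tensorBasis, Module.Basis.repr_reindex_apply]
  exact (Module.Basis.tensorProduct_repr_tmul_apply _ _ _ _ _ _).trans (by simp [mul_comm])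

theorem tensorBasis_mem (x : I × A) : X.tensorBasis x ∈ tensorDeg g 𝒞 (X.degC x.1) := by
  rw [tensorBasis_apply]
  exact tmul_mem_tensorDeg _ (X.bC_mem x.1)

theorem sign_tensorBasis (x : I × A) :
    tensorSign g 𝒞 (X.tensorBasis x) = (-1 : ℝ) ^ X.degC x.1 • X.tensorBasis x :=
  tensorSign_of_mem (X.tensorBasis_mem x)

/-- The Gram matrix of the pairing on `g ⊗ C`. -/
def gram : Matrix (I × A) (I × A) ℝ :=
  Matrix.of fun x y => tensorPair D B (X.tensorBasis x) (X.tensorBasis y)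

/-- The Hessian of `½ π(ω, l(v, ω))` for `v` of degree `1`, in the coordinates `ω^{Ia}`. -/
def hessian (v : g ⊗[ℝ] C) : Matrix (I × A) (I × A) ℝ :=
  Matrix.of fun x y => -((-1 : ℝ) ^ X.degC x.1) *
    tensorPair D B (X.tensorBasis x) (tensorBracket g C v (X.tensorBasis y))

variable [Fintype I] [Fintype A] [DecidableEq I] [DecidableEq A]

/-- The bivector of the propagator, including the sign from `wick`. -/
def bivector (K : C →ₗ[ℝ] C) : Matrix (I × A) (I × A) ℝ :=
  Matrix.of fun x y => -(X.propagator K x.1 y.1 *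
    (Matrix.of fun a b => B (X.bg a) (X.bg b))⁻¹ x.2 y.2)

/-- The matrix of an endomorphism of `g ⊗ C`. -/
def opMatrix (F : Module.End ℝ (g ⊗[ℝ] C)) : Matrix (I × A) (I × A) ℝ :=
  LinearMap.toMatrixAlgEquiv X.tensorBasis F

theorem opMatrix_mul (F G : Module.End ℝ (g ⊗[ℝ] C)) :
    X.opMatrix (F * G) = X.opMatrix F * X.opMatrix G := map_mul _ _ _

theorem opMatrix_pow (F : Module.End ℝ (g ⊗[ℝ] C)) (n : ℕ) :
    X.opMatrix (F ^ n) = X.opMatrix F ^ n := map_pow _ _ _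

theorem opMatrix_neg (F : Module.End ℝ (g ⊗[ℝ] C)) : X.opMatrix (-F) = -X.opMatrix F :=
  map_neg _ _

theorem opMatrix_apply (F : Module.End ℝ (g ⊗[ℝ] C)) (x y : I × A) :
    X.opMatrix F x y = X.tensorBasis.repr (F (X.tensorBasis y)) x := by
  simp [opMatrix, LinearMap.toMatrixAlgEquiv_apply]

theorem trace_opMatrix (F : Module.End ℝ (g ⊗[ℝ] C)) :
    (X.opMatrix F).trace = LinearMap.trace ℝ _ F :=
  (LinearMap.trace_eq_matrix_trace ℝ X.tensorBasis F).symm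

theorem opMatrix_tensorSign : X.opMatrix (tensorSign g 𝒞) = -SFun.parity X.oddC := by
  ext x y
  rw [opMatrix_apply, sign_tensorBasis, map_smul, Finsupp.smul_apply,
    Module.Basis.repr_self, SFun.parity, Matrix.neg_apply, Matrix.diagonal_apply]
  by_cases h : x = y
  · subst h
    simp only [Finsupp.single_eq_same, smul_eq_mul, mul_one, if_true, oddC, decide_eq_true_eq]
    split_ifs with he
    · rw [he.neg_one_pow, neg_neg]
    · rw [(Nat.not_even_iff_odd.1 he).neg_one_pow]
  · simp [h]

theorem parity_mul_opMatrix {F : Module.End ℝ (g ⊗[ℝ] C)}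
    (h : F * tensorSign g 𝒞 = -(tensorSign g 𝒞 * F)) :
    SFun.parity X.oddC * X.opMatrix F = -(X.opMatrix F * SFun.parity X.oddC) := by
  have := congrArg X.opMatrix h
  rw [opMatrix_neg, opMatrix_mul, opMatrix_mul, opMatrix_tensorSign] at this
  rw [mul_neg, neg_mul, neg_neg] at this
  exact this.symm

/-- Matrix of a bilinear form composed with an operator on the right. -/
theorem gram_mul_opMatrix (F : Module.End ℝ (g ⊗[ℝ] C)) (x y : I × A) :
    (X.gram B * X.opMatrix F) x y =
      tensorPair D B (X.tensorBasis x) (F (X.tensorBasis y)) := by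
  conv_rhs => rw [← X.tensorBasis.sum_repr (F (X.tensorBasis y))]
  simp only [Matrix.mul_apply, map_sum, map_smul, smul_eq_mul, opMatrix_apply, gram, Matrix.of_apply]
  exact Finset.sum_congr rfl fun z _ => mul_comm _ _

theorem opMatrix_transpose_mul_gram (F : Module.End ℝ (g ⊗[ℝ] C)) (x y : I × A) :
    ((X.opMatrix F).transpose * X.gram B) x y =
      tensorPair D B (F (X.tensorBasis x)) (X.tensorBasis y) := by
  conv_rhs => rw [← X.tensorBasis.sum_repr (F (X.tensorBasis x))]
  simp only [Matrix.mul_apply, Matrix.transpose_apply, opMatrix_apply, gram, Matrix.of_apply,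
    map_sum, map_smul, LinearMap.sum_apply, LinearMap.smul_apply, smul_eq_mul]

theorem gram_mulVec_repr (v : g ⊗[ℝ] C) (x : I × A) :
    ((X.gram B).mulVec (X.tensorBasis.repr v)) x = tensorPair D B (X.tensorBasis x) v := by
  conv_rhs => rw [← X.tensorBasis.sum_repr v]
  simp only [Matrix.mulVec, dotProduct, map_sum, map_smul, smul_eq_mul, gram, Matrix.of_apply]
  exact Finset.sum_congr rfl fun z _ => mul_comm _ _

theorem parity_mul_gram :
    SFun.parity X.oddC * X.gram B = -(X.gram B * SFun.parity X.oddC) := by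
  have h : (X.opMatrix (tensorSign g 𝒞)).transpose * X.gram B =
      -(X.gram B * X.opMatrix (tensorSign g 𝒞)) := by
    ext x y
    rw [Matrix.neg_apply, opMatrix_transpose_mul_gram, gram_mul_opMatrix, tensorPair_sign]
  rw [opMatrix_tensorSign, Matrix.transpose_neg, SFun.parity_transpose, neg_mul, mul_neg] at h
  exact neg_injective h

/-- The Hessian in terms of the Gram matrix and the matrix of `l(v, ·)`. -/
theorem hessian_eq (v : g ⊗[ℝ] C) :
    X.hessian B v = SFun.parity X.oddC * (X.gram B * X.opMatrix (tensorBracket g C v)) := by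
  ext x y
  rw [SFun.parity, Matrix.diagonal_mul, gram_mul_opMatrix, hessian, Matrix.of_apply]
  congr 1
  simp only [oddC, decide_eq_true_eq]
  split_ifs with he
  · rw [he.neg_one_pow]
  · rw [(Nat.not_even_iff_odd.1 he).neg_one_pow, neg_neg]

section Quadratic

variable {B} (hB : IsQuadratic B)
include hB

theorem gram_transpose : (X.gram B).transpose = X.gram B := by
  ext x y
  simp [gram, tensorPair_comm hB (X.tensorBasis y)]

theorem gramC_det : IsUnit (Matrix.of fun i j => D.pair (X.bC i) (X.bC j)).det := by
  have h := (LinearMap.BilinForm.nondegenerate_iff_det_ne_zero X.bC).1 D.pair_nondegenerate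
  rwa [← isUnit_iff_ne_zero, show LinearMap.BilinForm.toMatrix X.bC D.pair =
    Matrix.of fun i j => D.pair (X.bC i) (X.bC j) by
      ext i j; simp [LinearMap.BilinForm.toMatrix_apply]] at h

theorem gramLie_det : IsUnit (Matrix.of fun a b => B (X.bg a) (X.bg b)).det := by
  have h := (LinearMap.BilinForm.nondegenerate_iff_det_ne_zero X.bg).1 hB.nondegenerate
  rwa [← isUnit_iff_ne_zero, show LinearMap.BilinForm.toMatrix X.bg B =
    Matrix.of fun a b => B (X.bg a) (X.bg b) by
      ext i j; simp [LinearMap.BilinForm.toMatrix_apply]] at h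

open scoped Kronecker in
theorem gram_eq_kronecker : X.gram B =
    (Matrix.of fun i j => D.pair (X.bC i) (X.bC j)) ⊗ₖ
      (Matrix.of fun a b => B (X.bg a) (X.bg b)) := by
  ext x y
  simp [gram, tensorBasis_apply, mul_comm]

theorem gram_det : IsUnit (X.gram B).det := by
  rw [X.gram_eq_kronecker hB, Matrix.det_kronecker]
  exact ((X.gramC_det hB).pow _).mul ((X.gramLie_det hB).pow _)

theorem gram_mul_inv : X.gram B * (X.gram B)⁻¹ = 1 := Matrix.mul_nonsing_inv _ (X.gram_det hB)

theorem inv_mul_gram : (X.gram B)⁻¹ * X.gram B = 1 := Matrix.nonsing_inv_mul _ (X.gram_det hB)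

theorem parity_mul_gram_inv :
    SFun.parity X.oddC * (X.gram B)⁻¹ = -((X.gram B)⁻¹ * SFun.parity X.oddC) := by
  calc _ = (X.gram B)⁻¹ * (X.gram B * SFun.parity X.oddC) * (X.gram B)⁻¹ := by
        rw [← mul_assoc, X.inv_mul_gram hB, one_mul]
    _ = _ := by
        rw [← neg_eq_iff_eq_neg.2 (X.parity_mul_gram B), mul_neg, neg_mul, ← mul_assoc, mul_assoc,
          X.gram_mul_inv hB, mul_one]

open scoped Kronecker in
/-- The bivector of the propagator in terms of the matrix of `K` and the inverse Gram matrix. -/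
theorem bivector_eq (K : C →ₗ[ℝ] C) :
    X.bivector B K = -(X.opMatrix (LinearMap.lTensor g K) * (X.gram B)⁻¹) := by
  have h1 : X.opMatrix (LinearMap.lTensor g K) = LinearMap.toMatrix X.bC X.bC K ⊗ₖ 1 := by
    ext x y
    rw [opMatrix_apply, tensorBasis_apply, LinearMap.lTensor_tmul, tensorBasis_repr_tmul]
    simp [LinearMap.toMatrix_apply, Matrix.one_apply, Finsupp.single_apply, eq_comm]
  rw [h1, X.gram_eq_kronecker hB, Matrix.inv_kronecker, ← Matrix.mul_kronecker_mul, one_mul]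
  rfl

theorem isEven_bivector {K : C →ₗ[ℝ] C} (hK : D.IsSymmLowering K) :
    SFun.IsEven X.oddC (X.bivector B K) := by
  rw [SFun.isEven_iff, X.bivector_eq hB, Commute, SemiconjBy, mul_neg, neg_mul, ← mul_assoc,
    X.parity_mul_opMatrix (lTensor_mul_sign hK), neg_mul, mul_assoc, X.parity_mul_gram_inv hB,
    mul_neg, neg_neg, mul_assoc]

theorem isSuperSymm_bivector {K : C →ₗ[ℝ] C} (hK : D.IsSymmLowering K) :
    SFun.IsSuperSymm X.oddC (X.bivector B K) := by
  rw [SFun.isSuperSymm_iff (X.isEven_bivector hB hK), X.bivector_eq hB]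
  set k := X.opMatrix (LinearMap.lTensor g K) with hk
  have h : k.transpose * X.gram B = -(SFun.parity X.oddC * (X.gram B * k)) := by
    ext x y
    rw [opMatrix_transpose_mul_gram, tensorPair_lTensor hK, sign_tensorBasis, SFun.parity,
      Matrix.neg_apply, Matrix.diagonal_mul, gram_mul_opMatrix, map_smul, LinearMap.smul_apply,
      ← neg_mul, smul_eq_mul]
    congr 1
    simp only [oddC, decide_eq_true_eq]
    split_ifs with he
    · rw [he.neg_one_pow, neg_neg]
    · rw [(Nat.not_even_iff_odd.1 he).neg_one_pow]
  have h2 : k.transpose = -(SFun.parity X.oddC * X.gram B * k * (X.gram B)⁻¹) := by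
    rw [← mul_one k.transpose, ← X.gram_mul_inv hB, ← mul_assoc, h, neg_mul]
    simp only [mul_assoc]
  rw [Matrix.transpose_neg, Matrix.transpose_mul, Matrix.transpose_nonsing_inv,
    X.gram_transpose hB, h2, mul_neg, neg_neg, X.parity_mul_gram, mul_neg]
  simp only [neg_mul, mul_neg, ← mul_assoc, X.inv_mul_gram hB, one_mul]

theorem isEven_hessian {v : g ⊗[ℝ] C} (hv : v ∈ tensorDeg g 𝒞 1) :
    SFun.IsEven X.oddC (X.hessian B v) := by
  rw [SFun.isEven_iff, hessian_eq, Commute, SemiconjBy, mul_assoc, mul_assoc]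
  congr 1
  rw [← neg_eq_iff_eq_neg.2 (X.parity_mul_opMatrix (tensorBracket_mul_sign hv)), mul_neg,
    ← mul_assoc, X.parity_mul_gram, neg_mul, mul_assoc]

theorem hessian_transpose {v : g ⊗[ℝ] C} (hv : v ∈ tensorDeg g 𝒞 1) :
    (X.hessian B v).transpose = SFun.parity X.oddC * X.hessian B v := by
  set t := X.opMatrix (tensorBracket g C v) with ht
  have h : t.transpose * X.gram B = SFun.parity X.oddC * (X.gram B * t) := by
    ext x y
    rw [opMatrix_transpose_mul_gram, tensorPair_bracket_left hB hv, sign_tensorBasis, SFun.parity,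
      Matrix.diagonal_mul, gram_mul_opMatrix, map_smul, LinearMap.smul_apply, smul_eq_mul,
      ← neg_mul]
    congr 1
    simp only [oddC, decide_eq_true_eq]
    split_ifs with he
    · rw [he.neg_one_pow]
    · rw [(Nat.not_even_iff_odd.1 he).neg_one_pow, neg_neg]
  have hσσ : SFun.parity X.oddC * SFun.parity X.oddC = 1 := SFun.parity_mul_parity
  rw [hessian_eq, ← ht, Matrix.transpose_mul, Matrix.transpose_mul, X.gram_transpose hB,
    SFun.parity_transpose, h, ← mul_assoc (SFun.parity X.oddC) (SFun.parity X.oddC), hσσ, one_mul,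
    mul_assoc, mul_assoc,
    ← neg_eq_iff_eq_neg.2 (X.parity_mul_opMatrix (tensorBracket_mul_sign hv)), ← ht, mul_neg,
    ← mul_assoc (X.gram B), ← neg_eq_iff_eq_neg.2 (X.parity_mul_gram B), neg_mul, neg_neg,
    ← mul_assoc, ← mul_assoc, hσσ, one_mul]

theorem isSuperSymm_hessian {v : g ⊗[ℝ] C} (hv : v ∈ tensorDeg g 𝒞 1) :
    SFun.IsSuperSymm X.oddC (X.hessian B v) :=
  (SFun.isSuperSymm_iff (X.isEven_hessian hB hv)).2 (X.hessian_transpose hB hv)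

/-- The wheels are the supertraces of the powers of `K ∘ l(v, ·)`. -/
theorem wheelValue_eq {K : C →ₗ[ℝ] C} (hK : D.IsSymmLowering K) (v : g ⊗[ℝ] C)
    (n : ℕ) :
    SFun.wheelValue X.oddC (X.hessian B v) (X.bivector B K) (n + 1) =
      1 / 2 * ((-1 : ℝ) ^ (n + 2) *
        superTrace 𝒞 ((LinearMap.lTensor g K ∘ₗ tensorBracket g C v) ^ (n + 1))) := by
  set k := X.opMatrix (LinearMap.lTensor g K) with hk
  set t := X.opMatrix (tensorBracket g C v) with ht
  have hσσ : SFun.parity X.oddC * SFun.parity X.oddC = 1 := SFun.parity_mul_parity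
  have h1 : superTrace 𝒞 ((LinearMap.lTensor g K ∘ₗ tensorBracket g C v) ^ (n + 1)) =
      -(SFun.parity X.oddC * (k * t) ^ (n + 1)).trace := by
    rw [← Matrix.trace_neg, ← neg_mul, ← X.opMatrix_tensorSign, hk, ht, ← opMatrix_mul,
      ← opMatrix_pow, ← opMatrix_mul, trace_opMatrix]
    rfl
  have h2 : SFun.wheelMatrix X.oddC (X.hessian B v) (X.bivector B K) =
      -(X.gram B * (t * k) * (X.gram B)⁻¹) := by
    rw [SFun.wheelMatrix, hessian_eq, X.bivector_eq hB, ← mul_assoc (SFun.parity X.oddC),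
      hσσ, one_mul, mul_neg]
    simp only [mul_assoc, hk, ht]
  have h3 : ∀ m, (X.gram B * (t * k) * (X.gram B)⁻¹) ^ m =
      X.gram B * (t * k) ^ m * (X.gram B)⁻¹ := by
    intro m
    induction m with
    | zero => simp [X.gram_mul_inv hB]
    | succ m ih =>
      rw [pow_succ, ih, pow_succ]
      simp only [mul_assoc]
      rw [← mul_assoc (X.gram B)⁻¹ (X.gram B), X.inv_mul_gram hB, one_mul]
  have h4 : (SFun.parity X.oddC * (X.gram B * (t * k) ^ (n + 1) * (X.gram B)⁻¹)).trace =
      (SFun.parity X.oddC * (k * t) ^ (n + 1)).trace := by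
    have hpk := X.parity_mul_opMatrix (lTensor_mul_sign (g := g) hK)
    rw [← hk] at hpk
    have e1 : (t * k) ^ (n + 1) = t * (k * t) ^ n * k := by
      rw [pow_succ', mul_assoc, mul_assoc]
      congr 1
      have hs : SemiconjBy k (t * k) (k * t) := (mul_assoc _ _ _).symm
      exact (hs.pow_right n).eq
    calc (SFun.parity X.oddC * (X.gram B * (t * k) ^ (n + 1) * (X.gram B)⁻¹)).trace
        = ((X.gram B)⁻¹ * (SFun.parity X.oddC * X.gram B * (t * k) ^ (n + 1))).trace := by
          rw [← mul_assoc, ← mul_assoc, Matrix.trace_mul_comm]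
      _ = -(SFun.parity X.oddC * (t * (k * t) ^ n * k)).trace := by
          rw [X.parity_mul_gram, neg_mul, mul_neg, mul_assoc, ← mul_assoc (X.gram B)⁻¹,
            X.inv_mul_gram hB, one_mul, e1, Matrix.trace_neg]
      _ = -(k * SFun.parity X.oddC * (t * (k * t) ^ n)).trace := by
          rw [← mul_assoc, Matrix.trace_mul_comm, mul_assoc]
      _ = (SFun.parity X.oddC * (k * t) ^ (n + 1)).trace := by
          rw [← neg_eq_iff_eq_neg.2 hpk, neg_mul, Matrix.trace_neg, neg_neg, pow_succ']
          simp only [mul_assoc]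
  rw [SFun.wheelValue, h2, neg_pow, h3, h1]
  have e2 : ((-1 : Matrix (I × A) (I × A) ℝ) ^ (n + 1)) = ((-1 : ℝ) ^ (n + 1)) • 1 := by
    rw [← neg_one_smul ℝ (1 : Matrix (I × A) (I × A) ℝ), smul_pow, one_pow]
  rw [e2, smul_mul_assoc, one_mul, mul_smul_comm, Matrix.trace_smul, h4, smul_eq_mul, pow_succ _ (n + 1)]
  ring

end Quadratic

end FieldCoords

end ChernSimons

section ChernSimons

variable {C : Type*} [Ring C] [Algebra ℝ C] {𝒞 : ℕ → Submodule ℝ C} [GradedAlgebra 𝒞]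
variable {g : Type*} [LieRing g] [LieAlgebra ℝ g]

namespace FieldCoords

variable {D : DGFrobenius 𝒞} {I P A : Type*} (X : FieldCoords D g I P A)
variable (B : LinearMap.BilinForm ℝ g)

/-! ### The cubic form -/

/-- The coefficients of the polarized cubic term. -/
def cubicCoeff (x y z : I × A) : ℝ :=
  (-1 : ℝ) ^ (X.degC y.1 * (X.degC z.1 + 1)) *
    tensorPair D B (X.tensorBasis x) (tensorBracket g C (X.tensorBasis y) (X.tensorBasis z))

variable [Fintype I] [Fintype P] [Fintype A] [DecidableEq I] [DecidableEq A]
variable {R : Type*} [Ring R] [Algebra ℝ R]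

/-- The trilinear form polarizing (six times) the cubic term of the action. -/
def cubicForm (f h k : I × A → R) : R :=
  ∑ x, ∑ y, ∑ z, X.cubicCoeff B x y z • (f x * h y * k z)

theorem cubicTerm_eq (Ω : I → A → R) :
    X.cubicTerm B Ω = (1 / 6 : ℝ) •
      X.cubicForm B (Function.uncurry Ω) (Function.uncurry Ω) (Function.uncurry Ω) := by
  rw [cubicTerm, cubicForm]
  congr 1
  simp only [Fintype.sum_prod_type, Function.uncurry]
  refine Finset.sum_congr rfl fun i _ => ?_
  have h1 : ∀ j k, ∑ a, ∑ b, ∑ c, ((-1 : ℝ) ^ (X.degC j * (X.degC k + 1)) *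
      B (X.bg a) ⁅X.bg b, X.bg c⁆ * D.pair (X.bC i) (X.bC j * X.bC k)) • (Ω i a * Ω j b * Ω k c) =
      ∑ a, ∑ b, ∑ c, X.cubicCoeff B (i, a) (j, b) (k, c) • (Ω i a * Ω j b * Ω k c) := by
    intro j k
    refine Finset.sum_congr rfl fun a _ => Finset.sum_congr rfl fun b _ =>
      Finset.sum_congr rfl fun c _ => ?_
    simp only [cubicCoeff, tensorBasis_apply, tensorBracket_tmul, tensorPair_tmul, mul_assoc]
  simp only [h1]
  calc _ = ∑ j, ∑ a, ∑ k, ∑ b, ∑ c, X.cubicCoeff B (i, a) (j, b) (k, c) •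
        (Ω i a * Ω j b * Ω k c) := Finset.sum_congr rfl fun j _ => Finset.sum_comm
    _ = ∑ a, ∑ j, ∑ k, ∑ b, ∑ c, X.cubicCoeff B (i, a) (j, b) (k, c) •
        (Ω i a * Ω j b * Ω k c) := Finset.sum_comm
    _ = _ := Finset.sum_congr rfl fun a _ => Finset.sum_congr rfl fun j _ => Finset.sum_comm

theorem cubicForm_add_left (f f' h k : I × A → R) :
    X.cubicForm B (f + f') h k = X.cubicForm B f h k + X.cubicForm B f' h k := by
  simp only [cubicForm, Pi.add_apply, add_mul, smul_add, Finset.sum_add_distrib]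

theorem cubicForm_add_middle (f h h' k : I × A → R) :
    X.cubicForm B f (h + h') k = X.cubicForm B f h k + X.cubicForm B f h' k := by
  simp only [cubicForm, Pi.add_apply, add_mul, mul_add, smul_add, Finset.sum_add_distrib]

theorem cubicForm_add_right (f h k k' : I × A → R) :
    X.cubicForm B f h (k + k') = X.cubicForm B f h k + X.cubicForm B f h k' := by
  simp only [cubicForm, Pi.add_apply, mul_add, smul_add, Finset.sum_add_distrib]

theorem map_cubicForm {R' : Type*} [Ring R'] [Algebra ℝ R'] (F : R →ₐ[ℝ] R') (f h k : I × A → R) :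
    F (X.cubicForm B f h k) = X.cubicForm B (F ∘ f) (F ∘ h) (F ∘ k) := by
  simp [cubicForm]

/-- A vector of `g ⊗ C` as a field with constant components. -/
def constField (R : Type*) [Ring R] [Algebra ℝ R] (v : g ⊗[ℝ] C) (x : I × A) : R :=
  X.tensorBasis.repr v x • 1

theorem repr_tensorSign (v : g ⊗[ℝ] C) (x : I × A) :
    X.tensorBasis.repr (tensorSign g 𝒞 v) x = (-1 : ℝ) ^ X.degC x.1 * X.tensorBasis.repr v x := by
  suffices h : X.tensorBasis.coord x ∘ₗ tensorSign g 𝒞 =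
      (-1 : ℝ) ^ X.degC x.1 • X.tensorBasis.coord x from LinearMap.congr_fun h v
  refine X.tensorBasis.ext fun y => ?_
  rw [LinearMap.comp_apply, sign_tensorBasis, map_smul, LinearMap.smul_apply]
  by_cases h : y = x
  · rw [h]
  · simp [h]

theorem neg_one_pow_of_repr_ne_zero {i : ℕ} {v : g ⊗[ℝ] C} (hv : v ∈ tensorDeg g 𝒞 i) {x : I × A}
    (h : X.tensorBasis.repr v x ≠ 0) : (-1 : ℝ) ^ X.degC x.1 = (-1) ^ i := by
  have h1 := X.repr_tensorSign v x
  rw [tensorSign_of_mem hv, map_smul, Finsupp.smul_apply, smul_eq_mul] at h1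
  exact (mul_right_cancel₀ h h1).symm

theorem odd_degC_of_repr_ne_zero {v : g ⊗[ℝ] C} (hv : v ∈ tensorDeg g 𝒞 1) {x : I × A}
    (h : X.tensorBasis.repr v x ≠ 0) : Odd (X.degC x.1) := by
  have h1 := X.neg_one_pow_of_repr_ne_zero hv h
  rw [pow_one] at h1
  exact (neg_one_pow_eq_neg_one_iff_odd (by norm_num)).1 h1

theorem even_iff_of_isEven {N : Matrix (I × A) (I × A) ℝ} (hN : SFun.IsEven X.oddC N) {x y : I × A}
    (h : N x y ≠ 0) : Even (X.degC x.1) ↔ Even (X.degC y.1) := by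
  simpa [oddC] using hN x y h

theorem sum_repr_mul (v : g ⊗[ℝ] C) (F : (g ⊗[ℝ] C) →ₗ[ℝ] ℝ) :
    ∑ x, X.tensorBasis.repr v x * F (X.tensorBasis x) = F v := by
  conv_rhs => rw [← X.tensorBasis.sum_repr v]
  simp only [map_sum, map_smul, smul_eq_mul]

variable {B}

section Polarization

variable (hB : IsQuadratic B) {v : g ⊗[ℝ] C} (hv : v ∈ tensorDeg g 𝒞 1)
include hB hv

theorem sum_cubicCoeff_left (y z : I × A) :
    ∑ x, X.tensorBasis.repr v x * X.cubicCoeff B x y z = X.hessian B v y z := by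
  have h1 : X.hessian B v y z = (-1 : ℝ) ^ (X.degC y.1 * (X.degC z.1 + 1)) * X.hessian B v y z := by
    by_cases h : X.hessian B v y z = 0
    · rw [h, mul_zero]
    · have h2 := X.even_iff_of_isEven (X.isEven_hessian hB hv) h
      have h3 : Even (X.degC y.1 * (X.degC z.1 + 1)) := by
        rw [Nat.even_mul, Nat.even_add_one, h2]; tauto
      rw [h3.neg_one_pow, one_mul]
  rw [h1]
  have h2 := X.sum_repr_mul v (LinearMap.flip (tensorPair D B)
    (tensorBracket g C (X.tensorBasis y) (X.tensorBasis z)))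
  simp only [LinearMap.flip_apply] at h2
  have h3 : ∀ x, X.tensorBasis.repr v x * X.cubicCoeff B x y z =
      (-1 : ℝ) ^ (X.degC y.1 * (X.degC z.1 + 1)) * (X.tensorBasis.repr v x *
        tensorPair D B (X.tensorBasis x) (tensorBracket g C (X.tensorBasis y) (X.tensorBasis z))) := by
    intro x; rw [cubicCoeff]; ring
  simp only [h3, ← Finset.mul_sum]
  congr 1
  refine (Eq.trans h2 ?_)
  rw [tensorPair_bracket hB, tensorPair_bracket_left hB hv, sign_tensorBasis, map_smul,
    LinearMap.smul_apply, hessian, Matrix.of_apply, smul_eq_mul, neg_mul]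

theorem sum_cubicCoeff_middle (x z : I × A) :
    ∑ y, X.tensorBasis.repr v y * X.cubicCoeff B x y z = X.hessian B v x z := by
  have h1 : ∀ y, X.tensorBasis.repr v y * X.cubicCoeff B x y z =
      (-1 : ℝ) ^ (X.degC z.1 + 1) * (X.tensorBasis.repr v y *
        tensorPair D B (X.tensorBasis x) (tensorBracket g C (X.tensorBasis y) (X.tensorBasis z))) := by
    intro y
    by_cases h : X.tensorBasis.repr v y = 0
    · simp [h]
    · rw [cubicCoeff, pow_mul, (X.odd_degC_of_repr_ne_zero hv h).neg_one_pow]; ring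
  have h2 := X.sum_repr_mul v (tensorPair D B (X.tensorBasis x) ∘ₗ
    (tensorBracket g C).flip (X.tensorBasis z))
  simp only [LinearMap.comp_apply, LinearMap.flip_apply] at h2
  simp only [h1, ← Finset.mul_sum, h2]
  by_cases h : X.hessian B v x z = 0
  · rw [h]
    rw [hessian, Matrix.of_apply, mul_eq_zero, neg_eq_zero] at h
    rcases h with h | h
    · exact absurd h (by positivity)
    · rw [h, mul_zero]
  · have h2 := X.even_iff_of_isEven (X.isEven_hessian hB hv) h
    rw [hessian, Matrix.of_apply, pow_succ, mul_neg_one]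
    congr 2
    by_cases hx : Even (X.degC x.1)
    · rw [hx.neg_one_pow, (h2.1 hx).neg_one_pow]
    · rw [(Nat.not_even_iff_odd.1 hx).neg_one_pow,
        (Nat.not_even_iff_odd.1 (fun h' => hx (h2.2 h'))).neg_one_pow]

theorem tensorBracket_basis_swap (y : I × A) :
    tensorBracket g C (X.tensorBasis y) v =
      -((-1 : ℝ) ^ X.degC y.1) • tensorBracket g C v (X.tensorBasis y) := by
  have h := tensorBracket_swap D hv (X.tensorBasis y)
  rw [sign_tensorBasis, map_smul, LinearMap.smul_apply] at h
  rw [neg_smul, ← smul_neg, ← h, smul_smul, ← pow_add, Even.neg_one_pow ⟨_, rfl⟩, one_smul]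

theorem sum_cubicCoeff_right (x y : I × A) :
    ∑ z, X.tensorBasis.repr v z * X.cubicCoeff B x y z = X.hessian B v x y := by
  have h1 : ∀ z, X.tensorBasis.repr v z * X.cubicCoeff B x y z = X.tensorBasis.repr v z *
      tensorPair D B (X.tensorBasis x) (tensorBracket g C (X.tensorBasis y) (X.tensorBasis z)) := by
    intro z
    by_cases h : X.tensorBasis.repr v z = 0
    · simp [h]
    · rw [cubicCoeff, mul_comm (X.degC y.1), pow_mul,
        (X.odd_degC_of_repr_ne_zero hv h).add_one.neg_one_pow, one_pow, one_mul]
  have h2 := X.sum_repr_mul v (tensorPair D B (X.tensorBasis x) ∘ₗ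
    tensorBracket g C (X.tensorBasis y))
  simp only [LinearMap.comp_apply] at h2
  simp only [h1, h2]
  rw [X.tensorBracket_basis_swap hB hv, map_smul, smul_eq_mul]
  by_cases h : X.hessian B v x y = 0
  · rw [h]
    rw [hessian, Matrix.of_apply, mul_eq_zero, neg_eq_zero] at h
    rcases h with h | h
    · exact absurd h (by positivity)
    · rw [h, mul_zero]
  · have h2 := X.even_iff_of_isEven (X.isEven_hessian hB hv) h
    rw [hessian, Matrix.of_apply]
    congr 2
    by_cases hx : Even (X.degC x.1)
    · rw [hx.neg_one_pow, (h2.1 hx).neg_one_pow]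
    · rw [(Nat.not_even_iff_odd.1 hx).neg_one_pow,
        (Nat.not_even_iff_odd.1 (fun h' => hx (h2.2 h'))).neg_one_pow]

theorem cubicForm_const_left (f h : I × A → R) :
    X.cubicForm B (X.constField R v) f h = ∑ y, ∑ z, X.hessian B v y z • (f y * h z) := by
  simp only [cubicForm, constField, smul_mul_assoc, one_mul, smul_smul]
  rw [Finset.sum_comm]
  refine Finset.sum_congr rfl fun y _ => ?_
  rw [Finset.sum_comm]
  refine Finset.sum_congr rfl fun z _ => ?_
  rw [← Finset.sum_smul, ← X.sum_cubicCoeff_left hB hv]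
  simp only [mul_comm]

theorem cubicForm_const_middle (f h : I × A → R) :
    X.cubicForm B f (X.constField R v) h = ∑ y, ∑ z, X.hessian B v y z • (f y * h z) := by
  simp only [cubicForm, constField, smul_mul_assoc, mul_smul_comm, mul_one, smul_smul]
  refine Finset.sum_congr rfl fun y _ => ?_
  rw [Finset.sum_comm]
  refine Finset.sum_congr rfl fun z _ => ?_
  rw [← Finset.sum_smul, ← X.sum_cubicCoeff_middle hB hv]
  simp only [mul_comm]

theorem cubicForm_const_right (f h : I × A → R) :
    X.cubicForm B f h (X.constField R v) = ∑ y, ∑ z, X.hessian B v y z • (f y * h z) := by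
  simp only [cubicForm, constField, mul_smul_comm, mul_one, smul_smul]
  refine Finset.sum_congr rfl fun y _ => Finset.sum_congr rfl fun z _ => ?_
  rw [← Finset.sum_smul, ← X.sum_cubicCoeff_right hB hv]
  simp only [mul_comm]

/-- The linear form `π(l(v, v), ·)` in the basis of `g ⊗ C`. -/
theorem sum_hessian_left (z : I × A) : ∑ y, X.tensorBasis.repr v y * X.hessian B v y z =
    tensorPair D B (X.tensorBasis z) (tensorBracket g C v v) := by
  have h1 : ∀ y, X.tensorBasis.repr v y * X.hessian B v y z = X.tensorBasis.repr v y *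
      tensorPair D B (X.tensorBasis y) (tensorBracket g C v (X.tensorBasis z)) := by
    intro y
    by_cases h : X.tensorBasis.repr v y = 0
    · simp [h]
    · rw [hessian, Matrix.of_apply, (X.odd_degC_of_repr_ne_zero hv h).neg_one_pow, neg_neg, one_mul]
  have h2 := X.sum_repr_mul v (LinearMap.flip (tensorPair D B) (tensorBracket g C v (X.tensorBasis z)))
  simp only [LinearMap.flip_apply] at h2
  simp only [h1, h2]
  rw [tensorPair_bracket hB, tensorPair_comm hB]

theorem sum_hessian_right (y : I × A) : ∑ z, X.tensorBasis.repr v z * X.hessian B v y z =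
    tensorPair D B (X.tensorBasis y) (tensorBracket g C v v) := by
  have h2 := X.sum_repr_mul v (tensorPair D B (X.tensorBasis y) ∘ₗ tensorBracket g C v)
  simp only [LinearMap.comp_apply] at h2
  have h3 : ∀ z, X.tensorBasis.repr v z * X.hessian B v y z = -((-1 : ℝ) ^ X.degC y.1) *
      (X.tensorBasis.repr v z *
        tensorPair D B (X.tensorBasis y) (tensorBracket g C v (X.tensorBasis z))) := by
    intro z; rw [hessian, Matrix.of_apply]; ring
  simp only [h3, ← Finset.mul_sum, h2]
  by_cases hy : Odd (X.degC y.1)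
  · rw [hy.neg_one_pow]; ring
  · have h0 : tensorPair D B (X.tensorBasis y) (tensorBracket g C v v) = 0 := by
      have h := tensorPair_sign (D := D) (B := B) (X.tensorBasis y) (tensorBracket g C v v)
      rw [sign_tensorBasis, tensorSign_of_mem (tensorBracket_mem hv hv), map_smul,
        LinearMap.smul_apply, (Nat.not_odd_iff_even.1 hy).neg_one_pow] at h
      norm_num at h
      linarith
    rw [h0, mul_zero]

/-- Expansion of the cubic term around a constant field of degree `1`. -/
theorem cubicForm_const_add (w : I × A → R) :
    X.cubicForm B (X.constField R v + w) (X.constField R v + w) (X.constField R v + w) =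
      tensorPair D B v (tensorBracket g C v v) • 1 +
      (3 : ℝ) • (∑ z, tensorPair D B (X.tensorBasis z) (tensorBracket g C v v) • w z) +
      (3 : ℝ) • (∑ y, ∑ z, X.hessian B v y z • (w y * w z)) + X.cubicForm B w w w := by
  simp only [cubicForm_add_left, cubicForm_add_middle, cubicForm_add_right]
  simp only [X.cubicForm_const_left hB hv, X.cubicForm_const_middle hB hv,
    X.cubicForm_const_right hB hv]
  have e1 : ∑ y, ∑ z, X.hessian B v y z • (X.constField R v y * w z) =
      ∑ z, tensorPair D B (X.tensorBasis z) (tensorBracket g C v v) • w z := by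
    rw [Finset.sum_comm]
    refine Finset.sum_congr rfl fun z _ => ?_
    simp only [constField, smul_mul_assoc, one_mul, smul_smul]
    rw [← X.sum_hessian_left hB hv, Finset.sum_smul]
    simp only [mul_comm]
  have e2 : ∑ y, ∑ z, X.hessian B v y z • (w y * X.constField R v z) =
      ∑ z, tensorPair D B (X.tensorBasis z) (tensorBracket g C v v) • w z := by
    refine Finset.sum_congr rfl fun y _ => ?_
    simp only [constField, mul_smul_comm, mul_one, smul_smul]
    rw [← X.sum_hessian_right hB hv, Finset.sum_smul]
    simp only [mul_comm]
  have e3 : ∑ y, ∑ z, X.hessian B v y z • (X.constField R v y * X.constField R v z) =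
      tensorPair D B v (tensorBracket g C v v) • 1 := by
    have h2 := X.sum_repr_mul v (LinearMap.flip (tensorPair D B) (tensorBracket g C v v))
    simp only [LinearMap.flip_apply] at h2
    rw [← h2, Finset.sum_smul]
    refine Finset.sum_congr rfl fun y _ => ?_
    rw [← X.sum_hessian_right hB hv, Finset.mul_sum, Finset.sum_smul]
    refine Finset.sum_congr rfl fun z _ => ?_
    simp only [constField, smul_mul_assoc, one_mul, smul_smul]
    congr 1
    ring
  rw [e1, e2, e3]
  module

end Polarization

/-! ### The interaction -/

variable (B)

theorem sum_repr_mul_bC (c : C) (F : C →ₗ[ℝ] ℝ) : ∑ j, X.bC.repr c j * F (X.bC j) = F c := by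
  conv_rhs => rw [← X.bC.sum_repr c]
  simp only [map_sum, map_smul, smul_eq_mul]

/-- The quadratic term only sees the fluctuations, since the zero modes are closed. -/
theorem quadTerm_embedField_add {ι : D.Cohomology →ₗ[ℝ] C} (hι : ∀ x, D.d (ι x) = 0)
    (α : P → A → R) (Ω : I → A → R) :
    X.quadTerm B (X.embedField ι α + Ω) = X.quadTerm B Ω := by
  have h1 : ∀ i a b (r : R), ∑ j, ((-1 : ℝ) ^ (X.degC i + 1) * B (X.bg a) (X.bg b) *
      D.pair (X.bC i) (D.d (X.bC j))) • (r * X.embedField ι α j b) = 0 := by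
    intro i a b r
    simp only [embedField, Finset.mul_sum, Finset.smul_sum, mul_smul_comm, smul_smul]
    rw [Finset.sum_comm]
    refine Finset.sum_eq_zero fun p _ => ?_
    rw [← Finset.sum_smul]
    have := X.sum_repr_mul_bC (ι (X.bH p)) (D.pair (X.bC i) ∘ₗ D.d)
    simp only [LinearMap.comp_apply, hι, map_zero] at this
    simp only [mul_assoc, ← Finset.mul_sum, mul_comm (D.pair _ _), this, mul_zero, zero_smul]
  have h2 : ∀ j a b (r : R), ∑ i, ((-1 : ℝ) ^ (X.degC i + 1) * B (X.bg a) (X.bg b) *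
      D.pair (X.bC i) (D.d (X.bC j))) • (X.embedField ι α i a * r) = 0 := by
    intro j a b r
    simp only [embedField, Finset.sum_mul, Finset.smul_sum, smul_mul_assoc, smul_smul]
    rw [Finset.sum_comm]
    refine Finset.sum_eq_zero fun p _ => ?_
    rw [← Finset.sum_smul]
    have := X.sum_repr_mul_bC (ι (X.bH p)) (D.pair.flip (X.bC j) ∘ₗ D.d)
    simp only [LinearMap.comp_apply, hι, map_zero] at this
    have h3 : ∀ i, (-1 : ℝ) ^ (X.degC i + 1) * B (X.bg a) (X.bg b) *
        D.pair (X.bC i) (D.d (X.bC j)) * X.bC.repr (ι (X.bH p)) i =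
        B (X.bg a) (X.bg b) * (X.bC.repr (ι (X.bH p)) i * D.pair (D.d (X.bC i)) (X.bC j)) := by
      intro i
      have := D.pair_d (X.degC i) (X.bC i) (X.bC j) (X.bC_mem i)
      rw [eq_neg_of_add_eq_zero_left this, pow_succ]
      ring
    have h4 : ∑ i, X.bC.repr (ι (X.bH p)) i * D.pair (D.d (X.bC i)) (X.bC j) = 0 := this
    simp only [h3, ← Finset.mul_sum, h4, mul_zero, zero_smul]
  have hR : ∀ F : I → I → A → A → R, ∑ i, ∑ j, ∑ a, ∑ b, F i j a b =
      ∑ i, ∑ a, ∑ b, ∑ j, F i j a b := by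
    intro F
    refine Finset.sum_congr rfl fun i _ => ?_
    rw [Finset.sum_comm]
    exact Finset.sum_congr rfl fun a _ => Finset.sum_comm
  have hL : ∀ F : I → I → A → A → R, ∑ i, ∑ j, ∑ a, ∑ b, F i j a b =
      ∑ j, ∑ a, ∑ b, ∑ i, F i j a b := by
    intro F
    rw [Finset.sum_comm]
    refine Finset.sum_congr rfl fun j _ => ?_
    rw [Finset.sum_comm]
    exact Finset.sum_congr rfl fun a _ => Finset.sum_comm
  rw [quadTerm, quadTerm]
  congr 1
  simp only [Pi.add_apply, mul_add, smul_add, Finset.sum_add_distrib]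
  rw [hR (fun i j a b => _ • ((_ + _) * X.embedField ι α j b))]
  simp only [h1, Finset.sum_const_zero, zero_add, add_mul, smul_add, Finset.sum_add_distrib]
  rw [hL]
  simp only [h2, Finset.sum_const_zero, zero_add]

end FieldCoords

end ChernSimons

/-! ### Exponential generating series -/

section ExpSeries

open PowerSeries

variable {R S : Type*} [Ring R] [Algebra ℝ R] [Ring S] [Algebra ℝ S]

/-- The double series `∑ Φ_e(V^v) / (v! e!)`, generating the values of the functionals `Φ_e` on the
powers of `V`. -/
def expSeries (Φ : ℕ → R →ₗ[ℝ] S) (V : R) : PowerSeries (PowerSeries S) :=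
  PowerSeries.mk fun v => PowerSeries.mk fun e => ((v ! : ℝ)⁻¹ * (e ! : ℝ)⁻¹) • Φ e (V ^ v)

theorem coeff_expSeries (Φ : ℕ → R →ₗ[ℝ] S) (V : R) (v e : ℕ) :
    coeff e (coeff v (expSeries Φ V)) = ((v ! : ℝ)⁻¹ * (e ! : ℝ)⁻¹) • Φ e (V ^ v) := by
  rw [expSeries, coeff_mk, coeff_mk]

theorem inv_factorial_smul_add_pow {x y : R} (h : Commute x y) (n : ℕ) :
    (n ! : ℝ)⁻¹ • (x + y) ^ n = ∑ m ∈ Finset.HasAntidiagonal.antidiagonal n,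
      ((m.1 ! : ℝ)⁻¹ * (m.2 ! : ℝ)⁻¹) • (x ^ m.1 * y ^ m.2) := by
  rw [h.add_pow', Finset.smul_sum]
  refine Finset.sum_congr rfl fun m hm => ?_
  rw [← Finset.HasAntidiagonal.mem_antidiagonal.1 hm, ← Nat.cast_smul_eq_nsmul ℝ, smul_smul,
    Nat.choose_symm_add, Nat.add_choose, Nat.cast_div (Nat.factorial_mul_factorial_dvd_factorial_add _ _) (by positivity)]
  congr 1
  push_cast
  have h1 : (m.1 ! : ℝ) ≠ 0 := by positivity
  have h2 : (m.2 ! : ℝ) ≠ 0 := by positivity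
  have h3 : ((m.1 + m.2)! : ℝ) ≠ 0 := by positivity
  field_simp

/-- A summand of the exponent that passes through the functionals splits off a factor. -/
theorem expSeries_add {Φ : ℕ → R →ₗ[ℝ] S} {V₀ V : R} {s : S} (h : Commute V₀ V)
    (hΦ : ∀ e k f, Φ e (V₀ ^ k * f) = s ^ k * Φ e f) :
    expSeries Φ (V₀ + V) =
      (PowerSeries.mk fun k => (k ! : ℝ)⁻¹ • (C s : PowerSeries S) ^ k) * expSeries Φ V := by
  ext v e
  rw [coeff_expSeries, mul_comm, mul_smul, ← map_smul, inv_factorial_smul_add_pow h, map_sum,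
    Finset.smul_sum, coeff_mul, map_sum]
  refine Finset.sum_congr rfl fun m _ => ?_
  have h1 : coeff e ((m.1 ! : ℝ)⁻¹ • (C s : PowerSeries S) ^ m.1 * coeff m.2 (expSeries Φ V)) =
      (m.1 ! : ℝ)⁻¹ • (s ^ m.1 * coeff e (coeff m.2 (expSeries Φ V))) := by
    rw [smul_mul_assoc, ← map_pow, ← coeff_C_mul e _ (s ^ m.1)]
    rfl
  rw [coeff_mk, h1, coeff_expSeries, map_smul, hΦ, mul_smul_comm, smul_smul, smul_smul]
  congr 1
  ring

end ExpSeries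

/-! ### Polynomial families and their first jets -/

section Families

variable {V W : Type*} [AddCommGroup V] [Module ℝ V] [AddCommGroup W] [Module ℝ W]

variable (V) in
/-- Polynomial one-parameter families of vectors. -/
def polyFam : Submodule ℝ (ℝ → V) :=
  Submodule.span ℝ {f | ∃ (k : ℕ) (a : V), f = fun ε => ε ^ k • a}

theorem monomial_mem_polyFam (k : ℕ) (a : V) : (fun ε : ℝ => ε ^ k • a) ∈ polyFam V :=
  Submodule.subset_span ⟨k, a, rfl⟩

theorem const_mem_polyFam (a : V) : (fun _ : ℝ => a) ∈ polyFam V := by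
  simpa using monomial_mem_polyFam 0 a

theorem map_mem_polyFam (F : V →ₗ[ℝ] W) {f : ℝ → V} (hf : f ∈ polyFam V) :
    (fun ε => F (f ε)) ∈ polyFam W := by
  have h : polyFam V ≤ (polyFam W).comap (F.compLeft ℝ) := by
    refine Submodule.span_le.2 ?_
    rintro _ ⟨k, a, rfl⟩
    have h1 : F.compLeft ℝ (fun ε => ε ^ k • a) = fun ε => ε ^ k • F a := by ext ε; simp
    exact (congrArg (· ∈ polyFam W) h1).mpr (monomial_mem_polyFam k (F a))
  exact h hf

theorem smul_mem_polyFam {r : ℝ → ℝ} (hr : r ∈ polyFam ℝ) {f : ℝ → V} (hf : f ∈ polyFam V) :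
    (fun ε => r ε • f ε) ∈ polyFam V := by
  induction hr using Submodule.span_induction with
  | mem r hr =>
    obtain ⟨k, c, rfl⟩ := hr
    induction hf using Submodule.span_induction with
    | mem f hf =>
      obtain ⟨l, a, rfl⟩ := hf
      convert monomial_mem_polyFam (k + l) (c • a) using 1
      ext ε; simp only [smul_smul, smul_eq_mul]; congr 1; ring
    | zero =>
      convert Submodule.zero_mem (polyFam V) using 1
      ext ε; simp
    | add f f' _ _ h h' =>
      convert Submodule.add_mem _ h h' using 1
      ext ε; simp
    | smul c' f _ h =>
      convert Submodule.smul_mem _ c' h using 1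
      ext ε; simp only [Pi.smul_apply]; rw [smul_comm]
  | zero =>
    convert Submodule.zero_mem (polyFam V) using 1
    ext ε; simp
  | add f f' _ _ h h' =>
    convert Submodule.add_mem _ h h' using 1
    ext ε; simp [add_smul]
  | smul c' f _ h =>
    convert Submodule.smul_mem _ c' h using 1
    ext ε; simp [smul_smul]

theorem id_mem_polyFam : (fun ε : ℝ => ε) ∈ polyFam ℝ := by
  simpa using monomial_mem_polyFam 1 (1 : ℝ)

theorem mul_mem_polyFam {R : Type*} [Ring R] [Algebra ℝ R] {f h : ℝ → R} (hf : f ∈ polyFam R)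
    (hh : h ∈ polyFam R) : f * h ∈ polyFam R := by
  induction hf using Submodule.span_induction with
  | mem r hr =>
    obtain ⟨k, c, rfl⟩ := hr
    have := smul_mem_polyFam (monomial_mem_polyFam k (1 : ℝ))
      (map_mem_polyFam (LinearMap.mulLeft ℝ c) hh)
    convert this using 1
    ext ε; simp
  | zero => simp
  | add f f' _ _ h h' => rw [add_mul]; exact Submodule.add_mem _ h h'
  | smul c' f _ h => rw [smul_mul_assoc]; exact Submodule.smul_mem _ c' h

theorem pow_mem_polyFam {R : Type*} [Ring R] [Algebra ℝ R] {f : ℝ → R} (hf : f ∈ polyFam R)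
    (n : ℕ) : f ^ n ∈ polyFam R := by
  induction n with
  | zero => rw [pow_zero]; exact const_mem_polyFam (1 : R)
  | succ n ih => rw [pow_succ]; exact mul_mem_polyFam ih hf

variable (V) in
/-- Polynomial families vanishing to second order at `0`. -/
def sqFam : Submodule ℝ (ℝ → V) :=
  (polyFam V).map (LinearMap.pi fun ε => (ε ^ 2 : ℝ) • LinearMap.proj ε)

theorem mem_sqFam {f : ℝ → V} : f ∈ sqFam V ↔ ∃ h ∈ polyFam V, f = fun ε => ε ^ 2 • h ε := by
  simp only [sqFam, Submodule.mem_map]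
  refine exists_congr fun h => and_congr_right fun _ => ?_
  rw [eq_comm]
  rfl

theorem map_mem_sqFam (F : V →ₗ[ℝ] W) {f : ℝ → V} (hf : f ∈ sqFam V) :
    (fun ε => F (f ε)) ∈ sqFam W := by
  obtain ⟨h, hh, rfl⟩ := mem_sqFam.1 hf
  exact mem_sqFam.2 ⟨_, map_mem_polyFam F hh, by ext; simp⟩

theorem smul_mem_sqFam {r : ℝ → ℝ} (hr : r ∈ polyFam ℝ) {f : ℝ → V} (hf : f ∈ sqFam V) :
    (fun ε => r ε • f ε) ∈ sqFam V := by
  obtain ⟨h, hh, rfl⟩ := mem_sqFam.1 hf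
  exact mem_sqFam.2 ⟨_, smul_mem_polyFam hr hh, by ext; exact smul_comm _ _ _⟩

theorem smul_mem_sqFam' {r : ℝ → ℝ} (hr : r ∈ sqFam ℝ) {f : ℝ → V} (hf : f ∈ polyFam V) :
    (fun ε => r ε • f ε) ∈ sqFam V := by
  obtain ⟨h, hh, rfl⟩ := mem_sqFam.1 hr
  exact mem_sqFam.2 ⟨_, smul_mem_polyFam hh hf, by ext; simp [smul_smul]⟩

theorem differentiable_of_mem_polyFam {f : ℝ → ℝ} (hf : f ∈ polyFam ℝ) : Differentiable ℝ f := by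
  induction hf using Submodule.span_induction with
  | mem r hr =>
    obtain ⟨k, c, rfl⟩ := hr
    fun_prop
  | zero => exact differentiable_const _
  | add f f' _ _ h h' => exact h.add h'
  | smul c' f _ h => exact h.const_smul c'

theorem hasDerivAt_of_mem_sqFam {f : ℝ → ℝ} (hf : f ∈ sqFam ℝ) : f 0 = 0 ∧ HasDerivAt f 0 0 := by
  obtain ⟨h, hh, rfl⟩ := mem_sqFam.1 hf
  refine ⟨by simp, ?_⟩
  have h1 := (hasDerivAt_pow 2 (0 : ℝ)).smul ((differentiable_of_mem_polyFam hh) 0).hasDerivAt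
  exact h1.congr_deriv (by simp)

/-- Having the same value and the same derivative at `0`, as a relation between real functions. -/
def sameJet : Submodule ℝ ((ℝ → ℝ) × (ℝ → ℝ)) where
  carrier := {p | p.1 0 = p.2 0 ∧ ∃ a, HasDerivAt p.1 a 0 ∧ HasDerivAt p.2 a 0}
  add_mem' := by
    rintro p q ⟨h, a, ha, ha'⟩ ⟨h', b, hb, hb'⟩
    exact ⟨by simp [h, h'], a + b, ha.add hb, ha'.add hb'⟩
  zero_mem' := ⟨rfl, 0, hasDerivAt_const _ _, hasDerivAt_const _ _⟩
  smul_mem' := by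
    rintro c p ⟨h, a, ha, ha'⟩
    exact ⟨by simp [h], c * a, by simpa using ha.const_smul c, by simpa using ha'.const_smul c⟩

theorem mul_mem_sameJet {p q : (ℝ → ℝ) × (ℝ → ℝ)} (hp : p ∈ sameJet) (hq : q ∈ sameJet) :
    p * q ∈ sameJet := by
  obtain ⟨h, a, ha, ha'⟩ := hp
  obtain ⟨h', b, hb, hb'⟩ := hq
  refine ⟨by simp [h, h'], a * q.1 0 + p.1 0 * b, ha.mul hb, ?_⟩
  rw [h, h']
  exact ha'.mul hb'

theorem mem_sameJet_of_sub_mem_sqFam {f h : ℝ → ℝ} (hf : f ∈ polyFam ℝ) (hs : f - h ∈ sqFam ℝ) :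
    (f, h) ∈ sameJet := by
  obtain ⟨h0, h1⟩ := hasDerivAt_of_mem_sqFam hs
  have h2 := ((differentiable_of_mem_polyFam hf) 0).hasDerivAt
  refine ⟨(sub_eq_zero.1 h0 : f 0 = h 0), _, h2, ?_⟩
  have h3 := h2.sub h1
  rw [sub_zero, sub_sub_cancel] at h3
  exact h3

open PowerSeries in
/-- The coefficients of the formal logarithm of a family of double series are determined up to first
order by those of the family. -/
theorem coeff_formalLog_mem_sameJet {Z Z' : ℝ → PowerSeries (PowerSeries ℝ)}
    (h : ∀ v e, ((fun ε => coeff e (coeff v (Z ε)), fun ε => coeff e (coeff v (Z' ε))) :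
      (ℝ → ℝ) × (ℝ → ℝ)) ∈ sameJet) (v e : ℕ) :
    ((fun ε => coeff e (coeff v (formalLog (Z ε))), fun ε => coeff e (coeff v (formalLog (Z' ε)))) :
      (ℝ → ℝ) × (ℝ → ℝ)) ∈ sameJet := by
  let T : PowerSeries (PowerSeries ((ℝ → ℝ) × (ℝ → ℝ))) := PowerSeries.mk fun v =>
    PowerSeries.mk fun e => (fun ε => coeff e (coeff v (Z ε)), fun ε => coeff e (coeff v (Z' ε)))
  have h1 := coeff_coeff_formalLog_mem (S := fun _ _ => sameJet) (Z := T)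
    ⟨rfl, 0, hasDerivAt_const _ _, hasDerivAt_const _ _⟩
    (fun _ _ _ _ _ _ ha hb => mul_mem_sameJet ha hb) (fun v e => by simpa [T] using h v e) v e
  have key : ∀ (F : ((ℝ → ℝ) × (ℝ → ℝ)) →ₐ[ℝ] ℝ),
      F (coeff e (coeff v (formalLog T))) = coeff e (coeff v (formalLog
        (PowerSeries.map (PowerSeries.map (F : ((ℝ → ℝ) × (ℝ → ℝ)) →+* ℝ)) T))) := by
    intro F
    rw [← map_formalLog, coeff_map, coeff_map]
    · rfl
    · intro r x
      ext n
      exact map_smul F r (coeff n x)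
  have e1 : coeff e (coeff v (formalLog T)) = ((fun ε => coeff e (coeff v (formalLog (Z ε))),
      fun ε => coeff e (coeff v (formalLog (Z' ε)))) : (ℝ → ℝ) × (ℝ → ℝ)) := by
    refine Prod.ext (funext fun ε => ?_) (funext fun ε => ?_)
    · have := key ((Pi.evalAlgHom ℝ (fun _ : ℝ => ℝ) ε).comp (AlgHom.fst ℝ _ _))
      refine this.trans ?_
      congr 3
      ext v e
      simp [T]
    · have := key ((Pi.evalAlgHom ℝ (fun _ : ℝ => ℝ) ε).comp (AlgHom.snd ℝ _ _))
      refine this.trans ?_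
      congr 3
      ext v e
      simp [T]
  rwa [e1] at h1

end Families

theorem bilin_mem_polyFam {V W U : Type*} [AddCommGroup V] [Module ℝ V] [AddCommGroup W]
    [Module ℝ W] [AddCommGroup U] [Module ℝ U] (F : V →ₗ[ℝ] W →ₗ[ℝ] U) {f : ℝ → V}
    (hf : f ∈ polyFam V) {h : ℝ → W} (hh : h ∈ polyFam W) :
    (fun ε => F (f ε) (h ε)) ∈ polyFam U := by
  induction hf using Submodule.span_induction with
  | mem f hf =>
    obtain ⟨k, a, rfl⟩ := hf
    convert smul_mem_polyFam (monomial_mem_polyFam k (1 : ℝ)) (map_mem_polyFam (F a) hh) using 1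
    ext ε; simp
  | zero =>
    convert Submodule.zero_mem (polyFam U) using 1
    ext ε; simp
  | add f f' _ _ h h' =>
    convert Submodule.add_mem _ h h' using 1
    ext ε; simp
  | smul c' f _ h =>
    convert Submodule.smul_mem _ c' h using 1
    ext ε; simp

theorem sum_mem_polyFam {V κ : Type*} [AddCommGroup V] [Module ℝ V] {s : Finset κ}
    {f : κ → ℝ → V} (h : ∀ k ∈ s, f k ∈ polyFam V) : (fun ε => ∑ k ∈ s, f k ε) ∈ polyFam V := by
  convert Submodule.sum_mem _ h using 1
  ext ε; simp

theorem sum_mem_sqFam {V κ : Type*} [AddCommGroup V] [Module ℝ V] {s : Finset κ}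
    {f : κ → ℝ → V} (h : ∀ k ∈ s, f k ∈ sqFam V) : (fun ε => ∑ k ∈ s, f k ε) ∈ sqFam V := by
  convert Submodule.sum_mem _ h using 1
  ext ε; simp

theorem add_smul_mem_polyFam {V : Type*} [AddCommGroup V] [Module ℝ V] (a b : V) :
    (fun ε : ℝ => a + ε • b) ∈ polyFam V :=
  Submodule.add_mem _ (const_mem_polyFam a) (smul_mem_polyFam id_mem_polyFam (const_mem_polyFam b))

namespace SFun

open PowerSeries

variable {τ : Type*} {odd : τ → Bool}

/-! ### The one-loop coefficient of a perturbed Gaussian -/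

/-- The value at the origin of a superfunction. -/
def evalZero (odd : τ → Bool) : SFun τ odd →ₐ[ℝ] ℝ :=
  (Algebra.TensorProduct.lid ℝ ℝ).toAlgHom.comp
    (Algebra.TensorProduct.map ExteriorAlgebra.algebraMapInv (MvPolynomial.aeval fun _ => (0 : ℝ)))

theorem evalZero_coord (x : τ) : evalZero odd (coord odd x) = 0 := by
  rcases h : odd x
  · rw [coord_of_even h]
    simp [evalZero]
  · rw [coord_of_odd h]
    simp [evalZero, ExteriorAlgebra.algebraMapInv]

variable [Fintype τ] [DecidableEq τ] {N P : Matrix τ τ ℝ} {E : SFun τ odd →ₐ[ℝ] ℝ}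

theorem quad_mem_monoSpan (N : Matrix τ τ ℝ) : quad odd N ∈ monoSpan odd {s | s.card = 2} := by
  rw [quad]
  refine Submodule.smul_mem _ _ (Submodule.sum_mem _ fun x _ => Submodule.sum_mem _ fun y _ =>
    Submodule.smul_mem _ _ ?_)
  have := prod_mem_monoSpan (odd := odd) (S := {s | s.card = 2}) (l := [x, y]) rfl
  simpa using this

theorem laplace_pow_mem_monoSpan_card {k : ℕ} {f : SFun τ odd}
    (hf : f ∈ monoSpan odd {s | k ≤ s.card}) (e : ℕ) :
    (laplace odd P ^ e) f ∈ monoSpan odd {s | k ≤ s.card + 2 * e} := by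
  refine laplace_pow_mem_monoSpan (S := fun e => {s | k ≤ s.card + 2 * e}) ?_ (by simpa using hf) e
  intro e z w s _ h
  simp only [Set.mem_ofPred_eq, Multiset.card_cons] at h ⊢
  omega

theorem eval_laplace_pow_eq_zero (hE : ∀ x, E (coord odd x) = 0) {k e : ℕ} (h : 2 * e < k)
    {f : SFun τ odd} (hf : f ∈ monoSpan odd {s | k ≤ s.card}) : E ((laplace odd P ^ e) f) = 0 := by
  refine eval_eq_zero_of_mem_monoSpan hE ?_ (laplace_pow_mem_monoSpan_card hf e)
  simp only [Set.mem_ofPred_eq, Multiset.card_zero]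
  omega

theorem quad_add_pow_mem {V : SFun τ odd} (hV : V ∈ monoSpan odd {s | s.card = 3}) (n : ℕ) :
    (quad odd N + V) ^ n ∈ monoSpan odd {s | 2 * n ≤ s.card} := by
  refine pow_mem_monoSpan (S := fun n => {s | 2 * n ≤ s.card}) (by simp) ?_ ?_ n
  · intro n s hs t ht
    simp only [Set.mem_ofPred_eq, Multiset.card_add] at hs ht ⊢
    omega
  · refine Submodule.add_mem _ (monoSpan_mono ?_ (quad_mem_monoSpan N)) (monoSpan_mono ?_ hV)
    all_goals
      intro s hs
      simp only [Set.mem_ofPred_eq] at hs ⊢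
      omega

theorem quad_add_pow_sub_mem {V : SFun τ odd} (hV : V ∈ monoSpan odd {s | s.card = 3}) (n : ℕ) :
    (quad odd N + V) ^ n - quad odd N ^ n ∈ monoSpan odd {s | 2 * n + 1 ≤ s.card} := by
  induction n with
  | zero => simp
  | succ n ih =>
    have e1 : (quad odd N + V) ^ (n + 1) - quad odd N ^ (n + 1) =
        (quad odd N + V) ^ 1 * ((quad odd N + V) ^ n - quad odd N ^ n) + V * quad odd N ^ n := by
      rw [pow_succ', pow_succ', pow_one, mul_sub, add_mul _ _ (quad odd N ^ n)]; abel
    rw [e1]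
    have h0 : quad odd N ^ n ∈ monoSpan odd {s | 2 * n ≤ s.card} := by
      simpa using quad_add_pow_mem (N := N) (V := (0 : SFun τ odd)) (Submodule.zero_mem _) n
    refine Submodule.add_mem _ (mul_mem_monoSpan ?_ (quad_add_pow_mem hV 1) ih)
      (mul_mem_monoSpan ?_ hV h0)
    all_goals
      intro s hs t ht
      simp only [Set.mem_ofPred_eq, Multiset.card_add] at hs ht ⊢
      omega

/-- The functionals `f ↦ (Δ^e f)(0)`. -/
def contraction (E : SFun τ odd →ₐ[ℝ] ℝ) (P : Matrix τ τ ℝ) (e : ℕ) : SFun τ odd →ₗ[ℝ] ℝ :=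
  E.toLinearMap ∘ₗ (laplace odd P ^ e)

theorem contraction_apply (e : ℕ) (f : SFun τ odd) :
    contraction E P e f = E ((laplace odd P ^ e) f) := rfl

theorem constantCoeff_expSeries_contraction (V : SFun τ odd) :
    constantCoeff (expSeries (contraction E P) V) = 1 := by
  rw [← coeff_zero_eq_constantCoeff_apply]
  ext e
  rw [coeff_expSeries, contraction_apply, pow_zero, coeff_one]
  rcases Nat.eq_zero_or_pos e with rfl | he
  · simp
  · rw [if_neg he.ne']
    obtain ⟨k, rfl⟩ := Nat.exists_eq_succ_of_ne_zero he.ne'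
    have h1 : laplace odd P (1 : SFun τ odd) = 0 := by simp [laplace_apply, pd_one]
    rw [pow_succ, Module.End.mul_apply, h1, map_zero, map_zero, smul_zero]

/-- At one loop (as many propagators as vertices) only bivalent vertices contribute, and the logarithm
is the sum over wheels. -/
theorem coeff_formalLog_expSeries (hN : IsEven odd N) (hP : IsEven odd P) (hNs : IsSuperSymm odd N)
    (hPs : IsSuperSymm odd P) (hE : ∀ x, E (coord odd x) = 0) (c : ℝ) {V : SFun τ odd}
    (hV : V ∈ monoSpan odd {s | s.card = 3}) (n : ℕ) :
    coeff n (coeff n (formalLog (expSeries (contraction E P) (c • 1 + (quad odd N + V))))) =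
      wheelValue odd N P n / n := by
  have h1 := expSeries_add (Φ := contraction E P) (V₀ := c • 1) (V := quad odd N + V) (s := c)
    (Commute.smul_left (Commute.one_left _) c) (fun e k f => by
      rw [smul_pow, one_pow, smul_mul_assoc, one_mul, map_smul, smul_eq_mul])
  have h2 : constantCoeff (PowerSeries.mk fun k => (k ! : ℝ)⁻¹ • (C c : PowerSeries ℝ) ^ k) = 1 := by
    rw [← coeff_zero_eq_constantCoeff_apply, coeff_mk]
    simp
  rw [h1, formalLog_mul h2 (constantCoeff_expSeries_contraction _), formalLog_exp]
  have h3 : ∀ v e, e < v → coeff e (coeff v (expSeries (contraction E P) (quad odd N + V))) = 0 := by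
    intro v e h
    rw [coeff_expSeries, contraction_apply,
      eval_laplace_pow_eq_zero hE (by omega) (quad_add_pow_mem hV v), smul_zero]
  have h4 : diagPart (expSeries (contraction E P) (quad odd N + V)) =
      PowerSeries.mk (moment E N P) := by
    ext m
    rw [diagPart, coeff_mk, coeff_mk, coeff_expSeries, moment, contraction_apply, smul_eq_mul]
    congr 1
    have := eval_laplace_pow_eq_zero (P := P) (e := m) hE (by omega) (quad_add_pow_sub_mem (N := N) hV m)
    rw [map_sub, map_sub, sub_eq_zero] at this
    exact this
  have h5 : coeff n (coeff n (formalLog (expSeries (contraction E P) (quad odd N + V)))) =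
      wheelValue odd N P n / n := by
    have h6 := diagPart_formalLog h3
    rw [h4, formalLog_of_recursion (c := wheelValue odd N P)] at h6
    · have := congrArg (coeff n) h6
      rwa [diagPart, coeff_mk, coeff_mk] at this
    · rw [← coeff_zero_eq_constantCoeff_apply, coeff_mk]
      simp [moment]
    · intro m
      simp only [coeff_mk]
      exact moment_succ hN hP hNs hPs E hE m
  rw [map_add, map_add, h5]
  convert zero_add _ using 2
  rcases n with _ | n
  · simp
  · rw [coeff_succ_X_mul, coeff_C]
    split_ifs with h
    · rw [coeff_C, if_neg (by omega)]
    · simp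

/-! ### Perturbation of the linear term -/

/-- A linear form in the coordinates. -/
def linForm (odd : τ → Bool) (b : τ → ℝ) : SFun τ odd := ∑ z, b z • coord odd z

theorem linForm_comm {b : τ → ℝ} (hb : ∀ z, b z ≠ 0 → odd z = false) (f : SFun τ odd) :
    f * linForm odd b = linForm odd b * f := by
  have h : linForm odd b ∈ Subalgebra.center ℝ (SFun τ odd) := by
    refine mem_center_of_coord fun x => ?_
    rw [linForm, Finset.mul_sum, Finset.sum_mul]
    refine Finset.sum_congr rfl fun z _ => ?_
    by_cases hz : b z = 0
    · simp [hz]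
    · rw [mul_smul_comm, smul_mul_assoc, coord_mul_coord, sgn, hb z hz]
      simp
  exact (Subalgebra.mem_center_iff.1 h f)

theorem pd_linForm_mul {b : τ → ℝ} (hb : ∀ z, b z ≠ 0 → odd z = false) (w : τ) (f : SFun τ odd) :
    pd odd w (linForm odd b * f) = b w • f + linForm odd b * pd odd w f := by
  have h : ∀ z, pd odd w (b z • coord odd z * f) =
      (if w = z then b z • f else 0) + b z • coord odd z * pd odd w f := by
    intro z
    by_cases hz : b z = 0
    · simp [hz]
    · rw [smul_mul_assoc, map_smul, pd_coord_mul, sgn, hb z hz]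
      rw [if_neg (by simp : ¬(odd w = true ∧ false = true)), one_smul, smul_add, smul_mul_assoc]
      split_ifs <;> simp
  simp only [linForm, Finset.sum_mul, map_sum, h, Finset.sum_add_distrib, Finset.sum_ite_eq,
    Finset.mem_univ, if_true]

/-- The commutator of the Laplacian with an even linear form is the derivative along the vector
obtained by contracting the form with the bivector. -/
theorem laplace_linForm_mul {b : τ → ℝ} (hb : ∀ z, b z ≠ 0 → odd z = false)
    (hPs : IsSuperSymm odd P) (f : SFun τ odd) :
    laplace odd P (linForm odd b * f) = linForm odd b * laplace odd P f +
      ∑ w, (∑ z, P z w * b z) • pd odd w f := by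
  have h1 : ∀ z w, P z w • pd odd z (pd odd w (linForm odd b * f)) =
      P z w • (linForm odd b * pd odd z (pd odd w f)) + (P w z * b w) • pd odd z f +
        (P z w * b z) • pd odd w f := by
    intro z w
    have h2 : P z w * b w = P w z * b w := by
      by_cases hw : b w = 0
      · simp [hw]
      · rw [hPs z w, sgn, hb w hw]; simp
    rw [pd_linForm_mul hb, map_add, map_smul, pd_linForm_mul hb, ← h2]
    simp only [smul_add, smul_smul]
    abel
  have h3 : ∑ z, ∑ w, (P w z * b w) • pd odd z f = ∑ w, (∑ z, P z w * b z) • pd odd w f := by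
    simp only [Finset.sum_smul]
  have h4 : ∑ z, ∑ w, (P z w * b z) • pd odd w f = ∑ w, (∑ z, P z w * b z) • pd odd w f := by
    rw [Finset.sum_comm]
    simp only [Finset.sum_smul]
  simp only [laplace_apply, h1, Finset.sum_add_distrib, h3, h4]
  simp only [mul_smul_comm, Finset.mul_sum]
  module

section Family

variable {p : ℝ → Matrix τ τ ℝ} (hp : ∀ z w, (fun ε => p ε z w) ∈ polyFam ℝ)
include hp

theorem laplace_mem_polyFam {f : ℝ → SFun τ odd} (hf : f ∈ polyFam (SFun τ odd)) :
    (fun ε => laplace odd (p ε) (f ε)) ∈ polyFam (SFun τ odd) := by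
  simp only [laplace_apply]
  exact smul_mem_polyFam (const_mem_polyFam _) (sum_mem_polyFam fun z _ => sum_mem_polyFam fun w _ =>
    smul_mem_polyFam (hp z w) (map_mem_polyFam (pd odd z) (map_mem_polyFam (pd odd w) hf)))

theorem laplace_pow_mem_polyFam {f : ℝ → SFun τ odd} (hf : f ∈ polyFam (SFun τ odd)) (e : ℕ) :
    (fun ε => (laplace odd (p ε) ^ e) (f ε)) ∈ polyFam (SFun τ odd) := by
  induction e with
  | zero => exact hf
  | succ e ih =>
    simp only [pow_succ', Module.End.mul_apply]
    exact laplace_mem_polyFam hp ih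

theorem laplace_mem_sqFam {f : ℝ → SFun τ odd} (hf : f ∈ sqFam (SFun τ odd)) :
    (fun ε => laplace odd (p ε) (f ε)) ∈ sqFam (SFun τ odd) := by
  obtain ⟨h, hh, rfl⟩ := mem_sqFam.1 hf
  exact mem_sqFam.2 ⟨_, laplace_mem_polyFam hp hh, by ext1 ε; exact map_smul _ _ _⟩

variable {b : ℝ → τ → ℝ} (hb : ∀ z, (fun ε => b ε z) ∈ polyFam ℝ)
  (hb0 : ∀ ε z, b ε z ≠ 0 → odd z = false) (hps : ∀ ε, IsSuperSymm odd (p ε))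
  (hpb : ∀ w, (fun ε => ∑ z, p ε z w * b ε z) ∈ sqFam ℝ)
include hb hb0 hps hpb

/-- A linear form killed to first order by the propagator passes to first order through powers of the
Laplacian. -/
theorem laplace_pow_linForm_mul (e : ℕ) {f : ℝ → SFun τ odd} (hf : f ∈ polyFam (SFun τ odd)) :
    (fun ε => (laplace odd (p ε) ^ e) (linForm odd (b ε) * f ε) -
      linForm odd (b ε) * (laplace odd (p ε) ^ e) (f ε)) ∈ sqFam (SFun τ odd) := by
  induction e with
  | zero =>
    convert Submodule.zero_mem (sqFam (SFun τ odd)) using 1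
    ext1 ε; simp
  | succ e ih =>
    have h1 := laplace_mem_sqFam hp ih
    have h2 : (fun ε => ∑ w, (∑ z, p ε z w * b ε z) •
        pd odd w ((laplace odd (p ε) ^ e) (f ε))) ∈ sqFam (SFun τ odd) :=
      sum_mem_sqFam fun w _ => smul_mem_sqFam' (hpb w)
        (map_mem_polyFam (pd odd w) (laplace_pow_mem_polyFam hp hf e))
    convert Submodule.add_mem _ h1 h2 using 1
    ext1 ε
    simp only [pow_succ', Module.End.mul_apply, Pi.add_apply, map_sub,
      laplace_linForm_mul (hb0 ε) (hps ε)]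
    abel

/-- To first order, a linear term killed by the propagator does not change the contractions. -/
theorem contraction_add_linForm (hE : ∀ x, E (coord odd x) = 0) {U : ℝ → SFun τ odd}
    (hU : U ∈ polyFam (SFun τ odd)) (v e : ℕ) :
    (fun ε => contraction E (p ε) e ((U ε + linForm odd (b ε)) ^ v) -
      contraction E (p ε) e (U ε ^ v)) ∈ sqFam ℝ := by
  have hL : (fun ε => linForm odd (b ε)) ∈ polyFam (SFun τ odd) :=
    sum_mem_polyFam fun z _ => smul_mem_polyFam (hb z) (const_mem_polyFam _)
  have h1 : ∀ v, ∃ h ∈ polyFam (SFun τ odd), ∀ ε,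
      (U ε + linForm odd (b ε)) ^ v = U ε ^ v + linForm odd (b ε) * h ε := by
    intro v
    induction v with
    | zero => exact ⟨0, Submodule.zero_mem _, fun ε => by simp⟩
    | succ v ih =>
      obtain ⟨h, hh, h1⟩ := ih
      refine ⟨U ^ v + h * (U + fun ε => linForm odd (b ε)), Submodule.add_mem _
        (pow_mem_polyFam hU v) (mul_mem_polyFam hh (Submodule.add_mem _ hU hL)), fun ε => ?_⟩
      simp only [pow_succ, h1, Pi.add_apply, Pi.mul_apply, Pi.pow_apply, add_mul, mul_add,
        linForm_comm (hb0 ε) (U ε ^ v), mul_assoc]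
      abel
  obtain ⟨h, hh, h2⟩ := h1 v
  have h3 := map_mem_sqFam E.toLinearMap (laplace_pow_linForm_mul hp hb hb0 hps hpb e hh)
  convert h3 using 1
  ext ε
  have h4 : E (linForm odd (b ε)) = 0 := by simp [linForm, hE]
  simp only [contraction_apply, h2, map_add, add_sub_cancel_left, AlgHom.toLinearMap_apply, map_sub,
    map_mul, h4, zero_mul, sub_zero]

/-- To first order, a linear term killed by the propagator does not change the one-loop part. -/
theorem coeff_formalLog_family (hE : ∀ x, E (coord odd x) = 0) {N : ℝ → Matrix τ τ ℝ}
    (hN : ∀ z w, (fun ε => N ε z w) ∈ polyFam ℝ) {c : ℝ → ℝ} (hc : c ∈ polyFam ℝ)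
    (hNe : ∀ ε, IsEven odd (N ε)) (hpe : ∀ ε, IsEven odd (p ε)) (hNs : ∀ ε, IsSuperSymm odd (N ε))
    {V : SFun τ odd} (hV : V ∈ monoSpan odd {s | s.card = 3}) (n : ℕ) :
    ((fun ε => coeff n (coeff n (formalLog (expSeries (contraction E (p ε))
        (c ε • 1 + (quad odd (N ε) + V) + linForm odd (b ε))))),
      fun ε => wheelValue odd (N ε) (p ε) n / n) : (ℝ → ℝ) × (ℝ → ℝ)) ∈ sameJet := by
  have hU : (fun ε => c ε • (1 : SFun τ odd) + (quad odd (N ε) + V)) ∈ polyFam (SFun τ odd) := by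
    refine Submodule.add_mem _ (smul_mem_polyFam hc (const_mem_polyFam _))
      (Submodule.add_mem _ ?_ (const_mem_polyFam V))
    simp only [quad]
    exact smul_mem_polyFam (const_mem_polyFam _) (sum_mem_polyFam fun z _ =>
      sum_mem_polyFam fun w _ => smul_mem_polyFam (hN z w) (const_mem_polyFam _))
  have hL : (fun ε => linForm odd (b ε)) ∈ polyFam (SFun τ odd) :=
    sum_mem_polyFam fun z _ => smul_mem_polyFam (hb z) (const_mem_polyFam _)
  simp only [← fun ε => coeff_formalLog_expSeries (hNe ε) (hpe ε) (hNs ε) (hps ε) hE (c ε) hV n]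
  refine coeff_formalLog_mem_sameJet (fun v e => ?_) n n
  simp only [coeff_expSeries]
  refine mem_sameJet_of_sub_mem_sqFam ?_ ?_
  · exact smul_mem_polyFam (const_mem_polyFam _) (map_mem_polyFam E.toLinearMap
      (laplace_pow_mem_polyFam hp (pow_mem_polyFam (Submodule.add_mem _ hU hL) v) e))
  · convert smul_mem_sqFam (const_mem_polyFam ((v ! : ℝ)⁻¹ * (e ! : ℝ)⁻¹))
      (contraction_add_linForm hp hb hb0 hps hpb hE hU v e) using 1
    ext ε
    simp only [Pi.sub_apply, smul_sub]

end Family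

end SFun

section ChernSimons

variable {C : Type*} [Ring C] [Algebra ℝ C] {𝒞 : ℕ → Submodule ℝ C} [GradedAlgebra 𝒞]
variable {g : Type*} [LieRing g] [LieAlgebra ℝ g]

namespace FieldCoords

variable {D : DGFrobenius 𝒞} {I P A : Type*} (X : FieldCoords D g I P A)
variable (B : LinearMap.BilinForm ℝ g)
variable [Fintype I] [Fintype P] [Fintype A] [DecidableEq I] [DecidableEq A]

/-! ### Evaluation of the zero modes -/

/-- The coordinates of a real point of `g ⊗ H^1(C)`, extended by zero. -/
def extendPoint (α : X.P1 × A → ℝ) (x : P × A) : ℝ :=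
  if h : X.degH x.1 = 1 then α (⟨x.1, h⟩, x.2) else 0

/-- Evaluation of the zero modes at a real point, keeping the fluctuations. -/
def evalModes (α : X.P1 × A → ℝ) : X.FunTot →ₐ[ℝ] SFun (I × A) X.oddC :=
  SFun.affineHom _ _ (Sum.elim (X.extendPoint α) 0) (Matrix.fromCols 0 1)

theorem extendPoint_of_odd (α : X.P1 × A → ℝ) {x : P × A} (h : X.oddH x = true) :
    X.extendPoint α x = 0 := by
  rw [extendPoint, dif_neg]
  intro h1
  simp [oddH, h1] at h

theorem evalModes_shift (α : X.P1 × A → ℝ) (x : (P × A) ⊕ (I × A))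
    (h : Sum.elim X.oddH X.oddC x = true) : Sum.elim (X.extendPoint α) (0 : I × A → ℝ) x = 0 := by
  rcases x with x | x
  · exact X.extendPoint_of_odd α h
  · rfl

theorem fromCols_parity (y : I × A) (x : (P × A) ⊕ (I × A))
    (h : (Matrix.fromCols 0 1 : Matrix (I × A) ((P × A) ⊕ (I × A)) ℝ) y x ≠ 0) :
    X.oddC y = Sum.elim X.oddH X.oddC x := by
  rcases x with x | x
  · simp at h
  · rw [Matrix.fromCols_apply_inr, Matrix.one_apply] at h
    split_ifs at h with h1
    · rw [h1]; rfl
    · exact absurd rfl h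

theorem evalModes_coord (α : X.P1 × A → ℝ) (x : (P × A) ⊕ (I × A)) :
    X.evalModes α (SFun.coord _ x) = Sum.elim (X.extendPoint α) (0 : I × A → ℝ) x • 1 +
      ∑ y, (Matrix.fromCols 0 1 : Matrix (I × A) ((P × A) ⊕ (I × A)) ℝ) y x •
        SFun.coord X.oddC y :=
  SFun.affineHom_coord (X.evalModes_shift α) X.fromCols_parity x

theorem evalModes_inl (α : X.P1 × A → ℝ) (x : P × A) :
    X.evalModes α (SFun.coord _ (Sum.inl x)) = X.extendPoint α x • 1 := by
  rw [evalModes_coord]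
  simp

theorem evalModes_inr (α : X.P1 × A → ℝ) (x : I × A) :
    X.evalModes α (SFun.coord _ (Sum.inr x)) = SFun.coord X.oddC x := by
  rw [evalModes_coord]
  simp [Matrix.one_apply]

theorem restrictH1_coord (x : P × A) :
    X.restrictH1 (SFun.coord X.oddH x) =
      if h : X.degH x.1 = 1 then MvPolynomial.X (⟨x.1, h⟩, x.2) else 0 := by
  rcases h : X.oddH x
  · rw [SFun.coord_of_even h]
    simp [restrictH1]
  · rw [SFun.coord_of_odd h, dif_neg]
    · simp [restrictH1, ExteriorAlgebra.algebraMapInv]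
    · intro h1
      simp [oddH, h1] at h

/-- Evaluation at a real point of functions of the zero modes. -/
def evalAt (α : X.P1 × A → ℝ) : X.Fun' →ₐ[ℝ] ℝ := (MvPolynomial.aeval α).comp X.restrictH1

theorem evalZero_comp_evalModes (α : X.P1 × A → ℝ) :
    (SFun.evalZero X.oddC).comp (X.evalModes α) =
      (X.evalAt α).comp (SFun.setZero X.oddH X.oddC) := by
  refine SFun.algHom_ext fun x => ?_
  rcases x with x | x
  · simp only [AlgHom.comp_apply, evalModes_inl, SFun.setZero_coord_inl, evalAt, restrictH1_coord,
      extendPoint, map_smul, map_one]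
    split_ifs <;> simp
  · simp only [AlgHom.comp_apply, evalModes_inr, SFun.setZero_coord_inr, SFun.evalZero_coord,
      map_zero]

theorem wick_eq_laplace (K : C →ₗ[ℝ] C) : X.wick B K =
    SFun.laplace _ (Matrix.fromBlocks 0 0 0 (X.bivector B K)) := by
  refine LinearMap.ext fun f => ?_
  rw [SFun.laplace_apply, wick]
  simp only [Fintype.sum_sum_type, Matrix.fromBlocks_apply₁₁, Matrix.fromBlocks_apply₁₂,
    Matrix.fromBlocks_apply₂₁, Matrix.fromBlocks_apply₂₂, Matrix.zero_apply, zero_smul,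
    Finset.sum_const_zero, zero_add, Fintype.sum_prod_type, bivector, Matrix.of_apply]
  simp only [LinearMap.smul_apply, LinearMap.sum_apply, Module.End.mul_apply]
  rw [show (-1 / 2 : ℝ) = 1 / 2 * (-1) by norm_num, mul_smul]
  simp only [Finset.smul_sum]
  refine Finset.sum_congr rfl fun i _ => ?_
  rw [Finset.sum_comm]
  refine Finset.sum_congr rfl fun a _ => Finset.sum_congr rfl fun j _ =>
    Finset.sum_congr rfl fun b _ => ?_
  rw [smul_smul (-1 : ℝ)]
  congr 2
  exact neg_one_mul _

theorem evalModes_wick_pow (α : X.P1 × A → ℝ) (K : C →ₗ[ℝ] C) (e : ℕ) (f : X.FunTot) :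
    X.evalModes α ((X.wick B K ^ e) f) =
      (SFun.laplace X.oddC (X.bivector B K) ^ e) (X.evalModes α f) := by
  induction e with
  | zero => rfl
  | succ e ih =>
    rw [pow_succ', pow_succ', Module.End.mul_apply, Module.End.mul_apply, ← ih,
      SFun.laplace_affine (X.evalModes_shift α) X.fromCols_parity (X.evalModes_coord α),
      wick_eq_laplace]
    congr 3
    rw [Matrix.transpose_fromCols, Matrix.fromRows_mul, Matrix.fromRows_mul_fromCols]
    simp

/-! ### The interaction at a real point -/

theorem interaction_eq {ι : D.Cohomology →ₗ[ℝ] C} (hι : ∀ x, D.d (ι x) = 0) :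
    X.interaction B ι = (1 / 6 : ℝ) • X.cubicForm B
      (Function.uncurry (X.embedField ι fun p a => SFun.coord _ (Sum.inl (p, a))) +
        fun x => SFun.coord _ (Sum.inr x))
      (Function.uncurry (X.embedField ι fun p a => SFun.coord _ (Sum.inl (p, a))) +
        fun x => SFun.coord _ (Sum.inr x))
      (Function.uncurry (X.embedField ι fun p a => SFun.coord _ (Sum.inl (p, a))) +
        fun x => SFun.coord _ (Sum.inr x)) := by
  have h : X.interaction B ι = X.csAction B (X.embedField ι (fun p a => SFun.coord _ (Sum.inl (p, a)))
      + fun i a => SFun.coord _ (Sum.inr (i, a))) -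
      X.quadTerm B fun i a => SFun.coord _ (Sum.inr (i, a)) := rfl
  rw [h, csAction, X.quadTerm_embedField_add B hι, add_sub_cancel_left, cubicTerm_eq]
  rfl

theorem repr_lTensor_point (ι : D.Cohomology →ₗ[ℝ] C) (α : X.P1 × A → ℝ) (x : I × A) :
    X.tensorBasis.repr (LinearMap.lTensor g ι (X.point α)) x =
      ∑ p, X.bC.repr (ι (X.bH p)) x.1 * X.extendPoint α (p, x.2) := by
  have h1 : ∀ p : X.P1, X.bg.repr (X.gCoord α p) x.2 = α (p, x.2) := by
    intro p
    simp [gCoord, Finsupp.single_apply]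
  rw [point, map_sum, map_sum, Finsupp.finsetSum_apply]
  simp only [LinearMap.lTensor_tmul, tensorBasis_repr_tmul, h1]
  refine Fintype.sum_of_injective Subtype.val Subtype.val_injective _ _ ?_ ?_
  · intro p hp
    rw [extendPoint, dif_neg, mul_zero]
    intro h
    exact hp ⟨⟨p, h⟩, rfl⟩
  · intro p
    rw [extendPoint, dif_pos p.2, mul_comm]

theorem lTensor_point_mem {ι : D.Cohomology →ₗ[ℝ] C}
    (hι : ∀ i x, x ∈ D.cohomologyDeg i → ι x ∈ 𝒞 i) (α : X.P1 × A → ℝ) :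
    LinearMap.lTensor g ι (X.point α) ∈ tensorDeg g 𝒞 1 := by
  rw [point, map_sum]
  refine Submodule.sum_mem _ fun p _ => ?_
  rw [LinearMap.lTensor_tmul]
  refine tmul_mem_tensorDeg _ (hι 1 _ ?_)
  have := X.bH_mem p
  rwa [p.2] at this

theorem evalModes_embedField (ι : D.Cohomology →ₗ[ℝ] C) (α : X.P1 × A → ℝ) :
    (X.evalModes α) ∘ (Function.uncurry (X.embedField ι fun p a => SFun.coord _ (Sum.inl (p, a))) +
      fun x => SFun.coord _ (Sum.inr x)) =
      X.constField _ (LinearMap.lTensor g ι (X.point α)) + SFun.coord X.oddC := by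
  ext1 x
  simp only [Function.comp_apply, Pi.add_apply, map_add, evalModes_inr, Function.uncurry_def,
    embedField, map_sum, map_smul, evalModes_inl, constField, repr_lTensor_point, smul_smul,
    Finset.sum_smul]

variable {B}

theorem cubicForm_coord_mem : X.cubicForm B (SFun.coord X.oddC) (SFun.coord X.oddC)
    (SFun.coord X.oddC) ∈ SFun.monoSpan X.oddC {s | s.card = 3} := by
  rw [cubicForm]
  refine Submodule.sum_mem _ fun x _ => Submodule.sum_mem _ fun y _ => Submodule.sum_mem _ fun z _ =>
    Submodule.smul_mem _ _ ?_
  have := SFun.prod_mem_monoSpan (odd := X.oddC) (S := {s | s.card = 3}) (l := [x, y, z]) rfl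
  simpa [mul_assoc] using this

/-- Expansion of the interaction around a real point `α`, in powers of the fluctuation. -/
theorem evalModes_interaction (hB : IsQuadratic B) {ι : D.Cohomology →ₗ[ℝ] C}
    (hι : ∀ x, D.d (ι x) = 0) (hι' : ∀ i x, x ∈ D.cohomologyDeg i → ι x ∈ 𝒞 i)
    (α : X.P1 × A → ℝ) {v : g ⊗[ℝ] C} (hv : v = LinearMap.lTensor g ι (X.point α)) :
    X.evalModes α (X.interaction B ι) =
      (1 / 6 * tensorPair D B v (tensorBracket g C v v)) • 1 +
        (SFun.quad X.oddC (X.hessian B v) + (1 / 6 : ℝ) • X.cubicForm B (SFun.coord X.oddC)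
          (SFun.coord X.oddC) (SFun.coord X.oddC)) +
        SFun.linForm X.oddC fun z => 1 / 2 * tensorPair D B (X.tensorBasis z)
          (tensorBracket g C v v) := by
  rw [X.interaction_eq B hι, map_smul, map_cubicForm, evalModes_embedField, ← hv,
    X.cubicForm_const_add hB (hv ▸ X.lTensor_point_mem hι' α)]
  have h1 : SFun.linForm X.oddC (fun z => 1 / 2 * tensorPair D B (X.tensorBasis z)
      (tensorBracket g C v v)) = (1 / 2 : ℝ) • ∑ z, tensorPair D B (X.tensorBasis z)
      (tensorBracket g C v v) • SFun.coord X.oddC z := by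
    simp only [SFun.linForm, Finset.smul_sum, smul_smul]
  rw [h1, SFun.quad]
  module

open PowerSeries in
/-- Setting the fluctuations to zero and evaluating at a real point commute, so the one-loop part is
a coefficient of the logarithm of a partition function without zero modes. -/
theorem eval_loopPart_one {ι : D.Cohomology →ₗ[ℝ] C} (K : C →ₗ[ℝ] C) (α : X.P1 × A → ℝ) (n : ℕ) :
    MvPolynomial.eval α (X.loopPart B ι K 1 n) = coeff n (coeff n (formalLog
      (expSeries (SFun.contraction (SFun.evalZero X.oddC) (X.bivector B K))
        (X.evalModes α (X.interaction B ι))))) := by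
  have h0 : X.effAction B ι K 1 n = coeff n (coeff n (formalLog (X.partition B ι K))) := by
    rw [effAction, if_pos ⟨by omega, by omega⟩]
    rfl
  have h1 : MvPolynomial.eval α (X.loopPart B ι K 1 n) = X.evalAt α (X.effAction B ι K 1 n) := by
    rw [loopPart, evalAt, AlgHom.comp_apply, MvPolynomial.aeval_eq_eval]
  rw [h1, h0]
  have h2 : PowerSeries.map (PowerSeries.map (X.evalAt α : X.Fun' →+* ℝ)) (X.partition B ι K) =
      expSeries (SFun.contraction (SFun.evalZero X.oddC) (X.bivector B K))
        (X.evalModes α (X.interaction B ι)) := by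
    ext v e
    rw [coeff_map, coeff_map, coeff_expSeries, partition, coeff_mk, coeff_mk, SFun.contraction_apply,
      ← map_pow, ← evalModes_wick_pow, ← AlgHom.comp_apply, evalZero_comp_evalModes]
    exact map_smul (X.evalAt α) _ _
  rw [← h2, ← map_formalLog, coeff_map, coeff_map]
  · rfl
  · intro r x
    ext n
    exact map_smul (X.evalAt α) r (coeff n x)

end FieldCoords

end ChernSimons

section ChernSimons

variable {C : Type*} [Ring C] [Algebra ℝ C] {𝒞 : ℕ → Submodule ℝ C} [GradedAlgebra 𝒞]
variable {g : Type*} [LieRing g] [LieAlgebra ℝ g]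
variable {D : DGFrobenius 𝒞}

namespace DGFrobenius

theorem IsInductionData.d_ι {ι : D.Cohomology →ₗ[ℝ] C} {K : C →ₗ[ℝ] C}
    (h : D.IsInductionData ι K) (x : D.Cohomology) : D.d (ι x) = 0 := by
  obtain ⟨z, rfl⟩ := Submodule.mkQ_surjective _ x
  obtain ⟨y, hy⟩ := h.ι_rep z
  have hz : D.d (z : C) = 0 := z.2
  rw [cls] at hy
  rw [hy, map_add, hz, D.d_d, add_zero]

theorem IsInfinitesimalDeformation.d_δι {ι δι : D.Cohomology →ₗ[ℝ] C} {K δK : C →ₗ[ℝ] C}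
    (h : D.IsInfinitesimalDeformation ι K δι δK) (x : D.Cohomology) : D.d (δι x) = 0 := by
  obtain ⟨y, hy⟩ := h.ι_rep x
  rw [hy, D.d_d]

/-- The constant deformation. -/
theorem IsInductionData.constant {ι : D.Cohomology →ₗ[ℝ] C} {K : C →ₗ[ℝ] C} :
    D.IsInfinitesimalDeformation ι K 0 0 where
  ι_mem := by simp
  ι_rep x := ⟨0, by simp⟩
  K_mem := by simp
  K_zero := by simp
  homotopy_mem a x _ := ⟨0, by simp⟩
  homotopy_orth := by simp
  K_symm := by simp
  K_ι := by simp
  K_K := by simp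
  map_one := by simp
  map_mul := by simp

/-- Products of representatives are annihilated by the homotopy, to first order. -/
theorem IsInfinitesimalDeformation.mul_mem_sqFam {ι δι : D.Cohomology →ₗ[ℝ] C} {K δK : C →ₗ[ℝ] C}
    (h0 : D.IsInductionData ι K) (h1 : D.IsAlgHom ι) (h : D.IsInfinitesimalDeformation ι K δι δK)
    (x y : D.Cohomology) :
    (fun ε : ℝ => (K + ε • δK) ((ι + ε • δι) x * (ι + ε • δι) y)) ∈ sqFam C := by
  obtain ⟨a, rfl⟩ := Submodule.mkQ_surjective _ x
  obtain ⟨b, rfl⟩ := Submodule.mkQ_surjective _ y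
  have e1 := h1.map_mul a b
  have e2 := h.map_mul a b
  have e3 := h0.K_ι (D.cls ⟨a * b, D.mul_mem_cocycles a.2 b.2⟩)
  have e4 := h.K_ι (D.cls ⟨a * b, D.mul_mem_cocycles a.2 b.2⟩)
  rw [e1] at e3 e4
  rw [e2] at e4
  simp only [cls] at e3 e4
  refine mem_sqFam.2 ⟨_, add_smul_mem_polyFam (K (δι (D.coboundaries.mkQ a) *
    δι (D.coboundaries.mkQ b)) + δK (δι (D.coboundaries.mkQ a) * ι (D.coboundaries.mkQ b) +
    ι (D.coboundaries.mkQ a) * δι (D.coboundaries.mkQ b)))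
    (δK (δι (D.coboundaries.mkQ a) * δι (D.coboundaries.mkQ b))), ?_⟩
  ext1 ε
  simp only [LinearMap.add_apply, LinearMap.smul_apply, add_mul, mul_add, smul_mul_assoc,
    mul_smul_comm, map_add, map_smul, smul_add, smul_smul, e3] at e4 ⊢
  have e5 := congrArg (fun c => ε • c) e4
  simp only [smul_add, smul_zero] at e5
  rw [← sub_eq_zero]
  refine Eq.trans ?_ e5
  module

end DGFrobenius

/-- To first order in a deformation, the homotopy annihilates brackets of representatives. -/
theorem wheelOp_bracket_mem_sqFam {ι δι : D.Cohomology →ₗ[ℝ] C} {K δK : C →ₗ[ℝ] C}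
    (h0 : D.IsInductionData ι K) (h1 : D.IsAlgHom ι) (h : D.IsInfinitesimalDeformation ι K δι δK)
    (w w' : g ⊗[ℝ] D.Cohomology) :
    (fun ε : ℝ => LinearMap.lTensor g (K + ε • δK) (tensorBracket g C
      (LinearMap.lTensor g (ι + ε • δι) w) (LinearMap.lTensor g (ι + ε • δι) w'))) ∈
        sqFam (g ⊗[ℝ] C) := by
  induction w using TensorProduct.induction_on with
  | zero =>
    convert Submodule.zero_mem (sqFam (g ⊗[ℝ] C)) using 1
    ext1 ε; simp
  | add w₁ w₂ hw₁ hw₂ =>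
    convert Submodule.add_mem _ hw₁ hw₂ using 1
    ext1 ε; simp only [map_add, LinearMap.add_apply, Pi.add_apply]
  | tmul x a =>
    induction w' using TensorProduct.induction_on with
    | zero =>
      convert Submodule.zero_mem (sqFam (g ⊗[ℝ] C)) using 1
      ext1 ε; simp
    | add w₁ w₂ hw₁ hw₂ =>
      convert Submodule.add_mem _ hw₁ hw₂ using 1
      ext1 ε; simp only [map_add, Pi.add_apply]
    | tmul y b =>
      exact map_mem_sqFam (TensorProduct.mk ℝ g C ⁅x, y⁆) (h.mul_mem_sqFam h0 h1 a b)

namespace FieldCoords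

variable {I P A : Type*} (X : FieldCoords D g I P A)
variable {B : LinearMap.BilinForm ℝ g} (hB : IsQuadratic B)
variable [Fintype I] [Fintype P] [Fintype A] [DecidableEq I] [DecidableEq A]

/-! ### The one-loop part to first order in a deformation -/

include hB in
/-- Contracting the linear form `π(·, u)` with the propagator gives the coordinates of `K u`, up to
sign. -/
theorem sum_bivector_mul {K : C →ₗ[ℝ] C} (hK : D.IsSymmLowering K) (u : g ⊗[ℝ] C) (w : I × A) :
    ∑ z, X.bivector B K z w * tensorPair D B (X.tensorBasis z) u =
      (-1 : ℝ) ^ X.degC w.1 * X.tensorBasis.repr (LinearMap.lTensor g K u) w := by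
  have h1 : (X.bivector B K).transpose = SFun.parity X.oddC * X.bivector B K :=
    (SFun.isSuperSymm_iff (X.isEven_bivector hB hK)).1 (X.isSuperSymm_bivector hB hK)
  have h2 : ((X.bivector B K).transpose.mulVec ((X.gram B).mulVec (X.tensorBasis.repr u))) w =
      ∑ z, X.bivector B K z w * tensorPair D B (X.tensorBasis z) u := by
    simp only [Matrix.mulVec, dotProduct, Matrix.transpose_apply]
    refine Finset.sum_congr rfl fun z _ => ?_
    rw [← X.gram_mulVec_repr]
    rfl
  rw [← h2, h1, Matrix.mulVec_mulVec, Matrix.mul_assoc, X.bivector_eq hB, Matrix.neg_mul,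
    Matrix.mul_assoc, X.inv_mul_gram hB, Matrix.mul_one, mul_neg, Matrix.neg_mulVec,
    ← Matrix.mulVec_mulVec]
  have h3 : (X.opMatrix (LinearMap.lTensor g K)).mulVec (X.tensorBasis.repr u) =
      X.tensorBasis.repr (LinearMap.lTensor g K u) :=
    LinearMap.toMatrix_mulVec_repr X.tensorBasis X.tensorBasis (LinearMap.lTensor g K) u
  rw [h3, SFun.parity, Pi.neg_apply, Matrix.mulVec_diagonal]
  by_cases h : Even (X.degC w.1)
  · rw [h.neg_one_pow, if_pos (by simpa [oddC] using h)]; ring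
  · rw [(Nat.not_even_iff_odd.1 h).neg_one_pow, if_neg (by simpa [oddC] using h)]; ring

include hB in
/-- To first order in a deformation of the induction data through homomorphisms, the one-loop part is
one half of the supertrace of a logarithm. -/
theorem loopPart_one_mem_sameJet {ι δι : D.Cohomology →ₗ[ℝ] C} {K δK : C →ₗ[ℝ] C}
    (h0 : D.IsInductionData ι K) (h1 : D.IsAlgHom ι) (h : D.IsInfinitesimalDeformation ι K δι δK)
    (α : X.P1 × A → ℝ) (n : ℕ) :
    ((fun ε : ℝ => MvPolynomial.eval α (X.loopPart B (ι + ε • δι) (K + ε • δK) 1 n),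
      fun ε : ℝ => 1 / 2 * PowerSeries.coeff n
        (strLog 𝒞 (wheelOp (ι + ε • δι) (K + ε • δK) (X.point α)))) : (ℝ → ℝ) × (ℝ → ℝ)) ∈ sameJet := by
  set v : ℝ → g ⊗[ℝ] C := fun ε => LinearMap.lTensor g (ι + ε • δι) (X.point α) with hv
  have hι : ∀ ε : ℝ, ∀ x, D.d ((ι + ε • δι) x) = 0 := by
    intro ε x
    rw [LinearMap.add_apply, LinearMap.smul_apply, map_add, map_smul, h0.d_ι, h.d_δι, smul_zero,
      add_zero]
  have hι' : ∀ ε : ℝ, ∀ i x, x ∈ D.cohomologyDeg i → (ι + ε • δι) x ∈ 𝒞 i := fun ε i x hx =>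
    Submodule.add_mem _ (h0.ι_mem i x hx) (Submodule.smul_mem _ _ (h.ι_mem i x hx))
  have hK : ∀ ε : ℝ, D.IsSymmLowering (K + ε • δK) := fun ε =>
    h0.isSymmLowering.add_smul h.isSymmLowering ε
  have hv1 : ∀ ε, v ε ∈ tensorDeg g 𝒞 1 := fun ε => X.lTensor_point_mem (hι' ε) α
  have hvp : v ∈ polyFam (g ⊗[ℝ] C) := by
    convert add_smul_mem_polyFam (LinearMap.lTensor g ι (X.point α))
      (LinearMap.lTensor g δι (X.point α)) using 1
    ext1 ε
    rw [hv]
    simp only [LinearMap.lTensor_add, LinearMap.lTensor_smul, LinearMap.add_apply,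
      LinearMap.smul_apply]
  have hup : (fun ε => tensorBracket g C (v ε) (v ε)) ∈ polyFam (g ⊗[ℝ] C) :=
    bilin_mem_polyFam _ hvp hvp
  have hbiv : ∀ z w, (fun ε : ℝ => X.bivector B (K + ε • δK) z w) ∈ polyFam ℝ := by
    intro z w
    convert add_smul_mem_polyFam (X.bivector B K z w) (X.bivector B δK z w) using 1
    ext1 ε
    simp only [bivector, propagator, Matrix.of_apply, map_add, map_smul, Matrix.add_mul,
      Matrix.smul_mul, Matrix.add_apply, Matrix.smul_apply, smul_eq_mul]
    ring
  have key := SFun.coeff_formalLog_family (p := fun ε : ℝ => X.bivector B (K + ε • δK)) hbiv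
    (b := fun ε z => 1 / 2 * tensorPair D B (X.tensorBasis z) (tensorBracket g C (v ε) (v ε)))
    (fun z => smul_mem_polyFam (const_mem_polyFam _)
      (map_mem_polyFam (tensorPair D B (X.tensorBasis z)) hup))
    (fun ε z hz => by
      have h3 : tensorPair D B (X.tensorBasis z) (tensorBracket g C (v ε) (v ε)) ≠ 0 :=
        fun h => hz (by rw [h, mul_zero])
      by_contra h4
      have h5 : Even (X.degC z.1) := by simpa [oddC] using h4
      have h6 := tensorPair_sign (D := D) (B := B) (X.tensorBasis z)
        (tensorBracket g C (v ε) (v ε))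
      rw [sign_tensorBasis, tensorSign_of_mem (tensorBracket_mem (hv1 ε) (hv1 ε)), map_smul,
        LinearMap.smul_apply, h5.neg_one_pow] at h6
      norm_num at h6
      exact h3 (by linarith))
    (fun ε => X.isSuperSymm_bivector hB (hK ε))
    (fun w => by
      have h3 := map_mem_sqFam (((1 / 2 : ℝ) * (-1) ^ X.degC w.1) • X.tensorBasis.coord w)
        (wheelOp_bracket_mem_sqFam h0 h1 h (X.point α) (X.point α))
      convert h3 using 1
      ext1 ε
      simp only [mul_left_comm _ (1 / 2 : ℝ), ← Finset.mul_sum, X.sum_bivector_mul hB (hK ε),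
        LinearMap.smul_apply, Module.Basis.coord_apply, smul_eq_mul, mul_assoc]
      rfl)
    (E := SFun.evalZero X.oddC) SFun.evalZero_coord
    (N := fun ε => X.hessian B (v ε)) (fun z w => smul_mem_polyFam (const_mem_polyFam _)
      (map_mem_polyFam (tensorPair D B (X.tensorBasis z)) (map_mem_polyFam
        ((tensorBracket g C).flip (X.tensorBasis w)) hvp)))
    (c := fun ε => 1 / 6 * tensorPair D B (v ε) (tensorBracket g C (v ε) (v ε)))
    (smul_mem_polyFam (const_mem_polyFam _) (bilin_mem_polyFam (tensorPair D B) hvp hup))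
    (fun ε => X.isEven_hessian hB (hv1 ε)) (fun ε => X.isEven_bivector hB (hK ε))
    (fun ε => X.isSuperSymm_hessian hB (hv1 ε))
    (Submodule.smul_mem _ (1 / 6 : ℝ) (X.cubicForm_coord_mem (B := B))) n
  have e1 : (fun ε : ℝ => MvPolynomial.eval α (X.loopPart B (ι + ε • δι) (K + ε • δK) 1 n)) =
      fun ε => PowerSeries.coeff n (PowerSeries.coeff n (formalLog (expSeries
        (SFun.contraction (SFun.evalZero X.oddC) (X.bivector B (K + ε • δK)))
        ((1 / 6 * tensorPair D B (v ε) (tensorBracket g C (v ε) (v ε))) • 1 +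
        (SFun.quad X.oddC (X.hessian B (v ε)) + (1 / 6 : ℝ) • X.cubicForm B (SFun.coord X.oddC)
          (SFun.coord X.oddC) (SFun.coord X.oddC)) +
        SFun.linForm X.oddC fun z => 1 / 2 * tensorPair D B (X.tensorBasis z)
          (tensorBracket g C (v ε) (v ε)))))) := by
    ext1 ε
    rw [eval_loopPart_one, X.evalModes_interaction hB (hι ε) (hι' ε) α rfl]
  have e2 : (fun ε : ℝ => 1 / 2 * PowerSeries.coeff n
        (strLog 𝒞 (wheelOp (ι + ε • δι) (K + ε • δK) (X.point α)))) =
      fun ε => SFun.wheelValue X.oddC (X.hessian B (v ε)) (X.bivector B (K + ε • δK)) n / n := by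
    ext1 ε
    rcases n with _ | n
    · simp [strLog]
    · rw [X.wheelValue_eq hB (hK ε), strLog, PowerSeries.coeff_mk, if_neg (Nat.succ_ne_zero n), wheelOp]
      push_cast
      ring
  rw [e1, e2]
  exact key

include hB in
/-- The formula for the one-loop part: the value at `ε = 0` of the first-order statement for the
constant deformation. -/
theorem loopPart_one_eq_strLog {ι : D.Cohomology →ₗ[ℝ] C} {K : C →ₗ[ℝ] C}
    (h0 : D.IsInductionData ι K) (h1 : D.IsAlgHom ι) (α : X.P1 × A → ℝ) :
    PowerSeries.mk (fun n => MvPolynomial.eval α (X.loopPart B ι K 1 n)) =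
      (1 / 2 : ℝ) • strLog 𝒞 (wheelOp ι K (X.point α)) := by
  ext n
  have h := (X.loopPart_one_mem_sameJet hB h0 h1 DGFrobenius.IsInductionData.constant α n).1
  simp only [smul_zero, add_zero] at h
  rw [PowerSeries.coeff_mk, h, map_smul, smul_eq_mul]

end FieldCoords

end ChernSimons

/-! ### Supertraces of wheels under a variation of the homotopy -/

section WheelTrace

variable {V : Type*} [AddCommGroup V] [Module ℝ V] {s d K T P : Module.End ℝ V}

theorem trace_mul_swap_of_odd {Z Y : Module.End ℝ V} (hZ : Z * s = -(s * Z)) :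
    LinearMap.trace ℝ V (s * (Z * Y)) = -LinearMap.trace ℝ V (s * (Y * Z)) := by
  rw [← mul_assoc s Y Z, LinearMap.trace_mul_comm ℝ (s * Y) Z, ← mul_assoc Z s Y, hZ, neg_mul,
    map_neg, neg_neg, mul_assoc]

theorem trace_mul_swap_of_even {Z Y : Module.End ℝ V} (hZ : Z * s = s * Z) :
    LinearMap.trace ℝ V (s * (Z * Y)) = LinearMap.trace ℝ V (s * (Y * Z)) := by
  rw [← mul_assoc s Y Z, LinearMap.trace_mul_comm ℝ (s * Y) Z, ← mul_assoc Z s Y, hZ, mul_assoc]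

variable (s d K T P) in
/-- A homotopy `K` between `1` and a projection `P`, together with a twist `T` of the differential `d`
compatible with them; all three operators are odd with respect to the sign operator `s`. -/
structure IsWheelHomotopy : Prop where
  d_odd : d * s = -(s * d)
  K_odd : K * s = -(s * K)
  T_odd : T * s = -(s * T)
  homotopy : d * K + K * d = 1 - P
  d_T : d * T = -(T * d)
  T_T : T * T = 0
  K_T_P : K * T * P = 0
  P_T_K : P * T * K = 0

namespace IsWheelHomotopy

variable (h : IsWheelHomotopy s d K T P)
include h

theorem KT_even : K * T * s = s * (K * T) := by
  rw [mul_assoc, h.T_odd, mul_neg, ← mul_assoc, h.K_odd, neg_mul, neg_neg, mul_assoc]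

theorem P_even : P * s = s * P := by
  have h1 : P = 1 - (d * K + K * d) := by rw [h.homotopy, sub_sub_cancel]
  have h2 : d * K * s = s * (d * K) := by
    rw [mul_assoc, h.K_odd, mul_neg, ← mul_assoc, h.d_odd, neg_mul, neg_neg, mul_assoc]
  have h3 : K * d * s = s * (K * d) := by
    rw [mul_assoc, h.d_odd, mul_neg, ← mul_assoc, h.K_odd, neg_mul, neg_neg, mul_assoc]
  rw [h1, sub_mul, mul_sub, add_mul, mul_add, h2, h3, one_mul, mul_one]

theorem PT_odd : P * T * s = -(s * (P * T)) := by
  rw [mul_assoc, h.T_odd, mul_neg, ← mul_assoc, h.P_even, mul_assoc]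

/-- The differential passes through the wheel operator up to the twist. -/
theorem d_mul_pow (n : ℕ) :
    d * (K * T) ^ (n + 1) = (K * T) ^ (n + 1) * d + (1 - P) * T * (K * T) ^ n := by
  have h1 : d * (K * T) = K * T * d + (1 - P) * T := by
    rw [← h.homotopy, add_mul, mul_assoc K d T, h.d_T]
    noncomm_ring
  have h2 : K * T * ((1 - P) * T) = 0 := by
    rw [← mul_assoc, mul_sub, mul_one, sub_mul, h.K_T_P, zero_mul, sub_zero, mul_assoc, h.T_T,
      mul_zero]
  induction n with
  | zero => rw [zero_add, pow_one, pow_zero, mul_one, h1]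
  | succ n ih =>
    rw [pow_succ, ← mul_assoc, ih, add_mul, mul_assoc _ d (K * T), h1, mul_add, ← mul_assoc,
      pow_succ (K * T) n, mul_assoc ((K * T) ^ n) (K * T) ((1 - P) * T), h2, mul_zero, add_zero,
      mul_assoc ((1 - P) * T)]

theorem PT_pow_K (n : ℕ) : P * T * ((K * T) ^ n * K) = 0 := by
  rcases n with _ | n
  · rw [pow_zero, one_mul, h.P_T_K]
  · have e : P * T * ((K * T) ^ (n + 1) * K) = P * T * K * (T * (K * T) ^ n * K) := by
      rw [pow_succ']; simp only [mul_assoc]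
    rw [e, h.P_T_K, zero_mul]

theorem pow_mul_P (n : ℕ) : (K * T) ^ (n + 1) * P = 0 := by
  rw [pow_succ, mul_assoc, h.K_T_P, mul_zero]

/-- An exact variation of the homotopy does not change the wheels. -/
theorem trace_exact (L : Module.End ℝ V) (n : ℕ) :
    LinearMap.trace ℝ V (s * ((K * T) ^ n * (d * (L * K) - L * K * d) * T)) = 0 := by
  have h0 := trace_mul_swap_of_odd (Y := (K * T) ^ n * (L * K) * T) h.d_odd
  have h1 : (K * T) ^ n * (L * K) * T * d = -((K * T) ^ n * (L * K * d) * T) := by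
    rw [mul_assoc _ T d, ← neg_eq_iff_eq_neg.2 h.d_T]
    noncomm_ring
  rw [h1, mul_neg, map_neg, neg_neg] at h0
  have h2 : (K * T) ^ n * (d * (L * K) - L * K * d) * T =
      (K * T) ^ n * (d * (L * K)) * T - (K * T) ^ n * (L * K * d) * T := by
    rw [mul_sub, sub_mul]
  rw [h2, mul_sub, map_sub, ← h0, sub_eq_zero]
  rcases n with _ | n
  · simp only [pow_zero, one_mul, mul_assoc]
  · have h3 : d * ((K * T) ^ (n + 1) * (L * K) * T) =
        (K * T) ^ (n + 1) * (d * (L * K)) * T + (T * ((K * T) ^ n * (L * K) * T) -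
          P * T * (K * T) ^ n * L * (K * T)) := by
      rw [← mul_assoc, ← mul_assoc, h.d_mul_pow]
      noncomm_ring
    have h4 : LinearMap.trace ℝ V (s * (T * ((K * T) ^ n * (L * K) * T))) = 0 := by
      rw [trace_mul_swap_of_odd h.T_odd, mul_assoc _ T T, h.T_T, mul_zero, mul_zero, map_zero,
        neg_zero]
    have h5 : LinearMap.trace ℝ V (s * (P * T * (K * T) ^ n * L * (K * T))) = 0 := by
      rw [← trace_mul_swap_of_even h.KT_even, mul_assoc P, mul_assoc P,
        ← mul_assoc (K * T) P, h.K_T_P, zero_mul, mul_zero, map_zero]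
    rw [h3, mul_add, map_add, mul_sub, map_sub, h4, h5, sub_zero, add_zero]

/-- First-order variations of the homotopy do not change the wheels, for a fixed twist. -/
theorem trace_variation {K' : Module.End ℝ V} (G : Module.End ℝ V) (h1 : K' * P = K * G * P)
    (h2 : P * ((d * K' + K' * d) * K) = (d * K' + K' * d) * K) (n : ℕ) :
    LinearMap.trace ℝ V (s * ((K * T) ^ n * K' * T)) = 0 := by
  -- expand `K' = K' (d K + K d + P)`, and move `d` across in the first term
  have e : K' = (d * (-K' * K) - -K' * K * d) + K * G * P + (d * K' + K' * d) * K := by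
    have : K' = K' * (d * K + K * d + P) := by rw [h.homotopy, sub_add_cancel, mul_one]
    rw [← h1]
    nth_rw 1 [this]
    noncomm_ring
  have e1 : (K * T) ^ n * K' * T = (K * T) ^ n * (d * (-K' * K) - -K' * K * d) * T +
      ((K * T) ^ n * K * G) * (P * T) + (K * T) ^ n * ((d * K' + K' * d) * K) * T := by
    nth_rw 1 [e]
    simp only [mul_add, add_mul, mul_assoc]
  have t1 : LinearMap.trace ℝ V (s * (((K * T) ^ n * K * G) * (P * T))) = 0 := by
    have := trace_mul_swap_of_odd (Y := (K * T) ^ n * K * G) h.PT_odd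
    rw [← mul_assoc (P * T), h.PT_pow_K, zero_mul, mul_zero, map_zero, eq_comm, neg_eq_zero] at this
    exact this
  have t2 : LinearMap.trace ℝ V (s * ((K * T) ^ n * ((d * K' + K' * d) * K) * T)) = 0 := by
    rw [← h2]
    rcases n with _ | n
    · rw [pow_zero, one_mul, mul_assoc P, trace_mul_swap_of_even h.P_even, mul_assoc (_ * K),
        mul_assoc _ K, ← mul_assoc K, h.K_T_P, mul_zero, mul_zero, map_zero]
    · rw [← mul_assoc _ P, h.pow_mul_P, zero_mul, zero_mul, mul_zero, map_zero]
  rw [e1, mul_add, mul_add, map_add, map_add, h.trace_exact, t1, t2, add_zero, add_zero]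

/-- Integration by parts under the supertrace: the end of the descent along a tower. -/
theorem trace_commutator_zero (b : Module.End ℝ V) :
    LinearMap.trace ℝ V (s * (K * (d * b - b * d))) = LinearMap.trace ℝ V (s * ((1 - P) * b)) := by
  have h0 := trace_mul_swap_of_odd (Y := K * b) h.d_odd
  have e1 : s * (K * (d * b - b * d)) = s * ((1 - P) * b) - s * (d * (K * b)) - s * (K * b * d) := by
    rw [← h.homotopy]
    noncomm_ring
  rw [e1, map_sub, map_sub, h0]
  ring

/-- Trading a commutator with the differential for a commutator with the twist. -/
theorem trace_commutator_succ (b : Module.End ℝ V) (n : ℕ) :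
    LinearMap.trace ℝ V (s * ((K * T) ^ (n + 1) * K * (d * b - b * d))) =
      LinearMap.trace ℝ V (s * ((K * T) ^ n * K * (T * b - b * T))) := by
  have h0 := trace_mul_swap_of_odd (Y := (K * T) ^ (n + 1) * K * b) h.d_odd
  have h1 := trace_mul_swap_of_odd (Y := (K * T) ^ n * K * b) h.T_odd
  have e1 : (K * T) ^ (n + 1) * K * (d * b - b * d) =
      (K * T) ^ (n + 1) * (d * K + K * d) * b - (K * T) ^ (n + 1) * d * K * b -
        (K * T) ^ (n + 1) * K * b * d := by
    noncomm_ring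
  have e2 : d * ((K * T) ^ (n + 1) * K * b) = (K * T) ^ (n + 1) * d * K * b +
      T * ((K * T) ^ n * K * b) := by
    have : d * ((K * T) ^ (n + 1) * K * b) = (K * T) ^ (n + 1) * d * K * b +
      T * ((K * T) ^ n * K * b) - P * T * ((K * T) ^ n * K) * b := by
      rw [← mul_assoc, ← mul_assoc, h.d_mul_pow]
      noncomm_ring
    rw [this, h.PT_pow_K, zero_mul, sub_zero]
  have e3 : (K * T) ^ (n + 1) * (d * K + K * d) * b = (K * T) ^ (n + 1) * b := by
    rw [h.homotopy, mul_sub, mul_one, h.pow_mul_P, sub_zero]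
  have e4 : (K * T) ^ n * K * (T * b - b * T) = (K * T) ^ (n + 1) * b -
      (K * T) ^ n * K * b * T := by
    rw [pow_succ]
    noncomm_ring
  rw [e2] at h0
  rw [e1, e3, e4]
  simp only [mul_sub, map_sub, mul_add, map_add] at h0 ⊢
  linarith

/-- The contribution of a variation of the twist vanishes when the variation is generated by a tower
of operators `b j`. -/
theorem trace_tower {b : ℕ → Module.End ℝ V}
    (h1 : ∀ j, d * b (j + 1) - b (j + 1) * d = T * b j - b j * T)
    (h2 : ∀ j, LinearMap.trace ℝ V (s * ((1 - P) * b j)) = 0) (n : ℕ) : ∀ j,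
    LinearMap.trace ℝ V (s * ((K * T) ^ n * K * (d * b j - b j * d))) = 0 := by
  induction n with
  | zero =>
    intro j
    rw [pow_zero, one_mul, h.trace_commutator_zero, h2]
  | succ n ih =>
    intro j
    rw [h.trace_commutator_succ, ← h1, ih]

/-- The tower of vectors generated from a primitive of a twisted-closed vector. -/
theorem d_tower {v : V} (hv : T (d (K v)) = 0) (j : ℕ) :
    d (((K * T) ^ (j + 1) * K) v) = T (((K * T) ^ j * K) v) := by
  have hs : ∀ j, ((K * T) ^ (j + 1) * K) v = K (T (((K * T) ^ j * K) v)) := fun j => by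
    simp only [pow_succ', Module.End.mul_apply]
  have hst : ∀ j, T (d (((K * T) ^ j * K) v)) = 0 →
      d (((K * T) ^ (j + 1) * K) v) = T (((K * T) ^ j * K) v) := by
    intro j hj
    have e1 := LinearMap.congr_fun h.homotopy (T (((K * T) ^ j * K) v))
    have e2 := LinearMap.congr_fun (h.PT_pow_K j) v
    have e3 := LinearMap.congr_fun h.d_T (((K * T) ^ j * K) v)
    simp only [LinearMap.add_apply, LinearMap.sub_apply, LinearMap.neg_apply, Module.End.mul_apply,
      Module.End.one_apply, LinearMap.zero_apply] at e1 e2 e3 hj hs ⊢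
    rw [e3, hj, neg_zero, map_zero, add_zero, e2, sub_zero] at e1
    rw [hs, e1]
  refine hst j ?_
  induction j with
  | zero => rwa [pow_zero, one_mul]
  | succ j ih =>
    rw [hst j ih, ← Module.End.mul_apply, h.T_T, LinearMap.zero_apply]

end IsWheelHomotopy

end WheelTrace

section ChernSimons

variable {C : Type*} [Ring C] [Algebra ℝ C] {𝒞 : ℕ → Submodule ℝ C} [GradedAlgebra 𝒞]
variable {g : Type*} [LieRing g] [LieAlgebra ℝ g]
variable {D : DGFrobenius 𝒞}

/-! ### Consequences of the axioms of induction data -/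

namespace DGFrobenius

/-- The projection `1 - dK - Kd` onto the image of `ι`. -/
def proj (D : DGFrobenius 𝒞) (K : C →ₗ[ℝ] C) : C →ₗ[ℝ] C :=
  LinearMap.id - (D.d ∘ₗ K + K ∘ₗ D.d)

theorem proj_apply (K : C →ₗ[ℝ] C) (a : C) : D.proj K a = a - (D.d (K a) + K (D.d a)) := rfl

namespace IsInductionData

variable {ι : D.Cohomology →ₗ[ℝ] C} {K : C →ₗ[ℝ] C} (h : D.IsInductionData ι K)
include h

theorem injective : Function.Injective ι := by
  refine (injective_iff_map_eq_zero ι).2 fun x hx => ?_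
  obtain ⟨z, rfl⟩ := Submodule.mkQ_surjective _ x
  obtain ⟨y, hy⟩ := h.ι_rep z
  rw [cls, hx] at hy
  refine (Submodule.Quotient.mk_eq_zero _).2 ⟨-y, ?_⟩
  rw [map_neg]
  exact (eq_neg_of_add_eq_zero_left hy.symm).symm

theorem exists_retraction : ∃ p : C →ₗ[ℝ] D.Cohomology, ∀ x, p (ι x) = x := by
  obtain ⟨p, hp⟩ := LinearMap.exists_leftInverse_of_injective ι (LinearMap.ker_eq_bot.2 h.injective)
  exact ⟨p, fun x => LinearMap.congr_fun hp x⟩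

theorem d_proj (a : C) : D.d (D.proj K a) = 0 := by
  obtain ⟨x, hx⟩ := h.homotopy_mem a
  rw [proj_apply, ← hx, h.d_ι]

theorem proj_ι (x : D.Cohomology) : D.proj K (ι x) = ι x := by
  rw [proj_apply, h.K_ι, h.d_ι, map_zero, map_zero, add_zero, sub_zero]

theorem K_proj (a : C) : K (D.proj K a) = 0 := by
  obtain ⟨x, hx⟩ := h.homotopy_mem a
  rw [proj_apply, ← hx, h.K_ι]

/-- The side conditions `K ι = 0` and `K² = 0` give `K d K = K`. -/
theorem K_d_K (a : C) : K (D.d (K a)) = K a := by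
  have h1 := h.K_proj a
  rw [proj_apply, map_sub, map_add, h.K_K, add_zero, sub_eq_zero] at h1
  exact h1.symm

theorem proj_K (a : C) : D.proj K (K a) = 0 := by
  rw [proj_apply, h.K_K, map_zero, zero_add, h.K_d_K, sub_self]

theorem proj_d (a : C) : D.proj K (D.d a) = 0 := by
  have h1 := h.d_proj a
  rw [proj_apply, map_sub, map_add, D.d_d, zero_add] at h1
  rw [proj_apply, D.d_d, map_zero, add_zero, h1]

/-- The projection is orthogonal for the pairing. -/
theorem pair_proj (a b : C) : D.pair (D.proj K a) b = D.pair a (D.proj K b) := by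
  have hK := h.isSymmLowering
  have h1 : D.pair (D.d (K a)) b = D.pair a (K (D.d b)) := by
    have e : gradingSign 𝒞 (K a) = -K (gradingSign 𝒞 a) := by rw [hK.map_gradingSign, neg_neg]
    rw [D.pair_d_left, e, map_neg, LinearMap.neg_apply, neg_neg, hK.pair_map, gradingSign_gradingSign]
  have h2 : D.pair (K (D.d a)) b = D.pair a (D.d (K b)) := by
    have h3 := D.pair_d_left (gradingSign 𝒞 a) (K b)
    rw [gradingSign_gradingSign, D.d_gradingSign, map_neg, LinearMap.neg_apply, neg_inj] at h3
    rw [hK.pair_map, h3]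
  rw [proj_apply, proj_apply, map_sub, map_sub, LinearMap.sub_apply, map_add, map_add,
    LinearMap.add_apply, h1, h2, add_comm (D.pair a (K (D.d b)))]

end IsInductionData

/-- The first-order conditions satisfied by a deformation `(δι, δK)` of the induction data `(ι, K)`
through homomorphisms, as far as they matter for the one-loop part. -/
structure IsVariation (D : DGFrobenius 𝒞) (ι : D.Cohomology →ₗ[ℝ] C) (K : C →ₗ[ℝ] C)
    (δι : D.Cohomology →ₗ[ℝ] C) (δK : C →ₗ[ℝ] C) : Prop where
  ι_mem : ∀ x, x ∈ D.cohomologyDeg 1 → δι x ∈ 𝒞 1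
  ι_exact : ∀ x, δι x ∈ LinearMap.range D.d
  K_ι : ∀ x, δK (ι x) + K (δι x) = 0
  homotopy_mem : ∀ a, D.d (δK (K a)) + δK (D.d (K a)) ∈ LinearMap.range ι
  map_mul : ∀ a b : D.cocycles, δι (D.cls ⟨a * b, D.mul_mem_cocycles a.2 b.2⟩) =
    δι (D.cls a) * ι (D.cls b) + ι (D.cls a) * δι (D.cls b)

theorem IsInfinitesimalDeformation.isVariation {ι δι : D.Cohomology →ₗ[ℝ] C} {K δK : C →ₗ[ℝ] C}
    (h0 : D.IsInductionData ι K) (h : D.IsInfinitesimalDeformation ι K δι δK) :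
    D.IsVariation ι K δι δK where
  ι_mem x hx := h.ι_mem 1 x hx
  ι_exact x := by
    obtain ⟨y, hy⟩ := h.ι_rep x
    exact ⟨y, hy.symm⟩
  K_ι := h.K_ι
  homotopy_mem a := by
    obtain ⟨x, hx⟩ := h.homotopy_mem (K a) 0 (by rw [map_zero]; exact h0.proj_K a)
    rw [map_zero, zero_add, neg_eq_iff_eq_neg, ← map_neg] at hx
    exact ⟨_, hx.symm⟩
  map_mul := h.map_mul

end DGFrobenius

/-! ### Jacobi identity and Leibniz rule -/

theorem eq_of_mem_tensorDeg₂ {M : Type*} [AddCommGroup M] [Module ℝ M] {i j : ℕ}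
    {F G : (g ⊗[ℝ] C) →ₗ[ℝ] (g ⊗[ℝ] C) →ₗ[ℝ] M} (h : ∀ x y : g, ∀ a ∈ 𝒞 i, ∀ b ∈ 𝒞 j,
      F (x ⊗ₜ a) (y ⊗ₜ b) = G (x ⊗ₜ a) (y ⊗ₜ b)) {v w : g ⊗[ℝ] C}
    (hv : v ∈ tensorDeg g 𝒞 i) (hw : w ∈ tensorDeg g 𝒞 j) : F v w = G v w := by
  have h1 : ∀ y : g, ∀ b ∈ 𝒞 j, F v (y ⊗ₜ b) = G v (y ⊗ₜ b) := by
    intro y b hb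
    exact eq_of_mem_tensorDeg (F := F.flip (y ⊗ₜ b)) (G := G.flip (y ⊗ₜ b))
      (fun x a ha => h x y a ha b hb) hv
  exact eq_of_mem_tensorDeg h1 hw

theorem tensorBracket_jacobi (D : DGFrobenius 𝒞) {i j : ℕ} {u v : g ⊗[ℝ] C}
    (hu : u ∈ tensorDeg g 𝒞 i) (hv : v ∈ tensorDeg g 𝒞 j) (w : g ⊗[ℝ] C) :
    tensorBracket g C (tensorBracket g C u v) w = tensorBracket g C u (tensorBracket g C v w) -
      (-1 : ℝ) ^ (i * j) • tensorBracket g C v (tensorBracket g C u w) := by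
  induction w using TensorProduct.induction_on with
  | zero => simp
  | add w₁ w₂ h₁ h₂ =>
    simp only [map_add, h₁, h₂, smul_add]
    abel
  | tmul z c =>
    have h := eq_of_mem_tensorDeg₂
      (F := (tensorBracket g C).compr₂ ((tensorBracket g C).flip (z ⊗ₜ c)))
      (G := (tensorBracket g C).compl₂ ((tensorBracket g C).flip (z ⊗ₜ c)) - (-1 : ℝ) ^ (i * j) •
        LinearMap.flip ((tensorBracket g C).compl₂ ((tensorBracket g C).flip (z ⊗ₜ c))))
      (fun x y a ha b hb => ?_) hu hv
    · exact h
    · change ⁅⁅x, y⁆, z⁆ ⊗ₜ[ℝ] (a * b * c) = ⁅x, ⁅y, z⁆⁆ ⊗ₜ[ℝ] (a * (b * c)) -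
        (-1 : ℝ) ^ (i * j) • (⁅y, ⁅x, z⁆⁆ ⊗ₜ[ℝ] (b * (a * c)))
      rw [← TensorProduct.tmul_smul, ← mul_assoc b a c, ← smul_mul_assoc, ← D.mul_comm' i j a b ha hb,
        ← mul_assoc, ← TensorProduct.sub_tmul, lie_lie]

theorem lTensor_d_bracket {i : ℕ} {v : g ⊗[ℝ] C} (hv : v ∈ tensorDeg g 𝒞 i) (w : g ⊗[ℝ] C) :
    LinearMap.lTensor g D.d (tensorBracket g C v w) =
      tensorBracket g C (LinearMap.lTensor g D.d v) w +
        (-1 : ℝ) ^ i • tensorBracket g C v (LinearMap.lTensor g D.d w) := by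
  have h := eq_of_mem_tensorDeg
    (F := (LinearMap.llcomp ℝ (g ⊗[ℝ] C) (g ⊗[ℝ] C) (g ⊗[ℝ] C) (LinearMap.lTensor g D.d)) ∘ₗ
      tensorBracket g C)
    (G := tensorBracket g C ∘ₗ LinearMap.lTensor g D.d + (-1 : ℝ) ^ i •
      ((LinearMap.llcomp ℝ (g ⊗[ℝ] C) (g ⊗[ℝ] C) (g ⊗[ℝ] C)).flip (LinearMap.lTensor g D.d)) ∘ₗ
        tensorBracket g C) (fun x a ha => ?_) hv
  · exact LinearMap.congr_fun h w
  · refine TensorProduct.ext' fun z c => ?_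
    change ⁅x, z⁆ ⊗ₜ[ℝ] D.d (a * c) = ⁅x, z⁆ ⊗ₜ[ℝ] (D.d a * c) +
      (-1 : ℝ) ^ i • (⁅x, z⁆ ⊗ₜ[ℝ] (a * D.d c))
    rw [D.leibniz i a c ha, TensorProduct.tmul_add, TensorProduct.tmul_smul]

/-! ### Brackets of harmonic representatives -/

namespace DGFrobenius

variable {ι δι ι' : D.Cohomology →ₗ[ℝ] C} {K δK : C →ₗ[ℝ] C}

/-- Products of representatives are representatives, hence annihilated by `K`. -/
theorem IsInductionData.K_bracket (h : D.IsInductionData ι K) (h1 : D.IsAlgHom ι)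
    (u w : g ⊗[ℝ] D.Cohomology) : LinearMap.lTensor g K (tensorBracket g C
      (LinearMap.lTensor g ι u) (LinearMap.lTensor g ι w)) = 0 := by
  have key : ((tensorBracket g C).compl₁₂ (LinearMap.lTensor g ι) (LinearMap.lTensor g ι)).compr₂
      (LinearMap.lTensor g K) = 0 := by
    refine TensorProduct.ext' fun x a => TensorProduct.ext' fun y b => ?_
    change ⁅x, y⁆ ⊗ₜ[ℝ] K (ι a * ι b) = 0
    obtain ⟨a, rfl⟩ := Submodule.mkQ_surjective _ a
    obtain ⟨b, rfl⟩ := Submodule.mkQ_surjective _ b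
    have := h1.map_mul a b
    rw [cls] at this
    rw [← this, h.K_ι, TensorProduct.tmul_zero]
  exact LinearMap.congr_fun (LinearMap.congr_fun key u) w

/-- Compatibility of two homomorphisms with the product of the cohomology. -/
theorem IsInductionData.transport_bracket (h1 : D.IsAlgHom ι)
    (h1' : D.IsAlgHom ι') {p : C →ₗ[ℝ] D.Cohomology} (hp : ∀ x, p (ι x) = x)
    (u w : g ⊗[ℝ] D.Cohomology) : LinearMap.lTensor g (ι' ∘ₗ p) (tensorBracket g C
      (LinearMap.lTensor g ι u) (LinearMap.lTensor g ι w)) =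
      tensorBracket g C (LinearMap.lTensor g ι' u) (LinearMap.lTensor g ι' w) := by
  have key : ((tensorBracket g C).compl₁₂ (LinearMap.lTensor g ι) (LinearMap.lTensor g ι)).compr₂
      (LinearMap.lTensor g (ι' ∘ₗ p)) =
      (tensorBracket g C).compl₁₂ (LinearMap.lTensor g ι') (LinearMap.lTensor g ι') := by
    refine TensorProduct.ext' fun x a => TensorProduct.ext' fun y b => ?_
    change ⁅x, y⁆ ⊗ₜ[ℝ] ι' (p (ι a * ι b)) = ⁅x, y⁆ ⊗ₜ[ℝ] (ι' a * ι' b)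
    obtain ⟨a, rfl⟩ := Submodule.mkQ_surjective _ a
    obtain ⟨b, rfl⟩ := Submodule.mkQ_surjective _ b
    have e1 := h1.map_mul a b
    have e2 := h1'.map_mul a b
    rw [cls] at e1 e2
    rw [← e1, hp, e2]
  exact LinearMap.congr_fun (LinearMap.congr_fun key u) w

/-- The derivative of the compatibility with the product of the cohomology. -/
theorem IsVariation.transport_bracket (h1 : D.IsAlgHom ι) (h : D.IsVariation ι K δι δK)
    {p : C →ₗ[ℝ] D.Cohomology} (hp : ∀ x, p (ι x) = x) (u w : g ⊗[ℝ] D.Cohomology) :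
    LinearMap.lTensor g (δι ∘ₗ p) (tensorBracket g C
      (LinearMap.lTensor g ι u) (LinearMap.lTensor g ι w)) =
      tensorBracket g C (LinearMap.lTensor g δι u) (LinearMap.lTensor g ι w) +
      tensorBracket g C (LinearMap.lTensor g ι u) (LinearMap.lTensor g δι w) := by
  have key : ((tensorBracket g C).compl₁₂ (LinearMap.lTensor g ι) (LinearMap.lTensor g ι)).compr₂
      (LinearMap.lTensor g (δι ∘ₗ p)) =
      (tensorBracket g C).compl₁₂ (LinearMap.lTensor g δι) (LinearMap.lTensor g ι) +
      (tensorBracket g C).compl₁₂ (LinearMap.lTensor g ι) (LinearMap.lTensor g δι) := by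
    refine TensorProduct.ext' fun x a => TensorProduct.ext' fun y b => ?_
    change ⁅x, y⁆ ⊗ₜ[ℝ] δι (p (ι a * ι b)) = ⁅x, y⁆ ⊗ₜ[ℝ] (δι a * ι b) + ⁅x, y⁆ ⊗ₜ[ℝ] (ι a * δι b)
    obtain ⟨a, rfl⟩ := Submodule.mkQ_surjective _ a
    obtain ⟨b, rfl⟩ := Submodule.mkQ_surjective _ b
    have e1 := h1.map_mul a b
    have e2 := h.map_mul a b
    rw [cls] at e1 e2
    rw [← e1, hp, e2, TensorProduct.tmul_add]
  exact LinearMap.congr_fun (LinearMap.congr_fun key u) w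

end DGFrobenius

namespace FieldCoords

variable {I P A : Type*} (X : FieldCoords D g I P A)
variable {B : LinearMap.BilinForm ℝ g} (hB : IsQuadratic B)
variable [Fintype I] [Fintype P] [Fintype A] [DecidableEq I] [DecidableEq A]
variable {ι δι : D.Cohomology →ₗ[ℝ] C} {K δK : C →ₗ[ℝ] C}

include X hB

theorem eq_zero_of_tensorPair {v : g ⊗[ℝ] C} (h : ∀ w, tensorPair D B w v = 0) : v = 0 := by
  have h1 : (X.gram B).mulVec (X.tensorBasis.repr v) = 0 := by
    ext x
    rw [gram_mulVec_repr, h]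
    rfl
  have h2 : ⇑(X.tensorBasis.repr v) = 0 := by
    have := congrArg (X.gram B)⁻¹.mulVec h1
    rwa [Matrix.mulVec_mulVec, X.inv_mul_gram hB, Matrix.one_mulVec, Matrix.mulVec_zero] at this
  exact X.tensorBasis.repr.map_eq_zero_iff.1 (DFunLike.coe_injective h2)

/-- On the Maurer--Cartan set, the wheel operator is built from a homotopy and a flat twist. -/
theorem isWheelHomotopy (h0 : D.IsInductionData ι K) (h1 : D.IsAlgHom ι)
    {u : g ⊗[ℝ] D.Cohomology} (hu : LinearMap.lTensor g ι u ∈ tensorDeg g 𝒞 1)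
    (hMC : tensorBracket g C (LinearMap.lTensor g ι u) (LinearMap.lTensor g ι u) = 0) :
    IsWheelHomotopy (tensorSign g 𝒞) (LinearMap.lTensor g D.d) (LinearMap.lTensor g K)
      (tensorBracket g C (LinearMap.lTensor g ι u)) (LinearMap.lTensor g (D.proj K)) := by
  have hK := h0.isSymmLowering
  obtain ⟨p, hp⟩ := h0.exists_retraction
  have hP : LinearMap.lTensor g (D.proj K) =
      LinearMap.lTensor g ι ∘ₗ LinearMap.lTensor g (p ∘ₗ D.proj K) := by
    rw [← LinearMap.lTensor_comp]
    congr 1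
    refine LinearMap.ext fun a => ?_
    obtain ⟨x, hx⟩ := h0.homotopy_mem a
    rw [LinearMap.comp_apply, LinearMap.comp_apply, DGFrobenius.proj_apply, ← hx, hp]
  have hKTP : ∀ w, LinearMap.lTensor g K (tensorBracket g C (LinearMap.lTensor g ι u)
      (LinearMap.lTensor g (D.proj K) w)) = 0 := by
    intro w
    rw [hP]
    exact h0.K_bracket h1 u _
  have hpair : ∀ v w : g ⊗[ℝ] C, tensorPair D B (LinearMap.lTensor g (D.proj K) v) w =
      tensorPair D B v (LinearMap.lTensor g (D.proj K) w) := by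
    intro v w
    induction v using TensorProduct.induction_on with
    | zero => simp
    | add v₁ v₂ h₁ h₂ => simp only [map_add, LinearMap.add_apply, h₁, h₂]
    | tmul x a =>
      induction w using TensorProduct.induction_on with
      | zero => simp
      | add w₁ w₂ h₁ h₂ => simp only [map_add, h₁, h₂]
      | tmul y b =>
        rw [LinearMap.lTensor_tmul, LinearMap.lTensor_tmul, tensorPair_tmul, tensorPair_tmul,
          h0.pair_proj]
  have hsgn : ∀ w : g ⊗[ℝ] C, tensorSign g 𝒞 (tensorSign g 𝒞 w) = w := fun w =>
    LinearMap.congr_fun (tensorSign_mul_self (g := g) (𝒞 := 𝒞)) w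
  refine ⟨lTensor_d_mul_sign, lTensor_mul_sign hK, tensorBracket_mul_sign hu, ?_, ?_, ?_, ?_, ?_⟩
  · have e : LinearMap.lTensor g (D.proj K) = LinearMap.lTensor g (LinearMap.id) -
        (LinearMap.lTensor g (D.d ∘ₗ K) + LinearMap.lTensor g (K ∘ₗ D.d)) := by
      rw [← LinearMap.lTensor_add, ← LinearMap.lTensor_sub]
      rfl
    rw [e, LinearMap.lTensor_id, LinearMap.lTensor_comp, LinearMap.lTensor_comp]
    exact (sub_sub_cancel _ _).symm
  · refine LinearMap.ext fun w => ?_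
    have e := lTensor_d_bracket (D := D) hu w
    have e2 : LinearMap.lTensor g D.d (LinearMap.lTensor g ι u) = 0 := by
      rw [← LinearMap.comp_apply, ← LinearMap.lTensor_comp]
      have : D.d ∘ₗ ι = 0 := LinearMap.ext fun x => h0.d_ι x
      rw [this, LinearMap.lTensor_zero, LinearMap.zero_apply]
    rw [e2, map_zero, LinearMap.zero_apply, zero_add, pow_one, neg_one_smul] at e
    exact e
  · refine LinearMap.ext fun w => ?_
    have e := tensorBracket_jacobi D hu hu w
    rw [hMC, map_zero, LinearMap.zero_apply, mul_one, pow_one, neg_one_smul, sub_neg_eq_add,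
      ← two_smul ℝ] at e
    exact (smul_eq_zero.1 e.symm).resolve_left two_ne_zero
  · exact LinearMap.ext hKTP
  · refine LinearMap.ext fun w => X.eq_zero_of_tensorPair hB fun w' => ?_
    change tensorPair D B w' (LinearMap.lTensor g (D.proj K) (tensorBracket g C
      (LinearMap.lTensor g ι u) (LinearMap.lTensor g K w))) = 0
    have e1 := tensorPair_bracket_left hB hu (D := D)
      (tensorSign g 𝒞 (LinearMap.lTensor g (D.proj K) w')) (LinearMap.lTensor g K w)
    rw [hsgn] at e1
    have e2 : tensorBracket g C (LinearMap.lTensor g ι u)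
        (tensorSign g 𝒞 (LinearMap.lTensor g (D.proj K) w')) = -tensorSign g 𝒞
        (tensorBracket g C (LinearMap.lTensor g ι u) (LinearMap.lTensor g (D.proj K) w')) :=
      LinearMap.congr_fun (tensorBracket_mul_sign hu) _
    have e3 := tensorPair_lTensor (D := D) (B := B) hK
      (tensorSign g 𝒞 (tensorSign g 𝒞 (tensorBracket g C (LinearMap.lTensor g ι u)
        (LinearMap.lTensor g (D.proj K) w')))) w
    rw [hsgn, hKTP, map_zero, LinearMap.zero_apply] at e3
    rw [← hpair, ← neg_eq_zero, ← e1, e2, map_neg, LinearMap.neg_apply, ← e3, neg_zero]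

/-- A quadratic Lie algebra is unimodular: `ad x` is skew for the invariant form. -/
theorem trace_adjoint (x : g) : LinearMap.trace ℝ g (LieAlgebra.ad ℝ g x) = 0 := by
  set G : Matrix A A ℝ := Matrix.of fun a b => B (X.bg a) (X.bg b) with hG
  set M : Matrix A A ℝ := LinearMap.toMatrix X.bg X.bg (LieAlgebra.ad ℝ g x) with hM
  have hdet : IsUnit G.det := X.gramLie_det hB
  have hcol : ∀ a, ∑ c, M c a • X.bg c = ⁅x, X.bg a⁆ := by
    intro a
    have := X.bg.sum_repr ⁅x, X.bg a⁆
    rw [← this]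
    exact Finset.sum_congr rfl fun c _ => by rw [hM, LinearMap.toMatrix_apply]; rfl
  have h1 : G * M = -(M.transpose * G) := by
    ext a b
    have e1 : (G * M) a b = B (X.bg a) ⁅x, X.bg b⁆ := by
      rw [← hcol, map_sum, Matrix.mul_apply]
      refine Finset.sum_congr rfl fun c _ => ?_
      rw [map_smul, smul_eq_mul, mul_comm]
      rfl
    have e2 : (M.transpose * G) a b = B ⁅x, X.bg a⁆ (X.bg b) := by
      rw [← hcol, map_sum, LinearMap.sum_apply, Matrix.mul_apply]
      refine Finset.sum_congr rfl fun c _ => ?_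
      rw [map_smul, LinearMap.smul_apply, smul_eq_mul]
      rfl
    rw [Matrix.neg_apply, e1, e2, hB.invariant, ← lie_skew, map_neg, LinearMap.neg_apply]
  have h2 : M = -(G⁻¹ * (M.transpose * G)) := by
    rw [← Matrix.mul_neg, ← h1, ← Matrix.mul_assoc, Matrix.nonsing_inv_mul _ hdet, Matrix.one_mul]
  have h3 : M.trace = -M.trace := by
    nth_rw 1 [h2]
    rw [Matrix.trace_neg, Matrix.trace_mul_comm, Matrix.mul_assoc, Matrix.mul_nonsing_inv _ hdet,
      Matrix.mul_one, Matrix.trace_transpose]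
  rw [LinearMap.trace_eq_matrix_trace ℝ X.bg, ← hM]
  linarith

/-- Traces of `l(v, ·)` followed by an operator on `C` contain the factor `tr ad = 0`. -/
theorem trace_lTensor_bracket (F : C →ₗ[ℝ] C) (v : g ⊗[ℝ] C) :
    LinearMap.trace ℝ (g ⊗[ℝ] C) (LinearMap.lTensor g F ∘ₗ tensorBracket g C v) = 0 := by
  have := Module.Finite.of_basis X.bg
  have := Module.Finite.of_basis X.bC
  induction v using TensorProduct.induction_on with
  | zero => simp
  | add v₁ v₂ h₁ h₂ => rw [map_add, LinearMap.comp_add, map_add, h₁, h₂, add_zero]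
  | tmul x c =>
    have e : LinearMap.lTensor g F ∘ₗ tensorBracket g C (x ⊗ₜ c) =
        TensorProduct.map (LieAlgebra.ad ℝ g x) (F ∘ₗ LinearMap.mulLeft ℝ c) :=
      TensorProduct.ext' fun y b => rfl
    rw [e, LinearMap.trace_tensorProduct', X.trace_adjoint hB, zero_mul]

/-- The first variation of the supertraces of powers of the wheel operator vanishes on the
Maurer--Cartan set. -/
theorem superTrace_variation (h0 : D.IsInductionData ι K) (h1 : D.IsAlgHom ι)
    (h : D.IsVariation ι K δι δK)
    {u : g ⊗[ℝ] D.Cohomology} (hu : LinearMap.lTensor g ι u ∈ tensorDeg g 𝒞 1)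
    (hu' : LinearMap.lTensor g δι u ∈ tensorDeg g 𝒞 1)
    (hMC : tensorBracket g C (LinearMap.lTensor g ι u) (LinearMap.lTensor g ι u) = 0) (n : ℕ) :
    superTrace 𝒞 (wheelOp ι K u ^ n * (LinearMap.lTensor g δK * tensorBracket g C
      (LinearMap.lTensor g ι u) + LinearMap.lTensor g K * tensorBracket g C
      (LinearMap.lTensor g δι u))) = 0 := by
  have hw := X.isWheelHomotopy hB h0 h1 hu hMC
  obtain ⟨p, hp⟩ := h0.exists_retraction
  set v := LinearMap.lTensor g ι u with hv
  set v' := LinearMap.lTensor g δι u with hv'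
  -- the deformation `v'` of the twist is exact: `v' = d K v'`
  have hPι : ∀ x ∈ LinearMap.range ι, D.proj K x = x := by
    rintro _ ⟨x, rfl⟩
    exact h0.proj_ι x
  have hdKδ : ∀ x, D.d (K (δι x)) = δι x := by
    intro x
    obtain ⟨y, hy⟩ := h.ι_exact x
    have := h0.proj_d y
    rw [hy, DGFrobenius.proj_apply] at this
    rw [← hy, D.d_d, map_zero, add_zero, hy, sub_eq_zero] at this
    exact this.symm
  -- flatness of the twist to first order
  have hvv' : tensorBracket g C v v' = 0 := by
    have e1 := h.transport_bracket h1 hp u u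
    rw [hMC, map_zero] at e1
    have e2 := tensorBracket_swap D hu v'
    rw [tensorSign_of_mem hu', pow_one, neg_one_smul, map_neg, LinearMap.neg_apply, neg_inj] at e2
    rw [← hv, ← hv', e2, ← two_smul ℝ] at e1
    exact (smul_eq_zero.1 e1.symm).resolve_left two_ne_zero
  have hdKv : LinearMap.lTensor g D.d (LinearMap.lTensor g K v') = v' := by
    rw [hv', ← LinearMap.comp_apply, ← LinearMap.comp_apply, ← LinearMap.lTensor_comp,
      ← LinearMap.lTensor_comp]
    congr 2
    exact LinearMap.ext hdKδ
  -- the tower of gauge parameters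
  obtain ⟨β, hβ⟩ : ∃ β : ℕ → g ⊗[ℝ] C, ∀ j, β j =
    ((LinearMap.lTensor g K * tensorBracket g C v) ^ j * LinearMap.lTensor g K) v' :=
    ⟨_, fun _ => rfl⟩
  have hβ0 : β 0 = LinearMap.lTensor g K v' := by rw [hβ, pow_zero, one_mul]
  have hβs : ∀ j, β (j + 1) = LinearMap.lTensor g K (tensorBracket g C v (β j)) := fun j => by
    rw [hβ, hβ, pow_succ']
    rfl
  have hKdeg : ∀ {w : g ⊗[ℝ] C}, w ∈ tensorDeg g 𝒞 1 → LinearMap.lTensor g K w ∈ tensorDeg g 𝒞 0 :=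
    fun hw => map_mem_tensorDeg (fun x a ha => tmul_mem_tensorDeg x (h0.K_mem 0 a ha)) hw
  have hβdeg : ∀ j, β j ∈ tensorDeg g 𝒞 0 := by
    intro j
    induction j with
    | zero => rw [hβ0]; exact hKdeg hu'
    | succ j ih =>
      have e := tensorBracket_mem hu ih
      rw [add_zero] at e
      rw [hβs]
      exact hKdeg e
  have hdβ : ∀ j, LinearMap.lTensor g D.d (β (j + 1)) = tensorBracket g C v (β j) := by
    intro j
    rw [hβ, hβ]
    exact hw.d_tower (by rw [hdKv, hvv']) j
  have hdb : ∀ j, LinearMap.lTensor g D.d * tensorBracket g C (β j) -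
      tensorBracket g C (β j) * LinearMap.lTensor g D.d =
      tensorBracket g C (LinearMap.lTensor g D.d (β j)) := by
    intro j
    refine LinearMap.ext fun w => ?_
    have e := lTensor_d_bracket (D := D) (hβdeg j) w
    rw [pow_zero, one_smul] at e
    exact sub_eq_of_eq_add e
  have htower := hw.trace_tower (b := fun j => tensorBracket g C (β j)) (fun j => by
    rw [hdb, hdβ]
    refine LinearMap.ext fun w => ?_
    have e := tensorBracket_jacobi D hu (hβdeg j) w
    rw [mul_zero, pow_zero, one_smul] at e
    exact e) (fun j => by
    have e := X.trace_lTensor_bracket hB (gradingSign 𝒞 ∘ₗ (LinearMap.id - D.proj K)) (β j)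
    rw [LinearMap.lTensor_comp, LinearMap.lTensor_sub, LinearMap.lTensor_id] at e
    exact e) n 0
  rw [hdb, hβ0, hdKv] at htower
  -- the variation of the homotopy
  have hvar := hw.trace_variation (K' := LinearMap.lTensor g δK)
    (LinearMap.lTensor g (-(δι ∘ₗ p))) ?_ ?_ n
  · rw [mul_add, superTrace, LinearMap.comp_add, map_add]
    rw [mul_assoc] at hvar
    rw [mul_assoc] at htower
    exact (congrArg₂ (· + ·) hvar htower).trans (add_zero 0)
  · simp only [← LinearMap.lTensor_mul]
    congr 1
    refine LinearMap.ext fun a => ?_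
    obtain ⟨x, hx⟩ := h0.homotopy_mem a
    have e := h.K_ι x
    simp only [LinearMap.neg_apply, Module.End.mul_apply, LinearMap.comp_apply,
      DGFrobenius.proj_apply, ← hx, hp, map_neg]
    exact eq_neg_of_add_eq_zero_left e
  · simp only [← LinearMap.lTensor_mul, ← LinearMap.lTensor_add]
    congr 1
    exact LinearMap.ext fun a => hPι _ (h.homotopy_mem a)

end FieldCoords

end ChernSimons

/-! ### Weak derivatives of vector-valued paths -/

section LinDeriv

variable {V W U : Type*} [AddCommGroup V] [Module ℝ V] [AddCommGroup W] [Module ℝ W]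
  [AddCommGroup U] [Module ℝ U] {S : Set ℝ} {t : ℝ}

/-- The path `f` has derivative `f'` within `S` at `t`, tested against all linear functionals. This
avoids choosing a norm on the (finite-dimensional) spaces in question. -/
def HasLinDeriv (f : ℝ → V) (f' : V) (S : Set ℝ) (t : ℝ) : Prop :=
  ∀ F : V →ₗ[ℝ] ℝ, HasDerivWithinAt (fun r => F (f r)) (F f') S t

theorem HasLinDeriv.map {f : ℝ → V} {f' : V} (h : HasLinDeriv f f' S t) (L : V →ₗ[ℝ] W) :
    HasLinDeriv (fun r => L (f r)) (L f') S t := fun F => h (F ∘ₗ L)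

theorem hasLinDeriv_const (a : V) : HasLinDeriv (fun _ => a) 0 S t := fun F => by
  rw [map_zero]
  exact hasDerivWithinAt_const _ _ _

theorem HasLinDeriv.sub {f h : ℝ → V} {f' h' : V} (hf : HasLinDeriv f f' S t)
    (hh : HasLinDeriv h h' S t) : HasLinDeriv (fun r => f r - h r) (f' - h') S t := fun F => by
  simp only [map_sub]
  exact (hf F).sub (hh F)

theorem hasLinDeriv_of_basis {κ : Type*} [Fintype κ] (b : Module.Basis κ ℝ V) {f : ℝ → V} {f' : V}
    (h : ∀ i, HasDerivWithinAt (fun r => b.repr (f r) i) (b.repr f' i) S t) :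
    HasLinDeriv f f' S t := by
  intro F
  have e : ∀ v, F v = ∑ i, b.repr v i * F (b i) := fun v => by
    conv_lhs => rw [← b.sum_repr v]
    simp only [map_sum, map_smul, smul_eq_mul]
  rw [e f', show (fun r => F (f r)) = fun r => ∑ i, b.repr (f r) i * F (b i) from
    funext fun r => e (f r)]
  exact HasDerivWithinAt.fun_sum fun i _ => (h i).mul_const _

theorem HasLinDeriv.bilin [FiniteDimensional ℝ V] (L : V →ₗ[ℝ] W →ₗ[ℝ] U) {f : ℝ → V}
    {f' : V} {h : ℝ → W} {h' : W} (hf : HasLinDeriv f f' S t) (hh : HasLinDeriv h h' S t) :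
    HasLinDeriv (fun r => L (f r) (h r)) (L f' (h t) + L (f t) h') S t := by
  intro F
  let b := Module.finBasis ℝ V
  have e : ∀ v w, F (L v w) = ∑ i, b.coord i v * (F ∘ₗ L (b i)) w := fun v w => by
    conv_lhs => rw [← b.sum_repr v]
    simp only [map_sum, map_smul, LinearMap.sum_apply, LinearMap.smul_apply, smul_eq_mul,
      LinearMap.comp_apply, Module.Basis.coord_apply]
  rw [map_add]
  simp only [e, ← Finset.sum_add_distrib]
  exact HasDerivWithinAt.fun_sum fun i _ => (hf (b.coord i)).mul (hh (F ∘ₗ L (b i)))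

theorem HasLinDeriv.mem {f : ℝ → V} {f' : V} (h : HasLinDeriv f f' S t)
    (hS : UniqueDiffWithinAt ℝ S t) (ht : t ∈ S) {W : Submodule ℝ V} (hW : ∀ r ∈ S, f r ∈ W) :
    f' ∈ W := by
  by_contra hf
  obtain ⟨F, hF, hFW⟩ := Submodule.exists_le_ker_of_notMem hf
  have h1 : HasDerivWithinAt (fun r => F (f r)) 0 S t :=
    (hasDerivWithinAt_const t S (0 : ℝ)).congr (fun r hr => hFW (hW r hr)) (hFW (hW t ht))
  exact hF (hS.eq_deriv _ (h F) h1)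

theorem HasLinDeriv.eq_zero {f : ℝ → V} {f' : V} (h : HasLinDeriv f f' S t)
    (hS : UniqueDiffWithinAt ℝ S t) (ht : t ∈ S) (hf : ∀ r ∈ S, f r = 0) : f' = 0 :=
  (Submodule.mem_bot ℝ).1 (h.mem hS ht fun r hr => (Submodule.mem_bot ℝ).2 (hf r hr))

theorem exists_hasLinDeriv {κ : Type*} [Fintype κ] (b : Module.Basis κ ℝ V) {f : ℝ → V →ₗ[ℝ] W}
    (h : ∀ i, ∃ w, HasLinDeriv (fun r => f r (b i)) w S t) : ∃ f', HasLinDeriv f f' S t := by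
  choose w hw using h
  refine ⟨b.constr ℝ w, fun F => ?_⟩
  have e : ∀ L : V →ₗ[ℝ] W, F L = ∑ i, (F ∘ₗ LinearMap.smulRightₗ (b.coord i)) (L (b i)) := by
    intro L
    have : L = ∑ i, (b.coord i).smulRight (L (b i)) := by
      refine LinearMap.ext fun v => ?_
      conv_lhs => rw [← b.sum_repr v, map_sum]
      rw [LinearMap.sum_apply]
      exact Finset.sum_congr rfl fun i _ => map_smul L _ _
    conv_lhs => rw [this]
    rw [map_sum]
    rfl
  simp only [e, Module.Basis.constr_basis]
  exact HasDerivWithinAt.fun_sum fun i _ => hw i _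

theorem hasLinDeriv_add_smul (a b : V) : HasLinDeriv (fun r : ℝ => a + r • b) b S t := by
  intro F
  simp only [map_add, map_smul, smul_eq_mul]
  simpa using ((hasDerivWithinAt_id t S).mul_const (F b)).const_add (F a)

/-- If `X` commutes with `s` and the first variation of the traces of all powers vanishes, then these
traces have derivative zero. -/
theorem hasDerivWithinAt_trace_pow [FiniteDimensional ℝ V] (s : Module.End ℝ V)
    {X : ℝ → Module.End ℝ V} {X' : Module.End ℝ V} (hX : HasLinDeriv X X' S t)
    (hs : X t * s = s * X t) (h : ∀ k, LinearMap.trace ℝ V (s * (X t ^ k * X')) = 0) (n : ℕ) :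
    HasDerivWithinAt (fun r => LinearMap.trace ℝ V (s * X r ^ n)) 0 S t := by
  have key : ∀ n, ∃ Y, HasLinDeriv (fun r => X r ^ n) Y S t ∧
      ∀ m, LinearMap.trace ℝ V (s * (X t ^ m * Y)) = 0 := by
    intro n
    induction n with
    | zero => exact ⟨0, hasLinDeriv_const _, fun m => by rw [mul_zero, mul_zero, map_zero]⟩
    | succ n ih =>
      obtain ⟨Y, hY, hY'⟩ := ih
      refine ⟨X' * X t ^ n + X t * Y, ?_, fun m => ?_⟩
      · have := hX.bilin (LinearMap.mul ℝ (Module.End ℝ V)) hY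
        simp only [LinearMap.mul_apply'] at this
        simp only [pow_succ']
        exact this
      · have hs' : X t ^ n * s = s * X t ^ n := ((show Commute (X t) s from hs).pow_left n).eq
        have e : X t ^ m * (X' * X t ^ n + X t * Y) = X t ^ m * X' * X t ^ n + X t ^ (m + 1) * Y := by
          rw [mul_add, pow_succ, mul_assoc, mul_assoc]
        rw [e, mul_add, map_add, hY', add_zero, ← trace_mul_swap_of_even hs',
          ← mul_assoc (X t ^ n), ← pow_add, h]
  obtain ⟨Y, hY, hY'⟩ := key n
  have h1 := hY (LinearMap.trace ℝ V ∘ₗ LinearMap.mulLeft ℝ s)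
  have h2 := hY' 0
  rw [pow_zero, one_mul] at h2
  simp only [LinearMap.comp_apply, LinearMap.mulLeft_apply, h2] at h1
  exact h1

end LinDeriv

section ChernSimons

variable {C : Type*} [Ring C] [Algebra ℝ C] {𝒞 : ℕ → Submodule ℝ C} [GradedAlgebra 𝒞]
variable {g : Type*} [LieRing g] [LieAlgebra ℝ g]
variable {D : DGFrobenius 𝒞}

namespace DGFrobenius

/-- The velocity of a path of induction data through homomorphisms is a variation. -/
theorem isVariation_of_path [FiniteDimensional ℝ C] {ι : ℝ → D.Cohomology →ₗ[ℝ] C}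
    {K : ℝ → C →ₗ[ℝ] C} {S : Set ℝ} {t : ℝ} (h : ∀ r ∈ S, D.IsInductionData (ι r) (K r) ∧
      D.IsAlgHom (ι r)) (hS : UniqueDiffWithinAt ℝ S t) (ht : t ∈ S)
    {δι : D.Cohomology →ₗ[ℝ] C} {δK : C →ₗ[ℝ] C} (hι : HasLinDeriv ι δι S t)
    (hK : HasLinDeriv K δK S t) : D.IsVariation (ι t) (K t) δι δK := by
  have hιx : ∀ x, HasLinDeriv (fun r => ι r x) (δι x) S t := fun x =>
    hι.map (LinearMap.applyₗ x)
  have hKx : ∀ x, HasLinDeriv (fun r => K r x) (δK x) S t := fun x =>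
    hK.map (LinearMap.applyₗ x)
  have hKf : ∀ {f : ℝ → C} {f' : C}, HasLinDeriv f f' S t →
      HasLinDeriv (fun r => K r (f r)) (δK (f t) + K t f') S t := fun hf =>
    hK.bilin LinearMap.id hf
  refine ⟨fun x hx => ?_, fun x => ?_, fun x => ?_, fun a => ?_, fun a b => ?_⟩
  · exact (hιx x).mem hS ht fun r hr => (h r hr).1.ι_mem 1 x hx
  · have h1 := (hιx x).sub (hasLinDeriv_const (S := S) (t := t) (ι t x))
    rw [sub_zero] at h1
    refine h1.mem hS ht fun r hr => ?_
    obtain ⟨z, rfl⟩ := Submodule.mkQ_surjective _ x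
    obtain ⟨y, hy⟩ := (h r hr).1.ι_rep z
    obtain ⟨y', hy'⟩ := (h t ht).1.ι_rep z
    rw [cls] at hy hy'
    exact ⟨y - y', by rw [hy, hy', map_sub, add_sub_add_left_eq_sub]⟩
  · exact (hKf (hιx x)).eq_zero hS ht fun r hr => (h r hr).1.K_ι x
  · have h1 := (hKf (hKx a)).eq_zero hS ht fun r hr => (h r hr).1.K_K a
    have h2 := ((hKf ((hKx a).map D.d)).sub (hKx a)).eq_zero hS ht fun r hr =>
      sub_eq_zero.2 ((h r hr).1.K_d_K a)
    have h3 := (h t ht).1.homotopy_mem (δK a)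
    have e : D.d (δK (K t a)) + δK (D.d (K t a)) =
        δK a - (D.d (K t (δK a)) + K t (D.d (δK a))) := by
      rw [eq_neg_of_add_eq_zero_left h1, map_neg, ← sub_eq_zero, ← h2]
      abel
    rwa [e]
  · have h1 := ((hιx (D.cls ⟨a * b, D.mul_mem_cocycles a.2 b.2⟩)).sub
      ((hιx (D.cls a)).bilin (LinearMap.mul ℝ C) (hιx (D.cls b)))).eq_zero hS ht fun r hr =>
        sub_eq_zero.2 ((h r hr).2.map_mul a b)
    exact sub_eq_zero.1 h1

end DGFrobenius

namespace FieldCoords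

variable {I P A : Type*} (X : FieldCoords D g I P A)
variable {B : LinearMap.BilinForm ℝ g} (hB : IsQuadratic B)
variable [Fintype I] [Fintype P] [Fintype A] [DecidableEq I] [DecidableEq A]
variable {ι δι : D.Cohomology →ₗ[ℝ] C} {K δK : C →ₗ[ℝ] C}

/-! ### The Maurer--Cartan set -/

include hB in
/-- The Maurer--Cartan equations say that `ι(α)` is a flat field. -/
theorem bracket_point_eq_zero (h0 : D.IsInductionData ι K) (h1 : D.IsAlgHom ι) {α : X.P1 × A → ℝ}
    (hα : X.IsMaurerCartan ι α) : tensorBracket g C (LinearMap.lTensor g ι (X.point α))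
      (LinearMap.lTensor g ι (X.point α)) = 0 := by
  have hv : LinearMap.lTensor g ι (X.point α) = ∑ j, X.gCoord α j ⊗ₜ[ℝ] ι (X.bH j) := by
    rw [point, map_sum]
    rfl
  -- by non-degeneracy of the pairing on `g ⊗ C`, it suffices to pair with all vectors
  refine X.eq_zero_of_tensorPair hB fun w => ?_
  induction w using TensorProduct.induction_on with
  | zero => simp
  | add w₁ w₂ e₁ e₂ => rw [map_add, LinearMap.add_apply, e₁, e₂, add_zero]
  | tmul y c =>
    obtain ⟨x, hx⟩ := h0.homotopy_mem c
    -- only the component of `c` along the representatives matters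
    have e1 : ∀ j k : X.P1, D.pair c (ι (X.bH j) * ι (X.bH k)) =
        ∑ p, X.bH.repr x p * D.pair (ι (X.bH p)) (ι (X.bH j) * ι (X.bH k)) := by
      intro j k
      have e2 : ι (X.bH j) * ι (X.bH k) = D.proj K (ι (X.bH j) * ι (X.bH k)) := by
        obtain ⟨a, ha⟩ := Submodule.mkQ_surjective _ (X.bH j)
        obtain ⟨b, hb⟩ := Submodule.mkQ_surjective _ (X.bH k)
        have := h1.map_mul a b
        rw [DGFrobenius.cls, ha, hb] at this
        rw [← this, h0.proj_ι]
      have e3 : ι x = ∑ p, X.bH.repr x p • ι (X.bH p) := by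
        conv_lhs => rw [← X.bH.sum_repr x]
        simp only [map_sum, map_smul]
      rw [e2, ← h0.pair_proj, DGFrobenius.proj_apply, ← hx, ← e2, e3, map_sum, LinearMap.sum_apply]
      simp only [map_smul, LinearMap.smul_apply, smul_eq_mul]
    have e4 : ∀ p, ∑ j : X.P1, ∑ k : X.P1, B y ⁅X.gCoord α j, X.gCoord α k⁆ *
        D.pair (ι (X.bH p)) (ι (X.bH j) * ι (X.bH k)) = 0 := by
      intro p
      by_cases hp : X.degH p = 1
      · have := congrArg (B y) (hα ⟨p, hp⟩)
        simpa only [map_sum, map_smul, smul_eq_mul, map_zero, mul_comm] using this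
      · refine Finset.sum_eq_zero fun j _ => Finset.sum_eq_zero fun k _ => ?_
        by_contra hne
        have hjk : ι (X.bH j) * ι (X.bH k) ∈ 𝒞 (1 + 1) := by
          have hj := h0.ι_mem _ _ (X.bH_mem j)
          have hk := h0.ι_mem _ _ (X.bH_mem k)
          rw [j.2] at hj
          rw [k.2] at hk
          exact SetLike.mul_mem_graded hj hk
        have := D.pair_deg _ _ _ _ (h0.ι_mem _ _ (X.bH_mem p)) hjk (right_ne_zero_of_mul hne)
        omega
    rw [hv]
    have e5 : tensorPair D B (y ⊗ₜ[ℝ] c) (tensorBracket g C (∑ j, X.gCoord α j ⊗ₜ[ℝ] ι (X.bH j))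
        (∑ k, X.gCoord α k ⊗ₜ[ℝ] ι (X.bH k))) = ∑ j : X.P1, ∑ k : X.P1,
          B y ⁅X.gCoord α j, X.gCoord α k⁆ * D.pair c (ι (X.bH j) * ι (X.bH k)) := by
      rw [map_sum (tensorBracket g C), LinearMap.sum_apply, map_sum]
      refine Finset.sum_congr rfl fun j _ => ?_
      rw [map_sum, map_sum]
      exact Finset.sum_congr rfl fun k _ => by rw [tensorBracket_tmul, tensorPair_tmul]
    have e6 : ∀ j k : X.P1, B y ⁅X.gCoord α j, X.gCoord α k⁆ *
        D.pair c (ι (X.bH j) * ι (X.bH k)) = ∑ p, X.bH.repr x p *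
          (B y ⁅X.gCoord α j, X.gCoord α k⁆ * D.pair (ι (X.bH p)) (ι (X.bH j) * ι (X.bH k))) := by
      intro j k
      rw [e1, Finset.mul_sum]
      exact Finset.sum_congr rfl fun p _ => mul_left_comm _ _ _
    have e7 : ∀ F : X.P1 → X.P1 → P → ℝ, ∑ j, ∑ k, ∑ p, F j k p = ∑ p, ∑ j, ∑ k, F j k p := by
      intro F
      rw [Finset.sum_comm (s := (Finset.univ : Finset P))]
      exact Finset.sum_congr rfl fun j _ => Finset.sum_comm
    rw [e5]
    simp only [e6]
    rw [e7]
    simp only [← Finset.mul_sum, e4, mul_zero, Finset.sum_const_zero]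

/-! ### Invariance of the one-loop part -/

include hB in
/-- On the Maurer--Cartan set, the supertrace of the logarithm is stationary along any path whose
velocity is a variation. -/
theorem hasDerivWithinAt_strLog {ι : ℝ → D.Cohomology →ₗ[ℝ] C} {K : ℝ → C →ₗ[ℝ] C} {S : Set ℝ}
    {t : ℝ} (h0 : D.IsInductionData (ι t) (K t)) (h1 : D.IsAlgHom (ι t))
    (h : D.IsVariation (ι t) (K t) δι δK) (hι : HasLinDeriv ι δι S t) (hK : HasLinDeriv K δK S t)
    {α : X.P1 × A → ℝ} (hα : tensorBracket g C (LinearMap.lTensor g (ι t) (X.point α))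
      (LinearMap.lTensor g (ι t) (X.point α)) = 0) (n : ℕ) :
    HasDerivWithinAt (fun r => 1 / 2 * PowerSeries.coeff n
      (strLog 𝒞 (wheelOp (ι r) (K r) (X.point α)))) 0 S t := by
  have := Module.Finite.of_basis X.bg
  have := Module.Finite.of_basis X.bC
  have := Module.Finite.of_basis X.bH
  have hu := X.lTensor_point_mem h0.ι_mem α
  have hu' : LinearMap.lTensor g δι (X.point α) ∈ tensorDeg g 𝒞 1 := by
    rw [point, map_sum]
    refine Submodule.sum_mem _ fun p _ => ?_
    rw [LinearMap.lTensor_tmul]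
    refine tmul_mem_tensorDeg _ (h.ι_mem _ ?_)
    have := X.bH_mem p
    rwa [p.2] at this
  have hX : HasLinDeriv (fun r => wheelOp (ι r) (K r) (X.point α))
      (LinearMap.lTensor g δK * tensorBracket g C (LinearMap.lTensor g (ι t) (X.point α)) +
        LinearMap.lTensor g (K t) * tensorBracket g C (LinearMap.lTensor g δι (X.point α))) S t :=
    hK.bilin ((LinearMap.mul ℝ (Module.End ℝ (g ⊗[ℝ] C))).compl₁₂ (LinearMap.lTensorHom g)
      (tensorBracket g C ∘ₗ (LinearMap.lTensorHom g).flip (X.point α))) hι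
  have hw := X.isWheelHomotopy hB h0 h1 hu hα
  have key := hasDerivWithinAt_trace_pow (tensorSign g 𝒞) hX hw.KT_even
    (X.superTrace_variation hB h0 h1 h hu hu' hα) n
  simp only [strLog, PowerSeries.coeff_mk]
  rcases n with _ | n
  · simpa using hasDerivWithinAt_const t S (0 : ℝ)
  · simp only [if_neg (Nat.succ_ne_zero n)]
    have := (key.const_mul ((-1 : ℝ) ^ (n + 1 + 1) / ((n + 1 : ℕ) : ℝ))).const_mul (1 / 2 : ℝ)
    exact this.congr_deriv (by simp)

include hB in
/-- The one-loop part and the supertrace have the same derivative at `0`, and that of the latter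
vanishes. -/
theorem hasDerivAt_loopPart (h0 : D.IsInductionData ι K) (h1 : D.IsAlgHom ι)
    (h : D.IsInfinitesimalDeformation ι K δι δK) {α : X.P1 × A → ℝ} (hα : X.IsMaurerCartan ι α)
    (n : ℕ) : HasDerivAt (fun ε : ℝ =>
      MvPolynomial.eval α (X.loopPart B (ι + ε • δι) (K + ε • δK) 1 n)) 0 0 := by
  obtain ⟨-, a, ha, ha'⟩ := X.loopPart_one_mem_sameJet hB h0 h1 h α n
  have e1 : ι + (0 : ℝ) • δι = ι := by rw [zero_smul, add_zero]
  have e2 : K + (0 : ℝ) • δK = K := by rw [zero_smul, add_zero]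
  have hd := X.hasDerivWithinAt_strLog hB (ι := fun ε => ι + ε • δι) (K := fun ε => K + ε • δK)
    (t := 0) (S := Set.univ) (δι := δι) (δK := δK) (by simpa only [e1, e2] using h0)
    (by simpa only [e1] using h1) (by simpa only [e1, e2] using h.isVariation h0)
    (hasLinDeriv_add_smul _ _) (hasLinDeriv_add_smul _ _)
    (α := α) (by simpa only [e1] using X.bracket_point_eq_zero hB h0 h1 hα) n
  rw [hasDerivWithinAt_univ] at hd
  rwa [ha'.unique hd] at ha

include hB in
/-- The one-loop part has vanishing derivative along the whole path, for a fixed point of the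
Maurer--Cartan set. -/
theorem eval_loopPart_eq {ι : ℝ → D.Cohomology →ₗ[ℝ] C} {K : ℝ → C →ₗ[ℝ] C}
    (h : ∀ t ∈ Set.Icc (0 : ℝ) 1, D.IsInductionData (ι t) (K t) ∧ D.IsAlgHom (ι t))
    (hι : ∀ x i, DifferentiableOn ℝ (fun t => X.bC.repr (ι t x) i) (Set.Icc 0 1))
    (hK : ∀ c i, DifferentiableOn ℝ (fun t => X.bC.repr (K t c) i) (Set.Icc 0 1))
    {s : ℝ} (hs : s ∈ Set.Icc (0 : ℝ) 1) {t : ℝ} (ht : t ∈ Set.Icc (0 : ℝ) 1)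
    {α : X.P1 × A → ℝ} (hα : X.IsMaurerCartan (ι s) α) (n : ℕ) :
    MvPolynomial.eval α (X.loopPart B (ι s) (K s) 1 n) =
      MvPolynomial.eval α (X.loopPart B (ι t) (K t) 1 n) := by
  have := Module.Finite.of_basis X.bC
  have e1 : ∀ r ∈ Set.Icc (0 : ℝ) 1, MvPolynomial.eval α (X.loopPart B (ι r) (K r) 1 n) =
      1 / 2 * PowerSeries.coeff n (strLog 𝒞 (wheelOp (ι r) (K r) (X.point α))) := by
    intro r hr
    have := congrArg (PowerSeries.coeff n) (X.loopPart_one_eq_strLog hB (h r hr).1 (h r hr).2 α)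
    rwa [PowerSeries.coeff_mk, map_smul, smul_eq_mul] at this
  -- the Maurer--Cartan set does not depend on the representatives
  have hMC : ∀ r ∈ Set.Icc (0 : ℝ) 1, tensorBracket g C (LinearMap.lTensor g (ι r) (X.point α))
      (LinearMap.lTensor g (ι r) (X.point α)) = 0 := by
    intro r hr
    obtain ⟨p, hp⟩ := (h s hs).1.exists_retraction
    rw [← DGFrobenius.IsInductionData.transport_bracket (h s hs).2 (h r hr).2 hp,
      X.bracket_point_eq_zero hB (h s hs).1 (h s hs).2 hα, map_zero]
  have hd : ∀ r ∈ Set.Icc (0 : ℝ) 1, HasDerivWithinAt (fun r => 1 / 2 * PowerSeries.coeff n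
      (strLog 𝒞 (wheelOp (ι r) (K r) (X.point α)))) 0 (Set.Icc 0 1) r := by
    intro r hr
    have hex : ∀ {f : ℝ → C}, (∀ i, DifferentiableOn ℝ (fun t => X.bC.repr (f t) i) (Set.Icc 0 1)) →
        ∃ w, HasLinDeriv f w (Set.Icc 0 1) r := by
      intro f hf
      refine ⟨∑ i, derivWithin (fun t => X.bC.repr (f t) i) (Set.Icc 0 1) r • X.bC i,
        hasLinDeriv_of_basis X.bC fun i => ?_⟩
      rw [Module.Basis.repr_sum_self]
      exact (hf i r hr).hasDerivWithinAt
    obtain ⟨δι, hδι⟩ := exists_hasLinDeriv X.bH (f := ι) (S := Set.Icc 0 1) (t := r)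
      fun p => hex (hι (X.bH p))
    obtain ⟨δK, hδK⟩ := exists_hasLinDeriv X.bC (f := K) (S := Set.Icc 0 1) (t := r)
      fun i => hex (hK (X.bC i))
    exact X.hasDerivWithinAt_strLog hB (h r hr).1 (h r hr).2
      (DGFrobenius.isVariation_of_path h (uniqueDiffOn_Icc zero_lt_one r hr) hr hδι hδK) hδι hδK
      (hMC r hr) n
  have hconst := constant_of_derivWithin_zero (a := 0) (b := 1)
    (fun r hr => (hd r hr).differentiableWithinAt)
    (fun r hr => (hd r ⟨hr.1, hr.2.le⟩).derivWithin
      (uniqueDiffOn_Icc zero_lt_one r ⟨hr.1, hr.2.le⟩))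
  rw [e1 s hs, e1 t ht, hconst s hs, hconst t ht]

end FieldCoords

end ChernSimons

/-! ### Contractions in a basis -/

/-- Summing over a basis the values of a functional `F` against the coordinates of vectors `c n`
replaces the basis vectors by the `c n`. The sign factors `σ` are carried along; they only have to
agree on the supports. -/
theorem sum_smul_contract {κ J V R R' : Type*} [Fintype κ] [Fintype J] [AddCommGroup V] [Module ℝ V]
    [AddCommGroup R] [Module ℝ R] [AddCommGroup R'] [Module ℝ R'] (b : Module.Basis κ ℝ V)
    (c : J → V) (F : V →ₗ[ℝ] ℝ) {σ : κ → ℝ} {σ' : J → ℝ}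
    (hσ : ∀ n k, b.repr (c n) k ≠ 0 → σ k = σ' n) (Y : R →ₗ[ℝ] R') (u : J → R) :
    ∑ k, (σ k * F (b k)) • Y (∑ n, b.repr (c n) k • u n) = ∑ n, (σ' n * F (c n)) • Y (u n) := by
  simp only [map_sum, map_smul, Finset.smul_sum, smul_smul]
  rw [Finset.sum_comm]
  refine Finset.sum_congr rfl fun n _ => ?_
  rw [← Finset.sum_smul]
  congr 1
  conv_rhs => rw [← b.sum_repr (c n)]
  simp only [map_sum, map_smul, smul_eq_mul, Finset.mul_sum]
  refine Finset.sum_congr rfl fun k _ => ?_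
  by_cases h : b.repr (c n) k = 0
  · simp [h]
  · rw [hσ n k h]
    ring

theorem sum_rotate {I A R : Type*} [Fintype I] [Fintype A] [AddCommMonoid R]
    (F : I → I → I → A → A → A → R) :
    ∑ i, ∑ j, ∑ k, ∑ a, ∑ b, ∑ c, F i j k a b c = ∑ a, ∑ b, ∑ c, ∑ i, ∑ j, ∑ k, F i j k a b c := by
  have := Finset.sum_comm (s := (Finset.univ : Finset (I × I × I)))
    (t := (Finset.univ : Finset (A × A × A)))
    (f := fun p q => F p.1 p.2.1 p.2.2 q.1 q.2.1 q.2.2)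
  simpa only [Fintype.sum_prod_type] using this

section ChernSimons

variable {C : Type*} [Ring C] [Algebra ℝ C] {𝒞 : ℕ → Submodule ℝ C} [GradedAlgebra 𝒞]
variable {g : Type*} [LieRing g] [LieAlgebra ℝ g]
variable {D : DGFrobenius 𝒞}

namespace FieldCoords

variable {I P A : Type*} (X : FieldCoords D g I P A)
variable (B : LinearMap.BilinForm ℝ g)

/-! ### Supports of homogeneous elements -/

theorem degC_of_repr_ne_zero {n : ℕ} {c : C} (hc : c ∈ 𝒞 n) {i : I} (h : X.bC.repr c i ≠ 0) :
    X.degC i = n := by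
  by_contra hne
  have h1 : X.bC.coord i ∘ₗ GradedAlgebra.proj 𝒞 (X.degC i) = X.bC.coord i := by
    refine X.bC.ext fun j => ?_
    rw [LinearMap.comp_apply, GradedAlgebra.proj_apply]
    by_cases hj : X.degC j = X.degC i
    · rw [← hj, DirectSum.decompose_of_mem_same 𝒞 (X.bC_mem j)]
    · rw [DirectSum.decompose_of_mem_ne 𝒞 (X.bC_mem j) hj, map_zero, Module.Basis.coord_apply,
        X.bC.repr_self, Finsupp.single_eq_of_ne]
      rintro rfl
      exact hj rfl
  have h2 := LinearMap.congr_fun h1 c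
  rw [LinearMap.comp_apply, GradedAlgebra.proj_apply,
    DirectSum.decompose_of_mem_ne 𝒞 hc (Ne.symm hne), map_zero] at h2
  exact h h2.symm

theorem degC_of_tensorBasis_repr_ne_zero {n : ℕ} {v : g ⊗[ℝ] C} (hv : v ∈ tensorDeg g 𝒞 n)
    {x : I × A} (h : X.tensorBasis.repr v x ≠ 0) : X.degC x.1 = n := by
  by_contra hne
  refine h (eq_of_mem_tensorDeg (F := X.tensorBasis.coord x) (G := 0) (fun y c hc => ?_) hv)
  rw [Module.Basis.coord_apply, tensorBasis_repr_tmul, LinearMap.zero_apply]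
  by_contra h1
  exact hne (X.degC_of_repr_ne_zero hc (right_ne_zero_of_mul h1))

variable [Fintype I] [Fintype P] [Fintype A] [DecidableEq I] [DecidableEq A]

variable {B} in
/-- The inverse of the Gram matrix pairs complementary degrees. -/
theorem degC_add_of_gram_inv_ne_zero (hB : IsQuadratic B) {x y : I × A}
    (h : (X.gram B)⁻¹ x y ≠ 0) : X.degC x.1 + X.degC y.1 = 3 := by
  -- conjugation by the matrix `2 ^ deg` multiplies the Gram matrix by `2 ^ 3`, hence its inverse by
  -- `2 ^ (-3)`
  set E : Matrix (I × A) (I × A) ℝ := Matrix.diagonal fun x => (2 : ℝ)⁻¹ ^ X.degC x.1 with hE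
  set F : Matrix (I × A) (I × A) ℝ := Matrix.diagonal fun x => (2 : ℝ) ^ X.degC x.1 with hF
  have h1 : F * X.gram B * F = (8 : ℝ) • X.gram B := by
    ext x y
    rw [hF, Matrix.mul_diagonal, Matrix.diagonal_mul, Matrix.smul_apply, smul_eq_mul]
    by_cases h0 : X.gram B x y = 0
    · rw [h0]; ring
    · have h2 : X.degC x.1 + X.degC y.1 = 3 := by
        rw [gram, Matrix.of_apply, tensorBasis_apply, tensorBasis_apply, tensorPair_tmul] at h0
        exact D.pair_deg _ _ _ _ (X.bC_mem _) (X.bC_mem _) (right_ne_zero_of_mul h0)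
      have h3 : (2 : ℝ) ^ X.degC x.1 * 2 ^ X.degC y.1 = 8 := by
        rw [← pow_add, h2]; norm_num
      rw [mul_right_comm, h3]
  have h2 : F * E = 1 := by
    rw [hF, hE, Matrix.diagonal_mul_diagonal, ← Matrix.diagonal_one]
    congr 1
    ext x
    rw [← mul_pow]
    norm_num
  have h3 : (X.gram B)⁻¹ = (8 : ℝ) • (E * (X.gram B)⁻¹ * E) := by
    refine Matrix.inv_eq_right_inv ?_
    rw [Matrix.mul_smul, ← Matrix.smul_mul, ← h1]
    calc F * X.gram B * F * (E * (X.gram B)⁻¹ * E)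
        = F * (X.gram B * ((F * E) * (X.gram B)⁻¹)) * E := by simp only [Matrix.mul_assoc]
      _ = 1 := by rw [h2, Matrix.one_mul, X.gram_mul_inv hB, Matrix.mul_one, h2]
  have h4 := congrFun (congrFun h3 x) y
  rw [Matrix.smul_apply, hE, Matrix.mul_diagonal, Matrix.diagonal_mul, smul_eq_mul] at h4
  have h5 : (8 : ℝ) * ((2 : ℝ)⁻¹ ^ (X.degC x.1 + X.degC y.1)) = 1 := by
    refine mul_right_cancel₀ h ?_
    rw [one_mul]
    conv_rhs => rw [h4]
    rw [pow_add]
    ring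
  have h6 : (2 : ℝ) ^ (X.degC x.1 + X.degC y.1) = 2 ^ 3 := by
    rw [inv_pow, mul_inv_eq_one₀ (by positivity)] at h5
    rw [← h5]
    norm_num
  exact pow_right_injective₀ (by norm_num) (by norm_num) h6

variable {B} in
/-- The propagator joins coordinates whose degrees add up to `2`, since `K` lowers the degree by
one. -/
theorem degC_add_of_bivector_ne_zero (hB : IsQuadratic B) {K : C →ₗ[ℝ] C} (hK : D.IsSymmLowering K)
    {x y : I × A} (h : X.bivector B K x y ≠ 0) : X.degC x.1 + X.degC y.1 = 2 := by
  rw [X.bivector_eq hB, Matrix.neg_apply, neg_ne_zero, Matrix.mul_apply] at h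
  obtain ⟨z, -, hz⟩ := Finset.exists_ne_zero_of_sum_ne_zero h
  have h1 := X.degC_add_of_gram_inv_ne_zero hB (right_ne_zero_of_mul hz)
  have h2 := left_ne_zero_of_mul hz
  rw [opMatrix_apply, tensorBasis_apply, LinearMap.lTensor_tmul] at h2
  rcases h3 : X.degC z.1 with _ | n
  · rw [hK.zero _ (h3 ▸ X.bC_mem z.1)] at h2
    simp at h2
  · have h4 := X.degC_of_tensorBasis_repr_ne_zero (tmul_mem_tensorDeg (X.bg z.2)
      (hK.mem n _ (h3 ▸ X.bC_mem z.1))) h2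
    omega

/-! ### Cubic vertices -/

/-- The coordinate indices attached to a basis vector of `H^•(C)` or of `C`. -/
def coordIndex : P ⊕ I → A → (P × A) ⊕ (I × A)
  | .inl p, a => .inl (p, a)
  | .inr i, a => .inr (i, a)

/-- The degree of a basis vector of `H^•(C)` or of `C`. -/
def degSum : P ⊕ I → ℕ := Sum.elim X.degH X.degC

/-- The components of a field of the form `∑ c_j u^j`, where `u^j` runs over all coordinates. -/
def linearField (c : P ⊕ I → C) (i : I) (a : A) : X.FunTot :=
  ∑ j, X.bC.repr (c j) i • SFun.coord _ (coordIndex j a)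

/-- The cubic polynomial with weights `q` in the directions of `C` and with the structure constants
of `g`. -/
def vertex (q : P ⊕ I → P ⊕ I → P ⊕ I → ℝ) : X.FunTot :=
  ∑ a, ∑ b, ∑ c, ∑ j, ∑ k, ∑ l, (q j k l * B (X.bg a) ⁅X.bg b, X.bg c⁆) •
    (SFun.coord _ (coordIndex j a) * SFun.coord _ (coordIndex k b) * SFun.coord _ (coordIndex l c))

/-- The weights of the cubic term of the action on the field `∑ c_j u^j`. -/
def vertexWeight (c : P ⊕ I → C) (j k l : P ⊕ I) : ℝ :=
  1 / 6 * ((-1) ^ (X.degSum k * (X.degSum l + 1)) * D.pair (c j) (c k * c l))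

theorem vertex_sub (q q' : P ⊕ I → P ⊕ I → P ⊕ I → ℝ) :
    X.vertex B (fun j k l => q j k l - q' j k l) = X.vertex B q - X.vertex B q' := by
  simp only [vertex, ← Finset.sum_sub_distrib]
  refine Finset.sum_congr rfl fun a _ => Finset.sum_congr rfl fun b _ =>
    Finset.sum_congr rfl fun c _ => Finset.sum_congr rfl fun j _ => Finset.sum_congr rfl fun k _ =>
    Finset.sum_congr rfl fun l _ => ?_
  rw [sub_mul]
  exact sub_smul (M := X.FunTot) (_ : ℝ) _ _

/-- The cubic term of the action on a field that is linear in the coordinates. -/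
theorem cubicTerm_linearField {c : P ⊕ I → C} (hc : ∀ j, c j ∈ 𝒞 (X.degSum j)) :
    X.cubicTerm B (X.linearField c) = X.vertex B (X.vertexWeight c) := by
  rw [cubicTerm, sum_rotate, vertex]
  simp only [Finset.smul_sum (r := (1 / 6 : ℝ)) (s := (Finset.univ : Finset A))]
  refine Finset.sum_congr rfl fun a _ => Finset.sum_congr rfl fun b _ =>
    Finset.sum_congr rfl fun e _ => ?_
  have hdeg : ∀ n k, X.bC.repr (c n) k ≠ 0 → X.degC k = X.degSum n := fun n k h =>
    X.degC_of_repr_ne_zero (hc n) h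
  have h3 : ∀ i j, ∑ k, ((-1 : ℝ) ^ (X.degC j * (X.degC k + 1)) * B (X.bg a) ⁅X.bg b, X.bg e⁆ *
      D.pair (X.bC i) (X.bC j * X.bC k)) • (X.linearField c i a * X.linearField c j b *
        X.linearField c k e) = ∑ l, ((-1 : ℝ) ^ (X.degC j * (X.degSum l + 1)) *
          B (X.bg a) ⁅X.bg b, X.bg e⁆ * D.pair (X.bC i) (X.bC j * c l)) •
        (X.linearField c i a * X.linearField c j b * SFun.coord _ (coordIndex l e)) := by
    intro i j
    exact sum_smul_contract X.bC c (D.pair (X.bC i) ∘ₗ LinearMap.mulLeft ℝ (X.bC j))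
      (σ := fun k => (-1 : ℝ) ^ (X.degC j * (X.degC k + 1)) * B (X.bg a) ⁅X.bg b, X.bg e⁆)
      (σ' := fun l => (-1 : ℝ) ^ (X.degC j * (X.degSum l + 1)) * B (X.bg a) ⁅X.bg b, X.bg e⁆)
      (fun n k h => by rw [hdeg n k h])
      (LinearMap.mulLeft ℝ (X.linearField c i a * X.linearField c j b)) _
  have h2 : ∀ i l, ∑ j, ((-1 : ℝ) ^ (X.degC j * (X.degSum l + 1)) *
      B (X.bg a) ⁅X.bg b, X.bg e⁆ * D.pair (X.bC i) (X.bC j * c l)) •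
        (X.linearField c i a * X.linearField c j b * SFun.coord _ (coordIndex l e)) =
      ∑ k, ((-1 : ℝ) ^ (X.degSum k * (X.degSum l + 1)) *
      B (X.bg a) ⁅X.bg b, X.bg e⁆ * D.pair (X.bC i) (c k * c l)) •
        (X.linearField c i a * SFun.coord _ (coordIndex k b) * SFun.coord _ (coordIndex l e)) := by
    intro i l
    exact sum_smul_contract X.bC c (D.pair (X.bC i) ∘ₗ LinearMap.mulRight ℝ (c l))
      (σ := fun j => (-1 : ℝ) ^ (X.degC j * (X.degSum l + 1)) * B (X.bg a) ⁅X.bg b, X.bg e⁆)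
      (σ' := fun k => (-1 : ℝ) ^ (X.degSum k * (X.degSum l + 1)) * B (X.bg a) ⁅X.bg b, X.bg e⁆)
      (fun n k h => by rw [hdeg n k h])
      (LinearMap.mulRight ℝ (SFun.coord _ (coordIndex l e)) ∘ₗ
        LinearMap.mulLeft ℝ (X.linearField c i a)) _
  have h1 : ∀ k l, ∑ i, ((-1 : ℝ) ^ (X.degSum k * (X.degSum l + 1)) *
      B (X.bg a) ⁅X.bg b, X.bg e⁆ * D.pair (X.bC i) (c k * c l)) •
        (X.linearField c i a * SFun.coord _ (coordIndex k b) * SFun.coord _ (coordIndex l e)) =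
      ∑ j, ((-1 : ℝ) ^ (X.degSum k * (X.degSum l + 1)) *
      B (X.bg a) ⁅X.bg b, X.bg e⁆ * D.pair (c j) (c k * c l)) •
        (SFun.coord _ (coordIndex j a) * SFun.coord _ (coordIndex k b) *
          SFun.coord _ (coordIndex l e)) := by
    intro k l
    exact sum_smul_contract X.bC c (LinearMap.flip D.pair (c k * c l))
      (σ := fun _ => (-1 : ℝ) ^ (X.degSum k * (X.degSum l + 1)) * B (X.bg a) ⁅X.bg b, X.bg e⁆)
      (σ' := fun _ => (-1 : ℝ) ^ (X.degSum k * (X.degSum l + 1)) * B (X.bg a) ⁅X.bg b, X.bg e⁆)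
      (fun n k h => rfl)
      (LinearMap.mulRight ℝ (SFun.coord _ (coordIndex l e)) ∘ₗ
        LinearMap.mulRight ℝ (SFun.coord _ (coordIndex k b))) _
  have h4 : ∀ i, ∑ j, ∑ k, ((-1 : ℝ) ^ (X.degC j * (X.degC k + 1)) * B (X.bg a) ⁅X.bg b, X.bg e⁆ *
      D.pair (X.bC i) (X.bC j * X.bC k)) • (X.linearField c i a * X.linearField c j b *
        X.linearField c k e) = ∑ k, ∑ l, ((-1 : ℝ) ^ (X.degSum k * (X.degSum l + 1)) *
      B (X.bg a) ⁅X.bg b, X.bg e⁆ * D.pair (X.bC i) (c k * c l)) •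
        (X.linearField c i a * SFun.coord _ (coordIndex k b) *
          SFun.coord _ (coordIndex l e)) := by
    intro i
    simp only [h3]
    rw [Finset.sum_comm]
    simp only [h2]
    exact Finset.sum_comm
  simp only [h4]
  rw [Finset.sum_comm]
  have h5 : ∀ k, ∑ i, ∑ l, ((-1 : ℝ) ^ (X.degSum k * (X.degSum l + 1)) *
      B (X.bg a) ⁅X.bg b, X.bg e⁆ * D.pair (X.bC i) (c k * c l)) •
        (X.linearField c i a * SFun.coord _ (coordIndex k b) *
          SFun.coord _ (coordIndex l e)) = ∑ j, ∑ l, ((-1 : ℝ) ^ (X.degSum k * (X.degSum l + 1)) *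
      B (X.bg a) ⁅X.bg b, X.bg e⁆ * D.pair (c j) (c k * c l)) •
        (SFun.coord _ (coordIndex j a) * SFun.coord _ (coordIndex k b) *
          SFun.coord _ (coordIndex l e)) := by
    intro k
    rw [Finset.sum_comm]
    simp only [h1]
    exact Finset.sum_comm
  simp only [h5]
  rw [Finset.sum_comm]
  simp only [Finset.smul_sum, smul_smul, vertexWeight]
  refine Finset.sum_congr rfl fun j _ => Finset.sum_congr rfl fun k _ =>
    Finset.sum_congr rfl fun l _ => ?_
  congr 1
  ring

/-! ### Invariance of vertices under the adjoint action -/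

/-- The matrix of the infinitesimal adjoint action of `x` on the coordinates of `g ⊗ V`. -/
def adMatrix {J : Type*} [DecidableEq J] (x : g) : Matrix (J × A) (J × A) ℝ :=
  Matrix.of fun y z => if y.1 = z.1 then X.bg.repr ⁅x, X.bg y.2⁆ z.2 else 0

variable {B} in
/-- Vertices are invariant: the structure constants `B(x, [y, z])` form an invariant tensor. -/
theorem derivation_vertex (hB : IsQuadratic B) (x : g) {L : X.FunTot →ₗ[ℝ] X.FunTot}
    (hL : ∀ f h, L (f * h) = L f * h + f * L h)
    (hc : ∀ j a, L (SFun.coord _ (coordIndex j a)) =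
      ∑ b, X.bg.repr ⁅x, X.bg b⁆ a • SFun.coord _ (coordIndex j b))
    (q : P ⊕ I → P ⊕ I → P ⊕ I → ℝ) : L (X.vertex B q) = 0 := by
  rw [vertex, ← sum_rotate]
  simp only [map_sum, map_smul]
  refine Finset.sum_eq_zero fun j _ => Finset.sum_eq_zero fun k _ => Finset.sum_eq_zero fun l _ => ?_
  have h1 : ∀ b c, ∑ a, (q j k l * B (X.bg a) ⁅X.bg b, X.bg c⁆) •
      (L (SFun.coord _ (coordIndex j a)) * SFun.coord _ (coordIndex k b) *
        SFun.coord _ (coordIndex l c)) = ∑ a, (q j k l * B ⁅x, X.bg a⁆ ⁅X.bg b, X.bg c⁆) •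
      (SFun.coord (Sum.elim X.oddH X.oddC) (coordIndex j a) * SFun.coord _ (coordIndex k b) *
        SFun.coord _ (coordIndex l c)) := by
    intro b c
    simp only [hc]
    exact sum_smul_contract X.bg (fun a => ⁅x, X.bg a⁆) (LinearMap.flip B ⁅X.bg b, X.bg c⁆)
      (σ := fun _ => q j k l) (σ' := fun _ => q j k l) (fun _ _ _ => rfl)
      (LinearMap.mulRight ℝ (SFun.coord _ (coordIndex l c)) ∘ₗ
        LinearMap.mulRight ℝ (SFun.coord _ (coordIndex k b))) _
  have h2 : ∀ a c, ∑ b, (q j k l * B (X.bg a) ⁅X.bg b, X.bg c⁆) •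
      (SFun.coord _ (coordIndex j a) * L (SFun.coord _ (coordIndex k b)) *
        SFun.coord _ (coordIndex l c)) = ∑ b, (q j k l * B (X.bg a) ⁅⁅x, X.bg b⁆, X.bg c⁆) •
      (SFun.coord (Sum.elim X.oddH X.oddC) (coordIndex j a) * SFun.coord _ (coordIndex k b) *
        SFun.coord _ (coordIndex l c)) := by
    intro a c
    simp only [hc]
    exact sum_smul_contract X.bg (fun a => ⁅x, X.bg a⁆)
      (B (X.bg a) ∘ₗ LinearMap.flip (LieAlgebra.ad ℝ g : g →ₗ[ℝ] Module.End ℝ g) (X.bg c))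
      (σ := fun _ => q j k l) (σ' := fun _ => q j k l) (fun _ _ _ => rfl)
      (LinearMap.mulRight ℝ (SFun.coord _ (coordIndex l c)) ∘ₗ
        LinearMap.mulLeft ℝ (SFun.coord _ (coordIndex j a))) _
  have h3 : ∀ a b, ∑ c, (q j k l * B (X.bg a) ⁅X.bg b, X.bg c⁆) •
      (SFun.coord _ (coordIndex j a) * SFun.coord _ (coordIndex k b) *
        L (SFun.coord _ (coordIndex l c))) = ∑ c, (q j k l * B (X.bg a) ⁅X.bg b, ⁅x, X.bg c⁆⁆) •
      (SFun.coord (Sum.elim X.oddH X.oddC) (coordIndex j a) * SFun.coord _ (coordIndex k b) *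
        SFun.coord _ (coordIndex l c)) := by
    intro a b
    simp only [hc]
    exact sum_smul_contract X.bg (fun a => ⁅x, X.bg a⁆) (B (X.bg a) ∘ₗ LieAlgebra.ad ℝ g (X.bg b))
      (σ := fun _ => q j k l) (σ' := fun _ => q j k l) (fun _ _ _ => rfl)
      (LinearMap.mulLeft ℝ (SFun.coord _ (coordIndex j a) * SFun.coord _ (coordIndex k b))) _
  simp only [hL, add_mul, smul_add, Finset.sum_add_distrib, h3]
  have e1 : ∀ F : A → A → A → X.FunTot, ∑ a, ∑ b, ∑ c, F a b c = ∑ b, ∑ c, ∑ a, F a b c := by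
    intro F
    rw [Finset.sum_comm]
    exact Finset.sum_congr rfl fun b _ => Finset.sum_comm
  have e2 : ∀ F : A → A → A → X.FunTot, ∑ a, ∑ b, ∑ c, F a b c = ∑ a, ∑ c, ∑ b, F a b c :=
    fun F => Finset.sum_congr rfl fun a _ => Finset.sum_comm
  rw [e1 (fun a b c => _ • (L _ * _ * _)), e2 (fun a b c => _ • (_ * L _ * _))]
  simp only [h1, h2]
  rw [← e1 (fun a b c => (q j k l * B ⁅x, X.bg a⁆ ⁅X.bg b, X.bg c⁆) • _),
    ← e2 (fun a b c => (q j k l * B (X.bg a) ⁅⁅x, X.bg b⁆, X.bg c⁆) • _)]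
  simp only [← Finset.sum_add_distrib, ← add_smul, ← mul_add]
  refine Finset.sum_eq_zero fun a _ => Finset.sum_eq_zero fun b _ => Finset.sum_eq_zero fun c _ => ?_
  have e3 : B ⁅x, X.bg a⁆ ⁅X.bg b, X.bg c⁆ + B (X.bg a) ⁅⁅x, X.bg b⁆, X.bg c⁆ +
      B (X.bg a) ⁅X.bg b, ⁅x, X.bg c⁆⁆ = 0 := by
    rw [← lie_skew, map_neg, LinearMap.neg_apply, ← hB.invariant, add_assoc, ← map_add,
      ← leibniz_lie, neg_add_cancel]
  rw [e3, mul_zero, zero_smul]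

end FieldCoords

end ChernSimons

/-! ### Linear substitutions in the fluctuations -/

namespace SFun

variable {τ τ' : Type*} {odd : τ → Bool} {odd' : τ' → Bool} [Fintype τ] [Fintype τ']
  [DecidableEq τ]

/-- The linear substitution with matrix `T` in the variables of the second kind. -/
def substInr (odd : τ → Bool) (odd' : τ' → Bool) (T : Matrix τ' τ' ℝ) :
    SFun (τ ⊕ τ') (Sum.elim odd odd') →ₐ[ℝ] SFun (τ ⊕ τ') (Sum.elim odd odd') :=
  affineHom _ _ 0 (Matrix.fromBlocks 1 0 0 T)

variable {T : Matrix τ' τ' ℝ}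

theorem fromBlocks_parity (hT : IsEven odd' T) (y x : τ ⊕ τ')
    (h : (Matrix.fromBlocks 1 0 0 T : Matrix (τ ⊕ τ') (τ ⊕ τ') ℝ) y x ≠ 0) :
    Sum.elim odd odd' y = Sum.elim odd odd' x := by
  rcases x with x | x <;> rcases y with y | y
  · rw [Matrix.fromBlocks_apply₁₁, Matrix.one_apply] at h
    split_ifs at h with h1
    · rw [h1]
    · exact absurd rfl h
  · exact absurd rfl h
  · exact absurd rfl h
  · exact hT y x h

theorem substInr_coord (hT : IsEven odd' T) (x : τ ⊕ τ') :
    substInr odd odd' T (coord _ x) = (0 : τ ⊕ τ' → ℝ) x • 1 +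
      ∑ y, (Matrix.fromBlocks 1 0 0 T : Matrix (τ ⊕ τ') (τ ⊕ τ') ℝ) y x • coord _ y :=
  affineHom_coord (fun _ _ => rfl) (fromBlocks_parity hT) x

theorem substInr_inl (hT : IsEven odd' T) (x : τ) :
    substInr odd odd' T (coord _ (Sum.inl x)) = coord _ (Sum.inl x) := by
  rw [substInr_coord hT]
  simp [Matrix.one_apply]

theorem substInr_inr (hT : IsEven odd' T) (x : τ') :
    substInr odd odd' T (coord _ (Sum.inr x)) = ∑ y, T y x • coord _ (Sum.inr y) := by
  rw [substInr_coord hT]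
  simp

theorem setZero_substInr (hT : IsEven odd' T) (f : SFun (τ ⊕ τ') (Sum.elim odd odd')) :
    setZero odd odd' (substInr odd odd' T f) = setZero odd odd' f := by
  suffices h : (setZero odd odd').comp (substInr odd odd' T) = setZero odd odd' from
    DFunLike.congr_fun h f
  refine algHom_ext fun x => ?_
  rcases x with x | x
  · rw [AlgHom.comp_apply, substInr_inl hT]
  · rw [AlgHom.comp_apply, substInr_inr hT, map_sum, setZero_coord_inr]
    simp only [map_smul, setZero_coord_inr, smul_zero, Finset.sum_const_zero]

/-- A substitution preserving the bivector does not affect the contractions. -/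
theorem setZero_laplace_pow_substInr (hT : IsEven odd' T) {P : Matrix τ' τ' ℝ}
    (hP : T.transpose * P * T = P) (e : ℕ) (f : SFun (τ ⊕ τ') (Sum.elim odd odd')) :
    setZero odd odd' ((laplace _ (Matrix.fromBlocks 0 0 0 P) ^ e) (substInr odd odd' T f)) =
      setZero odd odd' ((laplace _ (Matrix.fromBlocks 0 0 0 P) ^ e) f) := by
  have h1 : (Matrix.fromBlocks 1 0 0 T : Matrix (τ ⊕ τ') (τ ⊕ τ') ℝ).transpose *
      Matrix.fromBlocks 0 0 0 P * Matrix.fromBlocks 1 0 0 T = Matrix.fromBlocks 0 0 0 P := by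
    rw [Matrix.fromBlocks_transpose, Matrix.fromBlocks_multiply, Matrix.fromBlocks_multiply]
    simp [hP]
  have h2 : ∀ f, laplace _ (Matrix.fromBlocks 0 0 0 P) (substInr odd odd' T f) =
      substInr odd odd' T (laplace _ (Matrix.fromBlocks 0 0 0 P) f) := by
    intro f
    rw [laplace_affine (fun _ _ => rfl) (fromBlocks_parity hT) (substInr_coord hT), h1]
  have h3 : (laplace _ (Matrix.fromBlocks 0 0 0 P) ^ e) (substInr odd odd' T f) =
      substInr odd odd' T ((laplace _ (Matrix.fromBlocks 0 0 0 P) ^ e) f) := by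
    induction e generalizing f with
    | zero => rfl
    | succ e ih => rw [pow_succ, Module.End.mul_apply, Module.End.mul_apply, h2, ih]
  rw [h3, setZero_substInr hT]

end SFun

section ChernSimons

variable {C : Type*} [Ring C] [Algebra ℝ C] {𝒞 : ℕ → Submodule ℝ C} [GradedAlgebra 𝒞]
variable {g : Type*} [LieRing g] [LieAlgebra ℝ g]
variable {D : DGFrobenius 𝒞}

/-! ### Reduction of the vertices -/

namespace FieldCoords

variable {I P A : Type*} (X : FieldCoords D g I P A)
variable (B : LinearMap.BilinForm ℝ g)
variable [Fintype I] [Fintype P] [Fintype A] [DecidableEq I] [DecidableEq A]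

theorem map_cubicTerm {R R' : Type*} [Ring R] [Algebra ℝ R] [Ring R'] [Algebra ℝ R']
    (F : R →ₐ[ℝ] R') (Ω : I → A → R) :
    F (X.cubicTerm B Ω) = X.cubicTerm B fun i a => F (Ω i a) := by
  simp only [cubicTerm, map_smul, map_sum, map_mul]

theorem linearField_sum_elim (ι : D.Cohomology →ₗ[ℝ] C) (c : I → C) :
    X.linearField (Sum.elim (fun p => ι (X.bH p)) c) =
      X.embedField ι (fun p a => SFun.coord _ (Sum.inl (p, a))) +
        fun i a => ∑ j, X.bC.repr (c j) i • SFun.coord _ (Sum.inr (j, a)) := by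
  ext i a
  rw [linearField, Fintype.sum_sum_type]
  rfl

theorem linearField_zero (ι : D.Cohomology →ₗ[ℝ] C) :
    X.linearField (Sum.elim (fun p => ι (X.bH p)) 0) =
      X.embedField ι fun p a => SFun.coord _ (Sum.inl (p, a)) := by
  rw [linearField_sum_elim]
  ext i a
  simp

theorem interaction_eq_cubicTerm {ι : D.Cohomology →ₗ[ℝ] C} (hι : ∀ x, D.d (ι x) = 0) :
    X.interaction B ι = X.cubicTerm B (X.embedField ι (fun p a => SFun.coord _ (Sum.inl (p, a))) +
        fun i a => SFun.coord _ (Sum.inr (i, a))) := by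
  have h : X.interaction B ι = X.csAction B (X.embedField ι (fun p a => SFun.coord _ (Sum.inl (p, a)))
      + fun i a => SFun.coord _ (Sum.inr (i, a))) -
      X.quadTerm B fun i a => SFun.coord _ (Sum.inr (i, a)) := rfl
  rw [h, csAction, X.quadTerm_embedField_add B hι, add_sub_cancel_left]

theorem isEven_opMatrix {F : Module.End ℝ (g ⊗[ℝ] C)} (hF : Commute (tensorSign g 𝒞) F) :
    SFun.IsEven X.oddC (X.opMatrix F) := by
  have := congrArg X.opMatrix hF.eq
  rw [opMatrix_mul, opMatrix_mul, opMatrix_tensorSign, neg_mul, mul_neg, neg_inj] at this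
  exact SFun.isEven_iff.2 this

/-- The matrix of the substitution `ω ↦ K d ω`. -/
def substMatrix (K : C →ₗ[ℝ] C) :
    Matrix (I × A) (I × A) ℝ :=
  (X.opMatrix (LinearMap.lTensor g (K ∘ₗ D.d))).transpose

variable {B}

theorem commute_sign_K_d {K : C →ₗ[ℝ] C} (hK : D.IsSymmLowering K) :
    Commute (tensorSign g 𝒞) (LinearMap.lTensor g (K ∘ₗ D.d)) := by
  refine TensorProduct.ext' fun x a => ?_
  change x ⊗ₜ[ℝ] gradingSign 𝒞 (K (D.d a)) = x ⊗ₜ[ℝ] K (D.d (gradingSign 𝒞 a))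
  rw [D.d_gradingSign, map_neg, hK.map_gradingSign, neg_neg]

theorem isEven_substMatrix {K : C →ₗ[ℝ] C} (hK : D.IsSymmLowering K) :
    SFun.IsEven X.oddC (X.substMatrix K) := fun x y h =>
  (X.isEven_opMatrix (commute_sign_K_d hK) y x h).symm

/-- The substitution `ω ↦ K d ω` preserves the propagator: on one index by `K d K = K`, on the other
one by symmetry. -/
theorem substMatrix_bivector (hB : IsQuadratic B) {ι : D.Cohomology →ₗ[ℝ] C} {K : C →ₗ[ℝ] C}
    (h : D.IsInductionData ι K) :
    (X.substMatrix K).transpose * X.bivector B K * X.substMatrix K = X.bivector B K := by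
  have hK := h.isSymmLowering
  have h1 : (X.substMatrix K).transpose * X.bivector B K = X.bivector B K := by
    rw [substMatrix, Matrix.transpose_transpose, X.bivector_eq hB, mul_neg, ← mul_assoc,
      ← opMatrix_mul, Module.End.mul_eq_comp, ← LinearMap.lTensor_comp]
    congr 4
    exact LinearMap.ext fun a => h.K_d_K a
  have h2 := (SFun.isSuperSymm_iff (X.isEven_bivector hB hK)).1 (X.isSuperSymm_bivector hB hK)
  have h3 : Commute (SFun.parity X.oddC) (X.substMatrix K).transpose := by
    rw [← SFun.isEven_iff, substMatrix, Matrix.transpose_transpose]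
    exact X.isEven_opMatrix (commute_sign_K_d hK)
  have h4 := congrArg Matrix.transpose h1
  rw [Matrix.transpose_mul, Matrix.transpose_transpose, h2] at h4
  rw [h1]
  have h5 : X.bivector B K = SFun.parity X.oddC * (SFun.parity X.oddC * X.bivector B K) := by
    rw [← mul_assoc, SFun.parity_mul_parity, one_mul]
  conv_lhs => rw [h5]
  rw [mul_assoc, h4, ← h5]

/-- The coefficients of the field `ι(α) + K d ω` in the coordinates of `α` and `ω`. -/
def reducedBasis (ι : D.Cohomology →ₗ[ℝ] C)
    (K : C →ₗ[ℝ] C) : P ⊕ I → C :=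
  Sum.elim (fun p => ι (X.bH p)) fun i => K (D.d (X.bC i))

theorem reducedBasis_mem {ι : D.Cohomology →ₗ[ℝ] C} {K : C →ₗ[ℝ] C}
    (h : D.IsInductionData ι K) (j : P ⊕ I) : X.reducedBasis ι K j ∈ 𝒞 (X.degSum j) := by
  rcases j with p | i
  · exact h.ι_mem _ _ (X.bH_mem p)
  · exact h.K_mem _ _ (D.d_mem _ _ (X.bC_mem i))

theorem zeroModeBasis_mem {ι : D.Cohomology →ₗ[ℝ] C} {K : C →ₗ[ℝ] C}
    (h : D.IsInductionData ι K) (j : P ⊕ I) :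
    (Sum.elim (fun p => ι (X.bH p)) 0 : P ⊕ I → C) j ∈ 𝒞 (X.degSum j) := by
  rcases j with p | i
  · exact h.ι_mem _ _ (X.bH_mem p)
  · exact Submodule.zero_mem _

variable (B) in
/-- After the substitution, the interaction is a cubic vertex with legs `ι(α)` and `K d ω`; its
quadratic term has disappeared since `ι(α)` is closed. -/
theorem substInr_interaction {ι : D.Cohomology →ₗ[ℝ] C} {K : C →ₗ[ℝ] C} [DecidableEq P]
    (h : D.IsInductionData ι K) :
    SFun.substInr X.oddH X.oddC (X.substMatrix K) (X.interaction B ι) =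
      X.vertex B (X.vertexWeight (X.reducedBasis ι K)) := by
  have hK := h.isSymmLowering
  rw [X.interaction_eq_cubicTerm B h.d_ι, map_cubicTerm, ← X.cubicTerm_linearField B
    (X.reducedBasis_mem h), reducedBasis, linearField_sum_elim]
  congr 1
  ext i a
  simp only [Pi.add_apply, map_add, embedField, map_sum, map_smul,
    SFun.substInr_inl (X.isEven_substMatrix hK), SFun.substInr_inr (X.isEven_substMatrix hK)]
  congr 1
  rw [Fintype.sum_prod_type]
  refine Finset.sum_congr rfl fun j _ => ?_
  rw [Finset.sum_eq_single a]
  · rw [substMatrix, Matrix.transpose_apply, opMatrix_apply, tensorBasis_apply,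
      LinearMap.lTensor_tmul, tensorBasis_repr_tmul]
    simp
  · intro b _ hb
    rw [substMatrix, Matrix.transpose_apply, opMatrix_apply, tensorBasis_apply,
      LinearMap.lTensor_tmul, tensorBasis_repr_tmul, Module.Basis.repr_self]
    rw [Finsupp.single_eq_of_ne (Ne.symm hb), zero_mul, zero_smul]
  · exact fun h => absurd (Finset.mem_univ a) h

variable (B) in
/-- The vertex without fluctuations is `W_prod`. -/
theorem setZero_vertex_zeroMode {ι : D.Cohomology →ₗ[ℝ] C} {K : C →ₗ[ℝ] C}
    (h : D.IsInductionData ι K) : SFun.setZero X.oddH X.oddC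
      (X.vertex B (X.vertexWeight (Sum.elim (fun p => ι (X.bH p)) 0))) = X.Wprod B ι := by
  rw [← X.cubicTerm_linearField B (X.zeroModeBasis_mem h), linearField_zero, map_cubicTerm, Wprod]
  congr 1
  ext i a
  simp only [embedField, map_sum, map_smul, SFun.setZero_coord_inl]
  rfl

/-- The functional extracting the term with `e` edges. -/
def edgeContraction (B : LinearMap.BilinForm ℝ g)
    (K : C →ₗ[ℝ] C) (e : ℕ) : X.FunTot →ₗ[ℝ] X.Fun' :=
  (SFun.setZero X.oddH X.oddC).toLinearMap ∘ₗ (X.wick B K ^ e)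

/-- The partition function of the substituted interaction is the original one. -/
theorem partition_eq_expSeries (hB : IsQuadratic B) {ι : D.Cohomology →ₗ[ℝ] C} {K : C →ₗ[ℝ] C}
    [DecidableEq P] (h : D.IsInductionData ι K) : X.partition B ι K =
      expSeries (X.edgeContraction B K) (X.vertex B (X.vertexWeight (X.reducedBasis ι K))) := by
  have hK := h.isSymmLowering
  ext v e : 2
  rw [coeff_expSeries, partition, PowerSeries.coeff_mk, PowerSeries.coeff_mk,
    ← X.substInr_interaction B h, edgeContraction, LinearMap.comp_apply, AlgHom.toLinearMap_apply,
    ← map_pow, wick_eq_laplace, SFun.setZero_laplace_pow_substInr (X.isEven_substMatrix hK)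
      (X.substMatrix_bivector hB h)]

end FieldCoords

end ChernSimons

section ChernSimons

variable {C : Type*} [Ring C] [Algebra ℝ C] {𝒞 : ℕ → Submodule ℝ C} [GradedAlgebra 𝒞]
variable {g : Type*} [LieRing g] [LieAlgebra ℝ g]
variable {D : DGFrobenius 𝒞}

/-! ### Vanishing of trees -/

/-- If `H^0` is one-dimensional, classes of degree `0` are represented by scalars. -/
theorem DGFrobenius.IsAlgHom.exists_eq_smul_one (hB0 : Module.finrank ℝ (D.cohomologyDeg 0) = 1)
    {ι : D.Cohomology →ₗ[ℝ] C} (h1 : D.IsAlgHom ι) {x : D.Cohomology} (hx : x ∈ D.cohomologyDeg 0) : ∃ r : ℝ, ι x = r • 1 := by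
  have hone : D.cls ⟨1, D.one_mem_cocycles⟩ ∈ D.cohomologyDeg 0 :=
    ⟨⟨1, D.one_mem_cocycles⟩, (SetLike.GradedOne.one_mem : (1 : C) ∈ 𝒞 0), rfl⟩
  by_cases h0 : D.cls ⟨1, D.one_mem_cocycles⟩ = 0
  · refine ⟨0, ?_⟩
    have h2 : (1 : C) = 0 := by rw [← h1.map_one, h0, map_zero]
    rw [← mul_one (ι x), h2, mul_zero, smul_zero]
  · obtain ⟨r, hr⟩ := (finrank_eq_one_iff_of_nonzero' (⟨_, hone⟩ : D.cohomologyDeg 0)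
      (fun h2 => h0 (congrArg Subtype.val h2))).1 hB0 ⟨x, hx⟩
    refine ⟨r, ?_⟩
    rw [← h1.map_one, ← map_smul]
    exact congrArg ι (congrArg Subtype.val hr).symm

/-- The image of `K` is orthogonal to products of representatives. -/
theorem DGFrobenius.IsInductionData.pair_K_ι_mul_ι {ι : D.Cohomology →ₗ[ℝ] C} {K : C →ₗ[ℝ] C}
    (h : D.IsInductionData ι K) (h1 : D.IsAlgHom ι) (c : C) (x y : D.Cohomology) :
    D.pair (K c) (ι x * ι y) = 0 := by
  obtain ⟨a, rfl⟩ := Submodule.mkQ_surjective _ x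
  obtain ⟨b, rfl⟩ := Submodule.mkQ_surjective _ y
  have h2 := h1.map_mul a b
  rw [cls] at h2
  rw [← h2, h.isSymmLowering.pair_map, h.K_ι, map_zero]

theorem DGFrobenius.IsInductionData.pair_K_K {ι : D.Cohomology →ₗ[ℝ] C} {K : C →ₗ[ℝ] C}
    (h : D.IsInductionData ι K) (b c : C) : D.pair (K b) (K c) = 0 := by
  rw [h.isSymmLowering.pair_map, h.K_K, map_zero]

namespace FieldCoords

variable {I P A : Type*} (X : FieldCoords D g I P A)
variable (B : LinearMap.BilinForm ℝ g)
variable [Fintype I] [Fintype P] [Fintype A] [DecidableEq I] [DecidableEq A]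

theorem degSum_add_of_vertexWeight_ne_zero {c : P ⊕ I → C} (hc : ∀ j, c j ∈ 𝒞 (X.degSum j))
    {j k l : P ⊕ I} (h : X.vertexWeight c j k l ≠ 0) :
    X.degSum j + (X.degSum k + X.degSum l) = 3 :=
  D.pair_deg _ _ _ _ (hc j) (SetLike.GradedMul.mul_mem (hc k) (hc l))
    (right_ne_zero_of_mul (right_ne_zero_of_mul h))

/-- The weights of the vertices with at least one fluctuation. -/
def fluctuationWeight (ι : D.Cohomology →ₗ[ℝ] C) (K : C →ₗ[ℝ] C) (j k l : P ⊕ I) : ℝ :=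
  X.vertexWeight (X.reducedBasis ι K) j k l -
    X.vertexWeight (Sum.elim (fun p => ι (X.bH p)) 0) j k l

variable {ι : D.Cohomology →ₗ[ℝ] C} {K : C →ₗ[ℝ] C}

theorem degSum_add_of_fluctuationWeight_ne_zero (h : D.IsInductionData ι K) {j k l : P ⊕ I}
    (hw : X.fluctuationWeight ι K j k l ≠ 0) : X.degSum j + (X.degSum k + X.degSum l) = 3 := by
  by_contra hne
  refine hw ?_
  rw [fluctuationWeight, sub_eq_zero]
  trans 0
  · by_contra h1
    exact hne (X.degSum_add_of_vertexWeight_ne_zero (X.reducedBasis_mem h) h1)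
  · by_contra h1
    exact hne (X.degSum_add_of_vertexWeight_ne_zero (X.zeroModeBasis_mem h) (Ne.symm h1))

/-- `1` for a fluctuation and `0` for a zero mode. -/
def flucCount : P ⊕ I → ℕ := Sum.elim 0 1

theorem fluctuationWeight_inr_inr (j k l : P ⊕ I) (h : 1 ≤ flucCount j + flucCount k + flucCount l) :
    X.fluctuationWeight ι K j k l = X.vertexWeight (X.reducedBasis ι K) j k l := by
  rw [fluctuationWeight, sub_eq_self, vertexWeight]
  rcases j with j | j <;> rcases k with k | k <;> rcases l with l | l <;> simp [flucCount] at h ⊢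

/-- Since `ι` is multiplicative, no vertex has exactly one fluctuation. -/
theorem two_le_flucCount (h : D.IsInductionData ι K) (h1 : D.IsAlgHom ι) {j k l : P ⊕ I}
    (hw : X.fluctuationWeight ι K j k l ≠ 0) :
    2 ≤ flucCount j + flucCount k + flucCount l := by
  by_contra hlt
  refine hw ?_
  by_cases h0 : 1 ≤ flucCount j + flucCount k + flucCount l
  · rw [X.fluctuationWeight_inr_inr j k l h0, vertexWeight]
    rcases j with j | j <;> rcases k with k | k <;> rcases l with l | l <;>
      simp only [flucCount, Sum.elim_inl, Sum.elim_inr, Pi.zero_apply, Pi.one_apply] at h0 hlt <;>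
      first
      | omega
      | skip
    · simp only [reducedBasis, Sum.elim_inl, Sum.elim_inr]
      rw [D.pair_mul, D.pair_comm, h.pair_K_ι_mul_ι h1]
      simp
    · simp only [reducedBasis, Sum.elim_inl, Sum.elim_inr]
      rw [D.pair_comm, ← D.pair_mul, h.pair_K_ι_mul_ι h1]
      simp
    · simp only [reducedBasis, Sum.elim_inl, Sum.elim_inr]
      rw [h.pair_K_ι_mul_ι h1]
      simp
  · rw [fluctuationWeight, sub_eq_zero]
    rcases j with j | j <;> rcases k with k | k <;> rcases l with l | l <;>
      simp [flucCount] at h0 ⊢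
    rfl

/-- A zero mode of degree `0` is a scalar, and decouples from the fluctuations. -/
theorem degH_ne_zero_of_fluctuationWeight (hB0 : Module.finrank ℝ (D.cohomologyDeg 0) = 1)
    (h : D.IsInductionData ι K) (h1 : D.IsAlgHom ι) {j k l : P ⊕ I}
    (hw : X.fluctuationWeight ι K j k l ≠ 0) {p : P} (hp : .inl p = j ∨ .inl p = k ∨ .inl p = l) :
    X.degH p ≠ 0 := by
  intro h0
  obtain ⟨r, hr⟩ := h1.exists_eq_smul_one hB0 (h0 ▸ X.bH_mem p)
  have h2 := X.two_le_flucCount h h1 hw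
  refine hw ?_
  rw [X.fluctuationWeight_inr_inr j k l (by omega), vertexWeight]
  rcases hp with rfl | rfl | rfl
  · rcases k with k | k <;> rcases l with l | l <;> simp [flucCount] at h2
    simp only [reducedBasis, Sum.elim_inl, Sum.elim_inr]
    rw [hr, D.pair_mul, smul_mul_assoc, one_mul, map_smul, LinearMap.smul_apply, h.pair_K_K]
    simp
  · rcases j with j | j <;> rcases l with l | l <;> simp [flucCount] at h2
    simp only [reducedBasis, Sum.elim_inl, Sum.elim_inr]
    rw [hr, smul_mul_assoc, one_mul, map_smul, h.pair_K_K]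
    simp
  · rcases j with j | j <;> rcases k with k | k <;> simp [flucCount] at h2
    simp only [reducedBasis, Sum.elim_inl, Sum.elim_inr]
    rw [hr, mul_smul_comm, mul_one, map_smul, h.pair_K_K]
    simp

/-! ### The monomials of the effective action -/

/-- The direction in `H^•(C)` or `C` of a coordinate. -/
def direction : (P × A) ⊕ (I × A) → P ⊕ I := Sum.map Prod.fst Prod.fst

theorem direction_coordIndex (j : P ⊕ I) (a : A) : direction (coordIndex j a) = j := by
  rcases j with j | j <;> rfl

/-- The monomials occurring after contracting `e` edges in a product of `v` vertices with fluctuations.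
There is no zero mode of degree `0`. Each vertex brings three legs of total degree `3`, at least two of
which are fluctuations; each edge removes two fluctuations, of total degree `2`. -/
def graphMonomials (v e : ℕ) : Set (Multiset ((P × A) ⊕ (I × A))) :=
  {s | (∀ x, Sum.inl x ∈ s → X.degH x.1 ≠ 0) ∧ s.card + 2 * e = 3 * v ∧
    (s.map fun x => X.degSum (direction x)).sum + 2 * e = 3 * v ∧
    2 * v ≤ (s.map fun x => flucCount (direction x)).sum + 2 * e}

theorem vertex_mem_graphMonomials (hB0 : Module.finrank ℝ (D.cohomologyDeg 0) = 1)
    (h : D.IsInductionData ι K) (h1 : D.IsAlgHom ι) :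
    X.vertex B (X.fluctuationWeight ι K) ∈ SFun.monoSpan _ (X.graphMonomials 1 0) := by
  rw [vertex]
  refine Submodule.sum_mem _ fun a _ => Submodule.sum_mem _ fun b _ => Submodule.sum_mem _ fun c _ =>
    Submodule.sum_mem _ fun j _ => Submodule.sum_mem _ fun k _ => Submodule.sum_mem _ fun l _ => ?_
  by_cases hw : X.fluctuationWeight ι K j k l = 0
  · rw [hw, zero_mul, zero_smul]
    exact Submodule.zero_mem _
  refine Submodule.smul_mem _ _ ?_
  have h2 := SFun.prod_mem_monoSpan (odd := Sum.elim X.oddH X.oddC) (S := X.graphMonomials 1 0)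
    (l := [coordIndex j a, coordIndex k b, coordIndex l c]) ?_
  · simpa [mul_assoc] using h2
  refine ⟨fun x hx => ?_, rfl, ?_, ?_⟩
  · refine X.degH_ne_zero_of_fluctuationWeight hB0 h h1 hw (p := x.1) ?_
    simp only [Multiset.mem_coe, List.mem_cons, List.not_mem_nil, or_false] at hx
    refine hx.imp ?_ (Or.imp ?_ ?_) <;>
    · intro hx
      have := congrArg direction hx
      rwa [direction_coordIndex] at this
  · have := X.degSum_add_of_fluctuationWeight_ne_zero h hw
    simpa [direction_coordIndex] using this
  · have := X.two_le_flucCount h h1 hw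
    simp [direction_coordIndex]
    omega

/-- The monomials in the zero modes of degree `1` in a graph with `v` vertices and `e` edges. -/
def zeroModeMonomials (v e : ℕ) : Set (Multiset (P × A)) :=
  {s | (∀ x ∈ s, X.degH x.1 = 1) ∧ s.card + 2 * e = 3 * v ∧ v ≤ e}

theorem eq_one_of_sum_le_card {α : Type*} {f : α → ℕ} {s : Multiset α} (h : ∀ x ∈ s, f x ≠ 0)
    (hs : (s.map f).sum ≤ s.card) : ∀ x ∈ s, f x = 1 := by
  have key : ∀ t : Multiset α, (∀ x ∈ t, f x ≠ 0) → t.card ≤ (t.map f).sum := by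
    intro t ht
    have := Multiset.card_nsmul_le_sum (s := t.map f) (a := 1) fun x hx => by
      obtain ⟨y, hy, rfl⟩ := Multiset.mem_map.1 hx
      exact Nat.one_le_iff_ne_zero.2 (ht y hy)
    simpa using this
  intro x hx
  obtain ⟨t, rfl⟩ := Multiset.exists_cons_of_mem hx
  have h1 := key t fun y hy => h y (Multiset.mem_cons_of_mem hy)
  have h2 := h x hx
  rw [Multiset.map_cons, Multiset.sum_cons, Multiset.card_cons] at hs
  omega

variable {B} in
/-- Without fluctuations left, a graph has at least as many edges as vertices. Its `3v - 2e` legs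
are zero modes of positive degrees with total `3v - 2e`, so all these degrees are `1`. -/
theorem edgeContraction_mem (hB : IsQuadratic B)
    (hB0 : Module.finrank ℝ (D.cohomologyDeg 0) = 1)
    (h : D.IsInductionData ι K) (h1 : D.IsAlgHom ι) (v e : ℕ) :
    X.edgeContraction B K e (X.vertex B (X.fluctuationWeight ι K) ^ v) ∈
      SFun.monoSpan X.oddH (X.zeroModeMonomials v e) := by
  rw [edgeContraction, LinearMap.comp_apply, AlgHom.toLinearMap_apply, wick_eq_laplace]
  refine SFun.setZero_mem_monoSpan (S := X.graphMonomials v e) ?_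
    (SFun.laplace_pow_mem_monoSpan (S := X.graphMonomials v) ?_
      (SFun.pow_mem_monoSpan (S := fun n => X.graphMonomials n 0) ?_ ?_
        (X.vertex_mem_graphMonomials B hB0 h h1) v) e)
  · rintro s ⟨h2, h3, h4, h5⟩
    simp only [Multiset.card_map, Multiset.map_map, Function.comp_def] at h3 h4 h5
    have h6 : ∀ x ∈ s, X.degH x.1 ≠ 0 := fun x hx => h2 x (Multiset.mem_map_of_mem _ hx)
    refine ⟨eq_one_of_sum_le_card h6 ?_, h3, ?_⟩
    · refine le_of_add_le_add_right (a := 2 * e) ?_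
      rw [h3]
      exact h4.le
    · have h7 : (s.map fun x => flucCount (direction (Sum.inl x : (P × A) ⊕ (I × A)))).sum = 0 := by
        rw [Multiset.sum_eq_zero_iff]
        intro y hy
        obtain ⟨x, -, rfl⟩ := Multiset.mem_map.1 hy
        rfl
      rw [h7] at h5
      omega
  · rintro e z w s hzw ⟨h2, h3, h4, h5⟩
    rcases z with z | z
    · rcases w with w | w <;> exact absurd rfl hzw
    rcases w with w | w
    · exact absurd rfl hzw
    have h6 := X.degC_add_of_bivector_ne_zero hB h.isSymmLowering hzw
    have e1 : X.degSum (direction (Sum.inr z : (P × A) ⊕ (I × A))) = X.degC z.1 := rfl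
    have e2 : X.degSum (direction (Sum.inr w : (P × A) ⊕ (I × A))) = X.degC w.1 := rfl
    have e3 : flucCount (direction (Sum.inr z : (P × A) ⊕ (I × A))) = 1 := rfl
    have e4 : flucCount (direction (Sum.inr w : (P × A) ⊕ (I × A))) = 1 := rfl
    simp only [Multiset.map_cons, Multiset.sum_cons, Multiset.card_cons, e1, e2, e3, e4] at h3 h4 h5
    refine ⟨fun x hx => h2 x (Multiset.mem_cons_of_mem (Multiset.mem_cons_of_mem hx)), ?_, ?_, ?_⟩
      <;> omega
  · exact ⟨by simp, rfl, rfl, by simp⟩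
  · rintro n s ⟨h2, h3, h4, h5⟩ t ⟨h2', h3', h4', h5'⟩
    refine ⟨fun x hx => (Multiset.mem_add.1 hx).elim (h2 x) (h2' x), ?_, ?_, ?_⟩ <;>
      simp only [Multiset.map_add, Multiset.sum_add, Multiset.card_add] <;> omega

theorem ofH1_X (i : X.P1) (a : A) :
    X.ofH1 (MvPolynomial.X (i, a)) = SFun.coord X.oddH (i.1, a) := by
  have h : X.oddH (i.1, a) = false := by simp [oddH, i.2]
  rw [SFun.coord_of_even h]
  simp [ofH1]

theorem restrictH1_ofH1 (F : MvPolynomial (X.P1 × A) ℝ) : X.restrictH1 (X.ofH1 F) = F := by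
  suffices h : X.restrictH1.comp X.ofH1 = AlgHom.id ℝ _ from DFunLike.congr_fun h F
  refine MvPolynomial.algHom_ext fun x => ?_
  rw [AlgHom.comp_apply, ofH1_X, restrictH1_coord, dif_pos x.1.2]
  rfl

theorem ofH1_mem_center (F : MvPolynomial (X.P1 × A) ℝ) :
    X.ofH1 F ∈ Subalgebra.center ℝ X.Fun' := by
  induction F using MvPolynomial.induction_on with
  | C r => rw [← MvPolynomial.algebraMap_eq, AlgHom.commutes]; exact Subalgebra.algebraMap_mem _ r
  | add F G hF hG => rw [map_add]; exact Subalgebra.add_mem _ hF hG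
  | mul_X F x hF =>
    rw [map_mul]
    refine Subalgebra.mul_mem _ hF ?_
    rw [ofH1_X]
    refine SFun.mem_center_of_coord fun y => ?_
    rw [SFun.coord_mul_coord]
    simp [SFun.sgn, oddH, x.1.2]

/-- Combinations of monomials in zero modes of degree `1` come from homogeneous polynomials in
`α_(1)`; there are none unless `v ≤ e` and `2e ≤ 3v`. -/
theorem exists_ofH1_of_mem_monoSpan {v e : ℕ} {f : X.Fun'}
    (hf : f ∈ SFun.monoSpan X.oddH (X.zeroModeMonomials v e)) :
    f ∈ (if v ≤ e ∧ 2 * e ≤ 3 * v then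
      MvPolynomial.homogeneousSubmodule (X.P1 × A) ℝ (3 * v - 2 * e) else ⊥).map
        X.ofH1.toLinearMap := by
  refine SFun.map_monoSpan LinearMap.id _ ?_ hf
  rintro l ⟨h1, h2, h3⟩
  rw [Multiset.coe_card] at h2
  rw [if_pos ⟨h3, by omega⟩, show 3 * v - 2 * e = l.length by omega]
  clear h2
  induction l with
  | nil => exact ⟨1, MvPolynomial.isHomogeneous_one _ _, map_one X.ofH1⟩
  | cons x l ih =>
    obtain ⟨F, hF, hF'⟩ := ih fun y hy => h1 y (List.mem_cons_of_mem _ hy)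
    refine ⟨MvPolynomial.X (⟨x.1, h1 x List.mem_cons_self⟩, x.2) * F, ?_, ?_⟩
    · rw [List.length_cons, add_comm]
      exact (MvPolynomial.isHomogeneous_X ℝ _).mul hF
    · rw [AlgHom.toLinearMap_apply] at hF' ⊢
      rw [map_mul, ofH1_X, hF']
      rfl

end FieldCoords

end ChernSimons

/-! ### Vector fields and even products in two kinds of variables -/

namespace SFun

variable {τ τ' : Type*} {odd : τ → Bool} {odd' : τ' → Bool} [Fintype τ] [Fintype τ']

theorem isEven_fromBlocks {M : Matrix τ τ ℝ} {M' : Matrix τ' τ' ℝ} (h : IsEven odd M)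
    (h' : IsEven odd' M') : IsEven (Sum.elim odd odd') (Matrix.fromBlocks M 0 0 M') := by
  rintro (x | x) (y | y) hxy
  · exact h x y hxy
  · exact absurd rfl hxy
  · exact absurd rfl hxy
  · exact h' x y hxy

theorem linVF_fromBlocks_inl (M : Matrix τ τ ℝ) (M' : Matrix τ' τ' ℝ) (x : τ) :
    linVF (Sum.elim odd odd') (Matrix.fromBlocks M 0 0 M') (coord _ (Sum.inl x)) =
      ∑ y, M y x • coord _ (Sum.inl y) := by
  rw [linVF_coord]
  simp

theorem linVF_fromBlocks_inr (M : Matrix τ τ ℝ) (M' : Matrix τ' τ' ℝ) (x : τ') :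
    linVF (Sum.elim odd odd') (Matrix.fromBlocks M 0 0 M') (coord _ (Sum.inr x)) =
      ∑ y, M' y x • coord _ (Sum.inr y) := by
  rw [linVF_coord]
  simp

/-- A block-diagonal vector field is tangent to the locus where the second variables vanish. -/
theorem setZero_linVF {M : Matrix τ τ ℝ} {M' : Matrix τ' τ' ℝ} (h : IsEven odd M)
    (h' : IsEven odd' M') (f : SFun (τ ⊕ τ') (Sum.elim odd odd')) :
    setZero odd odd' (linVF _ (Matrix.fromBlocks M 0 0 M') f) =
      linVF odd M (setZero odd odd' f) := by
  have hE := isEven_fromBlocks h h'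
  induction f using induction_coord with
  | h1 => rw [linVF_one, map_one, linVF_one, map_zero]
  | hc x f hf =>
    rw [linVF_mul hE, map_add, map_mul, map_mul, map_mul, hf, linVF_mul h]
    congr 2
    rcases x with x | x
    · rw [linVF_fromBlocks_inl, map_sum, setZero_coord_inl, linVF_coord]
      simp only [map_smul, setZero_coord_inl]
    · rw [linVF_fromBlocks_inr, map_sum, setZero_coord_inr, map_zero]
      simp only [map_smul, setZero_coord_inr, smul_zero, Finset.sum_const_zero]
  | ha f g hf hg => simp only [map_add, hf, hg]
  | hs r f hf => simp only [map_smul, hf]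

theorem laplace_fromBlocks_linVF {M : Matrix τ τ ℝ} {M' P : Matrix τ' τ' ℝ} (h : IsEven odd M)
    (h' : IsEven odd' M') (hP : M'.transpose * P + P * M' = 0)
    (f : SFun (τ ⊕ τ') (Sum.elim odd odd')) :
    laplace _ (Matrix.fromBlocks 0 0 0 P) (linVF _ (Matrix.fromBlocks M 0 0 M') f) =
      linVF _ (Matrix.fromBlocks M 0 0 M') (laplace _ (Matrix.fromBlocks 0 0 0 P) f) := by
  have h1 : (Matrix.fromBlocks M 0 0 M').transpose * Matrix.fromBlocks 0 0 0 P +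
      Matrix.fromBlocks 0 0 0 P * Matrix.fromBlocks M 0 0 M' = 0 := by
    rw [Matrix.fromBlocks_transpose, Matrix.fromBlocks_multiply, Matrix.fromBlocks_multiply,
      Matrix.fromBlocks_add]
    simp [hP]
  rw [laplace_linVF (isEven_fromBlocks h h'), h1]
  simp [laplace]

/-- A product of three variables of even total parity is central. -/
theorem coord_mul_triple {x y z : τ} (w : τ) (h : sgn odd w x * sgn odd w y * sgn odd w z = 1) :
    coord odd w * (coord odd x * coord odd y * coord odd z) =
      coord odd x * coord odd y * coord odd z * coord odd w := by
  calc coord odd w * (coord odd x * coord odd y * coord odd z)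
      = coord odd w * coord odd x * coord odd y * coord odd z := by simp only [mul_assoc]
    _ = (sgn odd w x * sgn odd w y * sgn odd w z) •
        (coord odd x * coord odd y * coord odd z * coord odd w) := by
      rw [coord_mul_coord w x, smul_mul_assoc, smul_mul_assoc, mul_assoc (coord odd x),
        coord_mul_coord w y, mul_smul_comm, smul_mul_assoc, mul_assoc (coord odd x),
        mul_assoc (coord odd y), coord_mul_coord w z, mul_smul_comm, mul_smul_comm, smul_smul,
        smul_smul]
      simp only [mul_assoc]
    _ = _ := by rw [h, one_smul]

/-- A derivative passes without sign through a product of three other variables of even total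
parity. -/
theorem pd_mul_triple [DecidableEq τ] {x y z w : τ} (hx : w ≠ x) (hy : w ≠ y) (hz : w ≠ z)
    (h : sgn odd w x * sgn odd w y * sgn odd w z = 1) (f : SFun τ odd) :
    pd odd w (coord odd x * coord odd y * coord odd z * f) =
      coord odd x * coord odd y * coord odd z * pd odd w f := by
  rw [mul_assoc, mul_assoc, pd_coord_mul, pd_coord_mul, pd_coord_mul, if_neg hx, if_neg hy,
    if_neg hz]
  rw [mul_assoc] at h
  simp only [zero_add, mul_smul_comm, smul_smul, mul_assoc, h, one_smul]

end SFun

theorem derivation_sum_apply {κ S : Type*} [CommRing S] [Algebra ℝ S] (s : Finset κ)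
    (f : κ → Derivation ℝ S S) (x : S) : (∑ i ∈ s, f i) x = ∑ i ∈ s, f i x := by
  have := congrFun (map_sum Derivation.coeFnAddMonoidHom f s) x
  rwa [Finset.sum_apply] at this

section ChernSimons

variable {C : Type*} [Ring C] [Algebra ℝ C] {𝒞 : ℕ → Submodule ℝ C} [GradedAlgebra 𝒞]
variable {g : Type*} [LieRing g] [LieAlgebra ℝ g]
variable {D : DGFrobenius 𝒞}

namespace FieldCoords

variable {I P A : Type*} (X : FieldCoords D g I P A)
variable (B : LinearMap.BilinForm ℝ g)
variable [Fintype I] [Fintype P] [Fintype A] [DecidableEq I] [DecidableEq A]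
variable {ι : D.Cohomology →ₗ[ℝ] C} {K : C →ₗ[ℝ] C}

/-! ### The adjoint action on functions -/

theorem isEven_adMatrix {J : Type*} [DecidableEq J] (x : g) (f : J → Bool) :
    SFun.IsEven (fun y : J × A => f y.1) (X.adMatrix x) := by
  intro y z h
  rw [adMatrix, Matrix.of_apply] at h
  split_ifs at h with h1
  · exact congrArg f h1
  · exact absurd rfl h

theorem sum_adMatrix {J R : Type*} [Fintype J] [DecidableEq J] [AddCommGroup R] [Module ℝ R] (x : g)
    (u : J × A → R) (j : J) (a : A) :
    ∑ y, X.adMatrix x y (j, a) • u y = ∑ b, X.bg.repr ⁅x, X.bg b⁆ a • u (j, b) := by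
  rw [Fintype.sum_prod_type, Finset.sum_eq_single j]
  · simp [adMatrix]
  · intro i _ hi
    simp [adMatrix, hi]
  · exact fun h => absurd (Finset.mem_univ j) h

variable {B} in
/-- The propagator is invariant, as it contains the inverse of the invariant form on `g`. -/
theorem adMatrix_bivector (hB : IsQuadratic B) (x : g) :
    (X.adMatrix x).transpose * X.bivector B K + X.bivector B K * X.adMatrix x = 0 := by
  set G : Matrix A A ℝ := Matrix.of fun a b => B (X.bg a) (X.bg b) with hG
  set M : Matrix A A ℝ := Matrix.of fun a b => X.bg.repr ⁅x, X.bg a⁆ b with hM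
  have hdet : IsUnit G.det := X.gramLie_det hB
  have h1 : M * G + G * M.transpose = 0 := by
    ext a b
    have e1 : (M * G) a b = B ⁅x, X.bg a⁆ (X.bg b) := by
      conv_rhs => rw [← X.bg.sum_repr ⁅x, X.bg a⁆]
      simp only [Matrix.mul_apply, hM, hG, Matrix.of_apply, map_sum, map_smul,
        LinearMap.sum_apply, LinearMap.smul_apply, smul_eq_mul]
    have e2 : (G * M.transpose) a b = B (X.bg a) ⁅x, X.bg b⁆ := by
      conv_rhs => rw [← X.bg.sum_repr ⁅x, X.bg b⁆]
      simp only [Matrix.mul_apply, hM, hG, Matrix.of_apply, Matrix.transpose_apply, map_sum,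
        map_smul, smul_eq_mul]
      exact Finset.sum_congr rfl fun c _ => mul_comm _ _
    rw [Matrix.add_apply, e1, e2, hB.invariant, ← lie_skew, map_neg, LinearMap.neg_apply,
      neg_add_cancel]
    rfl
  have h2 : M.transpose * G⁻¹ + G⁻¹ * M = 0 := by
    calc M.transpose * G⁻¹ + G⁻¹ * M
        = G⁻¹ * (M * G + G * M.transpose) * G⁻¹ := by
          rw [mul_add, add_mul, ← mul_assoc, mul_assoc (G⁻¹ * M), Matrix.mul_nonsing_inv _ hdet,
            mul_one, ← mul_assoc, Matrix.nonsing_inv_mul _ hdet, one_mul, add_comm]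
      _ = 0 := by rw [h1, mul_zero, zero_mul]
  ext y z
  have e1 : ((X.adMatrix x).transpose * X.bivector B K : Matrix (I × A) (I × A) ℝ) y z =
      -(X.propagator K y.1 z.1 * (M.transpose * G⁻¹) y.2 z.2) := by
    rw [Matrix.mul_apply, Fintype.sum_prod_type, Finset.sum_eq_single y.1]
    · simp [adMatrix, bivector, Matrix.mul_apply, hM, hG, Finset.mul_sum, mul_left_comm]
    · intro i _ hi
      simp [adMatrix, hi]
    · exact fun h => absurd (Finset.mem_univ _) h
  have e2 : (X.bivector B K * X.adMatrix x : Matrix (I × A) (I × A) ℝ) y z =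
      -(X.propagator K y.1 z.1 * (G⁻¹ * M) y.2 z.2) := by
    rw [Matrix.mul_apply, Fintype.sum_prod_type, Finset.sum_eq_single z.1]
    · simp [adMatrix, bivector, Matrix.mul_apply, hM, hG, Finset.mul_sum, mul_assoc]
    · intro i _ hi
      simp [adMatrix, hi]
    · exact fun h => absurd (Finset.mem_univ _) h
  have h3 := congrFun (congrFun h2 y.2) z.2
  rw [Matrix.add_apply] at h3 ⊢
  rw [e1, e2, ← neg_add, ← mul_add, h3]
  simp

/-- The infinitesimal adjoint action of `x` on functions of `α_(1)`. -/
def adDerivation (x : g) :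
    Derivation ℝ (MvPolynomial (X.P1 × A) ℝ) (MvPolynomial (X.P1 × A) ℝ) :=
  ∑ i : X.P1, ∑ a, ∑ b, X.bg.repr ⁅x, X.bg b⁆ a •
    ((MvPolynomial.X (i, b) : MvPolynomial (X.P1 × A) ℝ) • MvPolynomial.pderiv (i, a))

theorem adDerivation_apply (x : g) (F : MvPolynomial (X.P1 × A) ℝ) :
    X.adDerivation x F = ∑ i : X.P1, ∑ a, ∑ b,
      X.bg.repr ⁅x, X.bg b⁆ a • (MvPolynomial.X (i, b) * MvPolynomial.pderiv (i, a) F) := by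
  simp only [adDerivation, derivation_sum_apply]
  rfl

theorem adDerivation_X [DecidableEq P] (x : g) (i : X.P1) (a : A) :
    X.adDerivation x (MvPolynomial.X (i, a)) =
      ∑ b, X.bg.repr ⁅x, X.bg b⁆ a • MvPolynomial.X (i, b) := by
  rw [adDerivation_apply, Finset.sum_eq_single i]
  · rw [Finset.sum_eq_single a]
    · simp
    · intro a' _ ha
      simp [MvPolynomial.pderiv_X_of_ne (i := (i, a')) (j := (i, a)) (by simpa using ha.symm)]
    · exact fun h => absurd (Finset.mem_univ a) h
  · intro i' _ hi
    refine Finset.sum_eq_zero fun a' _ => Finset.sum_eq_zero fun b _ => ?_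
    rw [MvPolynomial.pderiv_X_of_ne (fun h => hi (congrArg Prod.fst h).symm), mul_zero, smul_zero]
  · exact fun h => absurd (Finset.mem_univ i) h

/-- On polynomials in `α_(1)` the linear vector field of `ad x` is the adjoint action. -/
theorem linVF_ofH1 [DecidableEq P] (x : g) (F : MvPolynomial (X.P1 × A) ℝ) :
    SFun.linVF X.oddH (X.adMatrix x) (X.ofH1 F) = X.ofH1 (X.adDerivation x F) := by
  have hE : SFun.IsEven X.oddH (X.adMatrix x) :=
    X.isEven_adMatrix x fun p => decide (Even (X.degH p))
  have h : ∀ (i : X.P1) (a : A), SFun.linVF X.oddH (X.adMatrix x) (SFun.coord X.oddH (i.1, a)) =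
      ∑ b, X.bg.repr ⁅x, X.bg b⁆ a • SFun.coord X.oddH (i.1, b) := fun i a =>
    (SFun.linVF_coord _ _).trans (X.sum_adMatrix x _ _ _)
  induction F using MvPolynomial.induction_on with
  | C r =>
    rw [← MvPolynomial.algebraMap_eq, AlgHom.commutes, Derivation.map_algebraMap, map_zero,
      Algebra.algebraMap_eq_smul_one, map_smul, SFun.linVF_one, smul_zero]
  | add F G hF hG => simp only [map_add, hF, hG]
  | mul_X F y hF =>
    rw [map_mul, SFun.linVF_mul hE, hF, Derivation.leibniz, map_add, smul_eq_mul, smul_eq_mul,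
      map_mul, map_mul, ofH1_X, h, adDerivation_X, map_sum,
      add_comm]
    congr 1
    · congr 1
      simp only [map_smul, ofH1_X]
    · rw [← ofH1_X]
      exact Subalgebra.mem_center_iff.1 (X.ofH1_mem_center _) _

/-- Contractions of invariant vertices are invariant. -/
theorem linVF_edgeContraction [DecidableEq P] {B} (hB : IsQuadratic B) (x : g)
    (q : P ⊕ I → P ⊕ I → P ⊕ I → ℝ) (v e : ℕ) :
    SFun.linVF X.oddH (X.adMatrix x) (X.edgeContraction B K e (X.vertex B q ^ v)) = 0 := by
  have hH : SFun.IsEven X.oddH (X.adMatrix x) :=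
    X.isEven_adMatrix x fun p => decide (Even (X.degH p))
  have hC : SFun.IsEven X.oddC (X.adMatrix x) :=
    X.isEven_adMatrix x fun p => decide (Even (X.degC p))
  have hE := SFun.isEven_fromBlocks hH hC
  rw [edgeContraction, LinearMap.comp_apply, AlgHom.toLinearMap_apply, ← SFun.setZero_linVF hH hC,
    wick_eq_laplace]
  have h1 : ∀ f, SFun.linVF _ (Matrix.fromBlocks (X.adMatrix x) 0 0 (X.adMatrix x))
      ((SFun.laplace (Sum.elim X.oddH X.oddC) (Matrix.fromBlocks 0 0 0 (X.bivector B K)) ^ e) f) =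
      (SFun.laplace (Sum.elim X.oddH X.oddC) (Matrix.fromBlocks 0 0 0 (X.bivector B K)) ^ e)
        (SFun.linVF _ (Matrix.fromBlocks (X.adMatrix x) 0 0 (X.adMatrix x)) f) := by
    induction e with
    | zero => exact fun f => rfl
    | succ e ih =>
      intro f
      rw [pow_succ, Module.End.mul_apply, Module.End.mul_apply, ih,
        SFun.laplace_fromBlocks_linVF hH hC (X.adMatrix_bivector hB x)]
  have h2 : SFun.linVF _ (Matrix.fromBlocks (X.adMatrix x) 0 0 (X.adMatrix x)) (X.vertex B q) = 0 := by
    refine X.derivation_vertex hB x (SFun.linVF_mul hE) (fun j a => ?_) q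
    rcases j with p | i
    · exact (SFun.linVF_fromBlocks_inl _ _ _).trans (X.sum_adMatrix x _ p a)
    · exact (SFun.linVF_fromBlocks_inr _ _ _).trans (X.sum_adMatrix x _ i a)
  have h3 : SFun.linVF _ (Matrix.fromBlocks (X.adMatrix x) 0 0 (X.adMatrix x))
      (X.vertex B q ^ v) = 0 := by
    induction v with
    | zero => rw [pow_zero, SFun.linVF_one]
    | succ v ih => rw [pow_succ, SFun.linVF_mul hE, ih, h2, zero_mul, mul_zero, add_zero]
  rw [h1, h3, map_zero, map_zero]

/-! ### Splitting off the vertices without fluctuations -/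

/-- The degrees along a vertex add up to `3`, an odd number, so an even number of its legs has even
degree, that is, an odd coordinate. -/
theorem sgn_triple {j k l : P ⊕ I} (h : X.degSum j + (X.degSum k + X.degSum l) = 3) (a b c : A)
    (w : (P × A) ⊕ (I × A)) :
    SFun.sgn (Sum.elim X.oddH X.oddC) w (coordIndex j a) *
      SFun.sgn (Sum.elim X.oddH X.oddC) w (coordIndex k b) *
      SFun.sgn (Sum.elim X.oddH X.oddC) w (coordIndex l c) = 1 := by
  have h1 : ∀ j a, Sum.elim X.oddH X.oddC (coordIndex j a) = decide (Even (X.degSum j)) := by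
    rintro (j | j) a <;> rfl
  simp only [SFun.sgn, h1, decide_eq_true_eq]
  rcases Sum.elim X.oddH X.oddC w
  · simp
  · have h2 : ¬ Even (X.degSum j + (X.degSum k + X.degSum l)) := by rw [h]; decide
    rw [Nat.even_add, Nat.even_add] at h2
    by_cases hj : Even (X.degSum j) <;> by_cases hk : Even (X.degSum k) <;>
      by_cases hl : Even (X.degSum l) <;> simp [hj, hk, hl] at h2 ⊢

theorem vertex_mem_center {q : P ⊕ I → P ⊕ I → P ⊕ I → ℝ}
    (hq : ∀ j k l, q j k l ≠ 0 → X.degSum j + (X.degSum k + X.degSum l) = 3) :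
    X.vertex B q ∈ Subalgebra.center ℝ X.FunTot := by
  rw [vertex]
  refine Subalgebra.sum_mem _ fun a _ => Subalgebra.sum_mem _ fun b _ => Subalgebra.sum_mem _ fun c _ =>
    Subalgebra.sum_mem _ fun j _ => Subalgebra.sum_mem _ fun k _ => Subalgebra.sum_mem _ fun l _ => ?_
  by_cases h : q j k l = 0
  · rw [h, zero_mul, zero_smul]
    exact Subalgebra.zero_mem _
  · exact Subalgebra.smul_mem _ (SFun.mem_center_of_coord fun w =>
      SFun.coord_mul_triple w (X.sgn_triple (hq j k l h) a b c w)) _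

/-- The vertex without fluctuations is constant in the directions of the fluctuations. -/
theorem pd_vertex_zeroMode [DecidableEq P] (h : D.IsInductionData ι K) (w : I × A) (f : X.FunTot) :
    SFun.pd (Sum.elim X.oddH X.oddC) (Sum.inr w)
      (X.vertex B (X.vertexWeight (Sum.elim (fun p => ι (X.bH p)) 0)) * f) =
      X.vertex B (X.vertexWeight (Sum.elim (fun p => ι (X.bH p)) 0)) *
        SFun.pd (Sum.elim X.oddH X.oddC) (Sum.inr w) f := by
  simp only [vertex, Finset.sum_mul, map_sum]
  refine Finset.sum_congr rfl fun a _ => Finset.sum_congr rfl fun b _ =>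
    Finset.sum_congr rfl fun c _ => Finset.sum_congr rfl fun j _ => Finset.sum_congr rfl fun k _ =>
    Finset.sum_congr rfl fun l _ => ?_
  by_cases h0 : X.vertexWeight (Sum.elim (fun p => ι (X.bH p)) 0) j k l = 0
  · rw [h0, zero_mul, zero_smul, zero_mul, zero_mul, map_zero]
  have h3 := X.sgn_triple (X.degSum_add_of_vertexWeight_ne_zero (X.zeroModeBasis_mem h) h0) a b c
    (Sum.inr w)
  rw [smul_mul_assoc, smul_mul_assoc, map_smul]
  congr 1
  rcases j with j | j
  · rcases k with k | k
    · rcases l with l | l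
      · exact SFun.pd_mul_triple (by simp [coordIndex]) (by simp [coordIndex])
          (by simp [coordIndex]) h3 f
      · simp [vertexWeight] at h0
    · simp [vertexWeight] at h0
  · simp [vertexWeight] at h0

/-- Vertices without fluctuations pass through the contraction. -/
theorem edgeContraction_vertex_zeroMode_mul [DecidableEq P] (h : D.IsInductionData ι K)
    (e k : ℕ) (f : X.FunTot) : X.edgeContraction B K e
      (X.vertex B (X.vertexWeight (Sum.elim (fun p => ι (X.bH p)) 0)) ^ k * f) =
      X.Wprod B ι ^ k * X.edgeContraction B K e f := by
  have h1 : ∀ f, X.wick B K (X.vertex B (X.vertexWeight (Sum.elim (fun p => ι (X.bH p)) 0)) * f) =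
      X.vertex B (X.vertexWeight (Sum.elim (fun p => ι (X.bH p)) 0)) * X.wick B K f := by
    intro f
    simp only [wick, LinearMap.smul_apply, LinearMap.sum_apply, Module.End.mul_apply,
      X.pd_vertex_zeroMode B h, mul_smul_comm, Finset.mul_sum]
  have h2 : ∀ f, (X.wick B K ^ e)
      (X.vertex B (X.vertexWeight (Sum.elim (fun p => ι (X.bH p)) 0)) * f) =
      X.vertex B (X.vertexWeight (Sum.elim (fun p => ι (X.bH p)) 0)) * (X.wick B K ^ e) f := by
    induction e with
    | zero => exact fun f => rfl
    | succ e ih => intro f; rw [pow_succ, Module.End.mul_apply, Module.End.mul_apply, h1, ih]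
  induction k generalizing f with
  | zero => rw [pow_zero, one_mul, pow_zero, one_mul]
  | succ k ih =>
    rw [pow_succ, mul_assoc, ih, pow_succ, mul_assoc]
    congr 1
    rw [edgeContraction, LinearMap.comp_apply, LinearMap.comp_apply, AlgHom.toLinearMap_apply,
      AlgHom.toLinearMap_apply, h2, map_mul, X.setZero_vertex_zeroMode B h]

theorem Wprod_mem_center (h : D.IsInductionData ι K) :
    X.Wprod B ι ∈ Subalgebra.center ℝ X.Fun' := by
  rw [← X.setZero_vertex_zeroMode B h]
  refine SFun.mem_center_of_coord fun y => ?_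
  have h1 := Subalgebra.mem_center_iff.1 (X.vertex_mem_center B fun j k l h0 =>
    X.degSum_add_of_vertexWeight_ne_zero (X.zeroModeBasis_mem h) h0)
    (SFun.coord _ (Sum.inl y))
  have h2 := congrArg (SFun.setZero X.oddH X.oddC) h1
  rwa [map_mul, map_mul, SFun.setZero_coord_inl] at h2

end FieldCoords

end ChernSimons

/-! ### The logarithm of an exponential with central coefficients -/

section Central

open PowerSeries

/-- For series with central coefficients, the logarithm splits off an exponential factor. -/
theorem formalLog_exp_mul_of_central {R : Type*} [Ring R] [Algebra ℝ R] {w : R}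
    (hw : w ∈ Subalgebra.center ℝ R) {Z : PowerSeries (PowerSeries R)}
    (hZ : ∀ v e, coeff e (coeff v Z) ∈ Subalgebra.center ℝ R) (h0 : constantCoeff Z = 1) :
    formalLog ((PowerSeries.mk fun k => (k ! : ℝ)⁻¹ • (C w : PowerSeries R) ^ k) * Z) =
      X * C (C w) + formalLog Z := by
  let ψ : Subalgebra.center ℝ R →ₐ[ℝ] R := (Subalgebra.center ℝ R).val
  let F : PowerSeries (PowerSeries (Subalgebra.center ℝ R)) →+* PowerSeries (PowerSeries R) :=
    PowerSeries.map (PowerSeries.map (ψ : Subalgebra.center ℝ R →+* R))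
  let w' : Subalgebra.center ℝ R := ⟨w, hw⟩
  let Z' : PowerSeries (PowerSeries (Subalgebra.center ℝ R)) :=
    PowerSeries.mk fun v => PowerSeries.mk fun e => ⟨coeff e (coeff v Z), hZ v e⟩
  have e1 : F Z' = Z := by
    ext v e
    simp only [F, Z', coeff_map, coeff_mk]
    rfl
  have e2 : F (PowerSeries.mk fun k => (k ! : ℝ)⁻¹ • (C w' : PowerSeries _) ^ k) =
      PowerSeries.mk fun k => (k ! : ℝ)⁻¹ • (C w : PowerSeries R) ^ k := by
    ext k n
    simp only [F, coeff_map, coeff_mk, ← map_pow, coeff_smul, coeff_C]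
    exact (map_smul ψ _ _).trans (by split_ifs <;> simp [ψ, w'])
  have e3 : F (X * C (C w')) = X * C (C w) := by
    simp only [F, map_mul, PowerSeries.map_X, PowerSeries.map_C]
    rfl
  have e4 : ∀ Y, F (formalLog Y) = formalLog (F Y) := fun Y =>
    map_formalLog _ (fun r x => by ext n; exact map_smul ψ r (coeff n x)) Y
  have h0' : constantCoeff Z' = 1 := by
    ext e
    have := congrArg (coeff e) h0
    rw [← coeff_zero_eq_constantCoeff_apply] at this ⊢
    simp only [Z', coeff_mk, this, coeff_one]
    split_ifs <;> rfl
  have e5 : formalLog ((PowerSeries.mk fun k => (k ! : ℝ)⁻¹ • (C w' : PowerSeries _) ^ k) * Z') =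
      X * C (C w') + formalLog Z' := by
    have h1 := formalLog_mul (Z := PowerSeries.mk fun k =>
      (k ! : ℝ)⁻¹ • (C w' : PowerSeries (Subalgebra.center ℝ R)) ^ k) (W := Z')
      (by simp [← coeff_zero_eq_constantCoeff_apply]) h0'
    rw [formalLog_exp] at h1
    exact h1
  rw [← e1, ← e2, ← map_mul, ← e4, e5, map_add, e3, e4]

end Central

section ChernSimons

variable {C : Type*} [Ring C] [Algebra ℝ C] {𝒞 : ℕ → Submodule ℝ C} [GradedAlgebra 𝒞]
variable {g : Type*} [LieRing g] [LieAlgebra ℝ g]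
variable {D : DGFrobenius 𝒞}

/-! ### The effective action -/

namespace FieldCoords

open PowerSeries

variable {I P A : Type*} (X : FieldCoords D g I P A)
variable {B : LinearMap.BilinForm ℝ g}
variable [Fintype I] [Fintype P] [Fintype A] [DecidableEq I] [DecidableEq A]
variable {ι : D.Cohomology →ₗ[ℝ] C} {K : C →ₗ[ℝ] C}

/-- The possible contributions of graphs with `v` vertices and `e` edges: invariant polynomials of
degree `3v - 2e`, which vanish unless there is a loop. -/
def loopTerms (v e : ℕ) : Submodule ℝ (MvPolynomial (X.P1 × A) ℝ) :=
  if v ≤ e ∧ 2 * e ≤ 3 * v then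
    MvPolynomial.homogeneousSubmodule (X.P1 × A) ℝ (3 * v - 2 * e) ⊓
      ⨅ x : g, LinearMap.ker (X.adDerivation x).toLinearMap
  else ⊥

theorem mem_loopTerms {v e : ℕ} {F : MvPolynomial (X.P1 × A) ℝ} (h : v ≤ e ∧ 2 * e ≤ 3 * v) :
    F ∈ X.loopTerms v e ↔ F.IsHomogeneous (3 * v - 2 * e) ∧ ∀ x, X.adDerivation x F = 0 := by
  rw [loopTerms, if_pos h, Submodule.mem_inf, Submodule.mem_iInf]
  rfl

theorem mul_mem_loopTerms {v e v' e' : ℕ} {F F' : MvPolynomial (X.P1 × A) ℝ}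
    (hF : F ∈ X.loopTerms v e) (hF' : F' ∈ X.loopTerms v' e') :
    F * F' ∈ X.loopTerms (v + v') (e + e') := by
  by_cases h : v ≤ e ∧ 2 * e ≤ 3 * v
  · by_cases h' : v' ≤ e' ∧ 2 * e' ≤ 3 * v'
    · rw [X.mem_loopTerms h] at hF
      rw [X.mem_loopTerms h'] at hF'
      rw [X.mem_loopTerms (by omega)]
      refine ⟨?_, fun x => ?_⟩
      · rw [show 3 * (v + v') - 2 * (e + e') = (3 * v - 2 * e) + (3 * v' - 2 * e') by omega]
        exact hF.1.mul hF'.1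
      · rw [Derivation.leibniz, hF.2, hF'.2, smul_zero, smul_zero, add_zero]
    · rw [loopTerms, if_neg h'] at hF'
      rw [(Submodule.mem_bot ℝ).1 hF', mul_zero]
      exact Submodule.zero_mem _
  · rw [loopTerms, if_neg h] at hF
    rw [(Submodule.mem_bot ℝ).1 hF, zero_mul]
    exact Submodule.zero_mem _

theorem edgeContraction_mem_loopTerms [DecidableEq P] (hB : IsQuadratic B)
    (hB0 : Module.finrank ℝ (D.cohomologyDeg 0) = 1)
    (h : D.IsInductionData ι K) (h1 : D.IsAlgHom ι) (v e : ℕ) :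
    X.edgeContraction B K e (X.vertex B (X.fluctuationWeight ι K) ^ v) ∈
      (X.loopTerms v e).map X.ofH1.toLinearMap := by
  obtain ⟨F, hF, hF'⟩ := X.exists_ofH1_of_mem_monoSpan (X.edgeContraction_mem hB hB0 h h1 v e)
  refine ⟨F, ?_, hF'⟩
  by_cases hve : v ≤ e ∧ 2 * e ≤ 3 * v
  · rw [if_pos hve] at hF
    refine (X.mem_loopTerms hve).2 ⟨hF, fun x => ?_⟩
    have h2 := X.linVF_edgeContraction hB (K := K) x (X.fluctuationWeight ι K) v e
    rw [← hF', AlgHom.toLinearMap_apply, linVF_ofH1] at h2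
    rw [← X.restrictH1_ofH1 (X.adDerivation x F), h2, map_zero]
  · rw [if_neg hve] at hF
    rwa [loopTerms, if_neg hve]

/-- The partition function is the exponential of `W_prod` times the generating series of the graphs
whose vertices all carry fluctuations. -/
theorem partition_eq_mul [DecidableEq P] (hB : IsQuadratic B) (h : D.IsInductionData ι K) :
    X.partition B ι K = (PowerSeries.mk fun k => (k ! : ℝ)⁻¹ •
      (PowerSeries.C (X.Wprod B ι) : PowerSeries X.Fun') ^ k) *
        expSeries (X.edgeContraction B K) (X.vertex B (X.fluctuationWeight ι K)) := by
  have h1 : X.vertex B (X.vertexWeight (X.reducedBasis ι K)) =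
      X.vertex B (X.vertexWeight (Sum.elim (fun p => ι (X.bH p)) 0)) +
        X.vertex B (X.fluctuationWeight ι K) := by
    rw [← sub_eq_iff_eq_add', ← vertex_sub]
    rfl
  rw [X.partition_eq_expSeries hB h, h1]
  refine expSeries_add ?_ (X.edgeContraction_vertex_zeroMode_mul B h)
  exact (Subalgebra.mem_center_iff.1 (X.vertex_mem_center B fun j k l h0 =>
    X.degSum_add_of_vertexWeight_ne_zero (X.zeroModeBasis_mem h) h0) _).symm

theorem coeff_expSeries_mem [DecidableEq P] (hB : IsQuadratic B)
    (hB0 : Module.finrank ℝ (D.cohomologyDeg 0) = 1)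
    (h : D.IsInductionData ι K) (h1 : D.IsAlgHom ι) (v e : ℕ) :
    coeff e (coeff v (expSeries (X.edgeContraction B K) (X.vertex B (X.fluctuationWeight ι K)))) ∈
      (X.loopTerms v e).map X.ofH1.toLinearMap := by
  rw [coeff_expSeries]
  exact Submodule.smul_mem _ _ (X.edgeContraction_mem_loopTerms hB hB0 h h1 v e)

theorem coeff_formalLog_expSeries_mem [DecidableEq P] (hB : IsQuadratic B)
    (hB0 : Module.finrank ℝ (D.cohomologyDeg 0) = 1)
    (h : D.IsInductionData ι K) (h1 : D.IsAlgHom ι) (v e : ℕ) :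
    coeff e (coeff v (formalLog
      (expSeries (X.edgeContraction B K) (X.vertex B (X.fluctuationWeight ι K))))) ∈
      (X.loopTerms v e).map X.ofH1.toLinearMap := by
  refine coeff_coeff_formalLog_mem (S := fun v e => (X.loopTerms v e).map X.ofH1.toLinearMap)
    ?_ ?_ (X.coeff_expSeries_mem hB hB0 h h1) v e
  · refine ⟨1, (X.mem_loopTerms (by omega)).2 ⟨MvPolynomial.isHomogeneous_one _ _, fun x => ?_⟩,
      map_one X.ofH1⟩
    exact Derivation.map_one_eq_zero _
  · rintro v e v' e' _ _ ⟨F, hF, rfl⟩ ⟨F', hF', rfl⟩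
    exact ⟨F * F', X.mul_mem_loopTerms hF hF', map_mul X.ofH1 F F'⟩

/-- Besides `W_prod`, which is the graph with one vertex and no edge, only loop terms contribute. -/
theorem coeff_formalLog_partition (hB : IsQuadratic B)
    (hB0 : Module.finrank ℝ (D.cohomologyDeg 0) = 1)
    (h : D.IsInductionData ι K) (h1 : D.IsAlgHom ι) (v e : ℕ) :
    ∃ F ∈ X.loopTerms v e, coeff e (coeff v (formalLog (X.partition B ι K))) =
      (if v = 1 ∧ e = 0 then X.Wprod B ι else 0) + X.ofH1 F := by
  classical
  obtain ⟨F, hF, hF'⟩ := X.coeff_formalLog_expSeries_mem hB hB0 h h1 v e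
  refine ⟨F, hF, ?_⟩
  have hc : constantCoeff
      (expSeries (X.edgeContraction B K) (X.vertex B (X.fluctuationWeight ι K))) = 1 := by
    ext e
    rw [← coeff_zero_eq_constantCoeff_apply, coeff_one]
    split_ifs with he
    · rw [he, coeff_expSeries, edgeContraction, LinearMap.comp_apply, pow_zero, pow_zero]
      simp
    · obtain ⟨F, hF, hF'⟩ := X.coeff_expSeries_mem hB hB0 h h1 0 e
      rw [loopTerms, if_neg (by omega)] at hF
      rw [← hF', (Submodule.mem_bot ℝ).1 hF, map_zero]
  rw [X.partition_eq_mul hB h, formalLog_exp_mul_of_central (X.Wprod_mem_center B h) (fun v e => ?_) hc,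
    map_add, map_add, ← hF']
  · congr 1
    rcases v with _ | v
    · simp
    · rw [coeff_succ_X_mul, coeff_C]
      by_cases hv : v = 0
      · rw [if_pos hv, coeff_C]
        simp [hv]
      · simp [hv]
  · obtain ⟨F, hF, hF'⟩ := X.coeff_expSeries_mem hB hB0 h h1 v e
    rw [← hF']
    exact X.ofH1_mem_center F

/-- At `l = 0` there are more vertices than edges, which excludes all loop terms. -/
theorem effAction_zero (hB : IsQuadratic B) (hB0 : Module.finrank ℝ (D.cohomologyDeg 0) = 1)
    (h : D.IsInductionData ι K) (h1 : D.IsAlgHom ι) (n : ℕ) :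
    X.effAction B ι K 0 n = if n = 3 then X.Wprod B ι else 0 := by
  rw [effAction]
  split_ifs with h2 h3 h3
  · subst h3
    obtain ⟨F, hF, hF'⟩ := X.coeff_formalLog_partition hB hB0 h h1 1 0
    rw [loopTerms, if_neg (by omega)] at hF
    refine hF'.trans ?_
    rw [if_pos ⟨rfl, rfl⟩, (Submodule.mem_bot ℝ).1 hF, map_zero, add_zero]
  · obtain ⟨F, hF, hF'⟩ := X.coeff_formalLog_partition hB hB0 h h1 (n + 2 * 0 - 2) (n + 3 * 0 - 3)
    rw [loopTerms, if_neg (by omega)] at hF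
    rw [hF', if_neg (by omega), (Submodule.mem_bot ℝ).1 hF, map_zero, add_zero]
  · omega
  · rfl

theorem exists_effAction_eq_ofH1 (hB : IsQuadratic B)
    (hB0 : Module.finrank ℝ (D.cohomologyDeg 0) = 1)
    (h : D.IsInductionData ι K) (h1 : D.IsAlgHom ι) {l : ℕ} (hl : 1 ≤ l) (n : ℕ) :
    ∃ F : MvPolynomial (X.P1 × A) ℝ, X.effAction B ι K l n = X.ofH1 F ∧ F.IsHomogeneous n ∧
      X.IsAdInvariant F := by
  rw [effAction, if_pos (by omega)]
  -- the subtractions are genuine since `1 ≤ l`, and `3v - 2e = n` for `v = n + 2l - 2`, `e = n + 3l - 3`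
  obtain ⟨F, hF, hF'⟩ :=
    X.coeff_formalLog_partition hB hB0 h h1 (n + 2 * l - 2) (n + 3 * l - 3)
  refine ⟨F, ?_, ?_⟩
  · rw [hF', if_neg (by omega), zero_add]
  · by_cases h2 : 2 * (n + 3 * l - 3) ≤ 3 * (n + 2 * l - 2)
    · rw [X.mem_loopTerms (by omega)] at hF
      rw [show 3 * (n + 2 * l - 2) - 2 * (n + 3 * l - 3) = n by omega] at hF
      exact ⟨hF.1, fun x => (X.adDerivation_apply x F).symm.trans (hF.2 x)⟩
    · omega

theorem loopPart_spec (hB : IsQuadratic B) (hB0 : Module.finrank ℝ (D.cohomologyDeg 0) = 1)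
    (h : D.IsInductionData ι K) (h1 : D.IsAlgHom ι) {l : ℕ} (hl : 1 ≤ l) (n : ℕ) :
    X.effAction B ι K l n = X.ofH1 (X.loopPart B ι K l n) ∧
      (X.loopPart B ι K l n).IsHomogeneous n ∧ X.IsAdInvariant (X.loopPart B ι K l n) := by
  obtain ⟨F, hF, hF'⟩ := X.exists_effAction_eq_ofH1 hB hB0 h h1 hl n
  have h2 : X.loopPart B ι K l n = F := by rw [loopPart, hF, restrictH1_ofH1]
  rw [h2]
  exact ⟨hF, hF'⟩

end FieldCoords

end ChernSimons

end

theorem proposition7 {C g : Type*} [Ring C] [Algebra ℝ C] {𝒞 : ℕ → Submodule ℝ C}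
    [GradedAlgebra 𝒞] [LieRing g] [LieAlgebra ℝ g]
    (D : DGFrobenius 𝒞) (hB0 : Module.finrank ℝ (D.cohomologyDeg 0) = 1)
    (B : LinearMap.BilinForm ℝ g) (hB : IsQuadratic B)
    {I P A : Type*} [Fintype I] [Fintype P] [Fintype A] [DecidableEq I] [DecidableEq A]
    (X : FieldCoords D g I P A) :
    -- the form of the effective action
    (∀ (ι : D.Cohomology →ₗ[ℝ] C) (K : C →ₗ[ℝ] C), D.IsInductionData ι K → D.IsAlgHom ι →
      (∀ n, X.effAction B ι K 0 n = if n = 3 then X.Wprod B ι else 0) ∧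
      (∀ l, 1 ≤ l → ∀ n,
        X.effAction B ι K l n = X.ofH1 (X.loopPart B ι K l n) ∧
        (X.loopPart B ι K l n).IsHomogeneous n ∧
        X.IsAdInvariant (X.loopPart B ι K l n)) ∧
      (∀ α : X.P1 × A → ℝ,
        PowerSeries.mk (fun n => MvPolynomial.eval α (X.loopPart B ι K 1 n)) =
          (1 / 2 : ℝ) • strLog 𝒞 (wheelOp ι K (X.point α)))) ∧
    -- invariance of the one-loop part on the Maurer--Cartan set: infinitesimal deformations
    (∀ (ι : D.Cohomology →ₗ[ℝ] C) (K : C →ₗ[ℝ] C), D.IsInductionData ι K → D.IsAlgHom ι →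
      ∀ (δι : D.Cohomology →ₗ[ℝ] C) (δK : C →ₗ[ℝ] C),
        D.IsInfinitesimalDeformation ι K δι δK →
        ∀ α : X.P1 × A → ℝ, X.IsMaurerCartan ι α →
          ∀ n, HasDerivAt (fun ε : ℝ =>
            MvPolynomial.eval α (X.loopPart B (ι + ε • δι) (K + ε • δK) 1 n)) 0 0) ∧
    -- and finite deformations
    (∀ (ι : ℝ → D.Cohomology →ₗ[ℝ] C) (K : ℝ → C →ₗ[ℝ] C),
      (∀ t ∈ Set.Icc (0 : ℝ) 1, D.IsInductionData (ι t) (K t) ∧ D.IsAlgHom (ι t)) →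
      (∀ x i, DifferentiableOn ℝ (fun t => X.bC.repr (ι t x) i) (Set.Icc 0 1)) →
      (∀ c i, DifferentiableOn ℝ (fun t => X.bC.repr (K t c) i) (Set.Icc 0 1)) →
      ∀ s ∈ Set.Icc (0 : ℝ) 1, ∀ t ∈ Set.Icc (0 : ℝ) 1,
        ∀ α : X.P1 × A → ℝ, X.IsMaurerCartan (ι s) α →
          ∀ n, MvPolynomial.eval α (X.loopPart B (ι s) (K s) 1 n) =
            MvPolynomial.eval α (X.loopPart B (ι t) (K t) 1 n)) := by
  refine ⟨fun ι K h h1 => ⟨X.effAction_zero hB hB0 h h1, fun l hl n => X.loopPart_spec hB hB0 h h1 hl n,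
    X.loopPart_one_eq_strLog hB h h1⟩, fun ι K h h1 δι δK h' α hα n =>
      X.hasDerivAt_loopPart hB h h1 h' hα n, fun ι K h hι hK s hs t ht α hα n =>
        X.eval_loopPart_eq hB h hι hK hs ht hα n⟩
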